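/- **Conventions.** A *sectorial domain* with opening an arc $(a,b)$, $0<b-a\le 2\pi$, is a simply connected domain $S\subset\mathbb C\setminus\{0\}$ whose closure in the real-oriented blowup of $\mathbb C_\hbar$ at $0$ meets the circle of directions exactly in $[a,b]$; it is understood to contain a straight sector $\{0<|\hbar|<r,\ \arg\hbar\in(a',b')\}$ for all $a<a'<b'<b$, and a Borel disc $\{\operatorname{Re}(e^{i\theta}/\hbar)>1/\delta\}$ (of some diameter $\delta>0$) for every $\theta\in[a+\frac\pi2,b-\frac\pi2]$. For a function $f(x,\hbar)$ and a series $\hat f=\sum_k f_k(x)\hbar^k$ put $R_n=f-\sum_{k<n}f_k\hbar^k$. We write $f\simeq\hat f$ *along the closed arc* $[a,b]$ uniformly on $V$ if there are a sectorial domain $S_0$ with opening $(a,b)$, contained in the given $\hbar$-domain, and $C,M>0$ with $|R_n(x,\hbar)|\le CM^n\,n!\,|\hbar|^n$ for all $n\ge0$, $x\in V$, $\hbar\in S_0$. *Gevrey* (resp. *Poincaré*) *asymptotics along the open arc* $(a,b)$, uniformly on $V$, means: for all $a<a'<b'<b$ the same bounds (resp. for each $n$ a bound $|R_n|\le C_n|\hbar|^n$)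 hold on some straight sector with opening $(a',b')$, with constants (and, in the Poincaré case, radius depending on $n$) depending on $(a',b')$. *Locally uniformly* on $U$ means uniformly near every point of $U$. A function $\psi$ admits locally uniform *exponential (Gevrey) asymptotics* along $(a,b)$ on $U$ if, for some polynomial $\Phi\in\mathcal O(U)[\hbar^{-1}]$, $e^{-\Phi/\hbar}\psi$ admits locally uniform Poincaré (Gevrey) asymptotics with coefficients in $\mathcal O(U)$; similarly for functions of $\hbar$ alone. **Setting.** Let $X\subset\mathbb C_x$ be a domain, $S\subset\mathbb C_\hbar$ a sectorial domain with opening $A=(\vartheta_-,\vartheta_+)$, $\pi\le|A|\le2\pi$, and let $p,q$ be holomorphic on $X\times S$ with $p\simeq\hat p=\sum p_k\hbar^k$, $q\simeq\hat q=\sum q_k\hbar^k$ along $\bar A$, locally uniformly on $X$, where $p_k,q_k\in\mathcal O(X)$. Consider $$\hbar^2\partial_x^2\psi+p\,\hbar\,\partial_x\psi+q\,\psi=0.\qquad(\ast)$$ Let $D_0=p_0^2-4q_0$; its zeros are the turning points. Let $\theta\in[\vartheta_-+\frac\pi2,\vartheta_+-\frac\pi2]$, $A_\theta=(\theta-\frac\pi2,\theta+\frac\pi2)$,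 and let $S_\theta=\{\operatorname{Re}(e^{i\theta}/\hbar)>1/\delta\}\subset S$ be a Borel disc. Let $U\subset X$ be a simply connected domain free of turning points, $x_0\in U$, and fix a holomorphic branch $\sqrt{D_0}$ on $U$; put $\Phi(x)=\int_{x_0}^x\sqrt{D_0}$. For a sign $\alpha\in\{+,-\}$ let $\lambda_\alpha=\frac12(p_0+\alpha\sqrt{D_0})$, let $\hat s_\alpha=\lambda_\alpha+\hbar\hat{\mathcal S}_\alpha\in\mathcal O(U)[[\hbar]]$ be the formal solution with leading term $\lambda_\alpha$ of $\hbar\partial_x\hat s=\hat s^2-\hat p\hat s+\hat q$, and let $$\hat\psi_\alpha=e^{-\Phi_\alpha/\hbar}\hat\Psi_\alpha,\qquad \Phi_\alpha=\int_{x_0}^x\lambda_\alpha,\quad \hat\Psi_\alpha=\exp\Big(-\int_{x_0}^x\hat{\mathcal S}_\alpha\Big)$$ be the formal WKB solution normalised at $x_0$. The complete WKB $(\theta,\alpha)$-ray emanating from $x\in U$ is the curve $\gamma_x:[0,\infty)\to X\setminus\{\text{turning points}\}$, if it exists, with $\gamma_x(0)=x$ and $\Phi(\gamma_x(t))=\Phi(x)+\alpha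 e^{i\theta}t$ for all $t\ge0$, where $\sqrt{D_0}$ and $\Phi$ are continued analytically along $\gamma_x$. **Hypotheses $(H_\alpha)$.** For every $x\in U$ the WKB $(\theta,\alpha)$-ray emanating from $x$ is complete, and every point of $U$ has a neighbourhood $V\subset U$ and an $R>0$ such that, on the set $V_{\theta,\alpha,R}$ of all points $y=\gamma_x(t)$ with $x\in V$, $t\ge0$ and $\operatorname{Re}(\alpha e^{-i\theta}\Phi(y))>R$ (with $\sqrt{D_0}$ and $\Phi$ continued along the rays), 1. $\frac1{\sqrt{D_0}}\partial_x\log\sqrt{D_0}$ is bounded; 2. $\frac1{\sqrt{D_0}}p\simeq\frac1{\sqrt{D_0}}\hat p$ and $\frac1{D_0}q\simeq\frac1{D_0}\hat q$ along $\bar A_\theta$, uniformly on $V_{\theta,\alpha,R}$. **Theorem.** (a) If $(H_\alpha)$ holds, there is $\delta'\in(0,\delta]$ such that, with $S'_\theta=\{\operatorname{Re}(e^{i\theta}/\hbar)>1/\delta'\}$, equation $(\ast)$ has a unique holomorphic solution $\psi_\alpha$ on $U\times S'_\theta$ satisfying $\psi_\alpha(x_0,\hbar)=1$ for all $\hbar\in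 S'_\theta$ and $\psi_\alpha\simeq\hat\psi_\alpha$ along $\bar A_\theta$, locally uniformly on $U$ (that is, $e^{\Phi_\alpha/\hbar}\psi_\alpha\simeq\hat\Psi_\alpha$). It is an exact solution on $(U;A_\theta)$, i.e. a holomorphic solution on $U\times S'$, for a sectorial subdomain $S'\subset S$ with opening $A_\theta$, that admits locally uniform exponential asymptotics along $A_\theta$. (b) If $(H_+)$ and $(H_-)$ hold, then $\psi_+,\psi_-$ form a basis of the exact solutions on $(U;A_\theta)$, and also of the exact solutions on $(U;A_\theta)$ with locally uniform exponential Gevrey asymptotics along $A_\theta$, in the following sense: $\psi_\pm$ belong to the class; every $\psi$ in the class equals $c_+\psi_++c_-\psi_-$ on $U\times S''$ for some sectorial domain $S''$ with opening $A_\theta$ and some $c_\pm$ holomorphic on $S''$ with exponential (resp. exponential Gevrey) asymptotics along $A_\theta$; and if $c_+\psi_++c_-\psi_-=0$ on $U\times S''$ with $c_\pm$ holomorphic on a sectorial domain $S''$ with opening $A_\theta$, on which $\psi_\pm$ are both defined, then $c_+=c_-=0$. -/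

import Mathlib

open Set Filter Topology

namespace ExactWKB

noncomputable section

/-! ### Sectorial domains -/

/-- The Borel disc `Re (exp (iθ) / ħ) > 1 / δ`, bisected by the direction `θ`, of diameter `δ > 0`.
(The point `ħ = 0` does not belong to it, since `exp (iθ) / 0 = 0`.) -/
def borelDisc (θ δ : ℝ) : Set ℂ :=
  {h : ℂ | 1 / δ < (Complex.exp (θ * Complex.I) / h).re}

/-- The straight sector of radius `r` whose opening is the open arc `(a, b)`. -/
def straightSector (a b r : ℝ) : Set ℂ :=
  {h : ℂ | ∃ ρ φ : ℝ, 0 < ρ ∧ ρ < r ∧ a < φ ∧ φ < b ∧ h = ρ * Complex.exp (φ * Complex.I)}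

/-- `S` is a sectorial domain near the origin of `ℂ` with opening the arc `(a, b)`
(of length at most `2π`): a simply connected domain in `ℂ \ {0}` whose closure in the real-oriented
blowup of `ℂ` at the origin meets the circle of directions exactly in the closed arc `[a, b]`.
As usual, such a domain contains a straight sector over every arc that is compactly contained in
`(a, b)`, and a Borel disc bisected by `θ` for every half-plane arc `(θ - π/2, θ + π/2)` that is
contained in `(a, b)`. -/
structure IsSectorialDomain (a b : ℝ) (S : Set ℂ) : Prop where
  arc_pos : a < b
  arc_le : b - a ≤ 2 * Real.pi
  isOpen : IsOpen S
  simplyConnected : IsSimplyConnected S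
  zero_notMem : (0 : ℂ) ∉ S
  directions : ∀ u : ℂ, MapClusterPt u (𝓝[S] (0 : ℂ)) (fun h : ℂ => h / (‖h‖ : ℂ)) ↔
    ∃ t ∈ Icc a b, Complex.exp ((t : ℂ) * Complex.I) = u
  sectors : ∀ a' b' : ℝ, a < a' → a' < b' → b' < b → ∃ r : ℝ, 0 < r ∧ straightSector a' b' r ⊆ S
  borel : ∀ θ ∈ Icc (a + Real.pi / 2) (b - Real.pi / 2), ∃ δ : ℝ, 0 < δ ∧ borelDisc θ δ ⊆ S

/-! ### Asymptotics

The parameter `x` ranges over a set `V` of an arbitrary type `ι`: a subset of the `x`-plane, a set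
of points together with a value of a square root, or a single point for functions of `ħ` alone. -/

/-- The remainder of order `n`: `f (x, ħ) - ∑_{k < n} c_k (x) ħ^k`. -/
def remainder {ι : Type} (f : ι → ℂ → ℂ) (c : ℕ → ι → ℂ) (n : ℕ) (x : ι) (h : ℂ) : ℂ :=
  f x h - ∑ k ∈ Finset.range n, c k x * h ^ k

/-- Gevrey bounds `|R_n (x, ħ)| ≤ C M^n n! |ħ|^n` on `V × S`. -/
def GevreyBounds {ι : Type} (f : ι → ℂ → ℂ) (c : ℕ → ι → ℂ) (V : Set ι) (S : Set ℂ) : Prop :=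
  ∃ C M : ℝ, 0 < C ∧ 0 < M ∧ ∀ n : ℕ, ∀ x ∈ V, ∀ h ∈ S,
    ‖remainder f c n x h‖ ≤ C * M ^ n * (n.factorial : ℝ) * ‖h‖ ^ n

/-- `f ≃ ∑ c_k ħ^k` as `ħ → 0` along the closed arc `[a, b]`, uniformly for `x ∈ V`. -/
def GevreyClosed {ι : Type} (f : ι → ℂ → ℂ) (c : ℕ → ι → ℂ) (V : Set ι) (a b : ℝ)
    (S : Set ℂ) : Prop :=
  ∃ S₀ : Set ℂ, S₀ ⊆ S ∧ IsSectorialDomain a b S₀ ∧ GevreyBounds f c V S₀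

/-- `f ≃ ∑ c_k ħ^k` as `ħ → 0` along the closed arc `[a, b]`, locally uniformly for `x ∈ U`. -/
def LocGevreyClosed (f : ℂ → ℂ → ℂ) (c : ℕ → ℂ → ℂ) (U : Set ℂ) (a b : ℝ) (S : Set ℂ) : Prop :=
  ∀ x ∈ U, ∃ V : Set ℂ, IsOpen V ∧ x ∈ V ∧ V ⊆ U ∧ GevreyClosed f c V a b S

/-- `f ≃ ∑ c_k ħ^k` as `ħ → 0` along the open arc `(a, b)`, uniformly for `x ∈ V`. -/
def GevreyOpen {ι : Type} (f : ι → ℂ → ℂ) (c : ℕ → ι → ℂ) (V : Set ι) (a b : ℝ)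
    (S : Set ℂ) : Prop :=
  ∀ a' b' : ℝ, a < a' → a' < b' → b' < b →
    ∃ r : ℝ, 0 < r ∧ straightSector a' b' r ⊆ S ∧ GevreyBounds f c V (straightSector a' b' r)

/-- `f ∼ ∑ c_k ħ^k` (Poincaré) as `ħ → 0` along the open arc `(a, b)`, uniformly for `x ∈ V`. -/
def PoincareOpen {ι : Type} (f : ι → ℂ → ℂ) (c : ℕ → ι → ℂ) (V : Set ι) (a b : ℝ)
    (S : Set ℂ) : Prop :=
  ∀ (n : ℕ) (a' b' : ℝ), a < a' → a' < b' → b' < b →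
    ∃ r : ℝ, 0 < r ∧ straightSector a' b' r ⊆ S ∧
      ∃ C : ℝ, ∀ x ∈ V, ∀ h ∈ straightSector a' b' r, ‖remainder f c n x h‖ ≤ C * ‖h‖ ^ n

/-- The function `exp (-Φ / ħ)` for the polynomial `Φ = ∑_{j ≤ m} φ_j ħ^{-j}` in `ħ^{-1}`. -/
def expFactor (m : ℕ) (φ : ℕ → ℂ) (h : ℂ) : ℂ :=
  Complex.exp (-(∑ j ∈ Finset.range (m + 1), φ j * (h⁻¹) ^ j) / h)

/-- `ψ` admits locally uniform exponential asymptotics on `U` as `ħ → 0` along `(a, b)`: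
for some `Φ ∈ 𝒪(U)[ħ⁻¹]`, the function `exp (-Φ / ħ) ψ` admits locally uniform asymptotics. -/
def LocExpPoincare (ψ : ℂ → ℂ → ℂ) (U : Set ℂ) (a b : ℝ) (S : Set ℂ) : Prop :=
  ∃ (m : ℕ) (φ c : ℕ → ℂ → ℂ),
    (∀ j, DifferentiableOn ℂ (φ j) U) ∧ (∀ k, DifferentiableOn ℂ (c k) U) ∧
    ∀ x ∈ U, ∃ V : Set ℂ, IsOpen V ∧ x ∈ V ∧ V ⊆ U ∧
      PoincareOpen (fun y h => expFactor m (fun j => φ j y) h * ψ y h) c V a b S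

/-- `ψ` admits locally uniform exponential Gevrey asymptotics on `U` as `ħ → 0` along `(a, b)`. -/
def LocExpGevrey (ψ : ℂ → ℂ → ℂ) (U : Set ℂ) (a b : ℝ) (S : Set ℂ) : Prop :=
  ∃ (m : ℕ) (φ c : ℕ → ℂ → ℂ),
    (∀ j, DifferentiableOn ℂ (φ j) U) ∧ (∀ k, DifferentiableOn ℂ (c k) U) ∧
    ∀ x ∈ U, ∃ V : Set ℂ, IsOpen V ∧ x ∈ V ∧ V ⊆ U ∧
      GevreyOpen (fun y h => expFactor m (fun j => φ j y) h * ψ y h) c V a b S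

/-- A function of `ħ` alone admits exponential asymptotics as `ħ → 0` along `(a, b)`. -/
def ExpPoincare (a b : ℝ) (S : Set ℂ) (g : ℂ → ℂ) : Prop :=
  ∃ (m : ℕ) (φ c : ℕ → ℂ),
    PoincareOpen (fun (_ : Unit) h => expFactor m φ h * g h) (fun k _ => c k) univ a b S

/-- A function of `ħ` alone admits exponential Gevrey asymptotics as `ħ → 0` along `(a, b)`. -/
def ExpGevrey (a b : ℝ) (S : Set ℂ) (g : ℂ → ℂ) : Prop :=
  ∃ (m : ℕ) (φ c : ℕ → ℂ),
    GevreyOpen (fun (_ : Unit) h => expFactor m φ h * g h) (fun k _ => c k) univ a b S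

/-! ### The differential equation and its exact solutions -/

/-- `ψ` is a holomorphic solution of `ħ² ∂ₓ²ψ + p ħ ∂ₓψ + q ψ = 0` on `U × S`. -/
def IsSolution (p q : ℂ → ℂ → ℂ) (U S : Set ℂ) (ψ : ℂ → ℂ → ℂ) : Prop :=
  DifferentiableOn ℂ (fun z : ℂ × ℂ => ψ z.1 z.2) (U ×ˢ S) ∧
  ∀ x ∈ U, ∀ h ∈ S,
    h ^ 2 * deriv (deriv (fun y => ψ y h)) x + p x h * h * deriv (fun y => ψ y h) x
      + q x h * ψ x h = 0

/-- `ψ`, given on `U × S'` with `S' ⊆ S` a sectorial subdomain with opening `(a, b)`,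
is an exact solution on `(U; (a, b))`. -/
def IsExactSolution (p q : ℂ → ℂ → ℂ) (S U : Set ℂ) (a b : ℝ)
    (S' : Set ℂ) (ψ : ℂ → ℂ → ℂ) : Prop :=
  S' ⊆ S ∧ IsSectorialDomain a b S' ∧ IsSolution p q U S' ψ ∧ LocExpPoincare ψ U a b S'

/-- An exact solution with locally uniform exponential Gevrey asymptotics. -/
def IsGevreyExactSolution (p q : ℂ → ℂ → ℂ) (S U : Set ℂ) (a b : ℝ)
    (S' : Set ℂ) (ψ : ℂ → ℂ → ℂ) : Prop :=
  IsExactSolution p q S U a b S' ψ ∧ LocExpGevrey ψ U a b S'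

/-- The pair `ψ₁, ψ₂`, given on `U × S₁` and `U × S₂`, is a basis for the space `M` of
(semi)sectorial germs of functions on `(U; (a, b))`, with coefficients in the class `R` of
sectorial germs on `(a, b)`: both belong to `M`, every element of `M` is a combination of them with
coefficients in `R`, and they are linearly independent, even over the ring of all holomorphic
sectorial germs on `(a, b)`. The first argument of `M` and `R` is the domain in the `ħ`-plane. -/
def IsBasisOfGerms (M : Set ℂ → (ℂ → ℂ → ℂ) → Prop) (R : Set ℂ → (ℂ → ℂ) → Prop)
    (U : Set ℂ) (a b : ℝ) (S₁ S₂ : Set ℂ) (ψ₁ ψ₂ : ℂ → ℂ → ℂ) : Prop :=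
  M S₁ ψ₁ ∧ M S₂ ψ₂ ∧
  (∀ (S' : Set ℂ) (ψ : ℂ → ℂ → ℂ), M S' ψ →
    ∃ (S'' : Set ℂ) (c₁ c₂ : ℂ → ℂ),
      S'' ⊆ S' ∩ (S₁ ∩ S₂) ∧ IsSectorialDomain a b S'' ∧
      DifferentiableOn ℂ c₁ S'' ∧ DifferentiableOn ℂ c₂ S'' ∧ R S'' c₁ ∧ R S'' c₂ ∧
      ∀ x ∈ U, ∀ h ∈ S'', ψ x h = c₁ h * ψ₁ x h + c₂ h * ψ₂ x h) ∧
  (∀ (S'' : Set ℂ) (c₁ c₂ : ℂ → ℂ),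
    S'' ⊆ S₁ ∩ S₂ → IsSectorialDomain a b S'' →
    DifferentiableOn ℂ c₁ S'' → DifferentiableOn ℂ c₂ S'' →
    (∀ x ∈ U, ∀ h ∈ S'', c₁ h * ψ₁ x h + c₂ h * ψ₂ x h = 0) →
    ∀ h ∈ S'', c₁ h = 0 ∧ c₂ h = 0)

/-! ### Formal WKB solutions -/

/-- The leading-order characteristic discriminant `D₀ = p₀² - 4 q₀`. -/
def disc₀ (pc qc : ℕ → ℂ → ℂ) (x : ℂ) : ℂ := pc 0 x ^ 2 - 4 * qc 0 x

open Classical in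
/-- The integral `∫_{x₀}^x f(t) dt` along paths in `U`: the primitive of `f` on `U` that vanishes
at `x₀` (for `f` holomorphic on a simply connected domain `U` it exists, and it is unique
on `U`). -/
def primitive (U : Set ℂ) (x₀ : ℂ) (f : ℂ → ℂ) : ℂ → ℂ :=
  if H : ∃ F : ℂ → ℂ, F x₀ = 0 ∧ ∀ x ∈ U, HasDerivAt F (f x) x then H.choose else 0

/-- The coefficients of the formal characteristic root with sign `α`, i.e. of the formal solution
`ŝ = ∑ s_k ħ^k` of the Riccati equation `ħ ∂ₓ ŝ = ŝ² - p̂ ŝ + q̂` with leading term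
`λ_α = (p₀ + α √D₀) / 2`; here `sq` is the branch of `√D₀`. The Riccati equation at order `ħ^(k+1)`
is solved for `s_(k+1)` by means of `2 λ_α - p₀ = α √D₀`. -/
def formalRoot (pc qc : ℕ → ℂ → ℂ) (sq : ℂ → ℂ) (α : ℤˣ) : ℕ → ℂ → ℂ
  | 0 => fun x => (pc 0 x + ((α : ℤ) : ℂ) * sq x) / 2
  | k + 1 => fun x => ((α : ℤ) : ℂ) / sq x *
      (deriv (formalRoot pc qc sq α k) x
        - ∑ i : Fin k, formalRoot pc qc sq α (i + 1) x * formalRoot pc qc sq α (k - i) x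
        + ∑ i : Fin (k + 1), pc (k + 1 - i) x * formalRoot pc qc sq α i x
        - qc (k + 1) x)
  termination_by k => k
  decreasing_by all_goals omega

/-- The WKB exponent `Φ_α (x) = ∫_{x₀}^x λ_α`. -/
def wkbExponent (pc qc : ℕ → ℂ → ℂ) (U : Set ℂ) (x₀ : ℂ) (sq : ℂ → ℂ) (α : ℤˣ) : ℂ → ℂ :=
  primitive U x₀ (formalRoot pc qc sq α 0)

/-- The exponential of a formal power series `r` with arbitrary constant term `r₀`:
`exp r = exp r₀ · ∑_j (r - r₀)^j / j!`. -/
def expSeries (r : PowerSeries ℂ) : PowerSeries ℂ :=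
  PowerSeries.mk fun n => Complex.exp (PowerSeries.constantCoeff r) *
    ∑ j ∈ Finset.range (n + 1),
      PowerSeries.coeff n ((r - PowerSeries.C (PowerSeries.constantCoeff r)) ^ j)
        / (j.factorial : ℂ)

/-- The coefficients of `Ψ̂_α = exp (-∫_{x₀}^x Ŝ_α)`, where `ŝ_α = λ_α + ħ Ŝ_α`. The formal WKB
solution normalised at `x₀` is `ψ̂_α = exp (-Φ_α / ħ) Ψ̂_α`. -/
def wkbCoeff (pc qc : ℕ → ℂ → ℂ) (U : Set ℂ) (x₀ : ℂ) (sq : ℂ → ℂ) (α : ℤˣ)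
    (n : ℕ) (x : ℂ) : ℂ :=
  PowerSeries.coeff n (expSeries
    (PowerSeries.mk fun k => -primitive U x₀ (formalRoot pc qc sq α (k + 1)) x))

/-! ### WKB rays -/

/-- `γ` restricted to `[0, ∞)` is the complete WKB `(θ, α)`-ray in `X` emanating from `x`, and `s` is
the analytic continuation along it of the branch of `√D₀` with value `s₀` at `x`. The equation says
that the Liouville transformation `Φ = ∫ √D₀`, continued along `γ`, satisfies
`Φ (γ t) = Φ x + α exp (iθ) t` for all `t ≥ 0`. -/
structure IsCompleteRay (X : Set ℂ) (D : ℂ → ℂ) (θ : ℝ) (α : ℤˣ) (x s₀ : ℂ) (γ s : ℝ → ℂ) :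
    Prop where
  start : γ 0 = x
  branch_start : s 0 = s₀
  branch_continuous : ContinuousOn s (Ici 0)
  mem : ∀ t : ℝ, 0 ≤ t → γ t ∈ X
  regular : ∀ t : ℝ, 0 ≤ t → s t ≠ 0
  branch_sq : ∀ t : ℝ, 0 ≤ t → s t ^ 2 = D (γ t)
  liouville : ∀ t : ℝ, 0 ≤ t →
    HasDerivWithinAt γ (((α : ℤ) : ℂ) * Complex.exp (θ * Complex.I) / s t) (Ici 0) t

/-- The region `V_{θ,α,R}` swept by the WKB `(θ, α)`-rays emanating from `V`, intersected with the
preimage under `Φ` of the half-plane `Re (α exp (-iθ) z) > R`. Its points are recorded together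
with the value of `√D₀` continued along the ray. -/
def sweptRegion (X : Set ℂ) (D : ℂ → ℂ) (U : Set ℂ) (x₀ : ℂ) (sq : ℂ → ℂ) (θ : ℝ) (α : ℤˣ)
    (V : Set ℂ) (R : ℝ) : Set (ℂ × ℂ) :=
  {z | ∃ x ∈ V, ∃ γ s : ℝ → ℂ, IsCompleteRay X D θ α x (sq x) γ s ∧
    ∃ t : ℝ, 0 ≤ t ∧
      R < (((α : ℤ) : ℂ) * Complex.exp (-(θ * Complex.I)) *
            (primitive U x₀ sq x + ((α : ℤ) : ℂ) * Complex.exp (θ * Complex.I) * t)).re ∧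
      z = (γ t, s t)}

/-- The hypotheses for the sign `α`: every WKB `(θ, α)`-ray emanating from `U` is complete and, near
every point of `U`, on the swept region `V_{θ,α,R}` for some `R > 0`, the function
`(1/√D₀) ∂ₓ log √D₀` is bounded and `p/√D₀ ≃ p̂/√D₀`, `q/D₀ ≃ q̂/D₀` uniformly along the closed
half-plane arc bisected by `θ`. -/
structure Hypotheses (X S : Set ℂ) (p q : ℂ → ℂ → ℂ) (pc qc : ℕ → ℂ → ℂ)
    (U : Set ℂ) (x₀ : ℂ) (sq : ℂ → ℂ) (θ : ℝ) (α : ℤˣ) : Prop where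
  complete : ∀ x ∈ U, ∃ γ s : ℝ → ℂ, IsCompleteRay X (disc₀ pc qc) θ α x (sq x) γ s
  bounds : ∀ x ∈ U, ∃ (V : Set ℂ) (R : ℝ), IsOpen V ∧ x ∈ V ∧ V ⊆ U ∧ 0 < R ∧
    (∃ B : ℝ, ∀ z ∈ sweptRegion X (disc₀ pc qc) U x₀ sq θ α V R,
      ‖1 / z.2 * (deriv (disc₀ pc qc) z.1 / (2 * disc₀ pc qc z.1))‖ ≤ B) ∧
    GevreyClosed (fun (z : ℂ × ℂ) h => 1 / z.2 * p z.1 h) (fun k z => 1 / z.2 * pc k z.1)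
      (sweptRegion X (disc₀ pc qc) U x₀ sq θ α V R) (θ - Real.pi / 2) (θ + Real.pi / 2) S ∧
    GevreyClosed (fun (z : ℂ × ℂ) h => 1 / disc₀ pc qc z.1 * q z.1 h)
      (fun k z => 1 / disc₀ pc qc z.1 * qc k z.1)
      (sweptRegion X (disc₀ pc qc) U x₀ sq θ α V R) (θ - Real.pi / 2) (θ + Real.pi / 2) S

/-- `ψ` is an exact WKB solution on `U × S_θ(δ)` with sign `α`, normalised at `x₀`: a holomorphic
solution with `ψ (x₀, ħ) = 1` and `ψ ≃ ψ̂_α = exp (-Φ_α / ħ) Ψ̂_α` along the closed half-plane arc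
bisected by `θ`, locally uniformly on `U`. -/
structure IsExactWKB (p q : ℂ → ℂ → ℂ) (pc qc : ℕ → ℂ → ℂ) (U : Set ℂ) (x₀ : ℂ) (sq : ℂ → ℂ)
    (θ : ℝ) (α : ℤˣ) (δ : ℝ) (ψ : ℂ → ℂ → ℂ) : Prop where
  solution : IsSolution p q U (borelDisc θ δ) ψ
  normalised : ∀ h ∈ borelDisc θ δ, ψ x₀ h = 1
  asymptotics : LocGevreyClosed
    (fun x h => Complex.exp (wkbExponent pc qc U x₀ sq α x / h) * ψ x h)
    (wkbCoeff pc qc U x₀ sq α) U (θ - Real.pi / 2) (θ + Real.pi / 2) (borelDisc θ δ)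

end

end ExactWKB

namespace ExactWKB

noncomputable section

/-! ### Holomorphic functions of two variables -/

section Analysis

variable {E : Type*} [NormedAddCommGroup E] [NormedSpace ℂ E]

/-! Writing ψ = exp(-∫ s/ħ) turns the linear equation into the Riccati equation ħ s' = s² - p s + q,
so the task is to find true solutions s asymptotic to the formal root. Near a point of U the
variable is replaced by the Liouville coordinate z measured along the ray. Completeness of the rays
makes the inverse map χ of this coordinate holomorphic on a half-strip around [0, ∞)
(`exists_strip`). After s is divided by √D₀ and ħ is rotated by e^{iθ}, the Riccati equation there
has leading discriminant 1, and its coefficients are Gevrey uniformly on a half-strip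
(`Setting.exists_strip_bounds`).

On the half-strip the correction to the first two formal terms solves w' = w/ħ + (bounded quadratic
in w). A bounded w is a fixed point of the Laplace-type integral ∫₀^∞ e^{-u/ħ} g(z+u) du, an
operator of norm at most δ on a Borel disc of diameter δ, hence a contraction for small δ
(`exists_quadratic_solution`). The same mechanism bounds remainders: each remainder solves such an
equation along the ray and is bounded, so its source controls it. Induction on the order then yields
Gevrey bounds (`gevreyWith_of_riccati`), given the factorial growth of the formal coefficients,
which follows from a Nagumo-type argument (`norm_formalRoot_le_aux`).

Uniqueness is Watson's lemma: a Gevrey-flat function on a Borel disc vanishes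
(`eq_zero_of_gevrey_flat`). It also does the gluing. The Borel disc on which a local root exists
shrinks from point to point, so ψ is instead defined by its Cauchy data at x₀ through the linear
equation, which is solvable on the whole simply connected U. The asymptotics are then carried from
disc to disc: where they hold, the logarithmic derivative of ψ has the same expansion as the next
local root, hence equals it (`Setting.logDeriv_eq`, `Setting.exists_hasWKBExponent`).

For (b), the Wronskian at x₀, multiplied by ħ, tends up to sign to √D₀(x₀) ≠ 0, so its inverse is
Gevrey and Cramer's rule gives the coefficients from the Cauchy data of ψ. The difficulty is that
differentiating an exponential factor could produce negative powers of ħ. Comparing leading orders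
in the equation shows that at x₀ either these polar terms vanish or the expansion itself is flat
(`Setting.flat_or_deriv_eq_zero`); both cases are harmless. -/

theorem norm_deriv_le_of_ball {f : ℂ → E} {c : ℂ} {r C : ℝ} (hr : 0 < r)
    (hf : DifferentiableOn ℂ f (Metric.ball c r)) (hC : ∀ z ∈ Metric.ball c r, ‖f z‖ ≤ C) :
    ‖deriv f c‖ ≤ C / r := by
  have h0 : 0 ≤ C := (norm_nonneg _).trans (hC c (Metric.mem_ball_self hr))
  -- Cauchy's estimate wants a closed disc; nothing is known on the boundary of the ball, so it is
  -- used on radii s < r and s is sent to r.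
  have key : ∀ s ∈ Ioo 0 r, ‖deriv f c‖ ≤ C / s := by
    intro s hs
    have hsub : Metric.closedBall c s ⊆ Metric.ball c r := Metric.closedBall_subset_ball hs.2
    refine Complex.norm_deriv_le_of_forall_mem_sphere_norm_le hs.1 ?_ ?_
    · exact (hf.mono hsub).diffContOnCl_ball subset_rfl
    · exact fun z hz => hC z (hsub (Metric.sphere_subset_closedBall hz))
  have ht : Tendsto (fun s : ℝ => C / s) (𝓝[<] r) (𝓝 (C / r)) :=
    ((continuousAt_const.div continuousAt_id hr.ne').tendsto).mono_left nhdsWithin_le_nhds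
  refine ge_of_tendsto ht ?_
  filter_upwards [Ioo_mem_nhdsLT hr] with s hs using key s hs

theorem differentiableOn_integral {α : Type*} [MeasurableSpace α] {μ : MeasureTheory.Measure α}
    {F : ℂ → α → E} {s : Set ℂ} {bound : α → ℝ} (hs : IsOpen s)
    (hF : ∀ a, DifferentiableOn ℂ (fun x => F x a) s)
    (hm : ∀ x ∈ s, MeasureTheory.AEStronglyMeasurable (F x) μ)
    (hb : MeasureTheory.Integrable bound μ) (hFb : ∀ x ∈ s, ∀ a, ‖F x a‖ ≤ bound a) :
    DifferentiableOn ℂ (fun x => ∫ a, F x a ∂μ) s := by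
  intro x₀ hx₀
  obtain ⟨ε, hε, hεs⟩ := Metric.isOpen_iff.1 hs x₀ hx₀
  have hε2 : 0 < ε / 2 := by positivity
  have hsub : ∀ x ∈ Metric.ball x₀ (ε / 2), Metric.ball x (ε / 2) ⊆ s := by
    intro x hx y hy
    apply hεs
    rw [Metric.mem_ball] at *
    linarith [dist_triangle y x x₀]
  have hin : ∀ x ∈ Metric.ball x₀ (ε / 2), x ∈ s := fun x hx =>
    hsub x hx (Metric.mem_ball_self hε2)
  have hx₀' := Metric.mem_ball_self (x := x₀) hε2
  have hda : ∀ a, ∀ x ∈ Metric.ball x₀ (ε / 2),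
      HasDerivAt (fun y => F y a) (deriv (fun y => F y a) x) x := fun a x hx =>
    ((hF a).differentiableAt (hs.mem_nhds (hin x hx))).hasDerivAt
  -- Measurability of the derivative in the parameter is free: it is a pointwise limit of difference
  -- quotients along a sequence of increments.
  have hmeas : MeasureTheory.AEStronglyMeasurable (fun a => deriv (fun y => F y a) x₀) μ := by
    have hseq : ∃ t : ℕ → ℂ, Tendsto t atTop (𝓝[≠] 0) ∧ ∀ n, x₀ + t n ∈ s := by
      obtain ⟨u, hu⟩ := exists_seq_tendsto (𝓝[≠] (0 : ℂ))
      have hev : ∀ᶠ n in atTop, x₀ + u n ∈ s := by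
        have : Tendsto (fun n => x₀ + u n) atTop (𝓝 x₀) := by
          simpa using (tendsto_const_nhds (x := x₀)).add (hu.mono_right nhdsWithin_le_nhds)
        exact this (hs.mem_nhds hx₀)
      obtain ⟨N, hN⟩ := eventually_atTop.1 hev
      exact ⟨fun n => u (n + N), hu.comp (tendsto_add_atTop_nat N), fun n => hN _ (by omega)⟩
    obtain ⟨t, ht, hts⟩ := hseq
    refine aestronglyMeasurable_of_tendsto_ae atTop
      (f := fun n a => (t n)⁻¹ • (F (x₀ + t n) a - F x₀ a)) ?_ ?_
    · exact fun n => ((hm _ (hts n)).sub (hm _ hx₀)).const_smul _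
    · exact Eventually.of_forall fun a =>
        ((hasDerivAt_iff_tendsto_slope_zero.1 (hda a x₀ hx₀')).comp ht)
  have := hasDerivAt_integral_of_dominated_loc_of_deriv_le (μ := μ) (F := F)
    (F' := fun x a => deriv (fun y => F y a) x) (bound := fun a => bound a / (ε / 2))
    (Metric.ball_mem_nhds x₀ hε2)
    (by filter_upwards [hs.mem_nhds hx₀] with x hx using hm x hx)
    (hb.mono' (hm x₀ hx₀) (Eventually.of_forall (hFb x₀ hx₀))) hmeas
    (Eventually.of_forall fun a x hx => norm_deriv_le_of_ball hε2
      ((hF a).mono (hsub x hx)) fun z hz => hFb z (hsub x hx hz) a)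
    (hb.div_const _) (Eventually.of_forall hda)
  exact this.2.differentiableAt.differentiableWithinAt

theorem exists_bidisc {W : Set (ℂ × ℂ)} (hW : IsOpen W) {z : ℂ × ℂ} (hz : z ∈ W)
    {P : ℂ × ℂ → Prop} (hP : ∀ᶠ w in 𝓝 z, P w) :
    ∃ r > 0, ∀ x ∈ Metric.ball z.1 r, ∀ h ∈ Metric.ball z.2 r, (x, h) ∈ W ∧ P (x, h) := by
  obtain ⟨r, hr, H⟩ := Metric.eventually_nhds_iff_ball.1 (Filter.Eventually.and (hW.mem_nhds hz : ∀ᶠ w in 𝓝 z, w ∈ W) hP)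
  refine ⟨r, hr, fun x hx h hh => H (x, h) ?_⟩
  rw [← ball_prod_same]
  exact ⟨hx, hh⟩

/-- The partial derivative of a bounded separately holomorphic function is Lipschitz in the other
variable. -/
theorem norm_deriv_sub_le {f : ℂ → ℂ → E} {x₀ h₀ : ℂ} {r C : ℝ} (hr : 0 < r)
    (h1 : ∀ h ∈ Metric.ball h₀ r, DifferentiableOn ℂ (fun x => f x h) (Metric.ball x₀ r))
    (h2 : ∀ x ∈ Metric.ball x₀ r, DifferentiableOn ℂ (fun h => f x h) (Metric.ball h₀ r))
    (hC : ∀ x ∈ Metric.ball x₀ r, ∀ h ∈ Metric.ball h₀ r, ‖f x h‖ ≤ C)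
    {x h : ℂ} (hx : x ∈ Metric.ball x₀ (r / 2)) (hh : h ∈ Metric.ball h₀ (r / 2)) :
    ‖deriv (fun y => f y h) x - deriv (fun y => f y h₀) x‖ ≤ C / (r / 2) * ‖h - h₀‖ / (r / 2) := by
  have hr2 : 0 < r / 2 := by positivity
  have sub1 : ∀ {c y : ℂ}, y ∈ Metric.ball c (r / 2) → Metric.ball y (r / 2) ⊆ Metric.ball c r := by
    intro c y hy w hw
    rw [Metric.mem_ball] at *
    linarith [dist_triangle w y c]
  have hhr : h ∈ Metric.ball h₀ r := Metric.ball_subset_ball (by linarith) hh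
  have h0r : h₀ ∈ Metric.ball h₀ r := Metric.mem_ball_self hr
  have hxr : x ∈ Metric.ball x₀ r := Metric.ball_subset_ball (by linarith) hx
  have d1 := (h1 h hhr).differentiableAt (Metric.isOpen_ball.mem_nhds hxr)
  have d2 := (h1 h₀ h0r).differentiableAt (Metric.isOpen_ball.mem_nhds hxr)
  rw [← deriv_fun_sub d1 d2]
  refine norm_deriv_le_of_ball hr2 (((h1 h hhr).sub (h1 h₀ h0r)).mono (sub1 hx)) ?_
  intro y hy
  have hyr := sub1 hx hy
  have := Convex.norm_image_sub_le_of_norm_deriv_le (f := fun h => f y h)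
    (s := Metric.ball h₀ (r / 2)) (C := C / (r / 2)) (x := h₀) (y := h)
    (fun w hw => (h2 y hyr).differentiableAt (Metric.isOpen_ball.mem_nhds
      (Metric.ball_subset_ball (by linarith) hw)))
    (fun w hw => norm_deriv_le_of_ball hr2 ((h2 y hyr).mono (sub1 hw))
      fun v hv => hC y hyr v (sub1 hw hv))
    (convex_ball _ _) (Metric.mem_ball_self hr2) hh
  simpa using this

/-- A separately holomorphic, locally bounded function of two variables is holomorphic. -/
theorem differentiableOn_of_separately [CompleteSpace E] {f : ℂ → ℂ → E} {W : Set (ℂ × ℂ)} (hW : IsOpen W)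
    (h1 : ∀ z ∈ W, DifferentiableAt ℂ (fun x => f x z.2) z.1)
    (h2 : ∀ z ∈ W, DifferentiableAt ℂ (fun h => f z.1 h) z.2)
    (hb : ∀ z ∈ W, ∃ C : ℝ, ∀ᶠ w in 𝓝 z, ‖f w.1 w.2‖ ≤ C) :
    DifferentiableOn ℂ (fun z : ℂ × ℂ => f z.1 z.2) W := by
  rintro ⟨x₀, h₀⟩ hz
  obtain ⟨C, hC⟩ := hb _ hz
  obtain ⟨r, hr, H⟩ := exists_bidisc hW hz hC
  have hr2 : 0 < r / 2 := by positivity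
  have d1 : ∀ h ∈ Metric.ball h₀ r, DifferentiableOn ℂ (fun x => f x h) (Metric.ball x₀ r) :=
    fun h hh x hx => (h1 _ (H x hx h hh).1).differentiableWithinAt
  have d2 : ∀ x ∈ Metric.ball x₀ r, DifferentiableOn ℂ (fun h => f x h) (Metric.ball h₀ r) :=
    fun x hx h hh => (h2 _ (H x hx h hh).1).differentiableWithinAt
  have hx0 : x₀ ∈ Metric.ball x₀ r := Metric.mem_ball_self hr
  have hh0 : h₀ ∈ Metric.ball h₀ r := Metric.mem_ball_self hr
  -- Joint continuity of a partial derivative: for frozen h₀ it is continuous by analyticity, and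
  -- moving h costs at most a multiple of |h - h₀| by `norm_deriv_sub_le`. Two continuous partials
  -- then give strict differentiability.
  have c1 : ContinuousAt (fun w : ℂ × ℂ => deriv (fun x => f x w.2) w.1) (x₀, h₀) := by
    have ha : ContinuousAt (fun x => deriv (fun y => f y h₀) x) x₀ :=
      ((((d1 h₀ hh0).analyticAt (Metric.isOpen_ball.mem_nhds hx0)).deriv).continuousAt)
    have hlim : Tendsto (fun w : ℂ × ℂ => deriv (fun x => f x w.2) w.1
        - deriv (fun x => f x h₀) w.1) (𝓝 (x₀, h₀)) (𝓝 0) := by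
      have hb' : Tendsto (fun w : ℂ × ℂ => C / (r / 2) * ‖w.2 - h₀‖ / (r / 2)) (𝓝 (x₀, h₀))
          (𝓝 0) := by
        have : Continuous (fun w : ℂ × ℂ => C / (r / 2) * ‖w.2 - h₀‖ / (r / 2)) := by fun_prop
        simpa using this.tendsto (x₀, h₀)
      refine squeeze_zero_norm' ?_ hb'
      have : Metric.ball x₀ (r / 2) ×ˢ Metric.ball h₀ (r / 2) ∈ 𝓝 (x₀, h₀) :=
        prod_mem_nhds (Metric.ball_mem_nhds _ hr2) (Metric.ball_mem_nhds _ hr2)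
      filter_upwards [this] with w hw
      exact norm_deriv_sub_le hr d1 d2 (fun x hx h hh => (H x hx h hh).2) hw.1 hw.2
    have hs := hlim.add (ha.tendsto.comp (continuous_fst.tendsto (x₀, h₀)))
    simpa [ContinuousAt, Function.comp_def] using hs
  have c2 : ContinuousAt (fun w : ℂ × ℂ => deriv (fun h => f w.1 h) w.2) (x₀, h₀) := by
    have ha : ContinuousAt (fun x => deriv (fun y => f x₀ y) x) h₀ :=
      ((((d2 x₀ hx0).analyticAt (Metric.isOpen_ball.mem_nhds hh0)).deriv).continuousAt)
    have hlim : Tendsto (fun w : ℂ × ℂ => deriv (fun h => f w.1 h) w.2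
        - deriv (fun h => f x₀ h) w.2) (𝓝 (x₀, h₀)) (𝓝 0) := by
      have hb' : Tendsto (fun w : ℂ × ℂ => C / (r / 2) * ‖w.1 - x₀‖ / (r / 2)) (𝓝 (x₀, h₀))
          (𝓝 0) := by
        have : Continuous (fun w : ℂ × ℂ => C / (r / 2) * ‖w.1 - x₀‖ / (r / 2)) := by fun_prop
        simpa using this.tendsto (x₀, h₀)
      refine squeeze_zero_norm' ?_ hb'
      have : Metric.ball x₀ (r / 2) ×ˢ Metric.ball h₀ (r / 2) ∈ 𝓝 (x₀, h₀) :=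
        prod_mem_nhds (Metric.ball_mem_nhds _ hr2) (Metric.ball_mem_nhds _ hr2)
      filter_upwards [this] with w hw
      exact norm_deriv_sub_le (f := fun h x => f x h) hr d2 d1
        (fun x hx h hh => (H h hh x hx).2) hw.2 hw.1
    have hs := hlim.add (ha.tendsto.comp (continuous_snd.tendsto (x₀, h₀)))
    simpa [ContinuousAt, Function.comp_def] using hs
  have hWn := hW.mem_nhds hz
  have := hasStrictFDerivAt_uncurry_coprod (𝕜 := ℂ) (u := (x₀, h₀)) (f := f)
    (f₁ := fun x h => ContinuousLinearMap.toSpanSingleton ℂ (deriv (fun y => f y h) x))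
    (f₂ := fun x h => ContinuousLinearMap.toSpanSingleton ℂ (deriv (fun y => f x y) h))
    (by filter_upwards [hWn] with v hv using (h1 v hv).hasDerivAt.hasFDerivAt)
    (by filter_upwards [hWn] with v hv using (h2 v hv).hasDerivAt.hasFDerivAt)
    ((ContinuousLinearMap.toSpanSingletonCLE (𝕜 := ℂ) (E := E)).continuous.continuousAt.comp c1)
    ((ContinuousLinearMap.toSpanSingletonCLE (𝕜 := ℂ) (E := E)).continuous.continuousAt.comp c2)
  exact this.hasFDerivAt.differentiableAt.differentiableWithinAt

theorem differentiableAt_fst_section {f : ℂ → ℂ → E} {W : Set (ℂ × ℂ)} (hW : IsOpen W)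
    (hf : DifferentiableOn ℂ (fun z : ℂ × ℂ => f z.1 z.2) W) {z : ℂ × ℂ} (hz : z ∈ W) :
    DifferentiableAt ℂ (fun x => f x z.2) z.1 := by
  have h := hf.differentiableAt (hW.mem_nhds hz)
  exact DifferentiableAt.comp (f := fun x : ℂ => (x, z.2)) (g := fun z : ℂ × ℂ => f z.1 z.2) z.1 h
    (by fun_prop)

theorem differentiableAt_snd_section {f : ℂ → ℂ → E} {W : Set (ℂ × ℂ)} (hW : IsOpen W)
    (hf : DifferentiableOn ℂ (fun z : ℂ × ℂ => f z.1 z.2) W) {z : ℂ × ℂ} (hz : z ∈ W) :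
    DifferentiableAt ℂ (fun h => f z.1 h) z.2 := by
  have h := hf.differentiableAt (hW.mem_nhds hz)
  exact DifferentiableAt.comp (f := fun x : ℂ => (z.1, x)) (g := fun z : ℂ × ℂ => f z.1 z.2) z.2 h
    (by fun_prop)

theorem eventually_norm_le_of_differentiableOn {f : ℂ × ℂ → E} {W : Set (ℂ × ℂ)} (hW : IsOpen W)
    (hf : DifferentiableOn ℂ f W) {z : ℂ × ℂ} (hz : z ∈ W) :
    ∃ C : ℝ, ∀ᶠ w in 𝓝 z, ‖f w‖ ≤ C := by
  have h := (hf.differentiableAt (hW.mem_nhds hz)).continuousAt.norm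
  exact ⟨‖f z‖ + 1, (h.eventually (gt_mem_nhds (lt_add_one _))).mono fun w hw => le_of_lt hw⟩

/-- The partial derivative in the first variable of a holomorphic function is holomorphic. -/
theorem differentiableOn_deriv_fst [CompleteSpace E] {f : ℂ → ℂ → E} {W : Set (ℂ × ℂ)} (hW : IsOpen W)
    (hf : DifferentiableOn ℂ (fun z : ℂ × ℂ => f z.1 z.2) W) :
    DifferentiableOn ℂ (fun z : ℂ × ℂ => deriv (fun x => f x z.2) z.1) W := by
  have key : ∀ z ∈ W, ∃ r > 0, ∃ C : ℝ, ∀ x ∈ Metric.ball z.1 r, ∀ h ∈ Metric.ball z.2 r,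
      (x, h) ∈ W ∧ ‖f x h‖ ≤ C := fun z hz => by
    obtain ⟨C, hC⟩ := eventually_norm_le_of_differentiableOn hW hf hz
    obtain ⟨r, hr, H⟩ := exists_bidisc hW hz hC
    exact ⟨r, hr, C, H⟩
  refine differentiableOn_of_separately (f := fun x h => deriv (fun x => f x h) x) hW ?_ ?_ ?_
  · rintro ⟨x₀, h₀⟩ hz
    obtain ⟨r, hr, C, H⟩ := key _ hz
    have : DifferentiableOn ℂ (fun x => f x h₀) (Metric.ball x₀ r) := fun x hx =>
      (differentiableAt_fst_section hW hf
        (H x hx h₀ (Metric.mem_ball_self hr)).1).differentiableWithinAt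
    exact (this.analyticAt (Metric.ball_mem_nhds _ hr)).deriv.differentiableAt
  · rintro ⟨x₀, h₀⟩ hz
    obtain ⟨r, hr, C, H⟩ := key _ hz
    have hr2 : 0 < r / 2 := by positivity
    have hcl : Metric.closedBall x₀ (r / 2) ⊆ Metric.ball x₀ r :=
      Metric.closedBall_subset_ball (by linarith)
    have hmem : ∀ t : ℝ, circleMap x₀ (r / 2) t ∈ Metric.ball x₀ r := fun t =>
      hcl (circleMap_mem_closedBall _ hr2.le t)
    -- Cauchy's formula over a circle that does not depend on h reduces holomorphy in h to
    -- differentiation under the integral sign.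
    have heq : EqOn (fun h => deriv (fun x => f x h) x₀)
        (fun h => (2 * (Real.pi : ℂ) * Complex.I)⁻¹ •
          ∮ z in C(x₀, r / 2), ((z - x₀) ^ 2)⁻¹ • f z h) (Metric.ball h₀ r) := by
      intro h hh
      refine (Complex.two_pi_I_inv_smul_circleIntegral_sub_sq_inv_smul_of_differentiable
        (Metric.isOpen_ball (x := x₀) (ε := r)) hcl ?_ (Metric.mem_ball_self hr2)).symm
      exact fun x hx =>
        (differentiableAt_fst_section hW hf (H x hx h hh).1).differentiableWithinAt
    have hd : DifferentiableOn ℂ (fun h => ∮ z in C(x₀, r / 2), ((z - x₀) ^ 2)⁻¹ • f z h)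
        (Metric.ball h₀ r) := by
      unfold circleIntegral
      simp only [intervalIntegral.integral_of_le Real.two_pi_pos.le]
      refine differentiableOn_integral (bound := fun _ => (r / 2) * (((r / 2) ^ 2)⁻¹ * C))
        Metric.isOpen_ball ?_ ?_ ?_ ?_
      · intro t
        have : DifferentiableOn ℂ (fun h => f (circleMap x₀ (r / 2) t) h) (Metric.ball h₀ r) :=
          fun h hh => (differentiableAt_snd_section hW hf
            (H _ (hmem t) h hh).1).differentiableWithinAt
        exact (this.const_smul _).const_smul _
      · intro h hh
        have hc : Continuous fun t : ℝ => f (circleMap x₀ (r / 2) t) h := by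
          rw [continuous_iff_continuousAt]
          intro t
          have h1 := (differentiableAt_fst_section hW hf (H _ (hmem t) h hh).1).continuousAt
          exact ContinuousAt.comp (g := fun x => f x h) h1 (continuous_circleMap _ _).continuousAt
        refine Continuous.aestronglyMeasurable ?_
        simp only [deriv_circleMap]
        refine Continuous.smul (by fun_prop) (Continuous.smul ?_ hc)
        refine Continuous.inv₀ (by fun_prop) fun t => ?_
        exact pow_ne_zero _ (sub_ne_zero.2 (circleMap_ne_center hr2.ne'))
      · exact MeasureTheory.integrableOn_const (by simp [ENNReal.mul_eq_top])
      · intro h hh t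
        rw [norm_smul, norm_smul]
        simp only [deriv_circleMap, norm_mul, Complex.norm_I, mul_one, norm_inv, norm_pow,
          circleMap_sub_center, norm_circleMap_zero, abs_of_pos hr2]
        have := (H _ (hmem t) h hh).2
        gcongr
    have hh0 : h₀ ∈ Metric.ball h₀ r := Metric.mem_ball_self hr
    have h3 : DifferentiableOn ℂ (fun h => deriv (fun x => f x h) x₀) (Metric.ball h₀ r) :=
      (hd.const_smul ((2 * (Real.pi : ℂ) * Complex.I)⁻¹)).congr heq
    exact h3.differentiableAt (Metric.ball_mem_nhds _ hr)
  · rintro ⟨x₀, h₀⟩ hz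
    obtain ⟨r, hr, C, H⟩ := key _ hz
    have hr2 : 0 < r / 2 := by positivity
    refine ⟨C / (r / 2), ?_⟩
    have : Metric.ball x₀ (r / 2) ×ˢ Metric.ball h₀ (r / 2) ∈ 𝓝 (x₀, h₀) :=
      prod_mem_nhds (Metric.ball_mem_nhds _ hr2) (Metric.ball_mem_nhds _ hr2)
    filter_upwards [this] with w hw
    have hsub : Metric.ball w.1 (r / 2) ⊆ Metric.ball x₀ r := by
      intro y hy
      have := hw.1
      rw [Metric.mem_ball] at *
      linarith [dist_triangle y w.1 x₀]
    have hh : w.2 ∈ Metric.ball h₀ r := Metric.ball_subset_ball (by linarith) hw.2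
    exact norm_deriv_le_of_ball hr2 (fun x hx => (differentiableAt_fst_section hW hf
        (H x (hsub hx) w.2 hh).1).differentiableWithinAt) fun x hx => (H x (hsub hx) w.2 hh).2

/-- Weierstrass's theorem applies in each variable separately; local boundedness is inherited from
one approximant at distance less than 1, and `differentiableOn_of_separately` concludes. -/
theorem differentiableOn_of_tendstoUniformlyOn [CompleteSpace E] {F : ℕ → ℂ → ℂ → E} {f : ℂ → ℂ → E}
    {W : Set (ℂ × ℂ)} (hW : IsOpen W)
    (hF : ∀ n, DifferentiableOn ℂ (fun z : ℂ × ℂ => F n z.1 z.2) W)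
    (h : TendstoUniformlyOn (fun n (z : ℂ × ℂ) => F n z.1 z.2) (fun z => f z.1 z.2) atTop W) :
    DifferentiableOn ℂ (fun z : ℂ × ℂ => f z.1 z.2) W := by
  refine differentiableOn_of_separately hW ?_ ?_ ?_
  · rintro ⟨x₀, h₀⟩ hz
    have hs : IsOpen ((fun x : ℂ => (x, h₀)) ⁻¹' W) := hW.preimage (by fun_prop)
    have := (h.comp (fun x : ℂ => (x, h₀))).tendstoLocallyUniformlyOn.differentiableOn
      (Eventually.of_forall fun n x hx =>
        (differentiableAt_fst_section hW (hF n) hx).differentiableWithinAt) hs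
    exact this.differentiableAt (hs.mem_nhds hz)
  · rintro ⟨x₀, h₀⟩ hz
    have hs : IsOpen ((fun x : ℂ => (x₀, x)) ⁻¹' W) := hW.preimage (by fun_prop)
    have := (h.comp (fun x : ℂ => (x₀, x))).tendstoLocallyUniformlyOn.differentiableOn
      (Eventually.of_forall fun n x hx =>
        (differentiableAt_snd_section hW (hF n) hx).differentiableWithinAt) hs
    exact this.differentiableAt (hs.mem_nhds hz)
  · intro z hz
    obtain ⟨n, hn⟩ := (Metric.tendstoUniformlyOn_iff.1 h 1 one_pos).exists
    obtain ⟨C, hC⟩ := eventually_norm_le_of_differentiableOn hW (hF n) hz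
    refine ⟨1 + C, ?_⟩
    filter_upwards [hC, hW.mem_nhds hz] with w hw hwW
    have := hn w hwW
    rw [dist_eq_norm] at this
    calc ‖f w.1 w.2‖ = ‖(f w.1 w.2 - F n w.1 w.2) + F n w.1 w.2‖ := by simp
      _ ≤ _ := norm_add_le _ _
      _ ≤ 1 + C := by gcongr

theorem differentiableOn_integral₂ [CompleteSpace E] {α : Type*} [MeasurableSpace α] {μ : MeasureTheory.Measure α}
    {F : ℂ → ℂ → α → E} {W : Set (ℂ × ℂ)} (hW : IsOpen W)
    (hF : ∀ a, DifferentiableOn ℂ (fun z : ℂ × ℂ => F z.1 z.2 a) W)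
    (hm : ∀ z ∈ W, MeasureTheory.AEStronglyMeasurable (F z.1 z.2) μ)
    (hb : ∀ z ∈ W, ∃ bound : α → ℝ, MeasureTheory.Integrable bound μ ∧
      ∀ᶠ w in 𝓝 z, ∀ a, ‖F w.1 w.2 a‖ ≤ bound a) :
    DifferentiableOn ℂ (fun z : ℂ × ℂ => ∫ a, F z.1 z.2 a ∂μ) W := by
  refine differentiableOn_of_separately (f := fun x h => ∫ a, F x h a ∂μ) hW ?_ ?_ ?_
  · rintro ⟨x₀, h₀⟩ hz
    obtain ⟨b, hbi, hb'⟩ := hb _ hz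
    obtain ⟨r, hr, H⟩ := exists_bidisc hW hz hb'
    have hh := Metric.mem_ball_self (x := h₀) hr
    refine (differentiableOn_integral (F := fun x a => F x h₀ a) (bound := b)
      Metric.isOpen_ball (s := Metric.ball x₀ r) ?_ ?_ hbi ?_).differentiableAt
      (Metric.ball_mem_nhds _ hr)
    · exact fun a x hx => (differentiableAt_fst_section (f := fun x h => F x h a) hW (hF a)
        (H x hx h₀ hh).1).differentiableWithinAt
    · exact fun x hx => hm _ (H x hx h₀ hh).1
    · exact fun x hx => (H x hx h₀ hh).2
  · rintro ⟨x₀, h₀⟩ hz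
    obtain ⟨b, hbi, hb'⟩ := hb _ hz
    obtain ⟨r, hr, H⟩ := exists_bidisc hW hz hb'
    have hh := Metric.mem_ball_self (x := x₀) hr
    refine (differentiableOn_integral (F := fun x a => F x₀ x a) (bound := b)
      Metric.isOpen_ball (s := Metric.ball h₀ r) ?_ ?_ hbi ?_).differentiableAt
      (Metric.ball_mem_nhds _ hr)
    · exact fun a x hx => (differentiableAt_snd_section (f := fun x h => F x h a) hW (hF a)
        (H x₀ hh x hx).1).differentiableWithinAt
    · exact fun x hx => hm _ (H x₀ hh x hx).1
    · exact fun x hx => (H x₀ hh x hx).2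
  · intro z hz
    obtain ⟨b, hbi, hb'⟩ := hb _ hz
    refine ⟨∫ a, b a ∂μ, ?_⟩
    filter_upwards [hb'] with w hw
    exact MeasureTheory.norm_integral_le_of_norm_le hbi (Eventually.of_forall hw)

end Analysis


/-! ### Gevrey asymptotics with explicit constants -/

/-- The saving of one index matters: a convolution of about n products of this kind costs n · n!,
which is still at most (n + 1)!, so convolutions stay within a constant of a single factorial. -/
theorem factorial_succ_mul_factorial_succ_le (i j : ℕ) :
    (i + 1).factorial * (j + 1).factorial ≤ (i + j + 1).factorial := by
  induction i with
  | zero => simp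
  | succ i ih =>
    calc (i + 1 + 1).factorial * (j + 1).factorial
        = (i + 2) * ((i + 1).factorial * (j + 1).factorial) := by
          rw [Nat.factorial_succ (i + 1)]; ring
      _ ≤ (i + j + 2) * (i + j + 1).factorial := Nat.mul_le_mul (by omega) ih
      _ = (i + 1 + j + 1).factorial := by
          rw [show i + 1 + j + 1 = (i + j + 1) + 1 by ring, Nat.factorial_succ (i + j + 1)]

/-- The two end terms each contribute n!. Every interior term is at most (n - 1)!, and there are n -
1 of them. -/
theorem sum_factorial_mul_factorial_le (n : ℕ) :
    ∑ k ∈ Finset.range (n + 1), (k.factorial : ℝ) * ((n - k).factorial : ℝ) ≤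
      4 * (n.factorial : ℝ) := by
  cases n with
  | zero => norm_num
  | succ n =>
    rw [Finset.sum_range_succ, Finset.sum_range_succ']
    have h : ∑ k ∈ Finset.range n, ((k + 1).factorial : ℝ) * ((n + 1 - (k + 1)).factorial : ℝ) ≤
        ∑ _k ∈ Finset.range n, (n.factorial : ℝ) := by
      refine Finset.sum_le_sum fun k hk => ?_
      have hk' := Finset.mem_range.1 hk
      have := factorial_succ_mul_factorial_succ_le k (n - k - 1)
      rw [show n - k - 1 + 1 = n + 1 - (k + 1) by omega,
        show k + (n - k - 1) + 1 = n by omega] at this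
      exact_mod_cast this
    rw [Finset.sum_const, Finset.card_range, nsmul_eq_mul] at h
    have h2 : (n : ℝ) * (n.factorial : ℝ) ≤ ((n + 1).factorial : ℝ) := by
      rw [Nat.factorial_succ]; push_cast
      nlinarith [Nat.cast_nonneg (α := ℝ) n.factorial]
    simp only [Nat.factorial_zero, Nat.cast_one, one_mul, Nat.sub_zero, Nat.sub_self, mul_one]
    have : (0 : ℝ) ≤ ((n + 1).factorial : ℝ) := Nat.cast_nonneg _
    linarith

theorem natCast_succ_factorial_le (n : ℕ) :
    ((n + 1).factorial : ℝ) ≤ 2 ^ n * (n.factorial : ℝ) := by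
  rw [Nat.factorial_succ]
  have : ((n + 1 : ℕ) : ℝ) ≤ 2 ^ n := by exact_mod_cast Nat.lt_two_pow_self (n := n)
  push_cast at *
  gcongr

section Gevrey

variable {ι : Type}

/-- Gevrey bounds with explicit constants. -/
def GevreyWith (f : ι → ℂ → ℂ) (c : ℕ → ι → ℂ) (V : Set ι) (S : Set ℂ) (C M : ℝ) : Prop :=
  ∀ n : ℕ, ∀ x ∈ V, ∀ h ∈ S, ‖remainder f c n x h‖ ≤ C * M ^ n * (n.factorial : ℝ) * ‖h‖ ^ n

variable {f g : ι → ℂ → ℂ} {c d : ℕ → ι → ℂ} {V : Set ι} {S : Set ℂ} {C D M : ℝ}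

theorem remainder_zero (f : ι → ℂ → ℂ) (c : ℕ → ι → ℂ) (x : ι) (h : ℂ) :
    remainder f c 0 x h = f x h := by simp [remainder]

theorem remainder_eq_succ (f : ι → ℂ → ℂ) (c : ℕ → ι → ℂ) (n : ℕ) (x : ι) (h : ℂ) :
    remainder f c n x h = c n x * h ^ n + remainder f c (n + 1) x h := by
  simp only [remainder, Finset.sum_range_succ]; ring

theorem GevreyWith.mono {V' : Set ι} {S' : Set ℂ} {C' M' : ℝ} (hf : GevreyWith f c V S C M)
    (hV : V' ⊆ V) (hS : S' ⊆ S) (hC0 : 0 ≤ C) (hC : C ≤ C') (hM0 : 0 ≤ M) (hM : M ≤ M') :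
    GevreyWith f c V' S' C' M' := fun n x hx h hh => by
  have hC' : 0 ≤ C' := hC0.trans hC
  exact (hf n x (hV hx) h (hS hh)).trans (by gcongr)

theorem GevreyBounds.mono {V' : Set ι} {S' : Set ℂ} (hf : GevreyBounds f c V S)
    (hV : V' ⊆ V) (hS : S' ⊆ S) : GevreyBounds f c V' S' := by
  obtain ⟨C, M, hC, hM, H⟩ := hf
  exact ⟨C, M, hC, hM, fun n x hx h hh => H n x (hV hx) h (hS hh)⟩

/-- A single threshold for both constants, so that several expansions can be given common constants
by taking maxima. -/
theorem GevreyBounds.exists_with (hf : GevreyBounds f c V S) :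
    ∃ C, 1 ≤ C ∧ ∀ C' M', C ≤ C' → C ≤ M' → GevreyWith f c V S C' M' := by
  obtain ⟨C, M, hC, hM, H⟩ := hf
  refine ⟨max (max C M) 1, by simp, fun C' M' hC' hM' => ?_⟩
  have h1 : C ≤ C' := le_trans (by simp) hC'
  have h2 : M ≤ M' := le_trans (by simp) hM'
  exact GevreyWith.mono (C := C) (M := M) H subset_rfl subset_rfl hC.le h1 hM.le h2

theorem GevreyWith.bounds (hf : GevreyWith f c V S C M) (hC : 0 ≤ C) (hM : 0 ≤ M) :
    GevreyBounds f c V S := by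
  refine ⟨C + 1, M + 1, by positivity, by positivity, fun n x hx h hh => ?_⟩
  exact GevreyWith.mono (C := C) (M := M) (C' := C + 1) (M' := M + 1) hf subset_rfl subset_rfl hC
    (by linarith) hM (by linarith) n x hx h hh

/-- Points of `S` accumulate at the origin. -/
def Accumulates (S : Set ℂ) : Prop := ∀ ε > 0, ∃ h ∈ S, h ≠ 0 ∧ ‖h‖ < ε

/-- From c_n h^n = R_n - R_{n+1}: divide by h^n and let h tend to 0 in S. The constants do not
deteriorate. -/
theorem GevreyWith.norm_coeff_le (hf : GevreyWith f c V S C M) (hS : Accumulates S) (n : ℕ)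
    {x : ι} (hx : x ∈ V) : ‖c n x‖ ≤ C * M ^ n * (n.factorial : ℝ) := by
  refine le_of_forall_pos_le_add fun ε hε => ?_
  set K := |C * M ^ (n + 1) * ((n + 1).factorial : ℝ)| with hK
  obtain ⟨h, hh, h0, hs⟩ := hS (ε / (K + 1)) (by positivity)
  have h1 := hf n x hx h hh
  have h2 := hf (n + 1) x hx h hh
  have hp : 0 < ‖h‖ := norm_pos_iff.2 h0
  have h3 : c n x * h ^ n = remainder f c n x h - remainder f c (n + 1) x h := by
    rw [remainder_eq_succ]; ring
  have h4 : ‖c n x‖ * ‖h‖ ^ n ≤ (C * M ^ n * (n.factorial : ℝ) + K * ‖h‖) * ‖h‖ ^ n := by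
    rw [← norm_pow, ← norm_mul, h3, norm_pow]
    refine (norm_sub_le _ _).trans ?_
    have h5 : C * M ^ (n + 1) * ((n + 1).factorial : ℝ) * ‖h‖ ^ (n + 1) ≤
      K * ‖h‖ ^ (n + 1) := by gcongr; exact le_abs_self _
    have h6 : K * ‖h‖ ^ (n + 1) = K * ‖h‖ * ‖h‖ ^ n := by ring
    linarith
  have h6 := le_of_mul_le_mul_right h4 (by positivity)
  have h7 : K * ‖h‖ ≤ ε := by
    rw [lt_div_iff₀ (by positivity)] at hs
    nlinarith
  linarith

theorem GevreyWith.norm_le (hf : GevreyWith f c V S C M) {x : ι} (hx : x ∈ V) {h : ℂ}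
    (hh : h ∈ S) : ‖f x h‖ ≤ C := by
  simpa [remainder_zero] using hf 0 x hx h hh

theorem GevreyWith.congr {f' : ι → ℂ → ℂ} {c' : ℕ → ι → ℂ} (hf : GevreyWith f c V S C M)
    (h1 : ∀ x ∈ V, ∀ h ∈ S, f' x h = f x h) (h2 : ∀ n, ∀ x ∈ V, c' n x = c n x) :
    GevreyWith f' c' V S C M := by
  intro n x hx h hh
  have : remainder f' c' n x h = remainder f c n x h := by
    simp only [remainder, h1 x hx h hh]
    congr 1
    exact Finset.sum_congr rfl fun k _ => by rw [h2 k x hx]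
  rw [this]; exact hf n x hx h hh

theorem GevreyBounds.congr {f' : ι → ℂ → ℂ} {c' : ℕ → ι → ℂ} (hf : GevreyBounds f c V S)
    (h1 : ∀ x ∈ V, ∀ h ∈ S, f' x h = f x h) (h2 : ∀ n, ∀ x ∈ V, c' n x = c n x) :
    GevreyBounds f' c' V S := by
  obtain ⟨C, M, hC, hM, H⟩ := hf
  exact ⟨C, M, hC, hM, GevreyWith.congr (C := C) (M := M) H h1 h2⟩

theorem GevreyBounds.add (hf : GevreyBounds f c V S) (hg : GevreyBounds g d V S) :
    GevreyBounds (fun x h => f x h + g x h) (fun n x => c n x + d n x) V S := by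
  obtain ⟨C, hC, hf⟩ := hf.exists_with
  obtain ⟨D, hD, hg⟩ := hg.exists_with
  have hf := hf (max C D) (max C D) (le_max_left _ _) (le_max_left _ _)
  have hg := hg (max C D) (max C D) (le_max_right _ _) (le_max_right _ _)
  have h0 : 0 ≤ max C D := le_trans (by linarith) (le_max_left _ _)
  refine GevreyWith.bounds (C := 2 * max C D) (M := max C D) (fun n x hx h hh => ?_)
    (by positivity) h0
  have : remainder (fun x h => f x h + g x h) (fun n x => c n x + d n x) n x h =
      remainder f c n x h + remainder g d n x h := by
    simp only [remainder, add_mul, Finset.sum_add_distrib]; ring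
  rw [this]
  refine (norm_add_le _ _).trans ?_
  linarith [hf n x hx h hh, hg n x hx h hh]

theorem GevreyBounds.const_mul (hf : GevreyBounds f c V S) {a : ι → ℂ} {A : ℝ}
    (ha : ∀ x ∈ V, ‖a x‖ ≤ A) :
    GevreyBounds (fun x h => a x * f x h) (fun n x => a x * c n x) V S := by
  obtain ⟨C, M, hC, hM, H⟩ := hf
  refine GevreyWith.bounds (C := max A 0 * C) (M := M) (fun n x hx h hh => ?_)
    (by positivity) hM.le
  have : remainder (fun x h => a x * f x h) (fun n x => a x * c n x) n x h =
      a x * remainder f c n x h := by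
    simp only [remainder, mul_sub, Finset.mul_sum, mul_assoc]
  rw [this, norm_mul]
  have h1 : ‖a x‖ ≤ max A 0 := (ha x hx).trans (le_max_left _ _)
  calc ‖a x‖ * ‖remainder f c n x h‖ ≤
      max A 0 * (C * M ^ n * (n.factorial : ℝ) * ‖h‖ ^ n) :=
        mul_le_mul h1 (H n x hx h hh) (norm_nonneg _) (le_max_right _ _)
    _ = _ := by ring

theorem GevreyBounds.neg (hf : GevreyBounds f c V S) :
    GevreyBounds (fun x h => -f x h) (fun n x => -c n x) V S := by
  have := hf.const_mul (a := fun _ => -1) (A := 1) (by simp)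
  simpa using this

theorem GevreyBounds.sub (hf : GevreyBounds f c V S) (hg : GevreyBounds g d V S) :
    GevreyBounds (fun x h => f x h - g x h) (fun n x => c n x - d n x) V S := by
  simpa [sub_eq_add_neg] using hf.add hg.neg

/-- A bounded function that does not depend on `h`. -/
theorem gevreyBounds_const {a : ι → ℂ} {A : ℝ} (ha : ∀ x ∈ V, ‖a x‖ ≤ A) :
    GevreyBounds (fun x _ => a x) (fun n x => if n = 0 then a x else 0) V S := by
  refine GevreyWith.bounds (C := max A 0) (M := 1) (fun n x hx h hh => ?_)
    (by positivity) zero_le_one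
  cases n with
  | zero => simpa [remainder_zero] using Or.inl (ha x hx)
  | succ n =>
    have : remainder (fun x _ => a x) (fun n x => if n = 0 then a x else 0) (n + 1) x h = 0 := by
      simp [remainder]
    rw [this, norm_zero]; positivity

/-- Division by `h` of a function with vanishing leading coefficient. -/
theorem GevreyBounds.div (hf : GevreyBounds f c V S) (h0 : (0 : ℂ) ∉ S) :
    GevreyBounds (fun x h => (f x h - c 0 x) / h) (fun n x => c (n + 1) x) V S := by
  obtain ⟨C, M, hC, hM, H⟩ := hf
  refine GevreyWith.bounds (C := C * M) (M := 2 * M) (fun n x hx h hh => ?_)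
    (by positivity) (by positivity)
  have hne : h ≠ 0 := fun h' => h0 (h' ▸ hh)
  have : remainder (fun x h => (f x h - c 0 x) / h) (fun n x => c (n + 1) x) n x h =
      remainder f c (n + 1) x h / h := by
    simp only [remainder, Finset.sum_range_succ', pow_zero, mul_one]
    rw [eq_div_iff hne, sub_mul, div_mul_cancel₀ _ hne, Finset.sum_mul]
    simp only [pow_succ, mul_assoc]
    ring
  rw [this, norm_div, div_le_iff₀ (norm_pos_iff.2 hne)]
  refine (H (n + 1) x hx h hh).trans ?_
  have := natCast_succ_factorial_le n
  calc C * M ^ (n + 1) * ((n + 1).factorial : ℝ) * ‖h‖ ^ (n + 1)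
      ≤ C * M ^ (n + 1) * (2 ^ n * (n.factorial : ℝ)) * ‖h‖ ^ (n + 1) := by gcongr
    _ = _ := by rw [mul_pow, pow_succ, pow_succ]; ring

/-- Multiplication by `h`. -/
theorem GevreyWith.h_mul (hf : GevreyWith f c V S C M) (hC : 0 ≤ C) (hM : 0 < M) {r ε : ℝ}
    (hr : ∀ h ∈ S, ‖h‖ ≤ r) (h1 : C * r ≤ ε) (h2 : C / M ≤ ε) :
    GevreyWith (fun x h => h * f x h) (fun n x => if n = 0 then 0 else c (n - 1) x) V S ε M := by
  intro n x hx h hh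
  have hr' := hr h hh
  cases n with
  | zero =>
    have := hf.norm_le hx hh
    simp only [remainder_zero, norm_mul, pow_zero, Nat.factorial_zero, Nat.cast_one, mul_one]
    calc ‖h‖ * ‖f x h‖ ≤ r * C := by gcongr; exact (norm_nonneg _).trans hr'
      _ ≤ ε := by linarith
  | succ n =>
    have : remainder (fun x h => h * f x h) (fun n x => if n = 0 then 0 else c (n - 1) x) (n + 1)
        x h = h * remainder f c n x h := by
      simp only [remainder, Finset.sum_range_succ', mul_sub, Finset.mul_sum]
      simp only [Nat.add_eq_zero_iff, one_ne_zero, and_false, ↓reduceIte, Nat.add_sub_cancel,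
        zero_mul, add_zero, pow_succ]
      congr 1
      exact Finset.sum_congr rfl fun k _ => by ring
    rw [this, norm_mul]
    -- The two smallness hypotheses serve the two cases: C r ≤ ε handles order 0, and C / M ≤ ε
    -- trades one factor M for the smaller amplitude at positive order. Large M and small r thus
    -- make ε as small as desired.
    have hCM : C ≤ ε * M := by rwa [div_le_iff₀ hM] at h2
    have hε : 0 ≤ ε := le_trans (by positivity) h2
    have hf' : ((n.factorial : ℕ) : ℝ) ≤ ((n + 1).factorial : ℝ) := by
      exact_mod_cast Nat.factorial_le (Nat.le_succ n)
    calc ‖h‖ * ‖remainder f c n x h‖ ≤ ‖h‖ * (C * M ^ n * (n.factorial : ℝ) * ‖h‖ ^ n) := by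
          gcongr; exact hf n x hx h hh
      _ ≤ ‖h‖ * (ε * M * M ^ n * ((n + 1).factorial : ℝ) * ‖h‖ ^ n) := by gcongr
      _ = _ := by rw [pow_succ, pow_succ]; ring

theorem GevreyBounds.h_mul (hf : GevreyBounds f c V S) {r : ℝ} (hr : ∀ h ∈ S, ‖h‖ ≤ r) :
    GevreyBounds (fun x h => h * f x h) (fun n x => if n = 0 then 0 else c (n - 1) x) V S := by
  obtain ⟨C, M, hC, hM, H⟩ := hf
  exact (GevreyWith.h_mul (C := C) (M := M) (ε := max (C * r) (C / M)) H hC.le hM hr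
    (le_max_left _ _) (le_max_right _ _)).bounds (le_trans (by positivity) (le_max_right _ _)) hM.le

/-- The remainder of a product. -/
theorem remainder_mul (f g : ι → ℂ → ℂ) (c d : ℕ → ι → ℂ) (n : ℕ) (x : ι) (h : ℂ) :
    remainder (fun x h => f x h * g x h)
        (fun n x => ∑ k ∈ Finset.range (n + 1), d k x * c (n - k) x) n x h =
      f x h * remainder g d n x h +
        ∑ k ∈ Finset.range n, d k x * h ^ k * remainder f c (n - k) x h := by
  -- The truncated Cauchy product is regrouped by the index of d: for each k there remains the
  -- partial sum of f of length n - k.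
  have key : ∑ m ∈ Finset.range n, (∑ k ∈ Finset.range (m + 1), d k x * c (m - k) x) * h ^ m =
      ∑ k ∈ Finset.range n, d k x * h ^ k * ∑ j ∈ Finset.range (n - k), c j x * h ^ j := by
    simp only [Finset.sum_mul, Finset.mul_sum]
    rw [Finset.sum_sigma', Finset.sum_sigma']
    refine Finset.sum_bij' (fun p _ => ⟨p.2, p.1 - p.2⟩) (fun p _ => ⟨p.1 + p.2, p.1⟩)
      ?_ ?_ ?_ ?_ ?_
    · rintro ⟨m, k⟩ hp
      simp only [Finset.mem_sigma, Finset.mem_range] at *; omega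
    · rintro ⟨m, k⟩ hp
      simp only [Finset.mem_sigma, Finset.mem_range] at *; omega
    · rintro ⟨m, k⟩ hp
      simp only [Finset.mem_sigma, Finset.mem_range] at *
      rw [Sigma.mk.injEq]; exact ⟨by omega, by rfl⟩
    · rintro ⟨m, k⟩ hp
      simp
    · rintro ⟨m, k⟩ hp
      simp only [Finset.mem_sigma, Finset.mem_range] at *
      have : h ^ m = h ^ k * h ^ (m - k) := by rw [← pow_add]; congr 1; omega
      rw [this]; ring
  simp only [remainder, mul_sub, Finset.sum_sub_distrib]
  rw [key]
  simp only [Finset.mul_sum]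
  have : ∑ i ∈ Finset.range n, f x h * (d i x * h ^ i) =
      ∑ i ∈ Finset.range n, d i x * h ^ i * f x h := Finset.sum_congr rfl fun i _ => by ring
  rw [this]; ring

/-- The growth rate M is preserved and only the amplitude changes, the 4 being that of
`sum_factorial_mul_factorial_le`. Hence a j-th power has amplitude (4C)^j with the same M, and power
series of Gevrey functions can be summed. -/
theorem GevreyWith.mul (hf : GevreyWith f c V S C M) (hg : GevreyWith g d V S D M)
    (hC : 0 ≤ C) (hD : 0 ≤ D) (hM : 0 ≤ M) (hS : Accumulates S) :
    GevreyWith (fun x h => f x h * g x h)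
      (fun n x => ∑ k ∈ Finset.range (n + 1), d k x * c (n - k) x) V S (4 * (C * D)) M := by
  intro n x hx h hh
  rw [remainder_mul]
  have h1 : ‖f x h * remainder g d n x h‖ ≤
      C * D * M ^ n * ‖h‖ ^ n * ((n.factorial : ℝ) * ((n - n).factorial : ℝ)) := by
    rw [norm_mul, Nat.sub_self, Nat.factorial_zero, Nat.cast_one, mul_one]
    calc ‖f x h‖ * ‖remainder g d n x h‖ ≤ C * (D * M ^ n * (n.factorial : ℝ) * ‖h‖ ^ n) :=
          mul_le_mul (hf.norm_le hx hh) (hg n x hx h hh) (norm_nonneg _) hC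
      _ = _ := by ring
  have h2 : ‖∑ k ∈ Finset.range n, d k x * h ^ k * remainder f c (n - k) x h‖ ≤
      ∑ k ∈ Finset.range n,
        C * D * M ^ n * ‖h‖ ^ n * ((k.factorial : ℝ) * ((n - k).factorial : ℝ)) := by
    refine norm_sum_le_of_le _ fun k hk => ?_
    have hk := (Finset.mem_range.1 hk).le
    rw [norm_mul, norm_mul, norm_pow]
    calc ‖d k x‖ * ‖h‖ ^ k * ‖remainder f c (n - k) x h‖
        ≤ (D * M ^ k * (k.factorial : ℝ)) * ‖h‖ ^ k *
          (C * M ^ (n - k) * ((n - k).factorial : ℝ) * ‖h‖ ^ (n - k)) := by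
          gcongr
          · exact hg.norm_coeff_le hS k hx
          · exact hf (n - k) x hx h hh
      _ = C * D * (M ^ k * M ^ (n - k)) * (‖h‖ ^ k * ‖h‖ ^ (n - k)) *
          ((k.factorial : ℝ) * ((n - k).factorial : ℝ)) := by ring
      _ = _ := by rw [← pow_add, ← pow_add, Nat.add_sub_cancel' hk]
  refine (norm_add_le _ _).trans ((add_le_add h1 h2).trans ?_)
  rw [add_comm, ← Finset.mul_sum, ← mul_add,
    ← Finset.sum_range_succ (fun k => (k.factorial : ℝ) * ((n - k).factorial : ℝ)) n]
  calc _ ≤ C * D * M ^ n * ‖h‖ ^ n * (4 * (n.factorial : ℝ)) := by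
        gcongr; exact sum_factorial_mul_factorial_le n
    _ = _ := by ring

theorem GevreyBounds.mul (hf : GevreyBounds f c V S) (hg : GevreyBounds g d V S)
    (hS : Accumulates S) :
    GevreyBounds (fun x h => f x h * g x h)
      (fun n x => ∑ k ∈ Finset.range (n + 1), d k x * c (n - k) x) V S := by
  obtain ⟨C, hC, hf⟩ := hf.exists_with
  obtain ⟨D, hD, hg⟩ := hg.exists_with
  have hf := hf (max C D) (max C D) (le_max_left _ _) (le_max_left _ _)
  have hg := hg (max C D) (max C D) (le_max_right _ _) (le_max_right _ _)
  have h0 : 0 ≤ max C D := le_trans (by linarith) (le_max_left _ _)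
  exact (hf.mul hg h0 h0 h0 hS).bounds (by positivity) h0

/-! ### Composition with a power series -/

theorem GevreyWith.pow (hg : GevreyWith g d V S C M) (hC : 0 ≤ C) (hM : 0 ≤ M)
    (hS : Accumulates S) (j : ℕ) :
    GevreyWith (fun x h => g x h ^ j)
      (fun n x => PowerSeries.coeff n ((PowerSeries.mk fun k => d k x) ^ j)) V S ((4 * C) ^ j) M := by
  induction j with
  | zero =>
    intro n x hx h hh
    cases n with
    | zero => simp [remainder_zero]
    | succ n =>
      have : remainder (fun x h => g x h ^ 0)
          (fun n x => PowerSeries.coeff n ((PowerSeries.mk fun k => d k x) ^ 0)) (n + 1) x h = 0 := by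
        simp [remainder, PowerSeries.coeff_one]
      rw [this, norm_zero]; positivity
  | succ j ih =>
    have h1 := ih.mul hg (by positivity) hC hM hS
    have h2 : 4 * ((4 * C) ^ j * C) = (4 * C) ^ (j + 1) := by rw [pow_succ]; ring
    rw [h2] at h1
    refine h1.congr (fun x _ h _ => by rw [pow_succ]) fun n x _ => ?_
    rw [pow_succ', PowerSeries.coeff_mul, Finset.Nat.sum_antidiagonal_eq_sum_range_succ
      (fun i j' => PowerSeries.coeff i (PowerSeries.mk fun k => d k x) *
        PowerSeries.coeff j' ((PowerSeries.mk fun k => d k x) ^ j))]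
    simp

theorem coeff_pow_eq_zero {r : PowerSeries ℂ} (hr : PowerSeries.constantCoeff r = 0) {n j : ℕ}
    (h : n < j) : PowerSeries.coeff n (r ^ j) = 0 := by
  have : (PowerSeries.X : PowerSeries ℂ) ^ j ∣ r ^ j :=
    pow_dvd_pow_of_dvd (PowerSeries.X_dvd_iff.2 hr) j
  exact (PowerSeries.X_pow_dvd_iff.1 this) n h

/-- The remainders of the powers are summed over j. Vanishing of the leading coefficient makes the
coefficient of order n a finite sum over j ≤ n, so the composed formal series makes sense. -/
theorem GevreyWith.comp (hg : GevreyWith g d V S C M) (hC : 0 ≤ C) (hM : 0 ≤ M)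
    (hS : Accumulates S) (hd : ∀ x ∈ V, d 0 x = 0) (a : ℕ → ℂ)
    (ha : Summable fun j => ‖a j‖ * (4 * C) ^ j) :
    GevreyWith (fun x h => ∑' j, a j * g x h ^ j)
      (fun n x => ∑ j ∈ Finset.range (n + 1),
        a j * PowerSeries.coeff n ((PowerSeries.mk fun k => d k x) ^ j)) V S
      (∑' j, ‖a j‖ * (4 * C) ^ j) M := by
  intro n x hx h hh
  have hp := fun j => hg.pow hC hM hS j
  have hs1 : HasSum (fun j => a j * g x h ^ j) (∑' j, a j * g x h ^ j) := by
    refine (Summable.of_norm_bounded ha fun j => ?_).hasSum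
    rw [norm_mul]
    gcongr
    exact (hp j).norm_le hx hh
  have hs2 : ∀ k, HasSum
      (fun j => a j * PowerSeries.coeff k ((PowerSeries.mk fun k => d k x) ^ j) * h ^ k)
      ((∑ j ∈ Finset.range (k + 1),
        a j * PowerSeries.coeff k ((PowerSeries.mk fun k => d k x) ^ j)) * h ^ k) := by
    intro k
    rw [Finset.sum_mul]
    refine hasSum_sum_of_ne_finset_zero fun j hj => ?_
    rw [coeff_pow_eq_zero (by simp [hd x hx]) (by simpa using hj)]
    simp
  have hs3 := hs1.sub (hasSum_sum (s := Finset.range n) fun k _ => hs2 k)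
  have hs4 : (fun j => a j * g x h ^ j - ∑ k ∈ Finset.range n,
      a j * PowerSeries.coeff k ((PowerSeries.mk fun k => d k x) ^ j) * h ^ k) =
      fun j => a j * remainder (fun x h => g x h ^ j)
        (fun n x => PowerSeries.coeff n ((PowerSeries.mk fun k => d k x) ^ j)) n x h := by
    funext j
    simp only [remainder, mul_sub, Finset.mul_sum, mul_assoc]
  rw [hs4] at hs3
  simp only [remainder]
  rw [← hs3.tsum_eq]
  have hsum := ha.hasSum.mul_right (M ^ n * (n.factorial : ℝ) * ‖h‖ ^ n)
  refine (tsum_of_norm_bounded hsum fun j => ?_).trans (by rw [mul_assoc, mul_assoc, mul_assoc])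
  rw [norm_mul]
  calc ‖a j‖ * _ ≤ ‖a j‖ * ((4 * C) ^ j * M ^ n * (n.factorial : ℝ) * ‖h‖ ^ n) := by
        gcongr; exact hp j n x hx h hh
    _ = _ := by ring

/-- The Gevrey asymptotics of an exponential. -/
theorem GevreyBounds.cexp (hg : GevreyBounds g d V S) (hS : Accumulates S) :
    GevreyBounds (fun x h => Complex.exp (g x h))
      (fun n x => PowerSeries.coeff n (expSeries (PowerSeries.mk fun k => d k x))) V S := by
  obtain ⟨C, hC, H⟩ := hg.exists_with
  have hd0 : ∀ x ∈ V, ‖d 0 x‖ ≤ C := fun x hx => by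
    simpa using (H C C le_rfl le_rfl).norm_coeff_le hS 0 hx
  -- The constant term is split off to meet the requirement of `GevreyWith.comp` and restored as the
  -- bounded factor exp(d₀). The exponential series converges everywhere, so no smallness is needed.
  have h0 := hg.sub (gevreyBounds_const (S := S) hd0)
  obtain ⟨D, hD, h0⟩ := h0.exists_with
  have ha : Summable fun j => ‖((j.factorial : ℂ))⁻¹‖ * (4 * D) ^ j := by
    have := Real.summable_pow_div_factorial (4 * D)
    refine this.congr fun j => ?_
    rw [norm_inv, Complex.norm_natCast]; ring
  have h1 := (h0 D D le_rfl le_rfl).comp (by linarith) (by linarith) hS (fun x hx => by simp)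
    (fun j => ((j.factorial : ℂ))⁻¹) ha
  have h2 := (h1.bounds (tsum_nonneg fun j => by positivity) (by linarith)).const_mul
    (a := fun x => Complex.exp (d 0 x)) (A := Real.exp C) fun x hx => by
      rw [Complex.norm_exp]
      exact Real.exp_le_exp.2 ((Complex.re_le_norm _).trans (hd0 x hx))
  refine h2.congr (fun x _ h _ => ?_) fun n x _ => ?_
  · have : ∑' j, ((j.factorial : ℂ))⁻¹ * (g x h - d 0 x) ^ j = Complex.exp (g x h - d 0 x) := by
      rw [Complex.exp_eq_exp_ℂ, NormedSpace.exp_eq_tsum_div]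
      exact tsum_congr fun j => by ring
    rw [this, ← Complex.exp_add]; congr 1; ring
  · have h3 : (PowerSeries.mk fun k => d k x) -
        PowerSeries.C (PowerSeries.constantCoeff (PowerSeries.mk fun k => d k x)) =
        PowerSeries.mk fun k => d k x - if k = 0 then d 0 x else 0 := by
      ext k
      by_cases hk : k = 0
      · simp [hk]
      · simp [hk, PowerSeries.coeff_C]
    rw [expSeries, PowerSeries.coeff_mk, h3]
    simp only [← PowerSeries.coeff_zero_eq_constantCoeff_apply, PowerSeries.coeff_mk]
    congr 1
    exact Finset.sum_congr rfl fun j _ => by rw [div_eq_inv_mul]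

/-- The Gevrey asymptotics of an inverse, after shrinking of the domain. -/
theorem GevreyBounds.inv (hg : GevreyBounds g d V S) (hS0 : (0 : ℂ) ∉ S)
    {b : ℝ} (hb : 0 < b) (hd : ∀ x ∈ V, b ≤ ‖d 0 x‖) :
    ∃ (e : ℕ → ι → ℂ) (ρ : ℝ), 0 < ρ ∧ ∀ S' ⊆ S, Accumulates S' → (∀ h ∈ S', ‖h‖ ≤ ρ) →
      (∀ x ∈ V, ∀ h ∈ S', g x h ≠ 0) ∧ GevreyBounds (fun x h => (g x h)⁻¹) e V S' := by
  have h1 := (hg.div hS0).const_mul (a := fun x => -(d 0 x)⁻¹) (A := b⁻¹) fun x hx => by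
    rw [norm_neg, norm_inv]; gcongr; exact hd x hx
  obtain ⟨C, hC, h1⟩ := h1.exists_with
  set k : ℕ → ι → ℂ := fun n x => if n = 0 then 0 else -(d 0 x)⁻¹ * d (n - 1 + 1) x with hk
  refine ⟨fun n x => (d 0 x)⁻¹ * ∑ j ∈ Finset.range (n + 1),
    1 * PowerSeries.coeff n ((PowerSeries.mk fun i => k i x) ^ j), (C * 8)⁻¹,
    by positivity, fun S' hS' hacc hr => ?_⟩
  -- Write 1/g = d₀⁻¹ ∑ (1 - g/d₀)^j, where 1 - g/d₀ is h times a Gevrey function. Radius (8C)⁻¹ and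
  -- growth rate 8C give it amplitude 1/8, so the amplitudes of its powers form a geometric series
  -- of ratio 4/8.
  have h2 := ((h1 C (C * 8) le_rfl (by linarith)).mono subset_rfl hS' (by linarith) le_rfl
    (by linarith) le_rfl).h_mul (r := (C * 8)⁻¹) (ε := 1 / 8) (by linarith) (by linarith) hr
    (by rw [mul_inv]; field_simp; norm_num) (by field_simp; norm_num)
  have ha : Summable fun j : ℕ => ‖(1 : ℂ)‖ * (4 * (1 / 8 : ℝ)) ^ j := by
    simp only [norm_one, one_mul]
    exact summable_geometric_of_lt_one (by norm_num) (by norm_num)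
  have h3 := h2.comp (by norm_num) (by linarith) hacc (fun x hx => by simp) (fun _ => (1 : ℂ)) ha
  have h4 := (h3.bounds (tsum_nonneg fun j => by positivity) (by linarith)).const_mul
    (a := fun x => (d 0 x)⁻¹) (A := b⁻¹) fun x hx => by
      rw [norm_inv]; gcongr; exact hd x hx
  have hid : ∀ x ∈ V, ∀ h ∈ S', g x h ≠ 0 ∧
      (g x h)⁻¹ = (d 0 x)⁻¹ * ∑' j : ℕ, (1 : ℂ) *
        (h * (-(d 0 x)⁻¹ * ((g x h - d 0 x) / h))) ^ j := by
    intro x hx h hh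
    have hne : h ≠ 0 := fun h' => hS0 (h' ▸ hS' hh)
    have hd0 : d 0 x ≠ 0 := norm_pos_iff.1 (hb.trans_le (hd x hx))
    have hle := h2.norm_le hx hh
    have heq : h * (-(d 0 x)⁻¹ * ((g x h - d 0 x) / h)) = 1 - g x h / d 0 x := by
      field_simp; ring
    rw [heq] at hle ⊢
    simp only [one_mul]
    rw [tsum_geometric_of_norm_lt_one (by linarith)]
    have hgne : g x h ≠ 0 := by
      intro h0
      rw [h0] at hle
      norm_num at hle
    refine ⟨hgne, ?_⟩
    rw [sub_sub_cancel, inv_div, ← mul_div_assoc, inv_mul_cancel₀ hd0, one_div]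
  exact ⟨fun x hx h hh => (hid x hx h hh).1, h4.congr (fun x hx h hh => (hid x hx h hh).2)
    fun n x _ => rfl⟩

end Gevrey


/-! ### Derivatives and primitives of Gevrey asymptotics -/

theorem remainder_deriv {f : ℂ → ℂ → ℂ} {c : ℕ → ℂ → ℂ} {x h : ℂ}
    (hf : DifferentiableAt ℂ (fun y => f y h) x) (hc : ∀ n, DifferentiableAt ℂ (c n) x) (n : ℕ) :
    HasDerivAt (fun y => remainder f c n y h)
      (remainder (fun y h => deriv (fun y => f y h) y) (fun n => deriv (c n)) n x h) x := by
  unfold remainder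
  exact hf.hasDerivAt.sub (HasDerivAt.fun_sum fun k _ => (hc k).hasDerivAt.mul_const _)

theorem norm_remainder_deriv_le {f : ℂ → ℂ → ℂ} {c : ℕ → ℂ → ℂ} {x h : ℂ} {r B : ℝ} {n : ℕ}
    (hr : 0 < r) (hf : DifferentiableOn ℂ (fun y => f y h) (Metric.ball x r))
    (hc : ∀ n, DifferentiableOn ℂ (c n) (Metric.ball x r))
    (hB : ∀ y ∈ Metric.ball x r, ‖remainder f c n y h‖ ≤ B) :
    ‖remainder (fun y h => deriv (fun y => f y h) y) (fun n => deriv (c n)) n x h‖ ≤ B / r := by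
  have hd : ∀ y ∈ Metric.ball x r, HasDerivAt (fun y => remainder f c n y h)
      (remainder (fun y h => deriv (fun y => f y h) y) (fun n => deriv (c n)) n y h) y :=
    fun y hy => remainder_deriv (hf.differentiableAt (Metric.isOpen_ball.mem_nhds hy))
      (fun n => (hc n).differentiableAt (Metric.isOpen_ball.mem_nhds hy)) n
  rw [← (hd x (Metric.mem_ball_self hr)).deriv]
  exact norm_deriv_le_of_ball hr (fun y hy => (hd y hy).differentiableAt.differentiableWithinAt) hB

/-- Differentiation of Gevrey asymptotics in a holomorphic parameter. -/
theorem GevreyBounds.deriv {f : ℂ → ℂ → ℂ} {c : ℕ → ℂ → ℂ} {V V' S : Set ℂ} {r : ℝ} (hr : 0 < r)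
    (hV : ∀ x ∈ V', Metric.ball x r ⊆ V) (hg : GevreyBounds f c V S)
    (hf : ∀ h ∈ S, DifferentiableOn ℂ (fun y => f y h) V) (hc : ∀ n, DifferentiableOn ℂ (c n) V) :
    GevreyBounds (fun y h => _root_.deriv (fun y => f y h) y) (fun n => _root_.deriv (c n))
      V' S := by
  obtain ⟨C, M, hC, hM, H⟩ := hg
  refine GevreyWith.bounds (C := C / r) (M := M) (fun n x hx h hh => ?_) (by positivity) hM.le
  refine (norm_remainder_deriv_le hr ((hf h hh).mono (hV x hx)) (fun n => (hc n).mono (hV x hx))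
    fun y hy => H n y (hV x hx hy) h hh).trans (le_of_eq ?_)
  ring

/-- Integration of Gevrey asymptotics. -/
theorem GevreyBounds.primitive {f F : ℂ → ℂ → ℂ} {c G : ℕ → ℂ → ℂ} {x₁ : ℂ} {r : ℝ} {S : Set ℂ}
    (hr : 0 < r) (hg : GevreyBounds f c (Metric.ball x₁ r) S)
    (hF : ∀ h ∈ S, ∀ x ∈ Metric.ball x₁ r, HasDerivAt (fun y => F y h) (f x h) x)
    (hG : ∀ n, ∀ x ∈ Metric.ball x₁ r, HasDerivAt (G n) (c n x) x)
    (hF0 : ∀ h ∈ S, F x₁ h = 0) (hG0 : ∀ n, G n x₁ = 0) :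
    GevreyBounds F G (Metric.ball x₁ r) S := by
  obtain ⟨C, M, hC, hM, H⟩ := hg
  refine GevreyWith.bounds (C := C * r) (M := M) (fun n x hx h hh => ?_) (by positivity) hM.le
  have hd : ∀ y ∈ Metric.ball x₁ r, HasDerivAt (fun y => remainder F G n y h)
      (remainder f c n y h) y := fun y hy => by
    unfold remainder
    exact (hF h hh y hy).sub (HasDerivAt.fun_sum fun k _ => (hG k y hy).mul_const _)
  have h1 := Convex.norm_image_sub_le_of_norm_deriv_le (x := x₁) (y := x)
    (fun y hy => (hd y hy).differentiableAt)
    (fun y hy => by rw [(hd y hy).deriv]; exact H n y hy h hh) (convex_ball x₁ r)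
    (Metric.mem_ball_self hr) hx
  have h2 : remainder F G n x₁ h = 0 := by simp [remainder, hF0 h hh, hG0]
  rw [h2, sub_zero] at h1
  refine h1.trans ?_
  have h3 : ‖x - x₁‖ ≤ r := by
    rw [← dist_eq_norm]; exact (Metric.mem_ball.1 hx).le
  calc _ ≤ C * M ^ n * (n.factorial : ℝ) * ‖h‖ ^ n * r := by gcongr
    _ = _ := by ring

/-! ### Borel discs -/

theorem mem_borelDisc_iff {θ δ : ℝ} {h : ℂ} :
    h ∈ borelDisc θ δ ↔ 1 / δ < (Complex.exp (θ * Complex.I) / h).re := Iff.rfl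

theorem borelDisc_mono {θ δ δ' : ℝ} (h0 : 0 < δ') (h : δ' ≤ δ) : borelDisc θ δ' ⊆ borelDisc θ δ := by
  intro z hz
  rw [mem_borelDisc_iff] at *
  exact (one_div_le_one_div_of_le h0 h).trans_lt hz

theorem ne_zero_of_mem_borelDisc {θ δ : ℝ} (hδ : 0 < δ) {h : ℂ} (hh : h ∈ borelDisc θ δ) :
    h ≠ 0 := by
  rintro rfl
  rw [mem_borelDisc_iff] at hh
  simp only [div_zero, Complex.zero_re] at hh
  have : 0 < 1 / δ := by positivity
  linarith

theorem zero_notMem_borelDisc {θ δ : ℝ} (hδ : 0 < δ) : (0 : ℂ) ∉ borelDisc θ δ :=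
  fun h => ne_zero_of_mem_borelDisc hδ h rfl

theorem norm_lt_of_mem_borelDisc {θ δ : ℝ} (hδ : 0 < δ) {h : ℂ} (hh : h ∈ borelDisc θ δ) :
    ‖h‖ < δ := by
  have hne := norm_pos_iff.2 (ne_zero_of_mem_borelDisc hδ hh)
  have h1 : 1 / δ < ‖h‖⁻¹ := by
    refine (mem_borelDisc_iff.1 hh).trans_le ((Complex.re_le_norm _).trans ?_)
    rw [norm_div, Complex.norm_exp_ofReal_mul_I, one_div]
  rw [one_div] at h1
  exact (inv_lt_inv₀ hδ hne).1 h1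

/-- The inversion h ↦ 1/h turns a half-plane not containing the origin into a disc whose boundary
passes through the origin. -/
theorem borelDisc_eq_ball {θ δ : ℝ} (hδ : 0 < δ) :
    borelDisc θ δ = Metric.ball (Complex.exp (θ * Complex.I) * (δ / 2 : ℝ)) (δ / 2) := by
  ext h
  rw [mem_borelDisc_iff, Metric.mem_ball, dist_eq_norm]
  set e := Complex.exp (θ * Complex.I) with he
  have hen : Complex.normSq e = 1 := by
    rw [Complex.normSq_eq_norm_sq, he, Complex.norm_exp_ofReal_mul_I]; norm_num
  have h2 : ‖h - e * (δ / 2 : ℝ)‖ < δ / 2 ↔ Complex.normSq (h - e * (δ / 2 : ℝ)) < (δ / 2) ^ 2 := by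
    rw [Complex.normSq_eq_norm_sq]
    exact (sq_lt_sq₀ (norm_nonneg _) (by positivity)).symm
  rw [h2]
  simp only [Complex.normSq_apply, Complex.sub_re, Complex.sub_im, Complex.mul_re, Complex.mul_im,
    Complex.ofReal_re, Complex.ofReal_im, mul_zero, sub_zero, zero_add] at *
  rw [Complex.div_re]
  by_cases h0 : h = 0
  · subst h0
    simp only [Complex.zero_re, Complex.zero_im, map_zero, mul_zero, div_zero, add_zero, zero_sub]
    have : 0 < 1 / δ := by positivity
    constructor
    · intro h; linarith
    · intro h; nlinarith
  · have hn : 0 < Complex.normSq h := Complex.normSq_pos.2 h0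
    rw [← add_div, div_lt_div_iff₀ hδ hn, Complex.normSq_apply]
    constructor <;> intro H <;> nlinarith

theorem isOpen_borelDisc {θ δ : ℝ} (hδ : 0 < δ) : IsOpen (borelDisc θ δ) := by
  rw [borelDisc_eq_ball hδ]; exact Metric.isOpen_ball

theorem isPreconnected_borelDisc {θ δ : ℝ} (hδ : 0 < δ) : IsPreconnected (borelDisc θ δ) := by
  rw [borelDisc_eq_ball hδ]; exact (convex_ball _ _).isPreconnected

theorem mem_borelDisc_polar {θ δ ρ φ : ℝ} (hδ : 0 < δ) (hρ : 0 < ρ) :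
    (ρ * Complex.exp (φ * Complex.I) : ℂ) ∈ borelDisc θ δ ↔ ρ < δ * Real.cos (θ - φ) := by
  rw [mem_borelDisc_iff]
  have : Complex.exp (θ * Complex.I) / (ρ * Complex.exp (φ * Complex.I)) =
      ((ρ⁻¹ : ℝ) : ℂ) * Complex.exp ((θ - φ : ℝ) * Complex.I) := by
    rw [mul_comm (ρ : ℂ), ← div_div, ← Complex.exp_sub]
    push_cast
    rw [div_eq_inv_mul]
    congr 2; ring
  rw [this, Complex.re_ofReal_mul, Complex.exp_ofReal_mul_I_re, inv_mul_eq_div,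
    div_lt_div_iff₀ hδ hρ]
  constructor <;> intro h <;> linarith

theorem exists_sector_subset_borelDisc {θ δ a' b' : ℝ} (hδ : 0 < δ) (ha : θ - Real.pi / 2 < a')
    (hab : a' < b') (hb : b' < θ + Real.pi / 2) :
    ∃ r : ℝ, 0 < r ∧ straightSector a' b' r ⊆ borelDisc θ δ := by
  have h1 : 0 < Real.cos (θ - a') := Real.cos_pos_of_mem_Ioo ⟨by linarith, by linarith⟩
  have h2 : 0 < Real.cos (θ - b') := Real.cos_pos_of_mem_Ioo ⟨by linarith, by linarith⟩
  refine ⟨δ * min (Real.cos (θ - a')) (Real.cos (θ - b')), by positivity, ?_⟩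
  rintro _ ⟨ρ, φ, hρ, hρr, hφa, hφb, rfl⟩
  rw [mem_borelDisc_polar hδ hρ]
  refine hρr.trans_le ?_
  gcongr
  rcases le_total φ θ with h | h
  · refine (min_le_left _ _).trans ?_
    rw [← Real.cos_abs (θ - φ), ← Real.cos_abs (θ - a'), abs_of_nonneg (by linarith),
      abs_of_nonneg (by linarith)]
    exact Real.cos_le_cos_of_nonneg_of_le_pi (by linarith) (by linarith [Real.pi_pos]) (by linarith)
  · refine (min_le_right _ _).trans ?_
    rw [← Real.cos_abs (θ - φ), ← Real.cos_abs (θ - b'), abs_of_nonpos (by linarith),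
      abs_of_nonpos (by linarith)]
    exact Real.cos_le_cos_of_nonneg_of_le_pi (by linarith) (by linarith [Real.pi_pos]) (by linarith)

theorem accumulates_borelDisc {θ δ : ℝ} (hδ : 0 < δ) : Accumulates (borelDisc θ δ) := by
  intro ε hε
  have hm : 0 < min (δ / 2) (ε / 2) := by positivity
  refine ⟨(min (δ / 2) (ε / 2) : ℝ) * Complex.exp (θ * Complex.I), ?_, ?_, ?_⟩
  · rw [mem_borelDisc_polar hδ hm]
    simp only [sub_self, Real.cos_zero, mul_one]
    exact (min_le_left _ _).trans_lt (by linarith)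
  · exact mul_ne_zero (by exact_mod_cast hm.ne') (Complex.exp_ne_zero _)
  · rw [norm_mul, Complex.norm_exp_ofReal_mul_I, mul_one, Complex.norm_real,
      Real.norm_of_nonneg hm.le]
    exact (min_le_right _ _).trans_lt (by linarith)

theorem accumulates_straightSector {a b r : ℝ} (hab : a < b) (hr : 0 < r) :
    Accumulates (straightSector a b r) := by
  intro ε hε
  have hm : 0 < min (r / 2) (ε / 2) := by positivity
  refine ⟨(min (r / 2) (ε / 2) : ℝ) * Complex.exp (((a + b) / 2 : ℝ) * Complex.I),
    ⟨_, _, hm, (min_le_left _ _).trans_lt (by linarith), by linarith, by linarith, rfl⟩, ?_, ?_⟩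
  · exact mul_ne_zero (by exact_mod_cast hm.ne') (Complex.exp_ne_zero _)
  · rw [norm_mul, Complex.norm_exp_ofReal_mul_I, mul_one, Complex.norm_real,
      Real.norm_of_nonneg hm.le]
    exact (min_le_right _ _).trans_lt (by linarith)

theorem isSectorialDomain_borelDisc {θ δ : ℝ} (hδ : 0 < δ) :
    IsSectorialDomain (θ - Real.pi / 2) (θ + Real.pi / 2) (borelDisc θ δ) := by
  have hpi := Real.pi_pos
  refine ⟨by linarith, by linarith, isOpen_borelDisc hδ, ?_, zero_notMem_borelDisc hδ, ?_,
    fun a' b' ha hab hb => exists_sector_subset_borelDisc hδ ha hab hb, ?_⟩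
  · rw [borelDisc_eq_ball hδ]
    have : ContractibleSpace (Metric.ball (Complex.exp (θ * Complex.I) * (δ / 2 : ℝ)) (δ / 2)) :=
      (convex_ball _ _).contractibleSpace ⟨_, Metric.mem_ball_self (by positivity)⟩
    exact SimplyConnectedSpace.ofContractible _
  · intro u
    constructor
    · intro hu
      -- Directions of points of the disc make an angle at most π/2 with θ. This is a closed
      -- condition, so it persists for cluster values.
      have hcl : IsClosed {w : ℂ | ‖w‖ = 1 ∧ 0 ≤ (Complex.exp (θ * Complex.I) * (starRingEnd ℂ) w).re} :=
        (isClosed_eq continuous_norm continuous_const).inter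
          (isClosed_le continuous_const (Complex.continuous_re.comp
            (continuous_const.mul Complex.continuous_conj)))
      have hmem : ∀ᶠ h in 𝓝[borelDisc θ δ] (0 : ℂ), h / (‖h‖ : ℂ) ∈
          {w : ℂ | ‖w‖ = 1 ∧ 0 ≤ (Complex.exp (θ * Complex.I) * (starRingEnd ℂ) w).re} := by
        filter_upwards [self_mem_nhdsWithin] with h hh
        have hne := ne_zero_of_mem_borelDisc hδ hh
        have hn : 0 < ‖h‖ := norm_pos_iff.2 hne
        refine ⟨by rw [norm_div, Complex.norm_real, norm_norm, div_self hn.ne'], ?_⟩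
        have h1 : 0 < (Complex.exp (θ * Complex.I) / h).re :=
          lt_trans (by positivity) (mem_borelDisc_iff.1 hh)
        have h2 : Complex.exp (θ * Complex.I) * (starRingEnd ℂ) (h / (‖h‖ : ℂ)) =
            ((‖h‖ : ℝ) : ℂ) * (Complex.exp (θ * Complex.I) / h) := by
          have h3 : h * (starRingEnd ℂ) h = (‖h‖ : ℂ) ^ 2 := Complex.mul_conj' h
          have hn' : (‖h‖ : ℂ) ≠ 0 := by exact_mod_cast hn.ne'
          rw [map_div₀, Complex.conj_ofReal]
          field_simp
          linear_combination h3
        rw [h2, Complex.re_ofReal_mul]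
        positivity
      obtain ⟨hu1, hu2⟩ := hcl.mem_of_mapClusterPt hu hmem
      have hu0 : u ≠ 0 := norm_pos_iff.1 (by rw [hu1]; exact one_pos)
      set v := u * Complex.exp (-(θ * Complex.I)) with hv
      have hvre : 0 ≤ v.re := by
        have : v = (starRingEnd ℂ) (Complex.exp (θ * Complex.I) * (starRingEnd ℂ) u) := by
          rw [map_mul, Complex.conj_conj, ← Complex.exp_conj, hv]
          simp [mul_comm]
        rw [this, Complex.conj_re]; exact hu2
      have hvn : ‖v‖ = 1 := by
        rw [hv, norm_mul, hu1, one_mul, ← neg_mul, ← Complex.ofReal_neg,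
          Complex.norm_exp_ofReal_mul_I]
      have harg := abs_le.1 (Complex.abs_arg_le_pi_div_two_iff.2 hvre)
      refine ⟨θ + v.arg, ⟨by linarith, by linarith⟩, ?_⟩
      have h4 := Complex.norm_mul_exp_arg_mul_I v
      rw [hvn, Complex.ofReal_one, one_mul] at h4
      push_cast
      rw [add_mul, Complex.exp_add, h4, hv, mul_comm, mul_assoc, ← Complex.exp_add]
      simp
    · rintro ⟨t, ht, rfl⟩
      have hopen : ∀ s ∈ Ioo (θ - Real.pi / 2) (θ + Real.pi / 2),
          MapClusterPt (Complex.exp ((s : ℂ) * Complex.I)) (𝓝[borelDisc θ δ] (0 : ℂ))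
            (fun h : ℂ => h / (‖h‖ : ℂ)) := by
        intro s hs
        have hc : 0 < Real.cos (θ - s) :=
          Real.cos_pos_of_mem_Ioo ⟨by linarith [hs.2], by linarith [hs.1]⟩
        have h1 : Tendsto (fun ρ : ℝ => (ρ * Complex.exp (s * Complex.I) : ℂ)) (𝓝[>] 0)
            (𝓝[borelDisc θ δ] (0 : ℂ)) := by
          refine tendsto_nhdsWithin_iff.2 ⟨?_, ?_⟩
          · have : Continuous fun ρ : ℝ => (ρ * Complex.exp (s * Complex.I) : ℂ) := by fun_prop
            simpa using (this.tendsto 0).mono_left nhdsWithin_le_nhds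
          · filter_upwards [Ioo_mem_nhdsGT (mul_pos hδ hc)] with ρ hρ
            exact (mem_borelDisc_polar hδ hρ.1).2 hρ.2
        have h2 : Tendsto (fun ρ : ℝ => (ρ * Complex.exp (s * Complex.I) : ℂ) /
            (‖(ρ * Complex.exp (s * Complex.I) : ℂ)‖ : ℂ)) (𝓝[>] 0)
            (𝓝 (Complex.exp (s * Complex.I))) := by
          refine tendsto_const_nhds.congr' ?_
          filter_upwards [self_mem_nhdsWithin] with ρ hρ
          have hρ' : (0 : ℝ) < ρ := hρ
          have : (ρ : ℂ) ≠ 0 := by exact_mod_cast hρ'.ne'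
          rw [norm_mul, Complex.norm_exp_ofReal_mul_I, mul_one, Complex.norm_real,
            Real.norm_of_nonneg hρ'.le]
          field_simp
        exact MapClusterPt.of_comp h1 h2.mapClusterPt
      -- Directions in the open arc are reached along straight rays; the two end directions are
      -- tangent to the disc and are obtained because the set of cluster values is closed.
      have hcl : IsClosed {s : ℝ | MapClusterPt (Complex.exp ((s : ℂ) * Complex.I))
          (𝓝[borelDisc θ δ] (0 : ℂ)) (fun h : ℂ => h / (‖h‖ : ℂ))} := by
        have : IsClosed {w : ℂ | MapClusterPt w (𝓝[borelDisc θ δ] (0 : ℂ))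
          (fun h : ℂ => h / (‖h‖ : ℂ))} := isClosed_setOfPred_clusterPt
        exact this.preimage (by fun_prop : Continuous fun s : ℝ => Complex.exp ((s : ℂ) * Complex.I))
      have := hcl.closure_subset_iff.2 hopen
      rw [closure_Ioo (by linarith)] at this
      exact this ht
  · rintro θ' ⟨h1, h2⟩
    have : θ' = θ := by linarith
    exact ⟨δ, hδ, this ▸ subset_rfl⟩

/-- A sectorial domain with opening containing a half-plane arc contains a Borel disc. -/
theorem IsSectorialDomain.exists_borelDisc {a b θ : ℝ} {S : Set ℂ} (hS : IsSectorialDomain a b S)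
    (hθ : θ ∈ Icc (a + Real.pi / 2) (b - Real.pi / 2)) (δ : ℝ) (hδ : 0 < δ) :
    ∃ δ' > 0, δ' ≤ δ ∧ borelDisc θ δ' ⊆ S := by
  obtain ⟨ε, hε, h⟩ := hS.borel θ hθ
  exact ⟨min ε δ, by positivity, min_le_right _ _,
    (borelDisc_mono (by positivity) (min_le_left _ _)).trans h⟩

theorem half_plane_mem (θ : ℝ) :
    θ ∈ Icc (θ - Real.pi / 2 + Real.pi / 2) (θ + Real.pi / 2 - Real.pi / 2) := by
  constructor <;> linarith


/-! ### Watson's lemma -/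

/-- A Gevrey flat bound is exponentially small. -/
theorem exp_bound_of_gevrey_flat {C M t A : ℝ} (hC : 0 ≤ C) (hM : 0 < M) (ht : 0 < t)
    (hA : ∀ n : ℕ, A ≤ C * M ^ n * (n.factorial : ℝ) * t ^ n) :
    A ≤ 2 * C * Real.exp (-(Real.log 2 / (2 * M)) / t) := by
  -- Near-optimal truncation: with n! ≤ n^n the bound is at most C (nMt)^n ≤ C 2^{-n}. Rounding down
  -- loses at most one factor 2, which is the 2 in front.
  set n := ⌊1 / (2 * M * t)⌋₊ with hn
  have hn1 : (n : ℝ) ≤ 1 / (2 * M * t) := Nat.floor_le (by positivity)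
  have hn2 : 1 / (2 * M * t) < n + 1 := Nat.lt_floor_add_one _
  have h1 : (n : ℝ) * (M * t) ≤ 1 / 2 := by
    rw [le_div_iff₀ (by positivity)] at hn1
    linarith
  have h2 : ((n.factorial : ℕ) : ℝ) ≤ (n : ℝ) ^ n := by exact_mod_cast Nat.factorial_le_pow n
  calc A ≤ C * M ^ n * (n.factorial : ℝ) * t ^ n := hA n
    _ ≤ C * M ^ n * (n : ℝ) ^ n * t ^ n := by gcongr
    _ = C * ((n : ℝ) * (M * t)) ^ n := by rw [mul_pow, mul_pow]; ring
    _ ≤ C * (1 / 2) ^ n := by gcongr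
    _ ≤ C * (2 * Real.exp (-(Real.log 2 / (2 * M)) / t)) := by
        gcongr
        have h3 : (1 / 2 : ℝ) ^ n = Real.exp (-(n * Real.log 2)) := by
          rw [Real.exp_neg, mul_comm, Real.exp_mul, Real.exp_log two_pos, Real.rpow_natCast]
          simp
        have h4 : (2 : ℝ) * Real.exp (-(Real.log 2 / (2 * M)) / t) =
            Real.exp (Real.log 2 + -(Real.log 2 / (2 * M)) / t) := by
          rw [Real.exp_add, Real.exp_log two_pos]
        rw [h3, h4]
        refine Real.exp_le_exp.2 ?_
        have h5 : -(Real.log 2 / (2 * M)) / t = -(Real.log 2 * (1 / (2 * M * t))) := by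
          field_simp
        rw [h5]
        have := Real.log_pos one_lt_two
        nlinarith
    _ = _ := by ring

/-- Decay of fixed exponential type is converted into superexponential decay on the positive axis,
where Phragmén–Lindelöf applies. The multiplier E = exp(-a (z+1) log(z+1)) with a = 2c/π grows at
most like exp(c|z|) on the half-plane, because |arg(z+1)| ≤ π/2, so E·D stays bounded. On the
positive axis E decays like exp(-a x log x). -/
theorem eq_zero_of_exponentially_small {D : ℂ → ℂ} (hD : DiffContOnCl ℂ D {z | 0 < z.re})
    {K c : ℝ} (hc : 0 < c) (hb : ∀ z : ℂ, 0 ≤ z.re → ‖D z‖ ≤ K * Real.exp (-(c * ‖z‖))) :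
    EqOn D 0 {z : ℂ | 0 ≤ z.re} := by
  have hK : 0 ≤ K := by
    have := (norm_nonneg _).trans (hb 0 (by simp))
    simpa using this
  set a : ℝ := 2 * c / Real.pi with ha
  have hpi := Real.pi_pos
  have ha0 : 0 < a := by positivity
  set E : ℂ → ℂ := fun z => Complex.exp (-(a * ((z + 1) * Complex.log (z + 1)))) with hE
  have hslit : ∀ z : ℂ, 0 ≤ z.re → z + 1 ∈ Complex.slitPlane := fun z hz => by
    rw [Complex.mem_slitPlane_iff]; left; simp; linarith
  have hcl : closure {z : ℂ | 0 < z.re} = {z | 0 ≤ z.re} := Complex.closure_setOfPred_lt_re 0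
  have hEd : DiffContOnCl ℂ E {z | 0 < z.re} := by
    refine DifferentiableOn.diffContOnCl ?_
    rw [hcl]
    intro z hz
    have : DifferentiableAt ℂ (fun z : ℂ => Complex.log (z + 1)) z :=
      DifferentiableAt.clog (by fun_prop) (hslit z hz)
    have h2 : DifferentiableAt ℂ E z := by fun_prop
    exact h2.differentiableWithinAt
  have hEn : ∀ z : ℂ, 0 ≤ z.re →
      ‖E z‖ ≤ Real.exp (c * ‖z‖) * Real.exp (-(a * ((z.re + 1) * Real.log (‖z + 1‖)))) := by
    intro z hz
    rw [hE, Complex.norm_exp, ← Real.exp_add]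
    refine Real.exp_le_exp.2 ?_
    rw [Complex.neg_re, Complex.re_ofReal_mul, Complex.mul_re, Complex.log_re, Complex.log_im]
    have h1 : |(z + 1).arg| ≤ Real.pi / 2 := Complex.abs_arg_le_pi_div_two_iff.2 (by simp; linarith)
    have h2 : (z + 1).im * (z + 1).arg ≤ ‖z‖ * (Real.pi / 2) := by
      refine (le_abs_self _).trans ?_
      rw [abs_mul]
      have : |(z + 1).im| ≤ ‖z‖ := by simpa using Complex.abs_im_le_norm z
      gcongr
    have h3 : a * (‖z‖ * (Real.pi / 2)) = c * ‖z‖ := by rw [ha]; field_simp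
    have h4 := mul_le_mul_of_nonneg_left h2 ha0.le
    rw [h3] at h4
    simp only [Complex.add_re, Complex.one_re]
    linarith
  have hlog : ∀ z : ℂ, 0 ≤ z.re → 0 ≤ Real.log ‖z + 1‖ := fun z hz => by
    refine Real.log_nonneg ?_
    refine le_trans ?_ (Complex.re_le_norm _)
    simp; linarith
  have hF : ∀ z : ℂ, 0 ≤ z.re →
      ‖E z * D z‖ ≤ K * Real.exp (-(a * ((z.re + 1) * Real.log (‖z + 1‖)))) := by
    intro z hz
    rw [norm_mul]
    calc ‖E z‖ * ‖D z‖ ≤ (Real.exp (c * ‖z‖) *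
          Real.exp (-(a * ((z.re + 1) * Real.log (‖z + 1‖))))) * (K * Real.exp (-(c * ‖z‖))) :=
          mul_le_mul (hEn z hz) (hb z hz) (norm_nonneg _) (by positivity)
      _ = K * Real.exp (-(a * ((z.re + 1) * Real.log (‖z + 1‖)))) *
          (Real.exp (c * ‖z‖) * Real.exp (-(c * ‖z‖))) := by ring
      _ = _ := by rw [← Real.exp_add]; simp
  have hFb : ∀ z : ℂ, 0 ≤ z.re → ‖E z * D z‖ ≤ K := by
    intro z hz
    refine (hF z hz).trans ?_
    have : Real.exp (-(a * ((z.re + 1) * Real.log (‖z + 1‖)))) ≤ 1 := by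
      refine Real.exp_le_one_iff.2 (neg_nonpos.2 ?_)
      have := hlog z hz
      positivity
    nlinarith
  have main := PhragmenLindelof.eq_zero_on_right_half_plane_of_superexponential_decay
    (f := fun z => E z * D z) (hEd.smul hD) ⟨1, by norm_num, 0, ?_⟩ ?_ ⟨K, fun x => ?_⟩
  · intro z hz
    have := main hz
    simpa [hE, Complex.exp_ne_zero] using this
  · refine Asymptotics.IsBigO.of_bound K ?_
    refine (eventually_inf_principal).2 (Eventually.of_forall fun z hz => ?_)
    simpa using hFb z (le_of_lt hz)
  · intro n
    have h1 : Tendsto (fun x : ℝ => Real.exp (-x)) atTop (𝓝 0) :=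
      Real.tendsto_exp_neg_atTop_nhds_zero
    have h2 : Tendsto (fun x : ℝ => K * Real.exp (-x)) atTop (𝓝 0) := by simpa using h1.const_mul K
    refine squeeze_zero_norm' ?_ h2
    filter_upwards [eventually_ge_atTop (Real.exp ((n + 1) / a)), eventually_ge_atTop 0]
      with x hx hx0
    have h3 := hF x (by simpa using hx0)
    have h4 : ‖(x : ℂ) + 1‖ = x + 1 := by
      rw [← Complex.ofReal_one, ← Complex.ofReal_add, Complex.norm_real,
        Real.norm_of_nonneg (by linarith)]
    rw [h4, Complex.ofReal_re] at h3
    have h5 : (n + 1) / a ≤ Real.log (x + 1) := by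
      rw [Real.le_log_iff_exp_le (by linarith)]; linarith
    have h6 : (n + 1 : ℝ) * (x + 1) ≤ a * ((x + 1) * Real.log (x + 1)) := by
      rw [div_le_iff₀ ha0] at h5
      nlinarith
    rw [norm_mul, norm_norm, norm_pow, Real.norm_of_nonneg (Real.exp_pos _).le, ← Real.exp_nat_mul]
    calc Real.exp (n * x) * ‖E x * D x‖
        ≤ Real.exp (n * x) * (K * Real.exp (-(a * ((x + 1) * Real.log (x + 1))))) := by gcongr
      _ = K * Real.exp (n * x + -(a * ((x + 1) * Real.log (x + 1)))) := by rw [Real.exp_add]; ring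
      _ ≤ K * Real.exp (-x) := by
          gcongr
          have : (0 : ℝ) ≤ n := Nat.cast_nonneg n
          nlinarith
  · exact hFb _ (by simp)

/-- Watson's lemma: a holomorphic function on a Borel disc that is Gevrey flat vanishes. -/
theorem eq_zero_of_gevrey_flat {d : ℂ → ℂ} {θ δ : ℝ} (hδ : 0 < δ)
    (hd : DifferentiableOn ℂ d (borelDisc θ δ)) {C M : ℝ} (hC : 0 ≤ C) (hM : 0 < M)
    (hb : ∀ n : ℕ, ∀ h ∈ borelDisc θ δ, ‖d h‖ ≤ C * M ^ n * (n.factorial : ℝ) * ‖h‖ ^ n) :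
    ∀ h ∈ borelDisc θ δ, d h = 0 := by
  intro h₀ hh₀
  set e := Complex.exp (θ * Complex.I) with he
  have hen : ‖e‖ = 1 := Complex.norm_exp_ofReal_mul_I θ
  have he0 : e ≠ 0 := Complex.exp_ne_zero _
  have h00 := ne_zero_of_mem_borelDisc hδ hh₀
  -- Choosing b strictly between 1/δ and Re(e/h₀) makes w ↦ e/(w+b) send the closed right half-plane
  -- into the disc and reach h₀ at the point e/h₀ - b.
  obtain ⟨b, hb1, hb2⟩ := exists_between (mem_borelDisc_iff.1 hh₀)
  have hb0 : 0 < b := lt_trans (by positivity) hb1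
  set φ : ℂ → ℂ := fun w => e / (w + b) with hφ
  have hwb : ∀ w : ℂ, 0 ≤ w.re → w + b ≠ 0 := fun w hw h => by
    have := congrArg Complex.re h
    simp at this; linarith
  have hφm : ∀ w : ℂ, 0 ≤ w.re → φ w ∈ borelDisc θ δ := fun w hw => by
    rw [mem_borelDisc_iff, hφ]
    simp only
    rw [← he, div_div_cancel₀ he0]
    simp only [Complex.add_re, Complex.ofReal_re]
    linarith
  set c := Real.log 2 / (2 * M) with hc
  have hc0 : 0 < c := by have := Real.log_pos one_lt_two; positivity
  have hcl : closure {z : ℂ | 0 < z.re} = {z | 0 ≤ z.re} := Complex.closure_setOfPred_lt_re 0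
  have main := eq_zero_of_exponentially_small (D := fun w => d (φ w)) (K := 2 * C * Real.exp (c * b))
    (c := c) ?_ hc0 ?_
  · have hw : (0 : ℝ) ≤ (e / h₀ - b).re := by simp; linarith
    have := main hw
    simp only [hφ, sub_add_cancel, Pi.zero_apply] at this
    rwa [div_div_cancel₀ he0] at this
  · refine DifferentiableOn.diffContOnCl ?_
    rw [hcl]
    intro w hw
    have h1 := hd.differentiableAt ((isOpen_borelDisc hδ).mem_nhds (hφm w hw))
    have h2 : DifferentiableAt ℂ φ w :=
      DifferentiableAt.fun_div (by fun_prop) (by fun_prop) (hwb w hw)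
    exact (DifferentiableAt.comp w h1 h2).differentiableWithinAt
  · intro w hw
    have hn : ‖φ w‖ = ‖w + b‖⁻¹ := by rw [hφ, norm_div, hen, one_div]
    have hp : 0 < ‖φ w‖ := by rw [hn]; exact inv_pos.2 (norm_pos_iff.2 (hwb w hw))
    refine (exp_bound_of_gevrey_flat hC hM hp fun n => hb n _ (hφm w hw)).trans ?_
    rw [mul_assoc (2 * C), ← Real.exp_add]
    gcongr
    rw [← hc, hn, div_inv_eq_mul]
    have : ‖w‖ ≤ ‖w + b‖ + b := by
      calc ‖w‖ = ‖(w + b) - b‖ := by simp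
        _ ≤ ‖w + b‖ + ‖(b : ℂ)‖ := norm_sub_le _ _
        _ = _ := by rw [Complex.norm_real, Real.norm_of_nonneg hb0.le]
    nlinarith

/-- Two functions with the same Gevrey asymptotics on a Borel disc coincide. -/
theorem eq_of_gevreyBounds {ι : Type} {f g : ι → ℂ → ℂ} {c : ℕ → ι → ℂ} {V : Set ι} {θ δ : ℝ}
    (hδ : 0 < δ) (hf : GevreyBounds f c V (borelDisc θ δ)) (hg : GevreyBounds g c V (borelDisc θ δ))
    {x : ι} (hx : x ∈ V) (hfd : DifferentiableOn ℂ (f x) (borelDisc θ δ))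
    (hgd : DifferentiableOn ℂ (g x) (borelDisc θ δ)) : ∀ h ∈ borelDisc θ δ, f x h = g x h := by
  obtain ⟨C, M, hC, hM, H⟩ := hf.sub hg
  intro h hh
  refine sub_eq_zero.1 (eq_zero_of_gevrey_flat hδ (hfd.sub hgd) hC.le hM (fun n h hh => ?_) h hh)
  simpa [remainder] using H n x hx h hh

/-! ### Asymptotics on the sectors contained in a Borel disc -/

theorem GevreyBounds.gevreyOpen {ι : Type} {f : ι → ℂ → ℂ} {c : ℕ → ι → ℂ} {V : Set ι} {θ δ : ℝ}
    {S : Set ℂ} (hδ : 0 < δ) (hS : borelDisc θ δ ⊆ S) (hf : GevreyBounds f c V (borelDisc θ δ)) :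
    GevreyOpen f c V (θ - Real.pi / 2) (θ + Real.pi / 2) S := by
  intro a' b' ha hab hb
  obtain ⟨r, hr, hsub⟩ := exists_sector_subset_borelDisc hδ ha hab hb
  exact ⟨r, hr, hsub.trans hS, hf.mono subset_rfl hsub⟩

theorem GevreyOpen.poincareOpen {ι : Type} {f : ι → ℂ → ℂ} {c : ℕ → ι → ℂ} {V : Set ι} {a b : ℝ}
    {S : Set ℂ} (hf : GevreyOpen f c V a b S) : PoincareOpen f c V a b S := by
  intro n a' b' ha hab hb
  obtain ⟨r, hr, hsub, C, M, hC, hM, H⟩ := hf a' b' ha hab hb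
  exact ⟨r, hr, hsub, C * M ^ n * (n.factorial : ℝ), H n⟩

theorem GevreyClosed.exists_bounds {ι : Type} {f : ι → ℂ → ℂ} {c : ℕ → ι → ℂ} {V : Set ι}
    {a b θ : ℝ} {S : Set ℂ} (hf : GevreyClosed f c V a b S)
    (hθ : θ ∈ Icc (a + Real.pi / 2) (b - Real.pi / 2)) :
    ∃ δ > 0, borelDisc θ δ ⊆ S ∧ GevreyBounds f c V (borelDisc θ δ) := by
  obtain ⟨S₀, hS₀, hsec, H⟩ := hf
  obtain ⟨δ, hδ, -, hsub⟩ := hsec.exists_borelDisc hθ 1 one_pos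
  exact ⟨δ, hδ, hsub.trans hS₀, H.mono subset_rfl hsub⟩


/-! ### Local systems on simply connected domains -/

/-- Monodromy principle. `t i x` sends a parameter to the value at x of the corresponding local
solution near i, and `ht` says that the transition between two families of local solutions is
locally constant. The parameters then form a covering space of U, and simple connectedness lifts the
identity to a global section. -/
theorem exists_section_of_isSimplyConnected {U : Set ℂ} (hU : IsOpen U) (hUs : IsSimplyConnected U)
    {F : Type*} (B : ℂ → Set ℂ) (hBo : ∀ i ∈ U, IsOpen (B i)) (hBm : ∀ i ∈ U, i ∈ B i)
    (t : ℂ → ℂ → F ≃ F)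
    (ht : ∀ i ∈ U, ∀ j ∈ U, ∀ x ∈ B i ∩ B j, ∀ v,
      ∀ᶠ y in 𝓝 x, (t j y).symm (t i y v) = (t j x).symm (t i x v))
    {x₀ : ℂ} (hx₀ : x₀ ∈ U) (v₀ : F) :
    ∃ f : ℂ → F, f x₀ = v₀ ∧ ∀ x ∈ U, ∀ᶠ y in 𝓝 x, f y = t x y ((t x x).symm (f x)) := by
  classical
  -- With discrete fibres, local constancy of the transitions is exactly continuity of the
  -- coordinate changes, and the bundle projection becomes a covering map.
  let : TopologicalSpace F := ⊥
  have : DiscreteTopology F := ⟨rfl⟩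
  have := hUs.simplyConnectedSpace
  have := hU.locallyPathConnectedSpace
  let Z : FiberBundleCore U U F :=
    { baseSet := fun i => Subtype.val ⁻¹' B i.1
      isOpen_baseSet := fun i => (hBo i.1 i.2).preimage continuous_subtype_val
      indexAt := id
      mem_baseSet_at := fun x => hBm x.1 x.2
      coordChange := fun i j x v => (t j.1 x.1).symm (t i.1 x.1 v)
      coordChange_self := fun i x _ v => by simp
      continuousOn_coordChange := by
        rintro i j ⟨x, v⟩ ⟨hx, -⟩
        refine ContinuousAt.continuousWithinAt ?_
        refine (tendsto_const_nhds (x := (t j.1 x.1).symm (t i.1 x.1 v))).congr' ?_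
        rw [nhds_prod_eq, nhds_discrete F]
        have h1 := continuous_subtype_val.continuousAt.eventually
          (ht i.1 i.2 j.1 j.2 x.1 hx v)
        have h2 : ∀ᶠ w in (pure v : Filter F), w = v := by simp
        filter_upwards [h1.prod_mk h2] with p hp
        simp only [hp.2]
        exact hp.1.symm
      coordChange_comp := fun i j k x _ v => by simp }
  have cov : IsCoveringMap (Bundle.TotalSpace.proj : Z.TotalSpace → U) :=
    FiberBundle.isCoveringMap (F := F) (E := Z.Fiber)
  obtain ⟨s, ⟨hs0, hs⟩, -⟩ := cov.existsUnique_continuousMap_lifts (ContinuousMap.id U) ⟨x₀, hx₀⟩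
    (⟨⟨x₀, hx₀⟩, (t x₀ x₀).symm v₀⟩ : Z.TotalSpace) rfl
  have hsp : ∀ y : U, (s y).proj = y := fun y => congrFun hs y
  refine ⟨fun y => if h : y ∈ U then t y y ((s ⟨y, h⟩).2 : F) else v₀, ?_, ?_⟩
  · simp only [dif_pos hx₀]
    have h2 : ∀ p q : Z.TotalSpace, p = q → (p.2 : F) = (q.2 : F) := by rintro _ _ rfl; rfl
    rw [h2 _ _ hs0]
    exact Equiv.apply_symm_apply _ _
  · intro x hx
    let x' : U := ⟨x, hx⟩
    have hbase : (s x').proj ∈ Z.baseSet x' := by rw [hsp]; exact hBm x hx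
    have hcont : ContinuousAt (fun y : U => (Z.localTriv x' (s y)).2) x' := by
      have h1 : ContinuousAt (Z.localTriv x') (s x') :=
        (Z.localTriv x').continuousAt (by rwa [Z.mem_localTriv_source])
      exact (ContinuousAt.comp (f := s) (g := Z.localTriv x') h1
        s.continuous.continuousAt).snd
    have hev : ∀ᶠ y in 𝓝 x', (Z.localTriv x' (s y)).2 = (Z.localTriv x' (s x')).2 := by
      have h1 := hcont.tendsto
      rw [nhds_discrete F] at h1
      exact tendsto_pure.1 h1
    have hfm : ∀ y : U, (Z.localTriv x' (s y)).2 = (t x y.1).symm (t y.1 y.1 (s y).2) := by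
      intro y
      rw [Z.localTriv_apply]
      change (t x (s y).proj.1).symm (t (s y).proj.1 (s y).proj.1 (s y).2) = _
      rw [hsp y]
    have hev2 : ∀ᶠ y in 𝓝 x, ∀ h : y ∈ U, (Z.localTriv x' (s ⟨y, h⟩)).2 =
        (Z.localTriv x' (s x')).2 := by
      rw [← map_nhds_subtype_coe_eq_nhds (p := fun z => z ∈ U) hx (hU.mem_nhds hx)]
      rw [eventually_map]
      filter_upwards [hev] with y hy _ using hy
    filter_upwards [hev2, hU.mem_nhds hx] with y hy hyU
    have h1 := hy hyU
    rw [hfm, hfm] at h1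
    simp only [dif_pos hyU, dif_pos hx]
    exact (Equiv.symm_apply_eq _).1 h1

/-- Holomorphic functions on simply connected domains have primitives. -/
theorem exists_primitive {U : Set ℂ} (hU : IsOpen U) (hUs : IsSimplyConnected U) {f : ℂ → ℂ}
    (hf : DifferentiableOn ℂ f U) {x₀ : ℂ} (hx₀ : x₀ ∈ U) :
    ∃ F : ℂ → ℂ, F x₀ = 0 ∧ ∀ x ∈ U, HasDerivAt F (f x) x := by
  have h1 : ∀ i : ℂ, ∃ (r : ℝ) (G : ℂ → ℂ), i ∈ U → 0 < r ∧
      Metric.ball i r ⊆ U ∧ ∀ x ∈ Metric.ball i r, HasDerivAt G (f x) x := by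
    intro i
    by_cases hi : i ∈ U
    · obtain ⟨r, hr, hsub⟩ := Metric.isOpen_iff.1 hU i hi
      obtain ⟨G, hG⟩ := (hf.mono hsub).isExactOn_ball
      exact ⟨r, G, fun _ => ⟨hr, hsub, hG⟩⟩
    · exact ⟨0, 0, fun h => absurd h hi⟩
  choose r G hrG using h1
  -- Local solutions are local primitives up to a constant, so the transition maps are translations
  -- by differences of primitives. Those are constant on the convex intersections of balls.
  have hsec := exists_section_of_isSimplyConnected hU hUs (F := ℂ)
    (fun i => Metric.ball i (r i)) (fun _ _ => Metric.isOpen_ball)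
    (fun i hi => Metric.mem_ball_self (hrG i hi).1) (fun i x => Equiv.addRight (G i x)) ?_ hx₀ 0
  · obtain ⟨F, hF0, hF⟩ := hsec
    refine ⟨F, hF0, fun x hx => ?_⟩
    have h2 := ((hrG x hx).2.2 x (Metric.mem_ball_self (hrG x hx).1)).const_add
      ((Equiv.addRight (G x x)).symm (F x))
    exact h2.congr_of_eventuallyEq (hF x hx)
  · intro i hi j hj x hx v
    have hopen : IsOpen (Metric.ball i (r i) ∩ Metric.ball j (r j)) :=
      Metric.isOpen_ball.inter Metric.isOpen_ball
    have hpre : IsPreconnected (Metric.ball i (r i) ∩ Metric.ball j (r j)) :=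
      ((convex_ball _ _).inter (convex_ball _ _)).isPreconnected
    have hd : ∀ y ∈ Metric.ball i (r i) ∩ Metric.ball j (r j),
        HasDerivAt (fun y => v + G i y - G j y) 0 y := fun y hy => by
      have := (((hrG i hi).2.2 y hy.1).const_add v).fun_sub ((hrG j hj).2.2 y hy.2)
      rwa [sub_self] at this
    filter_upwards [hopen.mem_nhds hx] with y hy
    have := hopen.is_const_of_deriv_eq_zero hpre
      (fun y hy => (hd y hy).differentiableAt.differentiableWithinAt)
      (fun y hy => (hd y hy).deriv) hy hx
    simpa [sub_eq_add_neg] using this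

theorem primitive_spec {U : Set ℂ} (hU : IsOpen U) (hUs : IsSimplyConnected U) {f : ℂ → ℂ}
    (hf : DifferentiableOn ℂ f U) {x₀ : ℂ} (hx₀ : x₀ ∈ U) :
    primitive U x₀ f x₀ = 0 ∧ ∀ x ∈ U, HasDerivAt (primitive U x₀ f) (f x) x := by
  have H := exists_primitive hU hUs hf hx₀
  rw [primitive, dif_pos H]
  exact H.choose_spec

/-! ### Fixed points in spaces of holomorphic functions -/

/-- Banach's fixed point theorem on the ball of radius R in the bounded holomorphic functions on W,
run by hand on plain functions because `K` is controlled only through values on W. The iterates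
converge uniformly, so the limit is holomorphic. -/
theorem exists_fixedPoint {E : Type*} [NormedAddCommGroup E] [NormedSpace ℂ E] [CompleteSpace E]
    {W : Set (ℂ × ℂ)} (hW : IsOpen W) (K : (ℂ → ℂ → E) → ℂ → ℂ → E) {R : ℝ} (hR : 0 ≤ R)
    (hK : ∀ f : ℂ → ℂ → E, DifferentiableOn ℂ (fun z : ℂ × ℂ => f z.1 z.2) W →
      (∀ z ∈ W, ‖f z.1 z.2‖ ≤ R) → DifferentiableOn ℂ (fun z : ℂ × ℂ => K f z.1 z.2) W ∧
        ∀ z ∈ W, ‖K f z.1 z.2‖ ≤ R)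
    (hL : ∀ f g : ℂ → ℂ → E, DifferentiableOn ℂ (fun z : ℂ × ℂ => f z.1 z.2) W →
      DifferentiableOn ℂ (fun z : ℂ × ℂ => g z.1 z.2) W → (∀ z ∈ W, ‖f z.1 z.2‖ ≤ R) →
      (∀ z ∈ W, ‖g z.1 z.2‖ ≤ R) → ∀ d : ℝ, (∀ z ∈ W, ‖f z.1 z.2 - g z.1 z.2‖ ≤ d) →
        ∀ z ∈ W, ‖K f z.1 z.2 - K g z.1 z.2‖ ≤ d / 2) :
    ∃ f : ℂ → ℂ → E, DifferentiableOn ℂ (fun z : ℂ × ℂ => f z.1 z.2) W ∧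
      (∀ z ∈ W, ‖f z.1 z.2‖ ≤ R) ∧ ∀ z ∈ W, K f z.1 z.2 = f z.1 z.2 := by
  set u : ℕ → ℂ → ℂ → E := fun n => K^[n] (fun _ _ => 0) with hu
  have hus : ∀ n, u (n + 1) = K (u n) := fun n => Function.iterate_succ_apply' K n _
  have hprop : ∀ n, DifferentiableOn ℂ (fun z : ℂ × ℂ => u n z.1 z.2) W ∧
      ∀ z ∈ W, ‖u n z.1 z.2‖ ≤ R := by
    intro n
    induction n with
    | zero => exact ⟨differentiableOn_const _, fun z _ => by simpa [hu] using hR⟩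
    | succ n ih => rw [hus]; exact hK _ ih.1 ih.2
  have hdiff : ∀ n, ∀ z ∈ W, ‖u (n + 1) z.1 z.2 - u n z.1 z.2‖ ≤ R / 2 ^ n := by
    intro n
    induction n with
    | zero => intro z hz; simpa [hu] using (hprop 1).2 z hz
    | succ n ih =>
      intro z hz
      rw [hus (n + 1), hus n]
      refine (hL _ _ (hus n ▸ (hprop (n + 1)).1) (hprop n).1 (hus n ▸ (hprop (n + 1)).2)
        (hprop n).2 (R / 2 ^ n) (hus n ▸ ih) z hz).trans (le_of_eq ?_)
      rw [pow_succ]; field_simp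
  have hdist : ∀ z ∈ W, ∀ n, dist (u n z.1 z.2) (u (n + 1) z.1 z.2) ≤ 2 * R / 2 / 2 ^ n := by
    intro z hz n
    rw [dist_comm, dist_eq_norm]
    refine (hdiff n z hz).trans (le_of_eq ?_)
    field_simp
  have hlim : ∀ z : ℂ × ℂ, ∃ l : E, z ∈ W → Tendsto (fun n => u n z.1 z.2) atTop (𝓝 l) := by
    intro z
    by_cases hz : z ∈ W
    · obtain ⟨l, hl⟩ := cauchySeq_tendsto_of_complete (cauchySeq_of_le_geometric_two (hdist z hz))
      exact ⟨l, fun _ => hl⟩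
    · exact ⟨0, fun h => absurd h hz⟩
  choose l hl using hlim
  have hun : ∀ z ∈ W, ∀ n, ‖l z - u n z.1 z.2‖ ≤ 2 * R / 2 ^ n := fun z hz n => by
    rw [← dist_eq_norm, dist_comm]
    exact dist_le_of_le_geometric_two_of_tendsto (hdist z hz) (hl z hz) n
  have hpow : Tendsto (fun n : ℕ => 2 * R / 2 ^ n) atTop (𝓝 0) := by
    have := (tendsto_pow_atTop_nhds_zero_of_lt_one (r := (1 / 2 : ℝ)) (by norm_num)
      (by norm_num)).const_mul (2 * R)
    simpa [div_eq_mul_inv] using this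
  have hunif : TendstoUniformlyOn (fun n (z : ℂ × ℂ) => u n z.1 z.2) (fun z => l (z.1, z.2)) atTop
      W := by
    rw [Metric.tendstoUniformlyOn_iff]
    intro ε hε
    filter_upwards [hpow.eventually (gt_mem_nhds hε)] with n hn z hz
    rw [dist_eq_norm]
    exact (hun z hz n).trans_lt hn
  have hd := differentiableOn_of_tendstoUniformlyOn (f := fun x h => l (x, h)) hW
    (fun n => (hprop n).1) hunif
  have hb : ∀ z ∈ W, ‖l (z.1, z.2)‖ ≤ R := fun z hz =>
    le_of_tendsto (hl z hz).norm (Eventually.of_forall fun n => (hprop n).2 z hz)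
  refine ⟨fun x h => l (x, h), hd, hb, fun z hz => ?_⟩
  have h1 : ∀ n, ‖K (fun x h => l (x, h)) z.1 z.2 - u (n + 1) z.1 z.2‖ ≤ 2 * R / 2 ^ n / 2 :=
    fun n => by
      rw [hus]
      exact hL _ _ hd (hprop n).1 hb (hprop n).2 _ (fun w hw => hun w hw n) z hz
  have h2 : Tendsto (fun n => u (n + 1) z.1 z.2) atTop (𝓝 (K (fun x h => l (x, h)) z.1 z.2)) := by
    rw [tendsto_iff_norm_sub_tendsto_zero]
    refine squeeze_zero (fun _ => norm_nonneg _) (fun n => ?_) (by simpa using hpow.div_const 2)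
    rw [norm_sub_rev]; exact h1 n
  exact tendsto_nhds_unique h2 ((hl z hz).comp (tendsto_add_atTop_nat 1))

/-! ### Linear differential equations -/

section LinearODE

variable {E : Type*} [NormedAddCommGroup E] [NormedSpace ℂ E]

/-- If y vanishes at x, then on a closed disc of radius at most 1/(2K), with K bounding A, the
maximum of ‖y‖ is at most half of itself. So the interior of the zero set is closed in U as well as
open, and U is connected. -/
theorem linear_ode_unique {A : ℂ → E →L[ℂ] E} {U : Set ℂ} (hU : IsOpen U) (hUc : IsPreconnected U)
    (hA : ContinuousOn A U) {y : ℂ → E} (hy : ∀ x ∈ U, HasDerivAt y (A x (y x)) x)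
    {x₁ : ℂ} (hx₁ : x₁ ∈ U) (h0 : y x₁ = 0) : ∀ x ∈ U, y x = 0 := by
  have hloc : ∀ x ∈ U, y x = 0 → ∀ᶠ z in 𝓝 x, y z = 0 := by
    intro x hx hyx
    have hc : ContinuousAt A x := hA.continuousAt (hU.mem_nhds hx)
    have hK := hc.norm.eventually (gt_mem_nhds (lt_add_one ‖A x‖))
    set K := ‖A x‖ + 1 with hKdef
    have hK0 : 0 < K := by positivity
    obtain ⟨r, hr, hb⟩ := Metric.eventually_nhds_iff_ball.1
      (hK.and (hU.mem_nhds hx : ∀ᶠ z in 𝓝 x, z ∈ U))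
    set ρ := min (r / 2) (1 / (2 * K)) with hρ
    have hρ0 : 0 < ρ := by positivity
    have hsub : Metric.closedBall x ρ ⊆ Metric.ball x r :=
      Metric.closedBall_subset_ball ((min_le_left _ _).trans_lt (by linarith))
    have hcont : ContinuousOn (fun z => ‖y z‖) (Metric.closedBall x ρ) := fun z hz =>
      (hy z (hb z (hsub hz)).2).continuousAt.norm.continuousWithinAt
    obtain ⟨m, hm, hmax⟩ := (isCompact_closedBall x ρ).exists_isMaxOn
      ⟨x, Metric.mem_closedBall_self hρ0.le⟩ hcont
    have h1 := Convex.norm_image_sub_le_of_norm_deriv_le (f := y) (C := K * ‖y m‖) (x := x) (y := m)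
      (fun z hz => (hy z (hb z (hsub hz)).2).differentiableAt) (fun z hz => by
        rw [(hy z (hb z (hsub hz)).2).deriv]
        refine (ContinuousLinearMap.le_opNorm _ _).trans ?_
        have := (hb z (hsub hz)).1.le
        have := hmax hz
        simp only [mem_ofPred_eq] at this
        gcongr) (convex_closedBall x ρ) (Metric.mem_closedBall_self hρ0.le) hm
    rw [hyx, sub_zero] at h1
    have h2 : ‖m - x‖ ≤ 1 / (2 * K) := by
      rw [← dist_eq_norm]; exact (Metric.mem_closedBall.1 hm).trans (min_le_right _ _)
    have h3 : ‖y m‖ ≤ ‖y m‖ / 2 := by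
      calc ‖y m‖ ≤ K * ‖y m‖ * ‖m - x‖ := h1
        _ ≤ K * ‖y m‖ * (1 / (2 * K)) := by gcongr
        _ = _ := by field_simp
    have h4 : ‖y m‖ = 0 := le_antisymm (by linarith) (norm_nonneg _)
    filter_upwards [Metric.closedBall_mem_nhds x hρ0] with z hz
    have := hmax hz
    simp only [mem_ofPred_eq, h4] at this
    exact norm_le_zero_iff.1 this
  have hsub : U ⊆ {x | ∀ᶠ z in 𝓝 x, y z = 0} := by
    refine hUc.subset_of_closure_inter_subset isOpen_setOfPred_eventually_nhds
      ⟨x₁, hx₁, hloc x₁ hx₁ h0⟩ ?_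
    rintro x ⟨hxc, hx⟩
    refine hloc x hx ?_
    have hcl : x ∈ closure ({x | ∀ᶠ z in 𝓝 x, y z = 0}) := hxc
    rw [mem_closure_iff_frequently] at hcl
    by_contra hne
    have : ∀ᶠ z in 𝓝 x, y z ≠ 0 := (hy x hx).continuousAt.eventually_ne hne
    obtain ⟨z, hz1, hz2⟩ := (hcl.and_eventually this).exists
    exact hz2 hz1.self_of_nhds
  exact fun x hx => (hsub hx : ∀ᶠ z in 𝓝 x, y z = 0).self_of_nhds

/-- Picard iteration along segments from x₁: Y is the fixed point of Y ↦ 1 + (x - x₁) ∫₀¹ A Y. The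
condition K r ≤ 1/4 makes this a contraction and keeps Y within 1/2 of the identity, hence
invertible. The parameter h is carried along holomorphically. -/
theorem exists_local_fundamental {𝔸 : Type*} [NormedRing 𝔸] [NormedAlgebra ℂ 𝔸] [CompleteSpace 𝔸]
    [NormOneClass 𝔸] {A : ℂ → ℂ → 𝔸} {x₁ : ℂ} {r K : ℝ} {H : Set ℂ} (hr : 0 < r) (hH : IsOpen H)
    (hA : DifferentiableOn ℂ (fun z : ℂ × ℂ => A z.1 z.2) (Metric.ball x₁ r ×ˢ H))
    (hK : ∀ x ∈ Metric.ball x₁ r, ∀ h ∈ H, ‖A x h‖ ≤ K) (hKr : K * r ≤ 1 / 4) :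
    ∃ Y : ℂ → ℂ → 𝔸, DifferentiableOn ℂ (fun z : ℂ × ℂ => Y z.1 z.2) (Metric.ball x₁ r ×ˢ H) ∧
      ∀ h ∈ H, Y x₁ h = 1 ∧ ∀ x ∈ Metric.ball x₁ r,
        HasDerivAt (fun x => Y x h) (A x h * Y x h) x ∧ ‖Y x h - 1‖ ≤ 1 / 2 := by
  set W := Metric.ball x₁ r ×ˢ H with hWdef
  have hW : IsOpen W := Metric.isOpen_ball.prod hH
  -- The time is clamped to [0, 1], so the path stays in the ball for every real t and the integrand
  -- is continuous on all of ℝ.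
  set p : ℝ → ℂ → ℂ := fun t x => x₁ + ((max 0 (min 1 t) : ℝ) : ℂ) * (x - x₁) with hp
  have hpm : ∀ t, ∀ x ∈ Metric.ball x₁ r, p t x ∈ Metric.ball x₁ r := by
    intro t x hx
    rw [Metric.mem_ball, dist_eq_norm] at *
    simp only [hp, add_sub_cancel_left, norm_mul, Complex.norm_real]
    have h1 : ‖max 0 (min 1 t)‖ ≤ 1 := by
      rw [Real.norm_of_nonneg (le_max_left _ _)]
      exact max_le zero_le_one (min_le_left _ _)
    nlinarith [norm_nonneg (x - x₁)]
  have hcomp : ∀ g : ℂ → ℂ → 𝔸, DifferentiableOn ℂ (fun z : ℂ × ℂ => g z.1 z.2) W → ∀ t,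
      DifferentiableOn ℂ (fun z : ℂ × ℂ => g (p t z.1) z.2) W := fun g hg t =>
    hg.comp (f := fun z : ℂ × ℂ => (p t z.1, z.2)) (by fun_prop)
      fun z hz => ⟨hpm t z.1 hz.1, hz.2⟩
  have hcont : ∀ g : ℂ → ℂ → 𝔸, DifferentiableOn ℂ (fun z : ℂ × ℂ => g z.1 z.2) W → ∀ z ∈ W,
      Continuous fun t => g (p t z.1) z.2 := fun g hg z hz =>
    hg.continuousOn.comp_continuous (f := fun t => (p t z.1, z.2)) (by fun_prop)
      fun t => ⟨hpm t z.1 hz.1, hz.2⟩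
  set I : MeasureTheory.Measure ℝ := MeasureTheory.volume.restrict (Ioc 0 1) with hI
  have hI1 : MeasureTheory.IsFiniteMeasure I := by rw [hI]; infer_instance
  have hIm : I.real univ = 1 := by simp [hI]
  have hKn : ∀ f : ℂ → ℂ → 𝔸, ∀ d, (∀ z ∈ W, ‖f z.1 z.2‖ ≤ d) → ∀ z ∈ W,
      ‖(z.1 - x₁) • ∫ t, A (p t z.1) z.2 * f (p t z.1) z.2 ∂I‖ ≤ d / 4 := by
    intro f d hf z hz
    have hd : 0 ≤ d := (norm_nonneg _).trans (hf z hz)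
    have h1 : ‖∫ t, A (p t z.1) z.2 * f (p t z.1) z.2 ∂I‖ ≤ K * d := by
      have := MeasureTheory.norm_integral_le_of_norm_le_const (μ := I) (C := K * d)
        (f := fun t => A (p t z.1) z.2 * f (p t z.1) z.2) (Eventually.of_forall fun t => by
          refine (norm_mul_le _ _).trans ?_
          have h2 := hK _ (hpm t z.1 hz.1) z.2 hz.2
          have h3 := hf (p t z.1, z.2) ⟨hpm t z.1 hz.1, hz.2⟩
          exact mul_le_mul h2 h3 (norm_nonneg _) ((norm_nonneg _).trans h2))
      rwa [hIm, mul_one] at this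
    have h2 : ‖z.1 - x₁‖ ≤ r := by rw [← dist_eq_norm]; exact (Metric.mem_ball.1 hz.1).le
    have hK0 : 0 ≤ K := (norm_nonneg _).trans (hK _ hz.1 _ hz.2)
    rw [norm_smul]
    calc _ ≤ r * (K * d) := by gcongr
      _ = K * r * d := by ring
      _ ≤ 1 / 4 * d := by gcongr
      _ = _ := by ring
  have hKint : ∀ f : ℂ → ℂ → 𝔸, DifferentiableOn ℂ (fun z : ℂ × ℂ => f z.1 z.2) W → ∀ z ∈ W,
      MeasureTheory.Integrable (fun t => A (p t z.1) z.2 * f (p t z.1) z.2) I := by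
    intro f hf z hz
    exact (((hcont A hA z hz).mul (hcont f hf z hz)).integrableOn_Icc (a := 0) (b := 1)).mono_set
      Ioc_subset_Icc_self
  have hfix := exists_fixedPoint hW
    (fun f x h => 1 + (x - x₁) • ∫ t, A (p t x) h * f (p t x) h ∂I) (R := 2) (by norm_num) ?_ ?_
  · obtain ⟨Y, hYd, hYb, hYK⟩ := hfix
    have hx1 : x₁ ∈ Metric.ball x₁ r := Metric.mem_ball_self hr
    refine ⟨Y, hYd, fun h hh => ⟨?_, fun x hx => ⟨?_, ?_⟩⟩⟩
    · rw [← hYK (x₁, h) ⟨hx1, hh⟩]; simp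
    · have hg : DifferentiableOn ℂ (fun x => A x h * Y x h) (Metric.ball x₁ r) := fun y hy =>
        ((differentiableAt_fst_section hW hA (z := (y, h)) ⟨hy, hh⟩).mul
          (differentiableAt_fst_section hW hYd (z := (y, h)) ⟨hy, hh⟩)).differentiableWithinAt
      obtain ⟨G, hG⟩ := hg.isExactOn_ball
      have hYG : ∀ y ∈ Metric.ball x₁ r, Y y h = 1 + (G y - G x₁) := by
        intro y hy
        have hseg : ∀ t ∈ Icc (0 : ℝ) 1, x₁ + t • (y - x₁) = p t y := fun t ht => by
          simp [hp, ht.1, ht.2]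
        rw [← hYK (y, h) ⟨hy, hh⟩]
        congr 1
        have h1 := intervalIntegral.integral_unitInterval_deriv_eq_sub (𝕜 := ℂ) (f := G)
          (f' := fun x => A x h * Y x h) (z₀ := x₁) (z₁ := y - x₁) ?_ ?_
        · rw [add_sub_cancel] at h1
          rw [← h1, intervalIntegral.integral_of_le zero_le_one]
          congr 1
          refine MeasureTheory.setIntegral_congr_fun measurableSet_Ioc fun t ht => ?_
          simp only [hseg t ⟨ht.1.le, ht.2⟩]
        · refine ContinuousOn.congr (((hcont A hA (y, h) ⟨hy, hh⟩).mul
            (hcont Y hYd (y, h) ⟨hy, hh⟩)).continuousOn) fun t ht => ?_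
          simp only [hseg t ht, Pi.mul_apply]
        · intro t ht
          rw [hseg t ht]
          exact hG _ (hpm t y hy)
      refine HasDerivAt.congr_of_eventuallyEq (((hG x hx).sub_const (G x₁)).const_add 1) ?_
      filter_upwards [Metric.isOpen_ball.mem_nhds hx] with y hy using hYG y hy
    · rw [← hYK (x, h) ⟨hx, hh⟩, add_sub_cancel_left]
      refine (hKn Y 2 hYb (x, h) ⟨hx, hh⟩).trans (by norm_num)
  · intro f hf hfb
    refine ⟨?_, fun z hz => ?_⟩
    · have hlin : DifferentiableOn ℂ (fun z : ℂ × ℂ => z.1 - x₁) W := by fun_prop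
      refine (differentiableOn_const _).add (hlin.smul ?_)
      refine differentiableOn_integral₂ (F := fun x h t => A (p t x) h * f (p t x) h) hW
        (fun t => (hcomp A hA t).mul (hcomp f hf t)) (fun z hz => (hKint f hf z hz).1)
        fun z hz => ⟨fun _ => K * 2, MeasureTheory.integrable_const _, ?_⟩
      filter_upwards [hW.mem_nhds hz] with w hw t
      refine (norm_mul_le _ _).trans ?_
      have h2 := hK _ (hpm t w.1 hw.1) w.2 hw.2
      have h3 := hfb (p t w.1, w.2) ⟨hpm t w.1 hw.1, hw.2⟩
      exact mul_le_mul h2 h3 (norm_nonneg _) ((norm_nonneg _).trans h2)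
    · refine (norm_add_le _ _).trans ?_
      have := hKn f 2 hfb z hz
      rw [norm_one]
      linarith
  · intro f g hf hg _ _ d hd z hz
    have h1 := hKn (fun x h => f x h - g x h) d hd z hz
    have hd0 : 0 ≤ d := (norm_nonneg _).trans (hd z hz)
    have h2 : (∫ t, A (p t z.1) z.2 * (f (p t z.1) z.2 - g (p t z.1) z.2) ∂I) =
        (∫ t, A (p t z.1) z.2 * f (p t z.1) z.2 ∂I) -
          ∫ t, A (p t z.1) z.2 * g (p t z.1) z.2 ∂I := by
      rw [← MeasureTheory.integral_sub (hKint f hf z hz) (hKint g hg z hz)]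
      simp only [mul_sub]
    simp only [h2] at h1
    rw [add_sub_add_left_eq_sub, ← smul_sub]
    linarith

variable [CompleteSpace E] [Nontrivial E]

theorem exists_norm_bound_bidisc {F : Type*} [NormedAddCommGroup F] [NormedSpace ℂ F]
    {A : ℂ → ℂ → F} {U H : Set ℂ} (hU : IsOpen U) (hH : IsOpen H)
    (hA : DifferentiableOn ℂ (fun z : ℂ × ℂ => A z.1 z.2) (U ×ˢ H)) {x h₀ : ℂ} (hx : x ∈ U)
    (hh : h₀ ∈ H) : ∃ r > 0, ∃ K : ℝ, K * r ≤ 1 / 4 ∧ Metric.ball x r ⊆ U ∧ Metric.ball h₀ r ⊆ H ∧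
      ∀ y ∈ Metric.ball x r, ∀ h ∈ Metric.ball h₀ r, ‖A y h‖ ≤ K := by
  have hW : IsOpen (U ×ˢ H) := hU.prod hH
  obtain ⟨K, hK⟩ := eventually_norm_le_of_differentiableOn hW hA (z := (x, h₀)) ⟨hx, hh⟩
  obtain ⟨r, hr, hb⟩ := exists_bidisc hW (z := (x, h₀)) ⟨hx, hh⟩ hK
  have hK0 : 0 ≤ K := (norm_nonneg _).trans
    (hb x (Metric.mem_ball_self hr) h₀ (Metric.mem_ball_self hr)).2
  have hle : min r (1 / (4 * (K + 1))) ≤ r := min_le_left _ _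
  refine ⟨min r (1 / (4 * (K + 1))), by positivity, K, ?_, fun y hy => ?_, fun h hh => ?_,
    fun y hy h hh => ?_⟩
  · calc K * min r (1 / (4 * (K + 1))) ≤ (K + 1) * (1 / (4 * (K + 1))) :=
        mul_le_mul (by linarith) (min_le_right _ _) (by positivity) (by positivity)
      _ = 1 / 4 := by field_simp
  · exact (hb y (Metric.ball_subset_ball hle hy) h₀ (Metric.mem_ball_self hr)).1.1
  · exact (hb x (Metric.mem_ball_self hr) h (Metric.ball_subset_ball hle hh)).1.2
  · exact (hb y (Metric.ball_subset_ball hle hy) h (Metric.ball_subset_ball hle hh)).2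

/-- Existence of solutions of linear differential equations on simply connected domains. -/
theorem exists_linear_ode {A : ℂ → E →L[ℂ] E} {U : Set ℂ} (hU : IsOpen U)
    (hUs : IsSimplyConnected U) (hA : DifferentiableOn ℂ A U) {x₀ : ℂ} (hx₀ : x₀ ∈ U) (v₀ : E) :
    ∃ y : ℂ → E, y x₀ = v₀ ∧ ∀ x ∈ U, HasDerivAt y (A x (y x)) x := by
  have h1 : ∀ i : ℂ, ∃ (r : ℝ) (Y : ℂ → (E →L[ℂ] E)ˣ), i ∈ U → 0 < r ∧
      Metric.ball i r ⊆ U ∧ ∀ x ∈ Metric.ball i r,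
        HasDerivAt (fun x => (Y x : E →L[ℂ] E)) (A x * Y x) x := by
    intro i
    by_cases hi : i ∈ U
    · have hA2 : DifferentiableOn ℂ (fun z : ℂ × ℂ => A z.1) (U ×ˢ univ) :=
        hA.comp differentiableOn_fst fun z hz => hz.1
      obtain ⟨r, hr, K, hKr, hrU, -, hK⟩ := exists_norm_bound_bidisc (A := fun x _ => A x) hU
        isOpen_univ hA2 hi (mem_univ 0)
      obtain ⟨Y, -, hY⟩ := exists_local_fundamental (A := fun x _ => A x) hr
        Metric.isOpen_ball (hA2.mono (prod_mono hrU (subset_univ (Metric.ball (0 : ℂ) r)))) hK hKr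
      have hY := (hY 0 (Metric.mem_ball_self hr)).2
      have hunit : ∀ x, ∃ u : (E →L[ℂ] E)ˣ, x ∈ Metric.ball i r → (u : E →L[ℂ] E) = Y x 0 := by
        intro x
        by_cases hx : x ∈ Metric.ball i r
        · have := (hY x hx).2
          refine ⟨Units.oneSub (1 - Y x 0) (by rw [norm_sub_rev]; linarith), fun _ => ?_⟩
          simp
        · exact ⟨1, fun h => absurd h hx⟩
      choose u hu using hunit
      refine ⟨r, u, fun _ => ⟨hr, hrU, fun x hx => ?_⟩⟩
      rw [hu x hx]
      refine (hY x hx).1.congr_of_eventuallyEq ?_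
      filter_upwards [Metric.isOpen_ball.mem_nhds hx] with y hy using hu y hy
    · exact ⟨0, fun _ => 1, fun h => absurd h hi⟩
  choose r Y hrY using h1
  have hsol : ∀ i ∈ U, ∀ v : E, ∀ x ∈ Metric.ball i (r i),
      HasDerivAt (fun y => (Y i y : E →L[ℂ] E) v) (A x ((Y i x : E →L[ℂ] E) v)) x :=
    fun i hi v x hx => by
      have := ((hrY i hi).2.2 x hx).clm_apply (hasDerivAt_const x v)
      simpa using this
  -- Local solutions are parametrised by the vector to which the fundamental matrix is applied;
  -- uniqueness for the linear equation makes the transitions locally constant.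
  let t : ℂ → ℂ → E ≃ E := fun i x =>
    { toFun := fun v => (Y i x : E →L[ℂ] E) v
      invFun := fun v => ((Y i x)⁻¹ : (E →L[ℂ] E)ˣ).1 v
      left_inv := fun v => by
        change ((((Y i x)⁻¹ : (E →L[ℂ] E)ˣ) : E →L[ℂ] E) * (Y i x : E →L[ℂ] E)) v = v
        rw [Units.inv_mul]; rfl
      right_inv := fun v => by
        change ((Y i x : E →L[ℂ] E) * (((Y i x)⁻¹ : (E →L[ℂ] E)ˣ) : E →L[ℂ] E)) v = v
        rw [Units.mul_inv]; rfl }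
  have hsec := exists_section_of_isSimplyConnected hU hUs (F := E)
    (fun i => Metric.ball i (r i)) (fun _ _ => Metric.isOpen_ball)
    (fun i hi => Metric.mem_ball_self (hrY i hi).1) t ?_ hx₀ v₀
  · obtain ⟨y, hy0, hy⟩ := hsec
    refine ⟨y, hy0, fun x hx => ?_⟩
    have h2 := hsol x hx ((t x x).symm (y x)) x (Metric.mem_ball_self (hrY x hx).1)
    have h3 : (Y x x : E →L[ℂ] E) ((t x x).symm (y x)) = y x := (t x x).apply_symm_apply (y x)
    rw [h3] at h2
    exact h2.congr_of_eventuallyEq (hy x hx)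
  · intro i hi j hj x hx v
    have hopen : IsOpen (Metric.ball i (r i) ∩ Metric.ball j (r j)) :=
      Metric.isOpen_ball.inter Metric.isOpen_ball
    have hpre : IsPreconnected (Metric.ball i (r i) ∩ Metric.ball j (r j)) :=
      ((convex_ball _ _).inter (convex_ball _ _)).isPreconnected
    set w := (t j x).symm (t i x v) with hw
    have huniq := linear_ode_unique hopen hpre
      (hA.continuousOn.mono fun z hz => (hrY i hi).2.1 hz.1)
      (y := fun y => (Y i y : E →L[ℂ] E) v - (Y j y : E →L[ℂ] E) w)
      (fun y hy => by
        rw [map_sub]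
        exact (hsol i hi v y hy.1).sub (hsol j hj w y hy.2)) hx
      (sub_eq_zero.2 ((t j x).apply_symm_apply (t i x v)).symm)
    filter_upwards [hopen.mem_nhds hx] with y hy
    rw [Equiv.symm_apply_eq]
    exact sub_eq_zero.1 (huniq y hy)

/-- Solutions of linear differential equations depend holomorphically on a parameter. -/
theorem exists_linear_ode_parameter {A : ℂ → ℂ → E →L[ℂ] E} {U H : Set ℂ} (hU : IsOpen U)
    (hUs : IsSimplyConnected U) (hH : IsOpen H)
    (hA : DifferentiableOn ℂ (fun z : ℂ × ℂ => A z.1 z.2) (U ×ˢ H)) {x₀ : ℂ} (hx₀ : x₀ ∈ U)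
    {v : ℂ → E} (hv : DifferentiableOn ℂ v H) :
    ∃ y : ℂ → ℂ → E, (∀ h ∈ H, y x₀ h = v h) ∧
      (∀ h ∈ H, ∀ x ∈ U, HasDerivAt (fun x => y x h) (A x h (y x h)) x) ∧
      DifferentiableOn ℂ (fun z : ℂ × ℂ => y z.1 z.2) (U ×ˢ H) := by
  have hW : IsOpen (U ×ˢ H) := hU.prod hH
  have hAh : ∀ h ∈ H, DifferentiableOn ℂ (fun x => A x h) U := fun h hh x hx =>
    (differentiableAt_fst_section hW hA (z := (x, h)) ⟨hx, hh⟩).differentiableWithinAt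
  have hex : ∀ h, ∃ y : ℂ → E, h ∈ H → y x₀ = v h ∧ ∀ x ∈ U, HasDerivAt y (A x h (y x)) x := by
    intro h
    by_cases hh : h ∈ H
    · obtain ⟨y, hy⟩ := exists_linear_ode hU hUs (hAh h hh) hx₀ (v h)
      exact ⟨y, fun _ => hy⟩
    · exact ⟨0, fun h' => absurd h' hh⟩
  choose y hy using hex
  refine ⟨fun x h => y h x, fun h hh => (hy h hh).1, fun h hh => (hy h hh).2, ?_⟩
  rintro ⟨x, h₀⟩ ⟨hx, hh₀⟩
  -- Near x₂ one has y(x, h) = Y(x, h) y(x₁, h) for any base point x₁ close to x₂, so holomorphy in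
  -- h at one x₁ spreads to joint holomorphy nearby. Radius r/4 leaves room to centre Y at x₁ with
  -- radius r/2.
  have hloc : ∀ x₂ ∈ U, ∃ ε > 0, ∀ x₁ ∈ Metric.ball x₂ ε,
      (∀ᶠ h in 𝓝 h₀, DifferentiableAt ℂ (fun h => y h x₁) h) → ∀ x ∈ Metric.ball x₂ ε,
        ∀ᶠ z in 𝓝 (x, h₀), DifferentiableAt ℂ (fun z : ℂ × ℂ => y z.2 z.1) z := by
    intro x₂ hx₂
    obtain ⟨r, hr, K, hKr, hrU, hrH, hK⟩ := exists_norm_bound_bidisc hU hH hA hx₂ hh₀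
    refine ⟨r / 4, by positivity, fun x₁ hx₁ hd x hx => ?_⟩
    have hsub : Metric.ball x₁ (r / 2) ⊆ Metric.ball x₂ r := fun z hz => by
      rw [Metric.mem_ball] at *; linarith [dist_triangle z x₁ x₂]
    have hx' : x ∈ Metric.ball x₁ (r / 2) := by
      rw [Metric.mem_ball] at *
      linarith [dist_triangle x x₂ x₁, dist_comm x₁ x₂]
    have hr2 : 0 < r / 2 := by positivity
    have hK0 : 0 ≤ K := (norm_nonneg _).trans
      (hK x₂ (Metric.mem_ball_self hr) h₀ (Metric.mem_ball_self hr))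
    obtain ⟨Y, hYd, hY⟩ := exists_local_fundamental hr2 Metric.isOpen_ball
      (hA.mono (prod_mono (hsub.trans hrU) hrH)) (fun z hz h hh => hK z (hsub hz) h hh)
      (by nlinarith)
    have hrep : ∀ z ∈ Metric.ball x₁ (r / 2) ×ˢ Metric.ball h₀ r,
        y z.2 z.1 = Y z.1 z.2 (y z.2 x₁) := by
      rintro ⟨x, h⟩ ⟨hx, hh⟩
      refine sub_eq_zero.1 (linear_ode_unique (A := fun x => A x h)
        (y := fun x => y h x - Y x h (y h x₁)) Metric.isOpen_ball
        (convex_ball _ _).isPreconnected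
        ((hAh h (hrH hh)).continuousOn.mono (hsub.trans hrU)) (fun z hz => ?_)
        (Metric.mem_ball_self hr2) (by simp [(hY h hh).1]) x hx)
      have h2 := (((hY h hh).2 z hz).1).clm_apply (hasDerivAt_const z (y h x₁))
      rw [map_sub]
      refine ((hy h (hrH hh)).2 z (hrU (hsub hz))).sub ?_
      simpa using h2
    have hopen : IsOpen (Metric.ball x₁ (r / 2) ×ˢ Metric.ball h₀ r) :=
      Metric.isOpen_ball.prod Metric.isOpen_ball
    have h3 : ∀ᶠ z in 𝓝 (x, h₀), DifferentiableAt ℂ (fun h => y h x₁) z.2 :=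
      (continuous_snd.tendsto (x, h₀)).eventually hd
    filter_upwards [h3, hopen.mem_nhds ⟨hx', Metric.mem_ball_self hr⟩] with z hz hzW
    have h4 : DifferentiableAt ℂ (fun z : ℂ × ℂ => y z.2 x₁) z :=
      DifferentiableAt.comp (g := fun h => y h x₁) z hz differentiableAt_snd
    have h5 := (hYd.differentiableAt (hopen.mem_nhds hzW)).clm_apply h4
    refine h5.congr_of_eventuallyEq ?_
    filter_upwards [hopen.mem_nhds hzW] with w hw using hrep w hw
  have hsec : ∀ x, (∀ᶠ z in 𝓝 (x, h₀), DifferentiableAt ℂ (fun z : ℂ × ℂ => y z.2 z.1) z) →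
      ∀ᶠ h in 𝓝 h₀, DifferentiableAt ℂ (fun h => y h x) h := by
    intro x hx
    have : Tendsto (fun h : ℂ => (x, h)) (𝓝 h₀) (𝓝 (x, h₀)) :=
      (continuous_const.prodMk continuous_id).tendsto h₀
    filter_upwards [this.eventually hx] with h hh
    exact DifferentiableAt.comp (g := fun z : ℂ × ℂ => y z.2 z.1) (f := fun h => (x, h)) h hh
      (by fun_prop)
  set N := {x | ∀ᶠ z in 𝓝 (x, h₀), DifferentiableAt ℂ (fun z : ℂ × ℂ => y z.2 z.1) z} with hN
  have hNopen : IsOpen (N ∩ U) := by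
    rw [Metric.isOpen_iff]
    rintro x ⟨hxN, hxU⟩
    obtain ⟨ε, hε, hb⟩ := hloc x hxU
    obtain ⟨ε', hε', hb'⟩ := Metric.isOpen_iff.1 hU x hxU
    refine ⟨min ε ε', by positivity, fun z hz => ⟨?_, hb' (Metric.ball_subset_ball
      (min_le_right _ _) hz)⟩⟩
    exact hb x (Metric.mem_ball_self hε) (hsec x hxN) z
      (Metric.ball_subset_ball (min_le_left _ _) hz)
  have hsubN : U ⊆ N ∩ U := by
    refine hUs.isPathConnected.isConnected.isPreconnected.subset_of_closure_inter_subset hNopen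
      ⟨x₀, hx₀, ?_, hx₀⟩ ?_
    · obtain ⟨ε, hε, hb⟩ := hloc x₀ hx₀
      refine hb x₀ (Metric.mem_ball_self hε) ?_ x₀ (Metric.mem_ball_self hε)
      filter_upwards [hH.mem_nhds hh₀] with h hh
      refine (hv.differentiableAt (hH.mem_nhds hh)).congr_of_eventuallyEq ?_
      filter_upwards [hH.mem_nhds hh] with h' hh' using (hy h' hh').1
    · rintro z ⟨hzc, hzU⟩
      obtain ⟨ε, hε, hb⟩ := hloc z hzU
      obtain ⟨x₁, hx₁, hx₁N⟩ := Metric.mem_closure_iff.1 hzc ε hε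
      exact ⟨hb x₁ (by rw [Metric.mem_ball, dist_comm]; exact hx₁N) (hsec x₁ hx₁.1) z
        (Metric.mem_ball_self hε), hzU⟩
  exact ((hsubN hx).1 : ∀ᶠ z in 𝓝 (x, h₀), _).self_of_nhds.differentiableWithinAt

end LinearODE


/-! ### Half-strips and bounded solutions along rays -/

/-- The neighbourhood of radius `ρ` of the half-line `[0, ∞)`. -/
def halfStrip (ρ : ℝ) : Set ℂ := {z : ℂ | ∃ t : ℝ, 0 ≤ t ∧ ‖z - t‖ < ρ}

theorem isOpen_halfStrip (ρ : ℝ) : IsOpen (halfStrip ρ) := by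
  have : halfStrip ρ = ⋃ t ∈ Ici (0 : ℝ), Metric.ball (t : ℂ) ρ := by
    ext z; simp [halfStrip, dist_eq_norm]
  rw [this]
  exact isOpen_biUnion fun t _ => Metric.isOpen_ball

theorem halfStrip_mono {r ρ : ℝ} (h : r ≤ ρ) : halfStrip r ⊆ halfStrip ρ :=
  fun _ ⟨t, ht, hz⟩ => ⟨t, ht, hz.trans_le h⟩

theorem add_mem_halfStrip {ρ : ℝ} {z : ℂ} (hz : z ∈ halfStrip ρ) {s : ℝ} (hs : 0 ≤ s) :
    z + s ∈ halfStrip ρ := by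
  obtain ⟨t, ht, hz⟩ := hz
  exact ⟨t + s, by positivity, by push_cast; simpa using hz⟩

theorem ball_subset_halfStrip {r ρ : ℝ} {z : ℂ} (hz : z ∈ halfStrip r) :
    Metric.ball z (ρ - r) ⊆ halfStrip ρ := by
  obtain ⟨t, ht, hz⟩ := hz
  intro w hw
  rw [Metric.mem_ball, dist_eq_norm] at hw
  refine ⟨t, ht, ?_⟩
  calc ‖w - t‖ = ‖(w - z) + (z - t)‖ := by ring_nf
    _ ≤ ‖w - z‖ + ‖z - t‖ := norm_add_le _ _
    _ < ρ := by linarith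

theorem ball_zero_subset_halfStrip (ρ : ℝ) : Metric.ball (0 : ℂ) ρ ⊆ halfStrip ρ :=
  fun z hz => ⟨0, le_rfl, by simpa using hz⟩

theorem mem_borelDisc_zero {δ : ℝ} {h : ℂ} : h ∈ borelDisc 0 δ ↔ 1 / δ < (1 / h).re := by
  rw [mem_borelDisc_iff]; simp

theorem norm_exp_neg_div (u : ℝ) (h : ℂ) :
    ‖Complex.exp (-(u / h))‖ = Real.exp (-((1 / h).re * u)) := by
  rw [Complex.norm_exp, Complex.neg_re, div_eq_mul_one_div, Complex.re_ofReal_mul, mul_comm]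

/-- A bounded solution of `h R' = R + h G` on a half-line is controlled by `G`. -/
theorem norm_le_of_bounded_ray {R G : ℝ → ℂ} {h : ℂ} {c B K : ℝ} (hc : 0 < c)
    (hch : c ≤ (1 / h).re)
    (hR : ∀ u, 0 ≤ u → HasDerivWithinAt R (R u / h + G u) (Ici u) u)
    (hRc : ContinuousOn R (Ici 0))
    (hB : ∀ u, 0 ≤ u → ‖R u‖ ≤ B) (hK : ∀ u, 0 ≤ u → ‖G u‖ ≤ K) : ‖R 0‖ ≤ K / c := by
  have hB0 : 0 ≤ B := (norm_nonneg _).trans (hB 0 le_rfl)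
  have hK0 : 0 ≤ K := (norm_nonneg _).trans (hK 0 le_rfl)
  have hexp : ∀ u : ℝ, 0 ≤ u → ‖Complex.exp (-(u / h))‖ ≤ Real.exp (-(c * u)) := fun u hu => by
    rw [norm_exp_neg_div]
    exact Real.exp_le_exp.2 (neg_le_neg (by gcongr))
  have hexpd : ∀ u : ℝ, HasDerivAt (fun u : ℝ => Complex.exp (-(u / h)))
      (Complex.exp (-(u / h)) * (-(1 / h))) u := fun u =>
    (((hasDerivAt_id u).ofReal_comp.div_const h).fun_neg).cexp
  -- The integrating factor e^{-u/h} removes the linear term. As u grows, boundedness of R kills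
  -- e^{-u/h} R(u), so R(0) is minus the integral of e^{-u/h} G; this is the point where a bounded
  -- solution loses its free constant.
  have hf : ∀ u : ℝ, 0 ≤ u → HasDerivWithinAt (fun u : ℝ => Complex.exp (-(u / h)) * R u - R 0)
      (Complex.exp (-(u / h)) * G u) (Ici u) u := fun u hu => by
    have := ((hexpd u).hasDerivWithinAt.mul (hR u hu)).sub_const (R 0)
    convert! this using 1
    ring
  have key : ∀ U : ℝ, 0 ≤ U → ‖R 0‖ ≤ K / c + B * Real.exp (-(c * U)) := by
    intro U hU
    have hbd : ∀ x : ℝ, HasDerivAt (fun u => K / c * (1 - Real.exp (-(c * u))))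
        (K * Real.exp (-(c * x))) x := fun x => by
      have := ((((hasDerivAt_id x).const_mul c).fun_neg).exp.const_sub 1).const_mul (K / c)
      convert! this using 1
      simp only [id]
      field_simp
    have h1 := image_norm_le_of_norm_deriv_right_le_deriv_boundary (a := 0) (b := U)
      (f := fun u : ℝ => Complex.exp (-(u / h)) * R u - R 0)
      (f' := fun u => Complex.exp (-(u / h)) * G u)
      (B := fun u => K / c * (1 - Real.exp (-(c * u)))) (B' := fun x => K * Real.exp (-(c * x)))
      ((ContinuousOn.mul (by fun_prop) (hRc.mono Icc_subset_Ici_self)).sub continuousOn_const)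
      (fun u hu => hf u hu.1) (by simp) hbd
      (fun u hu => by
        rw [norm_mul, mul_comm K]
        exact mul_le_mul (hexp u hu.1) (hK u hu.1) (norm_nonneg _) (Real.exp_pos _).le)
      (right_mem_Icc.2 hU)
    have h2 : ‖Complex.exp (-(U / h)) * R U‖ ≤ B * Real.exp (-(c * U)) := by
      rw [norm_mul, mul_comm B]
      exact mul_le_mul (hexp U hU) (hB U hU) (norm_nonneg _) (Real.exp_pos _).le
    have h3 : K / c * (1 - Real.exp (-(c * U))) ≤ K / c := by
      have := (Real.exp_pos (-(c * U))).le
      have : 0 ≤ K / c := by positivity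
      nlinarith
    calc ‖R 0‖ = ‖Complex.exp (-(U / h)) * R U - (Complex.exp (-(U / h)) * R U - R 0)‖ := by simp
      _ ≤ _ := norm_sub_le _ _
      _ ≤ _ := by linarith
  have hlim : Tendsto (fun U : ℝ => K / c + B * Real.exp (-(c * U))) atTop (𝓝 (K / c)) := by
    have h1 : Tendsto (fun U : ℝ => c * U) atTop atTop := tendsto_id.const_mul_atTop hc
    have h2 := (Real.tendsto_exp_neg_atTop_nhds_zero.comp h1).const_mul B
    simpa using h2.const_add (K / c)
  exact ge_of_tendsto hlim (by filter_upwards [eventually_ge_atTop 0] with U hU using key U hU)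

/-- As `norm_le_of_bounded_ray`, with a source term that is linear in the unknown. -/
theorem norm_le_of_bounded_ray_linear {R G : ℝ → ℂ} {h : ℂ} {c a B g : ℝ} (hc : 0 < c)
    (hch : c ≤ (1 / h).re) (ha : 0 ≤ a) (hac : a ≤ c / 2)
    (hR : ∀ u, 0 ≤ u → HasDerivAt R (R u / h + G u) u)
    (hB : ∀ u, 0 ≤ u → ‖R u‖ ≤ B) (hG : ∀ u, 0 ≤ u → ‖G u‖ ≤ a * ‖R u‖ + g) :
    ‖R 0‖ ≤ 2 * g / c := by
  have hRc : ContinuousOn R (Ici 0) := fun u hu => (hR u hu).continuousAt.continuousWithinAt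
  -- A bound B' valid along the whole ray improves to (a B' + g)/c ≤ B'/2 + g/c, by restarting the
  -- ray at each of its points. Iterating removes the a priori bound.
  have step : ∀ B', (∀ u, 0 ≤ u → ‖R u‖ ≤ B') → ∀ u, 0 ≤ u → ‖R u‖ ≤ (a * B' + g) / c := by
    intro B' hB' u hu
    have := norm_le_of_bounded_ray (R := fun s => R (u + s)) (G := fun s => G (u + s)) (h := h)
      (B := B') (K := a * B' + g) hc hch
      (fun s hs => ((hR (u + s) (by positivity)).comp_const_add u s).hasDerivWithinAt)
      (hRc.comp (by fun_prop) fun s hs => add_nonneg hu hs)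
      (fun s hs => hB' _ (by positivity)) (fun s hs => (hG _ (by positivity)).trans (by
        gcongr; exact hB' _ (by positivity)))
    simpa using this
  have hB0 : 0 ≤ B := (norm_nonneg _).trans (hB 0 le_rfl)
  have hiter : ∀ n : ℕ, ∀ u, 0 ≤ u → ‖R u‖ ≤ B / 2 ^ n + 2 * g / c := by
    have hg0 : 0 ≤ a * B + g := (norm_nonneg _).trans ((hG 0 le_rfl).trans (by
      gcongr; exact hB 0 le_rfl))
    intro n
    induction n with
    | zero =>
      intro u hu
      have h1 := hB u hu
      have h2 := step B hB u hu
      have h3 : (a * B + g) / c ≤ B / 2 + g / c := by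
        rw [add_div]
        have : a * B / c ≤ B / 2 := by
          rw [div_le_iff₀ hc]; nlinarith
        linarith
      by_cases hg : 0 ≤ g
      · have : 0 ≤ 2 * g / c := by positivity
        simp only [pow_zero, div_one]; linarith
      -- No sign is assumed for g. A negative g would force R to vanish identically, and then 0 ≤
      -- ‖G‖ ≤ g is absurd.
      · push Not at hg
        have h4 := fun u (hu : 0 ≤ u) => (step _ (step B hB) u hu)
        have hsup : ∀ n : ℕ, ∀ u, 0 ≤ u → ‖R u‖ ≤ B / 2 ^ n := by
          intro n
          induction n with
          | zero => simpa using hB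
          | succ n ih =>
            intro u hu
            refine (step _ ih u hu).trans ?_
            rw [div_le_iff₀ hc, pow_succ]
            have : 0 ≤ B / 2 ^ n := by positivity
            have h5 : B / (2 ^ n * 2) * c = (B / 2 ^ n) * (c / 2) := by field_simp
            rw [h5]
            nlinarith
        have hz : ∀ u, 0 ≤ u → ‖R u‖ = 0 := by
          intro u hu
          refine le_antisymm (ge_of_tendsto' (x := atTop) (f := fun n : ℕ => B / 2 ^ n) ?_
            fun n => hsup n u hu) (norm_nonneg _)
          have := (tendsto_pow_atTop_nhds_zero_of_lt_one (r := (1 / 2 : ℝ)) (by norm_num)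
            (by norm_num)).const_mul B
          simpa [div_eq_mul_inv] using this
        have h6 := (norm_nonneg _).trans (hG u hu)
        rw [hz u hu] at h6
        linarith
    | succ n ih =>
      intro u hu
      refine (step _ ih u hu).trans ?_
      have hnn : 0 ≤ B / 2 ^ n + 2 * g / c := (norm_nonneg _).trans (ih u hu)
      rw [div_le_iff₀ hc]
      have h5 : (B / 2 ^ (n + 1) + 2 * g / c) * c = (B / 2 ^ n + 2 * g / c) * (c / 2) + g := by
        field_simp; ring
      rw [h5]
      have := mul_le_mul_of_nonneg_right hac hnn
      linarith
  refine ge_of_tendsto' (x := atTop) (f := fun n : ℕ => B / 2 ^ n + 2 * g / c) ?_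
    fun n => hiter n 0 le_rfl
  have := (tendsto_pow_atTop_nhds_zero_of_lt_one (r := (1 / 2 : ℝ)) (by norm_num)
    (by norm_num)).const_mul B
  simpa [div_eq_mul_inv] using this.add_const (2 * g / c)

/-! ### The Laplace transform along the half-strip -/

/-- The bounded solution of `h f' = f - h g` on the half-strip. -/
def laplace (g : ℂ → ℂ → ℂ) (x h : ℂ) : ℂ :=
  ∫ u in Ioi (0 : ℝ), Complex.exp (-((max 0 u : ℝ) / h)) * g (x + (max 0 u : ℝ)) h

section Laplace

variable {r δ B : ℝ} {g : ℂ → ℂ → ℂ}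

/-- `max 0 u` agrees with u on the range of integration and keeps the shifted point in the
half-strip for every real u, so bounds and continuity hold without restricting u. -/
theorem laplace_norm_integrand_le
    (hB : ∀ z ∈ halfStrip r ×ˢ borelDisc 0 δ, ‖g z.1 z.2‖ ≤ B) {z : ℂ × ℂ}
    (hz : z ∈ halfStrip r ×ˢ borelDisc 0 δ) (u : ℝ) :
    ‖Complex.exp (-((max 0 u : ℝ) / z.2)) * g (z.1 + (max 0 u : ℝ)) z.2‖ ≤
      B * Real.exp (-(1 / δ * max 0 u)) := by
  rw [norm_mul, norm_exp_neg_div, mul_comm B]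
  have hm : (0 : ℝ) ≤ max 0 u := le_max_left _ _
  have h1 := mem_borelDisc_zero.1 hz.2
  refine mul_le_mul (Real.exp_le_exp.2 (neg_le_neg (by gcongr)))
    (hB (_, z.2) ⟨add_mem_halfStrip hz.1 hm, hz.2⟩) (norm_nonneg _) (Real.exp_pos _).le

theorem integrable_exp_max {c : ℝ} (hc : 0 < c) (B : ℝ) :
    MeasureTheory.Integrable (fun u : ℝ => B * Real.exp (-(c * max 0 u)))
      (MeasureTheory.volume.restrict (Ioi 0)) := by
  have h1 : MeasureTheory.IntegrableOn (fun u : ℝ => B * Real.exp (-c * u)) (Ioi 0) :=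
    (exp_neg_integrableOn_Ioi 0 hc).const_mul B
  refine (MeasureTheory.integrableOn_congr_fun (fun u hu => ?_) measurableSet_Ioi).1 h1
  have hu' : (0 : ℝ) < u := hu
  simp only [max_eq_right hu'.le, neg_mul]

theorem laplace_continuous (hg : DifferentiableOn ℂ (fun z : ℂ × ℂ => g z.1 z.2)
    (halfStrip r ×ˢ borelDisc 0 δ)) {z : ℂ × ℂ} (hz : z ∈ halfStrip r ×ˢ borelDisc 0 δ) :
    Continuous fun u : ℝ =>
      Complex.exp (-((max 0 u : ℝ) / z.2)) * g (z.1 + (max 0 u : ℝ)) z.2 := by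
  refine Continuous.mul (by fun_prop) ?_
  exact hg.continuousOn.comp_continuous (f := fun u : ℝ => (z.1 + ((max 0 u : ℝ) : ℂ), z.2))
    (by fun_prop) fun u => ⟨add_mem_halfStrip hz.1 (le_max_left _ _), hz.2⟩

theorem laplace_integrable (hδ : 0 < δ) (hg : DifferentiableOn ℂ (fun z : ℂ × ℂ => g z.1 z.2)
    (halfStrip r ×ˢ borelDisc 0 δ)) (hB : ∀ z ∈ halfStrip r ×ˢ borelDisc 0 δ, ‖g z.1 z.2‖ ≤ B)
    {z : ℂ × ℂ} (hz : z ∈ halfStrip r ×ˢ borelDisc 0 δ) :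
    MeasureTheory.Integrable (fun u : ℝ =>
      Complex.exp (-((max 0 u : ℝ) / z.2)) * g (z.1 + (max 0 u : ℝ)) z.2)
      (MeasureTheory.volume.restrict (Ioi 0)) :=
  (integrable_exp_max (by positivity : 0 < 1 / δ) B).mono'
    (laplace_continuous hg hz).aestronglyMeasurable
    (Eventually.of_forall (laplace_norm_integrand_le hB hz))

theorem laplace_differentiableOn (hδ : 0 < δ)
    (hg : DifferentiableOn ℂ (fun z : ℂ × ℂ => g z.1 z.2) (halfStrip r ×ˢ borelDisc 0 δ))
    (hB : ∀ z ∈ halfStrip r ×ˢ borelDisc 0 δ, ‖g z.1 z.2‖ ≤ B) :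
    DifferentiableOn ℂ (fun z : ℂ × ℂ => laplace g z.1 z.2) (halfStrip r ×ˢ borelDisc 0 δ) := by
  have hW : IsOpen (halfStrip r ×ˢ borelDisc 0 δ) := (isOpen_halfStrip r).prod (isOpen_borelDisc hδ)
  refine differentiableOn_integral₂ (F := fun x h u =>
    Complex.exp (-((max 0 u : ℝ) / h)) * g (x + (max 0 u : ℝ)) h) hW (fun u => ?_)
    (fun z hz => (laplace_continuous hg hz).aestronglyMeasurable)
    fun z hz => ⟨_, integrable_exp_max (by positivity : 0 < 1 / δ) B, ?_⟩
  · have hdiv : DifferentiableOn ℂ (fun z : ℂ × ℂ => ((max 0 u : ℝ) : ℂ) / z.2)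
        (halfStrip r ×ˢ borelDisc 0 δ) := by
      simp only [div_eq_mul_inv]
      exact (differentiableOn_const _).mul (differentiableOn_snd.fun_inv
        fun z hz => ne_zero_of_mem_borelDisc hδ hz.2)
    refine DifferentiableOn.mul hdiv.fun_neg.cexp ?_
    exact hg.comp (f := fun z : ℂ × ℂ => (z.1 + ((max 0 u : ℝ) : ℂ), z.2)) (by fun_prop)
      fun z hz => ⟨add_mem_halfStrip hz.1 (le_max_left _ _), hz.2⟩
  · filter_upwards [hW.mem_nhds hz] with w hw u using laplace_norm_integrand_le hB hw u

theorem norm_laplace_le (hδ : 0 < δ) (hB : ∀ z ∈ halfStrip r ×ˢ borelDisc 0 δ, ‖g z.1 z.2‖ ≤ B)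
    {z : ℂ × ℂ} (hz : z ∈ halfStrip r ×ˢ borelDisc 0 δ) : ‖laplace g z.1 z.2‖ ≤ δ * B := by
  have h1 : 0 < 1 / δ := by positivity
  refine (MeasureTheory.norm_integral_le_of_norm_le (integrable_exp_max h1 B)
    (Eventually.of_forall (laplace_norm_integrand_le hB hz))).trans (le_of_eq ?_)
  rw [MeasureTheory.integral_const_mul]
  have h2 : ∫ u in Ioi (0 : ℝ), Real.exp (-(1 / δ * max 0 u)) =
      ∫ u in Ioi (0 : ℝ), Real.exp (-(1 / δ) * u) := by
    refine MeasureTheory.setIntegral_congr_fun measurableSet_Ioi fun u hu => ?_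
    have hu' : (0 : ℝ) < u := hu
    simp only [max_eq_right hu'.le, neg_mul]
  rw [h2, integral_exp_mul_Ioi (by linarith) 0]
  simp [mul_comm]

/-- Holomorphy is already known, so the derivative may be computed along real increments s ≥ 0 only.
Translating the variable of integration by s gives e^{s/h} times the tail of the original integral,
whose right derivative at 0 is explicit. -/
theorem laplace_hasDerivAt (hδ : 0 < δ)
    (hg : DifferentiableOn ℂ (fun z : ℂ × ℂ => g z.1 z.2) (halfStrip r ×ˢ borelDisc 0 δ))
    (hB : ∀ z ∈ halfStrip r ×ˢ borelDisc 0 δ, ‖g z.1 z.2‖ ≤ B)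
    {z : ℂ × ℂ} (hz : z ∈ halfStrip r ×ˢ borelDisc 0 δ) :
    HasDerivAt (fun x => laplace g x z.2) (laplace g z.1 z.2 / z.2 - g z.1 z.2) z.1 := by
  have hW : IsOpen (halfStrip r ×ˢ borelDisc 0 δ) := (isOpen_halfStrip r).prod (isOpen_borelDisc hδ)
  have hd := (differentiableAt_fst_section hW (laplace_differentiableOn hδ hg hB) hz).hasDerivAt
  set φ : ℝ → ℂ := fun u => Complex.exp (-((max 0 u : ℝ) / z.2)) * g (z.1 + (max 0 u : ℝ)) z.2
    with hφ
  have hφc : Continuous φ := laplace_continuous hg hz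
  have hφi := laplace_integrable hδ hg hB hz
  have hrep : ∀ s ∈ Ici (0 : ℝ), laplace g (z.1 + s) z.2 =
      Complex.exp (s / z.2) * (laplace g z.1 z.2 - ∫ u in (0 : ℝ)..s, φ u) := by
    intro s hs
    have hs' : (0 : ℝ) ≤ s := hs
    have h1 : laplace g z.1 z.2 - ∫ u in (0 : ℝ)..s, φ u = ∫ u in Ioi s, φ u := by
      rw [intervalIntegral.integral_of_le hs', sub_eq_iff_eq_add, add_comm,
        ← MeasureTheory.setIntegral_union Ioc_disjoint_Ioi_same measurableSet_Ioi
          (MeasureTheory.IntegrableOn.mono_set hφi Ioc_subset_Ioi_self)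
          (MeasureTheory.IntegrableOn.mono_set hφi (Ioi_subset_Ioi hs')), Ioc_union_Ioi_eq_Ioi hs']
      rfl
    have h2 : ∫ u in Ioi s, φ u = ∫ u in Ioi (0 : ℝ), φ (u + s) := by
      have h3 := (MeasureTheory.measurePreserving_add_right MeasureTheory.volume
        s).setIntegral_preimage_emb (measurableEmbedding_addRight s) φ (Ioi s)
      rw [← h3]
      simp
    rw [h1, h2, ← MeasureTheory.integral_const_mul]
    refine MeasureTheory.setIntegral_congr_fun measurableSet_Ioi fun u hu => ?_
    have hu' : (0 : ℝ) < u := hu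
    simp only [hφ, max_eq_right hu'.le, max_eq_right (add_nonneg hu'.le hs')]
    rw [← mul_assoc, ← Complex.exp_add]
    push_cast
    congr 2
    · ring
    · ring
  have h1 : HasDerivWithinAt (fun s : ℝ => laplace g (z.1 + s) z.2)
      (deriv (fun x => laplace g x z.2) z.1) (Ici 0) 0 := by
    have h2 : HasDerivAt (fun s : ℝ => z.1 + (s : ℂ)) 1 0 :=
      ((hasDerivAt_id (0 : ℝ)).ofReal_comp).const_add z.1
    have h3 : HasDerivAt (fun x => laplace g x z.2) (deriv (fun x => laplace g x z.2) z.1)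
        (z.1 + ((0 : ℝ) : ℂ)) := by simpa using hd
    have := HasDerivAt.scomp (𝕜 := ℝ) (𝕜' := ℂ) (0 : ℝ) h3 h2
    rw [one_smul] at this
    exact this.hasDerivWithinAt
  have h2 : HasDerivWithinAt (fun s : ℝ => laplace g (z.1 + s) z.2)
      (laplace g z.1 z.2 / z.2 - g z.1 z.2) (Ici 0) 0 := by
    have h3 : HasDerivAt (fun s : ℝ => ∫ u in (0 : ℝ)..s, φ u) (φ 0) 0 :=
      intervalIntegral.integral_hasDerivAt_right (by simp) (hφc.stronglyMeasurableAtFilter _ _)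
        hφc.continuousAt
    have h4 : HasDerivAt (fun s : ℝ => Complex.exp (s / z.2))
        (Complex.exp ((0 : ℝ) / z.2) * (1 / z.2)) 0 :=
      ((hasDerivAt_id (0 : ℝ)).ofReal_comp.div_const z.2).cexp
    have h5 := (h4.mul (h3.const_sub (laplace g z.1 z.2))).hasDerivWithinAt (s := Ici 0)
    refine (h5.congr hrep (hrep 0 self_mem_Ici)).congr_deriv ?_
    simp [hφ]; ring
  have := (uniqueDiffWithinAt_Ici (0 : ℝ)).eq_deriv _ h1 h2
  rw [← this]; exact hd

theorem laplace_sub {g' : ℂ → ℂ → ℂ} {B' : ℝ} (hδ : 0 < δ)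
    (hg : DifferentiableOn ℂ (fun z : ℂ × ℂ => g z.1 z.2) (halfStrip r ×ˢ borelDisc 0 δ))
    (hB : ∀ z ∈ halfStrip r ×ˢ borelDisc 0 δ, ‖g z.1 z.2‖ ≤ B)
    (hg' : DifferentiableOn ℂ (fun z : ℂ × ℂ => g' z.1 z.2) (halfStrip r ×ˢ borelDisc 0 δ))
    (hB' : ∀ z ∈ halfStrip r ×ˢ borelDisc 0 δ, ‖g' z.1 z.2‖ ≤ B')
    {z : ℂ × ℂ} (hz : z ∈ halfStrip r ×ˢ borelDisc 0 δ) :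
    laplace g z.1 z.2 - laplace g' z.1 z.2 = laplace (fun x h => g x h - g' x h) z.1 z.2 := by
  unfold laplace
  rw [← MeasureTheory.integral_sub (laplace_integrable hδ hg hB hz)
    (laplace_integrable hδ hg' hB' hz)]
  simp only [mul_sub]

/-- Bounded solutions of `h w' = w + h (A₀ + A₁ w + w²)` on the half-strip. -/
theorem exists_quadratic_solution {A₀ A₁ : ℂ → ℂ → ℂ} {a : ℝ} (hδ : 0 < δ)
    (hA₀ : DifferentiableOn ℂ (fun z : ℂ × ℂ => A₀ z.1 z.2) (halfStrip r ×ˢ borelDisc 0 δ))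
    (hA₁ : DifferentiableOn ℂ (fun z : ℂ × ℂ => A₁ z.1 z.2) (halfStrip r ×ˢ borelDisc 0 δ))
    (ha : 1 ≤ a) (hb₀ : ∀ z ∈ halfStrip r ×ˢ borelDisc 0 δ, ‖A₀ z.1 z.2‖ ≤ a)
    (hb₁ : ∀ z ∈ halfStrip r ×ˢ borelDisc 0 δ, ‖A₁ z.1 z.2‖ ≤ a) (hδa : δ * (6 * a) ≤ 1) :
    ∃ w : ℂ → ℂ → ℂ, DifferentiableOn ℂ (fun z : ℂ × ℂ => w z.1 z.2)
        (halfStrip r ×ˢ borelDisc 0 δ) ∧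
      ∀ z ∈ halfStrip r ×ˢ borelDisc 0 δ, ‖w z.1 z.2‖ ≤ 1 ∧
        HasDerivAt (fun x => w x z.2) (w z.1 z.2 / z.2 +
          (A₀ z.1 z.2 + A₁ z.1 z.2 * w z.1 z.2 + w z.1 z.2 ^ 2)) z.1 := by
  set W := halfStrip r ×ˢ borelDisc 0 δ with hWdef
  have hW : IsOpen W := (isOpen_halfStrip r).prod (isOpen_borelDisc hδ)
  set q : (ℂ → ℂ → ℂ) → ℂ → ℂ → ℂ := fun f x h => A₀ x h + A₁ x h * f x h + f x h ^ 2 with hq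
  have hqd : ∀ f : ℂ → ℂ → ℂ, DifferentiableOn ℂ (fun z : ℂ × ℂ => f z.1 z.2) W →
      DifferentiableOn ℂ (fun z : ℂ × ℂ => q f z.1 z.2) W := fun f hf =>
    (hA₀.add (hA₁.mul hf)).add (hf.pow 2)
  have hqb : ∀ f : ℂ → ℂ → ℂ, (∀ z ∈ W, ‖f z.1 z.2‖ ≤ 1) → ∀ z ∈ W, ‖q f z.1 z.2‖ ≤ 3 * a := by
    intro f hf z hz
    have h1 := hf z hz
    calc _ ≤ ‖A₀ z.1 z.2‖ + ‖A₁ z.1 z.2‖ * ‖f z.1 z.2‖ + ‖f z.1 z.2‖ ^ 2 := by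
          refine (norm_add_le _ _).trans (add_le_add ((norm_add_le _ _).trans ?_) ?_)
          · rw [norm_mul]
          · rw [norm_pow]
      _ ≤ a + a * 1 + 1 ^ 2 := by
          gcongr
          · exact hb₀ z hz
          · exact hb₁ z hz
      _ ≤ 3 * a := by linarith
  have hδ3 : δ * (3 * a) ≤ 1 := by
    have : 0 ≤ δ * a := by positivity
    linarith
  -- The equation for w is the fixed point equation w = -laplace(A₀ + A₁ w + w²). On the unit ball
  -- the quadratic is bounded by 3a and is Lipschitz with constant a + 2 ≤ 3a. As `laplace` has norm
  -- at most δ, the condition 6aδ ≤ 1 gives contraction factor 1/2.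
  obtain ⟨w, hwd, hwb, hwK⟩ := exists_fixedPoint hW (fun f x h => -laplace (q f) x h) zero_le_one
    (fun f hf hfb => ⟨(laplace_differentiableOn hδ (hqd f hf) (hqb f hfb)).fun_neg, fun z hz => by
      rw [norm_neg]
      exact (norm_laplace_le hδ (hqb f hfb) hz).trans hδ3⟩)
    (fun f g hf hg hfb hgb d hd z hz => by
      have h1 : -laplace (q f) z.1 z.2 - -laplace (q g) z.1 z.2 =
          laplace (fun x h => q g x h - q f x h) z.1 z.2 := by
        rw [← laplace_sub hδ (hqd g hg) (hqb g hgb) (hqd f hf) (hqb f hfb) hz]; ring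
      rw [h1]
      refine (norm_laplace_le (B := 3 * a * d) hδ (fun y hy => ?_) hz).trans ?_
      · have h2 : q g y.1 y.2 - q f y.1 y.2 =
            (A₁ y.1 y.2 + (g y.1 y.2 + f y.1 y.2)) * (g y.1 y.2 - f y.1 y.2) := by
          simp only [hq]; ring
        rw [h2, norm_mul]
        refine mul_le_mul ?_ (by rw [norm_sub_rev]; exact hd y hy) (norm_nonneg _) (by linarith)
        refine (norm_add_le _ _).trans ?_
        have := norm_add_le (g y.1 y.2) (f y.1 y.2)
        linarith [hb₁ y hy, hgb y hy, hfb y hy]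
      · have hd0 : 0 ≤ d := (norm_nonneg _).trans (hd z hz)
        have : δ * (3 * a * d) = δ * (6 * a) * (d / 2) := by ring
        rw [this]
        nlinarith)
  refine ⟨w, hwd, fun z hz => ⟨hwb z hz, ?_⟩⟩
  have h1 := (laplace_hasDerivAt hδ (hqd w hwd) (hqb w hwb) hz).fun_neg
  have h2 : HasDerivAt (fun x => w x z.2)
      (-(laplace (q w) z.1 z.2 / z.2 - q w z.1 z.2)) z.1 := by
    refine h1.congr_of_eventuallyEq ?_
    filter_upwards [(isOpen_halfStrip r).mem_nhds hz.1] with x hx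
    exact (hwK (x, z.2) ⟨hx, hz.2⟩).symm
  refine h2.congr_deriv ?_
  rw [← hwK z hz]
  have h3 := hwK z hz
  have h4 : q w z.1 z.2 = A₀ z.1 z.2 + A₁ z.1 z.2 * w z.1 z.2 + w z.1 z.2 ^ 2 := rfl
  rw [h4, ← h3]; ring

end Laplace


/-! ### Formal solutions of the Riccati equation -/

theorem units_mul_self_cast (α : ℤˣ) : ((α : ℤ) : ℂ) * ((α : ℤ) : ℂ) = 1 := by
  rcases Int.units_eq_one_or α with h | h <;> subst h <;> simp

theorem units_cast_ne_zero (α : ℤˣ) : ((α : ℤ) : ℂ) ≠ 0 := by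
  rcases Int.units_eq_one_or α with h | h <;> subst h <;> simp

theorem norm_units_cast (α : ℤˣ) : ‖((α : ℤ) : ℂ)‖ = 1 := by
  rcases Int.units_eq_one_or α with h | h <;> subst h <;> simp

theorem formalRoot_zero (pc qc : ℕ → ℂ → ℂ) (sq : ℂ → ℂ) (α : ℤˣ) (x : ℂ) :
    formalRoot pc qc sq α 0 x = (pc 0 x + ((α : ℤ) : ℂ) * sq x) / 2 := by
  rw [formalRoot]

theorem formalRoot_succ (pc qc : ℕ → ℂ → ℂ) (sq : ℂ → ℂ) (α : ℤˣ) (k : ℕ) (x : ℂ) :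
    formalRoot pc qc sq α (k + 1) x = ((α : ℤ) : ℂ) / sq x *
      (deriv (formalRoot pc qc sq α k) x
        - ∑ i ∈ Finset.range k, formalRoot pc qc sq α (i + 1) x * formalRoot pc qc sq α (k - i) x
        + ∑ i ∈ Finset.range (k + 1), pc (k + 1 - i) x * formalRoot pc qc sq α i x
        - qc (k + 1) x) := by
  rw [formalRoot]
  rw [Finset.sum_range, Finset.sum_range]

/-- The Riccati equation at order `n + 1`, solved for the coefficient of index `n + 1`. -/
theorem riccati_coeff_iff {s p : ℕ → ℂ} {a w d q : ℂ} (ha : a * a = 1) (hw : w ≠ 0)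
    (h0 : s 0 = (p 0 + a * w) / 2) (n : ℕ) :
    d = ∑ i ∈ Finset.range (n + 2), s i * s (n + 1 - i)
        - ∑ i ∈ Finset.range (n + 2), p i * s (n + 1 - i) + q ↔
      s (n + 1) = a / w * (d - ∑ i ∈ Finset.range n, s (i + 1) * s (n - i)
        + ∑ i ∈ Finset.range (n + 1), p (n + 1 - i) * s i - q) := by
  have h1 : ∑ i ∈ Finset.range (n + 2), s i * s (n + 1 - i) =
      2 * s 0 * s (n + 1) + ∑ i ∈ Finset.range n, s (i + 1) * s (n - i) := by
    rw [Finset.sum_range_succ, Finset.sum_range_succ', Nat.sub_self, Nat.sub_zero]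
    have : ∀ i ∈ Finset.range n, s (i + 1) * s (n + 1 - (i + 1)) = s (i + 1) * s (n - i) :=
      fun i _ => by rw [Nat.add_sub_add_right]
    rw [Finset.sum_congr rfl this]; ring
  have h2 : ∑ i ∈ Finset.range (n + 2), p i * s (n + 1 - i) =
      p 0 * s (n + 1) + ∑ i ∈ Finset.range (n + 1), p (n + 1 - i) * s i := by
    rw [← Finset.sum_range_reflect (fun i => p i * s (n + 1 - i)) (n + 2), Finset.sum_range_succ,
      add_comm]
    have e : n + 2 - 1 - (n + 1) = 0 := by omega
    rw [e, Nat.sub_zero]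
    congr 1
    refine Finset.sum_congr rfl fun i hi => ?_
    rw [Finset.mem_range] at hi
    have e1 : n + 2 - 1 - i = n + 1 - i := by omega
    have e2 : n + 1 - (n + 1 - i) = i := by omega
    simp only [e1, e2]
  rw [h1, h2]
  set A := ∑ i ∈ Finset.range n, s (i + 1) * s (n - i)
  set B := ∑ i ∈ Finset.range (n + 1), p (n + 1 - i) * s i
  have h3 : 2 * s 0 = p 0 + a * w := by rw [h0]; ring
  rw [h3]
  constructor
  · intro h
    have : d - A + B - q = a * w * s (n + 1) := by rw [h]; ring
    rw [this]
    have : a / w * (a * w * s (n + 1)) = (a * a) * s (n + 1) := by field_simp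
    rw [this, ha, one_mul]
  · intro h
    have h4 : a * w * s (n + 1) = d - A + B - q := by
      rw [h]
      have : a * w * (a / w * (d - A + B - q)) = a * a * (d - A + B - q) := by field_simp
      rw [this, ha, one_mul]
    have : (p 0 + a * w) * s (n + 1) + A - (p 0 * s (n + 1) + B) + q =
      a * w * s (n + 1) + A - B + q := by ring
    rw [this, h4]; ring

theorem formalRoot_riccati (pc qc : ℕ → ℂ → ℂ) {sq : ℂ → ℂ} (α : ℤˣ) {x : ℂ} (hx : sq x ≠ 0)
    (n : ℕ) : deriv (formalRoot pc qc sq α n) x =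
      ∑ i ∈ Finset.range (n + 2), formalRoot pc qc sq α i x * formalRoot pc qc sq α (n + 1 - i) x
      - ∑ i ∈ Finset.range (n + 2), pc i x * formalRoot pc qc sq α (n + 1 - i) x
      + qc (n + 1) x :=
  (riccati_coeff_iff (s := fun k => formalRoot pc qc sq α k x) (p := fun k => pc k x)
    (units_mul_self_cast α) hx (formalRoot_zero pc qc sq α x) n).2 (formalRoot_succ pc qc sq α n x)

theorem formalRoot_riccati_zero {pc qc : ℕ → ℂ → ℂ} {sq : ℂ → ℂ} (α : ℤˣ) {x : ℂ}
    (hx : sq x ^ 2 = disc₀ pc qc x) :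
    formalRoot pc qc sq α 0 x * formalRoot pc qc sq α 0 x -
      pc 0 x * formalRoot pc qc sq α 0 x + qc 0 x = 0 := by
  rw [formalRoot_zero]
  rw [disc₀] at hx
  have := units_mul_self_cast α
  linear_combination (((α : ℤ) : ℂ) * ((α : ℤ) : ℂ) / 4) * hx + (pc 0 x ^ 2 - 4 * qc 0 x) / 4 * this

/-- Used to recognise the formal root after a change of coordinates: it is enough to check the
leading term and the Riccati recursion. -/
theorem formalRoot_unique {pc qc : ℕ → ℂ → ℂ} {sq : ℂ → ℂ} {α : ℤˣ} {U : Set ℂ} (hU : IsOpen U)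
    (hsq : ∀ x ∈ U, sq x ≠ 0) {c : ℕ → ℂ → ℂ}
    (h0 : ∀ x ∈ U, c 0 x = (pc 0 x + ((α : ℤ) : ℂ) * sq x) / 2)
    (hc : ∀ n, ∀ x ∈ U, deriv (c n) x = ∑ i ∈ Finset.range (n + 2), c i x * c (n + 1 - i) x
      - ∑ i ∈ Finset.range (n + 2), pc i x * c (n + 1 - i) x + qc (n + 1) x) (n : ℕ) :
    ∀ x ∈ U, c n x = formalRoot pc qc sq α n x := by
  induction n using Nat.strong_induction_on with
  | _ n ih =>
    intro x hx
    cases n with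
    | zero => rw [h0 x hx, formalRoot_zero]
    | succ n =>
      rw [(riccati_coeff_iff (s := fun k => c k x) (p := fun k => pc k x)
        (units_mul_self_cast α) (hsq x hx) (h0 x hx) n).1 (hc n x hx), formalRoot_succ]
      have h1 : deriv (c n) x = deriv (formalRoot pc qc sq α n) x :=
        Filter.EventuallyEq.deriv_eq (by
          filter_upwards [hU.mem_nhds hx] with y hy using ih n (by omega) y hy)
      have h2 : ∑ i ∈ Finset.range n, c (i + 1) x * c (n - i) x = ∑ i ∈ Finset.range n,
          formalRoot pc qc sq α (i + 1) x * formalRoot pc qc sq α (n - i) x :=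
        Finset.sum_congr rfl fun i hi => by
          rw [Finset.mem_range] at hi
          rw [ih (i + 1) (by omega) x hx, ih (n - i) (by omega) x hx]
      have h3 : ∑ i ∈ Finset.range (n + 1), pc (n + 1 - i) x * c i x =
          ∑ i ∈ Finset.range (n + 1), pc (n + 1 - i) x * formalRoot pc qc sq α i x :=
        Finset.sum_congr rfl fun i hi => by
          rw [Finset.mem_range] at hi
          rw [ih i (by omega) x hx]
      rw [h1, h2, h3]

theorem formalRoot_differentiableOn {pc qc : ℕ → ℂ → ℂ} {sq : ℂ → ℂ} (α : ℤˣ) {U : Set ℂ}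
    (hU : IsOpen U) (hpc : ∀ k, DifferentiableOn ℂ (pc k) U)
    (hqc : ∀ k, DifferentiableOn ℂ (qc k) U) (hsq : DifferentiableOn ℂ sq U)
    (hsq0 : ∀ x ∈ U, sq x ≠ 0) (n : ℕ) : DifferentiableOn ℂ (formalRoot pc qc sq α n) U := by
  induction n using Nat.strong_induction_on with
  | _ n ih =>
    cases n with
    | zero =>
      refine (((hpc 0).add (hsq.const_mul ((α : ℤ) : ℂ))).div_const 2).congr fun x _ =>
        formalRoot_zero pc qc sq α x
    | succ n =>
      refine DifferentiableOn.congr ?_ fun x _ => formalRoot_succ pc qc sq α n x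
      have h1 : DifferentiableOn ℂ (fun x => ∑ i ∈ Finset.range n,
          formalRoot pc qc sq α (i + 1) x * formalRoot pc qc sq α (n - i) x) U :=
        DifferentiableOn.fun_sum fun i hi => by
          rw [Finset.mem_range] at hi
          exact (ih _ (by omega)).fun_mul (ih _ (by omega))
      have h2 : DifferentiableOn ℂ (fun x => ∑ i ∈ Finset.range (n + 1),
          pc (n + 1 - i) x * formalRoot pc qc sq α i x) U :=
        DifferentiableOn.fun_sum fun i hi => by
          rw [Finset.mem_range] at hi
          exact (hpc _).fun_mul (ih _ (by omega))
      exact ((differentiableOn_const _).fun_div hsq hsq0).fun_mul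
        (((((ih n (by omega)).deriv hU).fun_sub h1).fun_add h2).fun_sub (hqc (n + 1)))

/-- The price, in the bound of order k, of shrinking the distance to the boundary by the fraction
1/(k + 2) in Nagumo's argument below. -/
theorem one_add_div_pow_le (k : ℕ) : (((k : ℝ) + 2) / (k + 1)) ^ k ≤ 3 := by
  have h1 : ((k : ℝ) + 2) / (k + 1) = 1 / (k + 1) + 1 := by field_simp; ring
  have h2 : ((k : ℝ) + 2) / (k + 1) ≤ Real.exp (1 / (k + 1)) := h1 ▸ Real.add_one_le_exp _
  calc (((k : ℝ) + 2) / (k + 1)) ^ k ≤ Real.exp (1 / (k + 1)) ^ k := by gcongr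
    _ = Real.exp (k / (k + 1)) := by rw [← Real.exp_nat_mul]; congr 1; ring
    _ ≤ Real.exp 1 := Real.exp_le_exp.2 (by rw [div_le_one (by positivity)]; linarith)
    _ ≤ 3 := Real.exp_one_lt_three.le

section Bounds

variable {pc qc : ℕ → ℂ → ℂ} {ρ C M : ℝ}

/-- Factorial growth of the coefficients of the formal Riccati solution on a half-strip. -/
theorem norm_formalRoot_le_aux (hC : 1 ≤ C) (hM : 0 < M)
    (hpc : ∀ k, DifferentiableOn ℂ (pc k) (halfStrip ρ))
    (hqc : ∀ k, DifferentiableOn ℂ (qc k) (halfStrip ρ))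
    (hpb : ∀ k, ∀ x ∈ halfStrip ρ, ‖pc k x‖ ≤ C * M ^ k * (k.factorial : ℝ))
    (hqb : ∀ k, ∀ x ∈ halfStrip ρ, ‖qc k x‖ ≤ C * M ^ k * (k.factorial : ℝ)) (k : ℕ) :
    ∀ r, 0 < r → r < ρ → ∀ x ∈ halfStrip r,
      ‖formalRoot pc qc (fun _ => 1) 1 (k + 1) x‖ ≤
        1 / 4 * (96 * C ^ 2 * (1 + M * ρ) / (ρ - r)) ^ (k + 1) * ((k + 1).factorial : ℝ) := by
  have hd := formalRoot_differentiableOn (pc := pc) (qc := qc) (sq := fun _ => 1) 1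
    (isOpen_halfStrip ρ) hpc hqc (differentiableOn_const _) (fun _ _ => one_ne_zero)
  set y := formalRoot pc qc (fun _ => 1) 1 with hy
  have hy0 : ∀ x ∈ halfStrip ρ, ‖y 0 x‖ ≤ C := by
    intro x hx
    rw [hy, formalRoot_zero]
    have h1 := hpb 0 x hx
    simp only [pow_zero, Nat.factorial_zero, Nat.cast_one, mul_one] at h1
    simp only [Units.val_one, Int.cast_one, mul_one, norm_div, Complex.norm_ofNat]
    have h2 := norm_add_le (pc 0 x) 1
    rw [norm_one] at h2
    linarith
  induction k using Nat.strong_induction_on with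
  | _ k ih =>
    intro r hr hrρ x hx
    -- Nagumo's device: the bound is proved for all r at once with the weight (ρ - r)^{-(k+1)},
    -- which absorbs the loss due to differentiation. N is chosen so that F = N/d dominates both
    -- 96C²/d and 96C²M. The four terms of the recursion then cost 1/16, 1/16, 1/48 and 1/96 of E,
    -- in total less than 1/4.
    set N := 96 * C ^ 2 * (1 + M * ρ) with hN
    set d := ρ - r with hdd
    have hd0 : 0 < d := by simp only [hdd]; linarith
    have hρ : 0 < ρ := hr.trans hrρ
    have hMρ : 0 < M * ρ := by positivity
    have hC2 : C ≤ C ^ 2 := by nlinarith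
    have hN0 : 0 < N := by positivity
    have hN1 : 96 * C ^ 2 ≤ N := by rw [hN]; nlinarith [sq_nonneg C]
    have hN2 : 96 * C ^ 2 * (M * ρ) ≤ N := by rw [hN]; nlinarith [sq_nonneg C]
    set F := N / d with hF
    have hF0 : 0 < F := by positivity
    have hdρ : d ≤ ρ := by simp only [hdd]; linarith
    have hMF : 96 * C ^ 2 * M ≤ F := by
      rw [hF, le_div_iff₀ hd0]
      calc 96 * C ^ 2 * M * d ≤ 96 * C ^ 2 * M * ρ := by gcongr
        _ ≤ N := by linarith
    have hMF' : M ≤ F := by nlinarith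
    have hdF : 96 * C ^ 2 / d ≤ F := by rw [hF]; gcongr
    have hx' := halfStrip_mono hrρ.le hx
    have hpow : ∀ j, M ^ (j + 1) ≤ F ^ (j + 1) / (96 * C ^ 2) := fun j => by
      rw [le_div_iff₀ (by positivity), pow_succ, pow_succ]
      calc M ^ j * M * (96 * C ^ 2) = M ^ j * (96 * C ^ 2 * M) := by ring
        _ ≤ F ^ j * F := by gcongr
    set E := F ^ (k + 1) * ((k + 1).factorial : ℝ) with hE
    have hE0 : 0 < E := by positivity
    have hkE : F ^ (k + 1) * (k * (k.factorial : ℝ)) ≤ E := by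
      rw [hE, Nat.factorial_succ]; push_cast
      gcongr; linarith
    -- derivative
    have hder : ‖deriv (y k) x‖ ≤ 1 / 16 * E := by
      -- Cauchy's estimate is taken on a disc of radius d/(k+2). It costs the factor (k+2)/d,
      -- comparable to (k+1)F, while the gap d shrinks only to d(k+1)/(k+2).
      have hη : 0 < d / (k + 2) := by positivity
      have hηd : d / (k + 2) < d := div_lt_self hd0 (by linarith [(Nat.cast_nonneg k : (0:ℝ) ≤ k)])
      have hsub : Metric.ball x (d / (k + 2)) ⊆ halfStrip (r + d / (k + 2)) := by
        have := ball_subset_halfStrip (ρ := r + d / (k + 2)) hx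
        simpa using this
      have hlt : r + d / (k + 2) < ρ := by linarith
      have hsub' := hsub.trans (halfStrip_mono hlt.le)
      cases k with
      | zero =>
        have h1 := norm_deriv_le_of_ball hη ((hd 0).mono hsub') fun z hz => hy0 z (hsub' hz)
        refine h1.trans ?_
        simp only [hE, zero_add, pow_one, Nat.factorial_one, Nat.cast_one, mul_one,
          CharP.cast_eq_zero]
        calc C / (d / 2) = 2 * C / d := by field_simp
          _ ≤ 6 * C ^ 2 / d := by gcongr; nlinarith
          _ = 1 / 16 * (96 * C ^ 2 / d) := by ring
          _ ≤ 1 / 16 * F := by gcongr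
      | succ k =>
        have h2 := fun z hz => ih k (by omega) (r + d / ((k + 1 : ℕ) + 2)) (by positivity) hlt z
          (hsub hz)
        have h1 := norm_deriv_le_of_ball hη ((hd (k + 1)).mono hsub') h2
        refine h1.trans ?_
        have e1 : ρ - (r + d / (((k + 1 : ℕ) : ℝ) + 2)) =
            d * ((((k + 1 : ℕ) : ℝ) + 1) / (((k + 1 : ℕ) : ℝ) + 2)) := by
          have : ρ = d + r := by rw [hdd]; ring
          rw [this]; field_simp; ring
        rw [e1]
        set m : ℕ := k + 1 with hm
        have e2 : (N / (d * (((m : ℝ) + 1) / (m + 2)))) ^ m = F ^ m * (((m : ℝ) + 2) / (m + 1)) ^ m := by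
          rw [← mul_pow]; congr 1; rw [hF]; field_simp
        rw [e2]
        have h3 := one_add_div_pow_le m
        have hm1 : (1 : ℝ) ≤ m := by rw [hm]; push_cast; linarith [(Nat.cast_nonneg k : (0:ℝ) ≤ k)]
        calc 1 / 4 * (F ^ m * (((m : ℝ) + 2) / (m + 1)) ^ m) * (m.factorial : ℝ) / (d / (m + 2))
            ≤ 1 / 4 * (F ^ m * 3) * (m.factorial : ℝ) / (d / (m + 2)) := by gcongr
          _ = 3 / 4 * F ^ m * ((m : ℝ) + 2) * (m.factorial : ℝ) / d := by field_simp
          _ ≤ 3 / 4 * F ^ m * (2 * ((m : ℝ) + 1)) * (m.factorial : ℝ) / d := by gcongr; linarith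
          _ = 1 / 64 * (F ^ m * (((m : ℝ) + 1) * (m.factorial : ℝ)) * (96 * 1 ^ 2 / d)) := by ring
          _ ≤ 1 / 64 * (F ^ m * (((m : ℝ) + 1) * (m.factorial : ℝ)) * F) := by
            gcongr
            refine le_trans ?_ hdF
            gcongr
          _ ≤ 1 / 16 * (F ^ m * (((m : ℝ) + 1) * (m.factorial : ℝ)) * F) := by gcongr; norm_num
          _ = 1 / 16 * E := by rw [hE, Nat.factorial_succ m]; push_cast; ring
    -- quadratic term
    have hquad : ‖∑ i ∈ Finset.range k, y (i + 1) x * y (k - i) x‖ ≤ 1 / 16 * E := by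
      have h1 : ∀ i ∈ Finset.range k, ‖y (i + 1) x * y (k - i) x‖ ≤
          1 / 16 * F ^ (k + 1) * (k.factorial : ℝ) := by
        intro i hi
        rw [Finset.mem_range] at hi
        obtain ⟨j, hj⟩ : ∃ j, k = i + j + 1 := ⟨k - i - 1, by omega⟩
        have e : k - i = j + 1 := by omega
        rw [e, norm_mul]
        have h2 := ih i (by omega) r hr hrρ x hx
        have h3 := ih j (by omega) r hr hrρ x hx
        have h4 : (((i + 1).factorial : ℝ) * ((j + 1).factorial : ℝ)) ≤ (k.factorial : ℝ) := by
          rw [hj]; exact_mod_cast factorial_succ_mul_factorial_succ_le i j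
        calc _ ≤ (1 / 4 * F ^ (i + 1) * ((i + 1).factorial : ℝ)) *
              (1 / 4 * F ^ (j + 1) * ((j + 1).factorial : ℝ)) := by gcongr
          _ = 1 / 16 * F ^ (k + 1) * (((i + 1).factorial : ℝ) * ((j + 1).factorial : ℝ)) := by
            rw [hj]; ring
          _ ≤ _ := by gcongr
      refine (norm_sum_le_of_le _ h1).trans ?_
      rw [Finset.sum_const, Finset.card_range, nsmul_eq_mul]
      linarith
    -- linear term
    have hlin : ‖∑ i ∈ Finset.range (k + 1), pc (k + 1 - i) x * y i x‖ ≤ 1 / 48 * E := by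
      rw [Finset.sum_range_succ']
      have h0 : ‖pc (k + 1 - 0) x * y 0 x‖ ≤ 1 / 96 * E := by
        rw [Nat.sub_zero, norm_mul]
        calc _ ≤ (C * M ^ (k + 1) * ((k + 1).factorial : ℝ)) * C := by
              gcongr
              · exact hpb _ x hx'
              · exact hy0 x hx'
          _ ≤ (C * (F ^ (k + 1) / (96 * C ^ 2)) * ((k + 1).factorial : ℝ)) * C := by
              gcongr; exact hpow k
          _ = 1 / 96 * E := by rw [hE]; field_simp
      have h1 : ∀ i ∈ Finset.range k, ‖pc (k + 1 - (i + 1)) x * y (i + 1) x‖ ≤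
          1 / 96 * F ^ (k + 1) * (k.factorial : ℝ) := by
        intro i hi
        rw [Finset.mem_range] at hi
        obtain ⟨j, hj⟩ : ∃ j, k = i + j + 1 := ⟨k - i - 1, by omega⟩
        have e : k + 1 - (i + 1) = j + 1 := by omega
        rw [e, norm_mul]
        have h2 := ih i (by omega) r hr hrρ x hx
        have h4 : (((i + 1).factorial : ℝ) * ((j + 1).factorial : ℝ)) ≤ (k.factorial : ℝ) := by
          rw [hj]; exact_mod_cast factorial_succ_mul_factorial_succ_le i j
        calc _ ≤ (C * M ^ (j + 1) * ((j + 1).factorial : ℝ)) *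
              (1 / 4 * F ^ (i + 1) * ((i + 1).factorial : ℝ)) := by
              gcongr; exact hpb _ x hx'
          _ ≤ (C * (F ^ (j + 1) / (96 * C ^ 2)) * ((j + 1).factorial : ℝ)) *
              (1 / 4 * F ^ (i + 1) * ((i + 1).factorial : ℝ)) := by gcongr; exact hpow j
          _ = (1 / (4 * C)) * (1 / 96 * F ^ (k + 1) *
              (((i + 1).factorial : ℝ) * ((j + 1).factorial : ℝ))) := by
            rw [hj]; field_simp; ring
          _ ≤ 1 * (1 / 96 * F ^ (k + 1) * (k.factorial : ℝ)) := by
            gcongr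
            rw [div_le_one (by positivity)]; linarith
          _ = _ := one_mul _
      have h2 := norm_sum_le_of_le _ h1
      rw [Finset.sum_const, Finset.card_range, nsmul_eq_mul] at h2
      refine (norm_add_le _ _).trans ?_
      linarith
    have hq : ‖qc (k + 1) x‖ ≤ 1 / 96 * E := by
      calc _ ≤ C * M ^ (k + 1) * ((k + 1).factorial : ℝ) := hqb _ x hx'
        _ ≤ C * (F ^ (k + 1) / (96 * C ^ 2)) * ((k + 1).factorial : ℝ) := by gcongr; exact hpow k
        _ = 1 / C * (1 / 96 * E) := by rw [hE]; field_simp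
        _ ≤ 1 * (1 / 96 * E) := by
          gcongr
          rw [div_le_one (by positivity)]; linarith
        _ = _ := one_mul _
    have hsucc : y (k + 1) x = deriv (y k) x - ∑ i ∈ Finset.range k, y (i + 1) x * y (k - i) x
        + ∑ i ∈ Finset.range (k + 1), pc (k + 1 - i) x * y i x - qc (k + 1) x := by
      rw [hy, formalRoot_succ]; simp
    rw [hsucc]
    have := norm_sub_le (deriv (y k) x - ∑ i ∈ Finset.range k, y (i + 1) x * y (k - i) x
        + ∑ i ∈ Finset.range (k + 1), pc (k + 1 - i) x * y i x) (qc (k + 1) x)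
    have h2 := norm_add_le (deriv (y k) x - ∑ i ∈ Finset.range k, y (i + 1) x * y (k - i) x)
      (∑ i ∈ Finset.range (k + 1), pc (k + 1 - i) x * y i x)
    have h3 := norm_sub_le (deriv (y k) x) (∑ i ∈ Finset.range k, y (i + 1) x * y (k - i) x)
    rw [mul_assoc, ← hE]
    linarith

/-- On a smaller half-strip, the coefficients of the formal Riccati solution and their derivatives
grow at most factorially. -/
theorem exists_norm_formalRoot_le (hC : 1 ≤ C) (hM : 0 < M)
    (hpc : ∀ k, DifferentiableOn ℂ (pc k) (halfStrip ρ))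
    (hqc : ∀ k, DifferentiableOn ℂ (qc k) (halfStrip ρ))
    (hpb : ∀ k, ∀ x ∈ halfStrip ρ, ‖pc k x‖ ≤ C * M ^ k * (k.factorial : ℝ))
    (hqb : ∀ k, ∀ x ∈ halfStrip ρ, ‖qc k x‖ ≤ C * M ^ k * (k.factorial : ℝ))
    {r : ℝ} (hr : 0 < r) (hrρ : r < ρ) :
    ∃ K, 1 ≤ K ∧ ∀ k, ∀ x ∈ halfStrip r,
      ‖formalRoot pc qc (fun _ => 1) 1 k x‖ ≤ K * K ^ k * (k.factorial : ℝ) ∧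
      ‖deriv (formalRoot pc qc (fun _ => 1) 1 k) x‖ ≤ K * K ^ k * (k.factorial : ℝ) := by
  have hd := formalRoot_differentiableOn (pc := pc) (qc := qc) (sq := fun _ => 1) 1
    (isOpen_halfStrip ρ) hpc hqc (differentiableOn_const _) (fun _ _ => one_ne_zero)
  have haux := norm_formalRoot_le_aux hC hM hpc hqc hpb hqb
  set y := formalRoot pc qc (fun _ => 1) 1 with hy
  have hy0 : ∀ x ∈ halfStrip ρ, ‖y 0 x‖ ≤ C := by
    intro x hx
    rw [hy, formalRoot_zero]
    have h1 := hpb 0 x hx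
    simp only [pow_zero, Nat.factorial_zero, Nat.cast_one, mul_one] at h1
    simp only [Units.val_one, Int.cast_one, mul_one, norm_div, Complex.norm_ofNat]
    have h2 := norm_add_le (pc 0 x) 1
    rw [norm_one] at h2
    linarith
  set r' := (r + ρ) / 2 with hr'
  set F := 96 * C ^ 2 * (1 + M * ρ) / (ρ - r') with hF
  have hρ : 0 < ρ := hr.trans hrρ
  have hd0 : 0 < ρ - r' := by rw [hr']; linarith
  have hF0 : 0 < F := by positivity
  have hbd : ∀ k, ∀ x ∈ halfStrip r', ‖y k x‖ ≤ C * F ^ k * (k.factorial : ℝ) := by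
    intro k x hx
    cases k with
    | zero => simpa using hy0 x (halfStrip_mono (by linarith) hx)
    | succ k =>
      refine (haux k r' (by rw [hr']; linarith) (by linarith) x hx).trans ?_
      gcongr
      linarith
  have hη : 0 < r' - r := by rw [hr']; linarith
  refine ⟨max 1 (C + C / (r' - r) + F), le_max_left _ _, fun k x hx => ?_⟩
  set K := max 1 (C + C / (r' - r) + F) with hK
  have h1 : C + C / (r' - r) + F ≤ K := le_max_right _ _
  have h0 : 0 < C / (r' - r) := by positivity
  have hFK : F ≤ K := by linarith
  constructor
  · refine (hbd k x (halfStrip_mono (by linarith) hx)).trans ?_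
    gcongr
    linarith
  · have h2 := norm_deriv_le_of_ball hη
      ((hd k).mono ((ball_subset_halfStrip hx).trans (halfStrip_mono (by linarith))))
      fun z hz => hbd k z (ball_subset_halfStrip hx hz)
    refine h2.trans ?_
    calc C * F ^ k * (k.factorial : ℝ) / (r' - r) = C / (r' - r) * F ^ k * (k.factorial : ℝ) := by
          ring
      _ ≤ _ := by gcongr; linarith

end Bounds


/-! ### Gevrey asymptotics of bounded solutions of the Riccati equation -/

theorem differentiableOn_remainder {f : ℂ → ℂ → ℂ} {c : ℕ → ℂ → ℂ} {V S : Set ℂ}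
    (hf : DifferentiableOn ℂ (fun z : ℂ × ℂ => f z.1 z.2) (V ×ˢ S))
    (hc : ∀ n, DifferentiableOn ℂ (c n) V) (n : ℕ) :
    DifferentiableOn ℂ (fun z : ℂ × ℂ => remainder f c n z.1 z.2) (V ×ˢ S) := by
  unfold remainder
  refine hf.fun_sub (DifferentiableOn.fun_sum fun k _ => DifferentiableOn.fun_mul ?_
    (differentiableOn_snd.fun_pow k))
  exact (hc k).comp differentiableOn_fst fun z hz => hz.1

theorem remainder_riccati (y P Q : ℂ → ℂ → ℂ) (c Pc Qc : ℕ → ℂ → ℂ) (n : ℕ) (x h : ℂ) :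
    y x h * y x h - P x h * y x h + Q x h - ∑ m ∈ Finset.range n,
        (∑ i ∈ Finset.range (m + 1), c i x * c (m - i) x
          - ∑ i ∈ Finset.range (m + 1), Pc i x * c (m - i) x + Qc m x) * h ^ m =
      y x h * remainder y c n x h - y x h * remainder P Pc n x h + remainder Q Qc n x h
        + ∑ k ∈ Finset.range n, (c k x - Pc k x) * h ^ k * remainder y c (n - k) x h := by
  have h1 := remainder_mul y y c c n x h
  have h2 := remainder_mul y P c Pc n x h
  simp only [sub_mul, Finset.sum_sub_distrib, add_mul, Finset.sum_add_distrib]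
  rw [remainder] at h1 h2
  have h3 : remainder Q Qc n x h = Q x h - ∑ k ∈ Finset.range n, Qc k x * h ^ k := rfl
  rw [h3]
  linear_combination h1 - h2

/-- The coefficient of R_{m+2}/h is 2c₀ - P₀ = 1 up to y - c₀ = O(h), which is what makes the ray
estimate applicable. The term with R_{m+1} is rewritten as c_{m+1} h^{m+1} + R_{m+2}, so the other
remainders of y that occur have order at most m and are covered by induction. -/
theorem hasDerivAt_remainder_riccati {y P Q : ℂ → ℂ → ℂ} {c Pc Qc : ℕ → ℂ → ℂ} {x h : ℂ}
    (hh : h ≠ 0)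
    (hy : HasDerivAt (fun x => y x h) ((y x h * y x h - P x h * y x h + Q x h) / h) x)
    (hc : ∀ n, DifferentiableAt ℂ (c n) x)
    (hric : ∀ n, deriv (c n) x = ∑ i ∈ Finset.range (n + 2), c i x * c (n + 1 - i) x
      - ∑ i ∈ Finset.range (n + 2), Pc i x * c (n + 1 - i) x + Qc (n + 1) x)
    (h0 : c 0 x * c 0 x - Pc 0 x * c 0 x + Qc 0 x = 0) (h1 : 2 * c 0 x - Pc 0 x = 1) (m : ℕ) :
    HasDerivAt (fun x => remainder y c (m + 2) x h)
      (remainder y c (m + 2) x h / h + ((y x h - c 0 x) / h * remainder y c (m + 2) x h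
        + (c 1 x - Pc 1 x) * (remainder y c (m + 2) x h + c (m + 1) x * h ^ (m + 1))
        + (∑ k ∈ Finset.range m, (c (k + 2) x - Pc (k + 2) x) * h ^ (k + 2) *
            remainder y c (m - k) x h
          - y x h * remainder P Pc (m + 2) x h + remainder Q Qc (m + 2) x h) / h
        - deriv (c (m + 1)) x * h ^ (m + 1))) x := by
  have hd : HasDerivAt (fun x => remainder y c (m + 2) x h)
      ((y x h * y x h - P x h * y x h + Q x h) / h -
        ∑ k ∈ Finset.range (m + 2), deriv (c k) x * h ^ k) x := by
    unfold remainder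
    exact hy.sub (HasDerivAt.fun_sum fun k _ => (hc k).hasDerivAt.mul_const _)
  refine hd.congr_deriv ?_
  have key := remainder_riccati y P Q c Pc Qc (m + 2) x h
  have hs : ∑ j ∈ Finset.range (m + 2), (∑ i ∈ Finset.range (j + 1), c i x * c (j - i) x
          - ∑ i ∈ Finset.range (j + 1), Pc i x * c (j - i) x + Qc j x) * h ^ j =
      h * ∑ k ∈ Finset.range (m + 1), deriv (c k) x * h ^ k := by
    rw [Finset.sum_range_succ', Finset.mul_sum]
    have e0 : (∑ i ∈ Finset.range (0 + 1), c i x * c (0 - i) x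
          - ∑ i ∈ Finset.range (0 + 1), Pc i x * c (0 - i) x + Qc 0 x) * h ^ 0 = 0 := by
      simp [h0]
    rw [e0, add_zero]
    refine Finset.sum_congr rfl fun k _ => ?_
    rw [hric k, pow_succ]; ring
  obtain ⟨D, hD⟩ : ∃ D, D = ∑ k ∈ Finset.range (m + 1), deriv (c k) x * h ^ k := ⟨_, rfl⟩
  rw [hs, ← hD, Finset.sum_range_succ' _ (m + 1), Finset.sum_range_succ' _ m] at key
  have e1 : ∀ k ∈ Finset.range m, (c (k + 1 + 1) x - Pc (k + 1 + 1) x) * h ^ (k + 1 + 1) *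
      remainder y c (m + 2 - (k + 1 + 1)) x h =
      (c (k + 2) x - Pc (k + 2) x) * h ^ (k + 2) * remainder y c (m - k) x h := fun k _ => by
    rw [show m + 2 - (k + 1 + 1) = m - k by omega]
  rw [Finset.sum_congr rfl e1] at key
  have e2 : m + 2 - (0 + 1) = m + 1 := by omega
  rw [e2, Nat.sub_zero, remainder_eq_succ y c (m + 1), zero_add, pow_one, pow_zero, mul_one] at key
  rw [Finset.sum_range_succ _ (m + 1), ← hD]
  field_simp
  linear_combination key + remainder y c (m + 2) x h * h1

theorem sum_half_pow_le (m : ℕ) : ∑ k ∈ Finset.range m, (1 / 2 : ℝ) ^ (k + 2) ≤ 1 / 2 := by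
  have : ∀ m : ℕ, ∑ k ∈ Finset.range m, (1 / 2 : ℝ) ^ (k + 2) = 1 / 2 - (1 / 2) ^ (m + 1) := by
    intro m
    induction m with
    | zero => norm_num
    | succ m ih => rw [Finset.sum_range_succ, ih, pow_succ (1 / 2 : ℝ) (m + 1)]; ring
  rw [this]
  have : (0 : ℝ) ≤ (1 / 2) ^ (m + 1) := by positivity
  linarith

/-- R_{m+1} is reached through R_{m+2}: the latter solves a ray equation whose source is
4K²|R_{m+2}| plus a term of size |h|^{m+1}, and boundedness along the ray yields |R_{m+2}| ≤ K E
|h|^{m+1} once δ is small. Adding back c_{m+1} h^{m+1} gives the bound at order m + 1. No bound at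
order m + 2 is claimed in this step. -/
theorem gevreyWith_of_riccati {y P Q : ℂ → ℂ → ℂ} {c Pc Qc : ℕ → ℂ → ℂ} {r δ K : ℝ} (hδ : 0 < δ)
    (hK : 1 ≤ K) (hδK : 30 * K ^ 2 * δ ≤ 1)
    (hy : ∀ x ∈ halfStrip r, ∀ h ∈ borelDisc 0 δ,
      HasDerivAt (fun x => y x h) ((y x h * y x h - P x h * y x h + Q x h) / h) x)
    (hc : ∀ n, ∀ x ∈ halfStrip r, DifferentiableAt ℂ (c n) x)
    (hric : ∀ x ∈ halfStrip r, ∀ n, deriv (c n) x =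
      ∑ i ∈ Finset.range (n + 2), c i x * c (n + 1 - i) x
      - ∑ i ∈ Finset.range (n + 2), Pc i x * c (n + 1 - i) x + Qc (n + 1) x)
    (h0 : ∀ x ∈ halfStrip r, c 0 x * c 0 x - Pc 0 x * c 0 x + Qc 0 x = 0)
    (h1 : ∀ x ∈ halfStrip r, 2 * c 0 x - Pc 0 x = 1)
    (hcb : ∀ n, ∀ x ∈ halfStrip r, ‖c n x‖ ≤ K * K ^ n * (n.factorial : ℝ))
    (hcb' : ∀ n, ∀ x ∈ halfStrip r, ‖deriv (c n) x‖ ≤ K * K ^ n * (n.factorial : ℝ))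
    (hPcb : ∀ n, ∀ x ∈ halfStrip r, ‖Pc n x‖ ≤ K * K ^ n * (n.factorial : ℝ))
    (hP : GevreyWith P Pc (halfStrip r) (borelDisc 0 δ) K K)
    (hQ : GevreyWith Q Qc (halfStrip r) (borelDisc 0 δ) K K)
    (hyb : ∀ x ∈ halfStrip r, ∀ h ∈ borelDisc 0 δ, ‖y x h‖ ≤ 2 * K)
    (hyb' : ∀ x ∈ halfStrip r, ∀ h ∈ borelDisc 0 δ, ‖y x h - c 0 x‖ ≤ 2 * K ^ 2 * ‖h‖) :
    GevreyWith y c (halfStrip r) (borelDisc 0 δ) (2 * K) (2 * K) := by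
  have hK0 : 0 < K := by linarith
  intro n
  induction n using Nat.strong_induction_on with
  | _ n ih =>
    intro x hx h hh
    cases n with
    | zero => simpa [remainder_zero] using hyb x hx h hh
    | succ m =>
      have hh0 := ne_zero_of_mem_borelDisc hδ hh
      have hhn : 0 < ‖h‖ := norm_pos_iff.2 hh0
      have hhδ := norm_lt_of_mem_borelDisc hδ hh
      set H := ‖h‖ ^ (m + 1) with hH
      have hH0 : 0 < H := by positivity
      set E := (2 * K) ^ (m + 1) * ((m + 1).factorial : ℝ) with hE
      have hE0 : 0 < E := by positivity
      have hKE : K ^ (m + 1) * ((m + 1).factorial : ℝ) ≤ E := by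
        rw [hE]; gcongr; linarith
      have hKE2 : K ^ (m + 2) * ((m + 2).factorial : ℝ) ≤ K * E := by
        calc K ^ (m + 2) * ((m + 2).factorial : ℝ)
            ≤ K ^ (m + 2) * (2 ^ (m + 1) * ((m + 1).factorial : ℝ)) := by
              gcongr; exact natCast_succ_factorial_le (m + 1)
          _ = K * E := by rw [hE]; ring
      have hc1 : ∀ z ∈ halfStrip r, ‖c 1 z - Pc 1 z‖ ≤ 2 * K ^ 2 := fun z hz => by
        have e1 := hcb 1 z hz
        have e2 := hPcb 1 z hz
        simp only [pow_one, Nat.factorial_one, Nat.cast_one, mul_one] at e1 e2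
        have := norm_sub_le (c 1 z) (Pc 1 z)
        nlinarith
      -- the source term
      set G : ℂ → ℂ := fun z => (y z h - c 0 z) / h * remainder y c (m + 2) z h
        + (c 1 z - Pc 1 z) * (remainder y c (m + 2) z h + c (m + 1) z * h ^ (m + 1))
        + (∑ k ∈ Finset.range m, (c (k + 2) z - Pc (k + 2) z) * h ^ (k + 2) *
            remainder y c (m - k) z h
          - y z h * remainder P Pc (m + 2) z h + remainder Q Qc (m + 2) z h) / h
        - deriv (c (m + 1)) z * h ^ (m + 1) with hG
      have hGb : ∀ z ∈ halfStrip r, ‖G z‖ ≤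
          4 * K ^ 2 * ‖remainder y c (m + 2) z h‖ + 15 * K ^ 3 * E * H := by
        intro z hz
        have b1 : ‖(y z h - c 0 z) / h * remainder y c (m + 2) z h‖ ≤
            2 * K ^ 2 * ‖remainder y c (m + 2) z h‖ := by
          rw [norm_mul, norm_div]
          gcongr
          rw [div_le_iff₀ hhn]
          exact hyb' z hz h hh
        have b2 : ‖(c 1 z - Pc 1 z) * (remainder y c (m + 2) z h + c (m + 1) z * h ^ (m + 1))‖ ≤
            2 * K ^ 2 * ‖remainder y c (m + 2) z h‖ + 2 * K ^ 3 * E * H := by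
          rw [norm_mul]
          have : ‖remainder y c (m + 2) z h + c (m + 1) z * h ^ (m + 1)‖ ≤
              ‖remainder y c (m + 2) z h‖ + K * E * H := by
            refine (norm_add_le _ _).trans ?_
            rw [norm_mul, norm_pow]
            gcongr
            refine (hcb (m + 1) z hz).trans ?_
            rw [mul_assoc]; gcongr
          calc _ ≤ 2 * K ^ 2 * (‖remainder y c (m + 2) z h‖ + K * E * H) := by
                gcongr; exact hc1 z hz
            _ = _ := by ring
        have b3 : ‖∑ k ∈ Finset.range m, (c (k + 2) z - Pc (k + 2) z) * h ^ (k + 2) *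
            remainder y c (m - k) z h‖ ≤ 4 * K ^ 3 * E * (H * ‖h‖) := by
          -- The coefficients grow at rate K while the remainders are allowed rate 2K; the ratio 1/2
          -- makes the convolution a geometric sum, so its constant does not grow with m.
          have t : ∀ k ∈ Finset.range m, ‖(c (k + 2) z - Pc (k + 2) z) * h ^ (k + 2) *
              remainder y c (m - k) z h‖ ≤ 8 * K ^ 3 * E * (H * ‖h‖) * (1 / 2) ^ (k + 2) := by
            intro k hk
            rw [Finset.mem_range] at hk
            obtain ⟨j, rfl⟩ : ∃ j, m = k + j + 1 := ⟨m - k - 1, by omega⟩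
            have e : k + j + 1 - k = j + 1 := by omega
            rw [e, norm_mul, norm_mul, norm_pow]
            have t1 : ‖c (k + 2) z - Pc (k + 2) z‖ ≤
                2 * (K * K ^ (k + 2) * ((k + 2).factorial : ℝ)) := by
              have := norm_sub_le (c (k + 2) z) (Pc (k + 2) z)
              linarith [hcb (k + 2) z hz, hPcb (k + 2) z hz]
            have t2 := ih (j + 1) (by omega) z hz h hh
            have t3 : ((k + 2).factorial : ℝ) * ((j + 1).factorial : ℝ) ≤
                ((k + j + 1 + 1).factorial : ℝ) := by
              have := factorial_succ_mul_factorial_succ_le (k + 1) j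
              rw [show k + 1 + j + 1 = k + j + 1 + 1 by ring] at this
              exact_mod_cast this
            calc _ ≤ 2 * (K * K ^ (k + 2) * ((k + 2).factorial : ℝ)) * ‖h‖ ^ (k + 2) *
                  (2 * K * (2 * K) ^ (j + 1) * ((j + 1).factorial : ℝ) * ‖h‖ ^ (j + 1)) := by
                  gcongr
              _ = 4 * K ^ 2 * (K ^ (k + 2) * (2 * K) ^ (j + 1)) * (‖h‖ ^ (k + j + 1 + 1) * ‖h‖) *
                  (((k + 2).factorial : ℝ) * ((j + 1).factorial : ℝ)) := by ring
              _ ≤ 4 * K ^ 2 * (K ^ (k + 2) * (2 * K) ^ (j + 1)) * (‖h‖ ^ (k + j + 1 + 1) * ‖h‖) *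
                  ((k + j + 1 + 1).factorial : ℝ) := by gcongr
              _ = _ := by
                have : K ^ (k + 2) = (2 * K) ^ (k + 2) * (1 / 2) ^ (k + 2) := by
                  rw [← mul_pow]; congr 1; ring
                rw [hE, hH, this]; ring
          refine (norm_sum_le_of_le _ t).trans ?_
          rw [← Finset.mul_sum]
          calc _ ≤ 8 * K ^ 3 * E * (H * ‖h‖) * (1 / 2) := by
                gcongr; exact sum_half_pow_le m
            _ = _ := by ring
        have b4 : ‖y z h * remainder P Pc (m + 2) z h‖ ≤ 2 * K ^ 3 * E * (H * ‖h‖) := by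
          rw [norm_mul]
          calc _ ≤ 2 * K * (K * K ^ (m + 2) * ((m + 2).factorial : ℝ) * ‖h‖ ^ (m + 2)) := by
                gcongr
                · exact hyb z hz h hh
                · exact hP _ z hz h hh
            _ = 2 * K ^ 2 * (K ^ (m + 2) * ((m + 2).factorial : ℝ)) * (H * ‖h‖) := by
                rw [hH]; ring
            _ ≤ 2 * K ^ 2 * (K * E) * (H * ‖h‖) := by gcongr
            _ = _ := by ring
        have b5 : ‖remainder Q Qc (m + 2) z h‖ ≤ K ^ 3 * E * (H * ‖h‖) := by
          calc _ ≤ K * K ^ (m + 2) * ((m + 2).factorial : ℝ) * ‖h‖ ^ (m + 2) := hQ _ z hz h hh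
            _ = K * (K ^ (m + 2) * ((m + 2).factorial : ℝ)) * (H * ‖h‖) := by rw [hH]; ring
            _ ≤ K * (K * E) * (H * ‖h‖) := by gcongr
            _ = K ^ 2 * E * (H * ‖h‖) := by ring
            _ ≤ _ := by gcongr; norm_num
        have b6 : ‖deriv (c (m + 1)) z * h ^ (m + 1)‖ ≤ K ^ 3 * E * H := by
          rw [norm_mul, norm_pow]
          gcongr
          calc _ ≤ K * (K ^ (m + 1) * ((m + 1).factorial : ℝ)) := by
                rw [← mul_assoc]; exact hcb' (m + 1) z hz
            _ ≤ K * E := by gcongr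
            _ ≤ K ^ 3 * E := by gcongr; nlinarith [sq_nonneg K]
        have b7 : ‖(∑ k ∈ Finset.range m, (c (k + 2) z - Pc (k + 2) z) * h ^ (k + 2) *
            remainder y c (m - k) z h
          - y z h * remainder P Pc (m + 2) z h + remainder Q Qc (m + 2) z h) / h‖ ≤
            7 * K ^ 3 * E * H := by
          rw [norm_div, div_le_iff₀ hhn]
          refine ((norm_add_le _ _).trans (add_le_add (norm_sub_le _ _) le_rfl)).trans ?_
          calc _ ≤ 4 * K ^ 3 * E * (H * ‖h‖) + 2 * K ^ 3 * E * (H * ‖h‖)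
                + K ^ 3 * E * (H * ‖h‖) := by gcongr
            _ = _ := by ring
        have hpos : 0 ≤ K ^ 3 * E * H := by positivity
        calc _ ≤ 2 * K ^ 2 * ‖remainder y c (m + 2) z h‖
              + (2 * K ^ 2 * ‖remainder y c (m + 2) z h‖ + 2 * K ^ 3 * E * H)
              + 7 * K ^ 3 * E * H + K ^ 3 * E * H := by
              refine (norm_sub_le _ _).trans (add_le_add ?_ b6)
              refine (norm_add_le _ _).trans (add_le_add ?_ b7)
              exact (norm_add_le _ _).trans (add_le_add b1 b2)
          _ ≤ _ := by linarith
      have hx' : ∀ u : ℝ, 0 ≤ u → x + u ∈ halfStrip r := fun u hu => add_mem_halfStrip hx hu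
      -- The bound B depends on h and m and is very crude. Only its finiteness matters, since it
      -- does not enter the conclusion.
      have hray := norm_le_of_bounded_ray_linear
        (R := fun u : ℝ => remainder y c (m + 2) (x + u) h) (G := fun u : ℝ => G (x + u))
        (h := h) (c := 1 / δ) (a := 4 * K ^ 2) (g := 15 * K ^ 3 * E * H)
        (B := 2 * K + ∑ k ∈ Finset.range (m + 2), K * K ^ k * (k.factorial : ℝ) * ‖h‖ ^ k)
        (by positivity) (mem_borelDisc_zero.1 hh).le (by positivity)
        (by rw [div_div, le_div_iff₀ (by positivity)]; nlinarith [mul_pos (pow_pos hK0 2) hδ])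
        (fun u hu => by
          have hd := hasDerivAt_remainder_riccati hh0 (hy _ (hx' u hu) h hh)
            (fun n => hc n _ (hx' u hu)) (hric _ (hx' u hu)) (h0 _ (hx' u hu)) (h1 _ (hx' u hu)) m
          have h2 : HasDerivAt (fun s : ℝ => x + (s : ℂ)) 1 u :=
            ((hasDerivAt_id u).ofReal_comp).const_add x
          have := HasDerivAt.scomp (𝕜 := ℝ) (𝕜' := ℂ) u hd h2
          rw [one_smul] at this
          exact this)
        (fun u hu => by
          unfold remainder
          refine (norm_sub_le _ _).trans (add_le_add (hyb _ (hx' u hu) h hh) ?_)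
          refine norm_sum_le_of_le _ fun k _ => ?_
          rw [norm_mul, norm_pow]
          gcongr
          exact hcb k _ (hx' u hu))
        (fun u hu => hGb _ (hx' u hu))
      simp only [Complex.ofReal_zero, add_zero] at hray
      have hfin : ‖remainder y c (m + 2) x h‖ ≤ K * E * H := by
        refine hray.trans ?_
        have : 2 * (15 * K ^ 3 * E * H) / (1 / δ) = (30 * K ^ 2 * δ) * (K * E * H) := by
          field_simp; ring
        rw [this]
        exact mul_le_of_le_one_left (by positivity) hδK
      rw [remainder_eq_succ]
      refine (norm_add_le _ _).trans ?_
      have e3 : ‖c (m + 1) x * h ^ (m + 1)‖ ≤ K * E * H := by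
        rw [norm_mul, norm_pow]
        gcongr
        refine (hcb (m + 1) x hx).trans ?_
        rw [mul_assoc]; gcongr
      calc _ ≤ K * E * H + K * E * H := add_le_add e3 hfin
        _ = _ := by rw [hE, hH]; ring


/-- Existence of a solution of the Riccati equation on a half-strip that is asymptotic to the formal
solution, when the leading discriminant is `1`. -/
theorem exists_riccati_gevrey {P Q : ℂ → ℂ → ℂ} {Pc Qc : ℕ → ℂ → ℂ} {r ρ δ : ℝ} (hδ : 0 < δ)
    (hr : 0 < r) (hrρ : r < ρ)
    (hP : DifferentiableOn ℂ (fun z : ℂ × ℂ => P z.1 z.2) (halfStrip ρ ×ˢ borelDisc 0 δ))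
    (hQ : DifferentiableOn ℂ (fun z : ℂ × ℂ => Q z.1 z.2) (halfStrip ρ ×ˢ borelDisc 0 δ))
    (hPc : ∀ k, DifferentiableOn ℂ (Pc k) (halfStrip ρ))
    (hQc : ∀ k, DifferentiableOn ℂ (Qc k) (halfStrip ρ))
    (hPg : GevreyBounds P Pc (halfStrip ρ) (borelDisc 0 δ))
    (hQg : GevreyBounds Q Qc (halfStrip ρ) (borelDisc 0 δ))
    (hdisc : ∀ x ∈ halfStrip ρ, disc₀ Pc Qc x = 1) :
    ∃ δ', 0 < δ' ∧ δ' ≤ δ ∧ ∃ y : ℂ → ℂ → ℂ,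
      DifferentiableOn ℂ (fun z : ℂ × ℂ => y z.1 z.2) (halfStrip r ×ˢ borelDisc 0 δ') ∧
      (∀ x ∈ halfStrip r, ∀ h ∈ borelDisc 0 δ',
        HasDerivAt (fun x => y x h) ((y x h * y x h - P x h * y x h + Q x h) / h) x) ∧
      GevreyBounds y (formalRoot Pc Qc (fun _ => 1) 1) (halfStrip r) (borelDisc 0 δ') := by
  obtain ⟨C₁, hC₁, hP₁⟩ := hPg.exists_with
  obtain ⟨C₂, hC₂, hQ₁⟩ := hQg.exists_with
  have hacc := accumulates_borelDisc (θ := 0) hδ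
  have hC : 1 ≤ max C₁ C₂ := hC₁.trans (le_max_left _ _)
  have hPC := hP₁ _ _ (le_max_left C₁ C₂) (le_max_left C₁ C₂)
  have hQC := hQ₁ _ _ (le_max_right C₁ C₂) (le_max_right C₁ C₂)
  obtain ⟨K₀, hK₀, hKb⟩ := exists_norm_formalRoot_le hC (by linarith) hPc hQc
    (fun k x hx => hPC.norm_coeff_le hacc k hx) (fun k x hx => hQC.norm_coeff_le hacc k hx) hr hrρ
  have hd := formalRoot_differentiableOn (pc := Pc) (qc := Qc) (sq := fun _ => 1) 1
    (isOpen_halfStrip ρ) hPc hQc (differentiableOn_const _) (fun _ _ => one_ne_zero)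
  have hric := fun x n => formalRoot_riccati Pc Qc (sq := fun _ => 1) 1 (x := x) one_ne_zero n
  have hlead : ∀ x ∈ halfStrip ρ, _ := fun x hx =>
    formalRoot_riccati_zero (pc := Pc) (qc := Qc) (sq := fun _ => 1) 1 (x := x)
      (by rw [hdisc x hx, one_pow])
  have htwo : ∀ x, 2 * formalRoot Pc Qc (fun _ => 1) 1 0 x - Pc 0 x = 1 := fun x => by
    rw [formalRoot_zero]; simp; ring
  set c := formalRoot Pc Qc (fun _ => 1) 1 with hc
  set K := max (max C₁ C₂) K₀ with hKdef
  have hK : 1 ≤ K := hC.trans (le_max_left _ _)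
  have hK0 : 0 < K := by linarith
  have hsub : halfStrip r ⊆ halfStrip ρ := halfStrip_mono hrρ.le
  have hcb : ∀ n, ∀ x ∈ halfStrip r, ‖c n x‖ ≤ K * K ^ n * (n.factorial : ℝ) := fun n x hx =>
    (hKb n x hx).1.trans (by gcongr <;> exact le_max_right _ _)
  have hcb' : ∀ n, ∀ x ∈ halfStrip r, ‖deriv (c n) x‖ ≤ K * K ^ n * (n.factorial : ℝ) :=
    fun n x hx => (hKb n x hx).2.trans (by gcongr <;> exact le_max_right _ _)
  -- The coefficients A₀, A₁ below are bounded by a = 12K⁵, and the contraction needs 6aδ' ≤ 1;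
  -- hence 72. The fifth power comes from the term R₂(P)/h² · (c₀ + h c₁), of size 2K³ · 2K².
  set δ' := min δ (1 / (72 * K ^ 5)) with hδ'def
  have hδ' : 0 < δ' := by positivity
  have hδ'δ : δ' ≤ δ := min_le_left _ _
  have hK5 : 1 ≤ K ^ 5 := one_le_pow₀ hK
  have hδK : δ' * (6 * (12 * K ^ 5)) ≤ 1 := by
    have : δ' ≤ 1 / (72 * K ^ 5) := min_le_right _ _
    rw [le_div_iff₀ (by positivity)] at this
    linarith
  have hS : borelDisc 0 δ' ⊆ borelDisc 0 δ := borelDisc_mono hδ' hδ'δ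
  have hsub2 : halfStrip r ×ˢ borelDisc 0 δ' ⊆ halfStrip ρ ×ˢ borelDisc 0 δ := prod_mono hsub hS
  have hPK : GevreyWith P Pc (halfStrip r) (borelDisc 0 δ') K K :=
    (hP₁ K K ((le_max_left _ _).trans (le_max_left _ _))
      ((le_max_left _ _).trans (le_max_left _ _))).mono hsub hS hK0.le le_rfl hK0.le le_rfl
  have hQK : GevreyWith Q Qc (halfStrip r) (borelDisc 0 δ') K K :=
    (hQ₁ K K ((le_max_right _ _).trans (le_max_left _ _))
      ((le_max_right _ _).trans (le_max_left _ _))).mono hsub hS hK0.le le_rfl hK0.le le_rfl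
  have hPcb := fun n x hx => hPK.norm_coeff_le (accumulates_borelDisc (θ := 0) hδ') n (x := x) hx
  have hne : ∀ z ∈ halfStrip r ×ˢ borelDisc 0 δ', z.2 ≠ 0 := fun z hz =>
    ne_zero_of_mem_borelDisc hδ' hz.2
  have hlt1 : ∀ h ∈ borelDisc 0 δ', ‖h‖ ≤ 1 := fun h hh => by
    have h1 := (norm_lt_of_mem_borelDisc hδ' hh).le
    have : δ' ≤ δ' * (6 * (12 * K ^ 5)) := by nlinarith
    linarith
  -- coefficients as functions of two variables
  have hc2 : ∀ n, DifferentiableOn ℂ (fun z : ℂ × ℂ => c n z.1) (halfStrip r ×ˢ borelDisc 0 δ') :=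
    fun n => (hd n).comp differentiableOn_fst fun z hz => hsub hz.1
  have hc2' : ∀ n, DifferentiableOn ℂ (fun z : ℂ × ℂ => deriv (c n) z.1)
      (halfStrip r ×ˢ borelDisc 0 δ') :=
    fun n => ((hd n).deriv (isOpen_halfStrip ρ)).comp differentiableOn_fst fun z hz => hsub hz.1
  have hPc2 : ∀ n, DifferentiableOn ℂ (fun z : ℂ × ℂ => Pc n z.1)
      (halfStrip r ×ˢ borelDisc 0 δ') :=
    fun n => (hPc n).comp differentiableOn_fst fun z hz => hsub hz.1
  have hinv : ∀ n : ℕ, DifferentiableOn ℂ (fun z : ℂ × ℂ => (z.2 ^ n)⁻¹)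
      (halfStrip r ×ˢ borelDisc 0 δ') := fun n =>
    (differentiableOn_snd.fun_pow n).fun_inv fun z hz => pow_ne_zero _ (hne z hz)
  have hRP := fun n => (differentiableOn_remainder hP hPc n).mono hsub2
  have hRQ := fun n => (differentiableOn_remainder hQ hQc n).mono hsub2
  have b0 : ∀ x ∈ halfStrip r, ‖c 0 x‖ ≤ K := fun x hx => by simpa using hcb 0 x hx
  have b1 : ∀ x ∈ halfStrip r, ‖c 1 x‖ ≤ K ^ 2 := fun x hx => by
    simpa [pow_two] using hcb 1 x hx
  have b1' : ∀ x ∈ halfStrip r, ‖deriv (c 1) x‖ ≤ K ^ 2 := fun x hx => by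
    simpa [pow_two] using hcb' 1 x hx
  have bP1 : ∀ x ∈ halfStrip r, ‖Pc 1 x‖ ≤ K ^ 2 := fun x hx => by
    simpa [pow_two] using hPcb 1 x hx
  have bR : ∀ {f : ℂ → ℂ → ℂ} {e : ℕ → ℂ → ℂ}, GevreyWith f e (halfStrip r) (borelDisc 0 δ') K K →
      ∀ n, ∀ z ∈ halfStrip r ×ˢ borelDisc 0 δ',
        ‖remainder f e n z.1 z.2 * (z.2 ^ n)⁻¹‖ ≤ K * K ^ n * (n.factorial : ℝ) := by
    intro f e hf n z hz
    have h1 : 0 < ‖z.2‖ ^ n := pow_pos (norm_pos_iff.2 (hne z hz)) n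
    rw [norm_mul, norm_inv, norm_pow, ← div_eq_mul_inv, div_le_iff₀ h1]
    exact hf n z.1 hz.1 z.2 hz.2
  -- Substitute y = c₀ + h c₁ + h w. The two lowest orders cancel by the formal equation and 2c₀ -
  -- P₀ = 1 supplies w/h; the rest has bounded coefficients because two terms of the expansion were
  -- extracted.
  set A₀ : ℂ → ℂ → ℂ := fun x h => c 1 x * c 1 x - Pc 1 x * c 1 x - deriv (c 1) x
    - (remainder P Pc 2 x h * (h ^ 2)⁻¹) * (c 0 x + h * c 1 x)
    + remainder Q Qc 2 x h * (h ^ 2)⁻¹ with hA₀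
  set A₁ : ℂ → ℂ → ℂ := fun x h => 2 * c 1 x - remainder P Pc 1 x h * (h ^ 1)⁻¹ with hA₁
  have hK25 : K ^ 2 ≤ K ^ 5 := pow_le_pow_right₀ hK (by norm_num)
  have hK35 : K ^ 3 ≤ K ^ 5 := pow_le_pow_right₀ hK (by norm_num)
  have hK45 : K ^ 4 ≤ K ^ 5 := pow_le_pow_right₀ hK (by norm_num)
  have hK12 : K ≤ K ^ 2 := by nlinarith
  obtain ⟨w, hwd, hw⟩ := exists_quadratic_solution (A₀ := A₀) (A₁ := A₁) (a := 12 * K ^ 5)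
    (r := r) hδ'
    ((((((hc2 1).mul (hc2 1)).sub ((hPc2 1).mul (hc2 1))).sub (hc2' 1)).sub
      (((hRP 2).mul (hinv 2)).mul ((hc2 0).add (differentiableOn_snd.mul (hc2 1))))).add
      ((hRQ 2).mul (hinv 2)))
    (((hc2 1).const_mul 2).sub ((hRP 1).mul (hinv 1))) (by linarith)
    (fun z hz => by
      have t1 : ‖c 1 z.1 * c 1 z.1‖ ≤ K ^ 4 := by
        rw [norm_mul]
        calc _ ≤ K ^ 2 * K ^ 2 := by gcongr <;> exact b1 _ hz.1
          _ = _ := by ring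
      have t2 : ‖Pc 1 z.1 * c 1 z.1‖ ≤ K ^ 4 := by
        rw [norm_mul]
        calc _ ≤ K ^ 2 * K ^ 2 := by
              gcongr
              · exact bP1 _ hz.1
              · exact b1 _ hz.1
          _ = _ := by ring
      have t3 : ‖c 0 z.1 + z.2 * c 1 z.1‖ ≤ 2 * K ^ 2 := by
        refine (norm_add_le _ _).trans ?_
        rw [norm_mul]
        have : ‖z.2‖ * ‖c 1 z.1‖ ≤ 1 * K ^ 2 := by
          gcongr
          · exact hlt1 _ hz.2
          · exact b1 _ hz.1
        linarith [b0 _ hz.1]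
      have t4 : ‖(remainder P Pc 2 z.1 z.2 * (z.2 ^ 2)⁻¹) * (c 0 z.1 + z.2 * c 1 z.1)‖ ≤
          4 * K ^ 5 := by
        rw [norm_mul]
        calc _ ≤ (K * K ^ 2 * ((2 : ℕ).factorial : ℝ)) * (2 * K ^ 2) := by
              gcongr; exact bR hPK 2 z hz
          _ = _ := by simp; ring
      have t5 := bR hQK 2 z hz
      simp only [Nat.factorial_two, Nat.cast_ofNat] at t5
      calc ‖A₀ z.1 z.2‖ ≤ K ^ 4 + K ^ 4 + K ^ 2 + 4 * K ^ 5 + K * K ^ 2 * 2 := by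
            refine (norm_add_le _ _).trans (add_le_add ?_ t5)
            refine (norm_sub_le _ _).trans (add_le_add ?_ t4)
            refine (norm_sub_le _ _).trans (add_le_add ?_ (b1' _ hz.1))
            exact (norm_sub_le _ _).trans (add_le_add t1 t2)
        _ ≤ 12 * K ^ 5 := by nlinarith)
    (fun z hz => by
      have t5 := bR hPK 1 z hz
      simp only [Nat.factorial_one, Nat.cast_one, mul_one] at t5
      calc ‖A₁ z.1 z.2‖ ≤ 2 * K ^ 2 + K * K ^ 1 := by
            refine (norm_sub_le _ _).trans (add_le_add ?_ t5)
            rw [norm_mul, Complex.norm_ofNat]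
            gcongr; exact b1 _ hz.1
        _ ≤ 12 * K ^ 5 := by nlinarith) hδK
  refine ⟨δ', hδ', hδ'δ, fun x h => c 0 x + h * c 1 x + h * w x h, ?_, ?_, ?_⟩
  · exact ((hc2 0).add (differentiableOn_snd.mul (hc2 1))).add (differentiableOn_snd.mul hwd)
  all_goals
    have hode : ∀ x ∈ halfStrip r, ∀ h ∈ borelDisc 0 δ',
        HasDerivAt (fun x => c 0 x + h * c 1 x + h * w x h)
          (((c 0 x + h * c 1 x + h * w x h) * (c 0 x + h * c 1 x + h * w x h)
            - P x h * (c 0 x + h * c 1 x + h * w x h) + Q x h) / h) x := by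
      intro x hx h hh
      have hh0 := ne_zero_of_mem_borelDisc hδ' hh
      have hcd := fun n => ((hd n).differentiableAt
        ((isOpen_halfStrip ρ).mem_nhds (hsub hx))).hasDerivAt
      refine (((hcd 0).add ((hcd 1).const_mul h)).add
        ((hw (x, h) ⟨hx, hh⟩).2.const_mul h)).congr_deriv ?_
      have e0 := hric x 0
      have el := hlead x (hsub hx)
      have et := htwo x
      have eP : P x h = Pc 0 x + Pc 1 x * h + remainder P Pc 2 x h := by
        simp [remainder, Finset.sum_range_succ]
      have eP1 : remainder P Pc 1 x h = Pc 1 x * h + remainder P Pc 2 x h := by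
        rw [remainder_eq_succ]; ring
      have eQ : Q x h = Qc 0 x + Qc 1 x * h + remainder Q Qc 2 x h := by
        simp [remainder, Finset.sum_range_succ]
      simp only [Finset.sum_range_succ, Finset.sum_range_zero, zero_add, Nat.sub_zero,
        Nat.sub_self] at e0
      simp only [hA₀, hA₁, eP, eQ, eP1]
      field_simp
      linear_combination h * e0 - el - h * w x h * et
  · exact hode
  · refine GevreyWith.bounds (gevreyWith_of_riccati hδ' hK ?_ hode
      (fun n x hx => (hd n).differentiableAt ((isOpen_halfStrip ρ).mem_nhds (hsub hx)))
      (fun x _ n => hric x n) (fun x hx => hlead x (hsub hx)) (fun x _ => htwo x) hcb hcb'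
      hPcb hPK hQK ?_ ?_) (by linarith) (by linarith)
    · have : 0 ≤ δ' := hδ'.le
      nlinarith
    · intro x hx h hh
      have hh1 := (norm_lt_of_mem_borelDisc hδ' hh).le
      have h2 := (hw (x, h) ⟨hx, hh⟩).1
      have t1 : ‖h * c 1 x‖ ≤ δ' * K ^ 5 := by
        rw [norm_mul]; gcongr; exact (b1 _ hx).trans hK25
      have t2 : ‖h * w x h‖ ≤ δ' * K ^ 5 := by
        rw [norm_mul]; gcongr; exact h2.trans hK5
      calc _ ≤ K + δ' * K ^ 5 + δ' * K ^ 5 := by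
            refine (norm_add_le _ _).trans (add_le_add ?_ t2)
            exact (norm_add_le _ _).trans (add_le_add (b0 _ hx) t1)
        _ ≤ 2 * K := by linarith
    · intro x hx h hh
      have h2 := (hw (x, h) ⟨hx, hh⟩).1
      have e : c 0 x + h * c 1 x + h * w x h - c 0 x = (c 1 x + w x h) * h := by ring
      rw [e, norm_mul]
      gcongr
      refine (norm_add_le _ _).trans ?_
      have := b1 x hx
      have : (1 : ℝ) ≤ K ^ 2 := one_le_pow₀ hK
      simp only at h2
      linarith


/-! ### Flows of the Liouville coordinate -/

/-- A branch of the square root of `D` near `x`, with a primitive and its inverse function. -/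
structure SqrtChart (X : Set ℂ) (D : ℂ → ℂ) (x s : ℂ) where
  N : Set ℂ
  σ : ℂ → ℂ
  F : ℂ → ℂ
  G : ℂ → ℂ
  ε : ℝ
  isOpen : IsOpen N
  mem : x ∈ N
  sub : N ⊆ X
  diff : DifferentiableOn ℂ σ N
  base : σ x = s
  sq : ∀ y ∈ N, σ y ^ 2 = D y
  ne : ∀ y ∈ N, σ y ≠ 0
  branch : ∀ y ∈ N, ∀ w, w ^ 2 = D y → ‖w - s‖ < ‖s‖ → w = σ y
  deriv : ∀ y ∈ N, HasDerivAt F (σ y) y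
  zero : F x = 0
  inj : InjOn F N
  pos : 0 < ε
  G_mem : ∀ z ∈ Metric.ball 0 ε, G z ∈ N
  F_G : ∀ z ∈ Metric.ball 0 ε, F (G z) = z
  G_deriv : ∀ z ∈ Metric.ball 0 ε, HasDerivAt G (σ (G z))⁻¹ z

theorem exists_sqrtChart {X : Set ℂ} {D : ℂ → ℂ} (hX : IsOpen X) (hD : DifferentiableOn ℂ D X)
    {x s : ℂ} (hx : x ∈ X) (hs : s ≠ 0) (hsD : s ^ 2 = D x) : Nonempty (SqrtChart X D x s) := by
  -- D/s² is close to 1 near x, so the principal logarithm gives the branch of √D equal to s at x.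
  set σ : ℂ → ℂ := fun y => s * Complex.exp (Complex.log (D y / s ^ 2) / 2) with hσ
  have hs2 : s ^ 2 ≠ 0 := pow_ne_zero _ hs
  have hDx : D x / s ^ 2 = 1 := by rw [← hsD, div_self hs2]
  have hDc : ContinuousAt D x := (hD.differentiableAt (hX.mem_nhds hx)).continuousAt
  have hσx : σ x = s := by simp [hσ, hDx]
  have hslit : ∀ᶠ y in 𝓝 x, D y / s ^ 2 ∈ Complex.slitPlane :=
    (hDc.div_const _).eventually_mem (Complex.isOpen_slitPlane.mem_nhds (by rw [hDx]; simp))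
  have hσc : ContinuousAt σ x := by
    refine continuousAt_const.mul (Complex.continuous_exp.continuousAt.comp ?_)
    refine ContinuousAt.div_const ((continuousAt_clog ?_).comp (hDc.div_const _)) _
    rw [hDx]; simp
  have hnear : ∀ᶠ y in 𝓝 x, ‖σ y - s‖ < ‖s‖ := by
    have h1 : Tendsto (fun y => ‖σ y - s‖) (𝓝 x) (𝓝 0) := by
      have := (hσc.sub (continuousAt_const (y := s))).norm
      simpa [ContinuousAt, hσx] using this
    exact h1.eventually (gt_mem_nhds (norm_pos_iff.2 hs))
  obtain ⟨r, hr, hsub⟩ := Metric.eventually_nhds_iff_ball.1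
    ((hX.eventually_mem hx).and (hslit.and hnear))
  have hσd : DifferentiableOn ℂ σ (Metric.ball x r) := fun y hy => by
    have h1 := (hsub y hy).1
    have h2 : DifferentiableAt ℂ D y := hD.differentiableAt (hX.mem_nhds h1)
    exact (((h2.div_const _).clog (hsub y hy).2.1).div_const 2).cexp.const_mul s
      |>.differentiableWithinAt
  have hσsq : ∀ y ∈ Metric.ball x r, σ y ^ 2 = D y := fun y hy => by
    have h1 : D y / s ^ 2 ≠ 0 := Complex.slitPlane_ne_zero (hsub y hy).2.1
    simp only [hσ]
    rw [mul_pow, ← Complex.exp_nat_mul]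
    have e : ((2 : ℕ) : ℂ) * (Complex.log (D y / s ^ 2) / 2) = Complex.log (D y / s ^ 2) := by
      push_cast; ring
    rw [e, Complex.exp_log h1]; field_simp
  have hσne : ∀ y, σ y ≠ 0 := fun y => mul_ne_zero hs (Complex.exp_ne_zero _)
  obtain ⟨F₀, hF₀⟩ := hσd.isExactOn_ball
  set F : ℂ → ℂ := fun y => F₀ y - F₀ x with hF
  have hFd : ∀ y ∈ Metric.ball x r, HasDerivAt F (σ y) y := fun y hy => (hF₀ y hy).sub_const _
  have hxb : x ∈ Metric.ball x r := Metric.mem_ball_self hr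
  have han : AnalyticAt ℂ F x :=
    DifferentiableOn.analyticAt (s := Metric.ball x r)
      (fun y hy => (hFd y hy).differentiableAt.differentiableWithinAt)
      (Metric.isOpen_ball.mem_nhds hxb)
  have hstrict : HasStrictDerivAt F (σ x) x := by
    have := han.hasStrictDerivAt
    rwa [(hFd x hxb).deriv] at this
  set e := (hstrict.hasStrictFDerivAt_equiv (hσne x)).toOpenPartialHomeomorph F with he
  have hex : x ∈ e.source := HasStrictFDerivAt.mem_toOpenPartialHomeomorph_source _
  have hecoe : (e : ℂ → ℂ) = F := HasStrictFDerivAt.toOpenPartialHomeomorph_coe _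
  have hF0 : F x = 0 := by simp [hF]
  have h0t : (0 : ℂ) ∈ e.target := by
    have := e.map_source hex
    rwa [hecoe, hF0] at this
  have hsymm0 : e.symm 0 = x := by
    have := e.left_inv hex
    rwa [hecoe, hF0] at this
  have hGev : ∀ᶠ z in 𝓝 (0 : ℂ), z ∈ e.target ∧ e.symm z ∈ e.source ∩ Metric.ball x r := by
    refine (e.open_target.eventually_mem h0t).and ?_
    refine (e.symm.continuousAt (x := 0) h0t).eventually_mem ?_
    rw [hsymm0]
    exact (e.open_source.inter Metric.isOpen_ball).mem_nhds ⟨hex, hxb⟩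
  obtain ⟨ε, hε, hG⟩ := Metric.eventually_nhds_iff_ball.1 hGev
  exact ⟨{ N := e.source ∩ Metric.ball x r
           σ := σ
           F := F
           G := e.symm
           ε := ε
           isOpen := e.open_source.inter Metric.isOpen_ball
           mem := ⟨hex, hxb⟩
           sub := fun y hy => (hsub y hy.2).1
           diff := hσd.mono inter_subset_right
           base := hσx
           sq := fun y hy => hσsq y hy.2
           ne := fun y _ => hσne y
           -- If w were the opposite root -σ y, then w - s and σ y - s would add up to -2s, although
           -- both are shorter than |s|.
           branch := fun y hy w hw hws => by
             rw [← hσsq y hy.2] at hw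
             rcases sq_eq_sq_iff_eq_or_eq_neg.1 hw with h | h
             · exact h
             · exfalso
               have h1 := (hsub y hy.2).2.2
               have h2 := norm_add_le (w - s) (σ y - s)
               have h3 : (w - s) + (σ y - s) = -(2 * s) := by rw [h]; ring
               rw [h3, norm_neg, norm_mul, Complex.norm_ofNat] at h2
               linarith
           deriv := fun y hy => hFd y hy.2
           zero := hF0
           inj := by
             have := e.injOn.mono (inter_subset_left (t := Metric.ball x r))
             rwa [hecoe] at this
           pos := hε
           G_mem := fun z hz => (hG z hz).2
           F_G := fun z hz => by
             have := e.right_inv (hG z hz).1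
             rwa [hecoe] at this
           G_deriv := fun z hz => e.hasDerivAt_symm (hG z hz).1 (hσne _) (by
             rw [hecoe]; exact hFd _ (hG z hz).2.2) }⟩

/-- A curve `γ` with `γ' = e / s`, where `s` is a continuous branch of `√D` along `γ`. -/
structure IsFlow (X : Set ℂ) (D : ℂ → ℂ) (e : ℂ) (I : Set ℝ) (γ s : ℝ → ℂ) : Prop where
  mem : ∀ t ∈ I, γ t ∈ X
  ne : ∀ t ∈ I, s t ≠ 0
  sq : ∀ t ∈ I, s t ^ 2 = D (γ t)
  cont : ContinuousOn s I
  deriv : ∀ t ∈ I, HasDerivWithinAt γ (e / s t) I t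

/-- The holomorphic analogue of `IsFlow`. -/
structure IsHolFlow (X : Set ℂ) (D : ℂ → ℂ) (e : ℂ) (Ω : Set ℂ) (χ σ : ℂ → ℂ) : Prop where
  mem : ∀ z ∈ Ω, χ z ∈ X
  ne : ∀ z ∈ Ω, σ z ≠ 0
  sq : ∀ z ∈ Ω, σ z ^ 2 = D (χ z)
  cont : ContinuousOn σ Ω
  deriv : ∀ z ∈ Ω, HasDerivAt χ (e / σ z) z

variable {X : Set ℂ} {D : ℂ → ℂ} {e : ℂ}

theorem IsFlow.mono {I J : Set ℝ} {γ s : ℝ → ℂ} (h : IsFlow X D e I γ s) (hJ : J ⊆ I) :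
    IsFlow X D e J γ s :=
  ⟨fun t ht => h.mem t (hJ ht), fun t ht => h.ne t (hJ ht), fun t ht => h.sq t (hJ ht),
    h.cont.mono hJ, fun t ht => (h.deriv t (hJ ht)).mono hJ⟩

theorem IsFlow.congr {I : Set ℝ} {γ s γ' s' : ℝ → ℂ} (h : IsFlow X D e I γ s)
    (h' : ∀ t ∈ I, γ' t = γ t ∧ s' t = s t) : IsFlow X D e I γ' s' :=
  ⟨fun t ht => by rw [(h' t ht).1]; exact h.mem t ht,
    fun t ht => by rw [(h' t ht).2]; exact h.ne t ht,
    fun t ht => by rw [(h' t ht).1, (h' t ht).2]; exact h.sq t ht,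
    h.cont.congr fun t ht => (h' t ht).2,
    fun t ht => by
      rw [(h' t ht).2]
      exact (h.deriv t ht).congr (fun u hu => (h' u hu).1) (h' t ht).1⟩

theorem IsHolFlow.congr {Ω : Set ℂ} (hΩ : IsOpen Ω) {χ σ χ' σ' : ℂ → ℂ}
    (h : IsHolFlow X D e Ω χ σ) (h' : ∀ z ∈ Ω, χ' z = χ z ∧ σ' z = σ z) :
    IsHolFlow X D e Ω χ' σ' :=
  ⟨fun t ht => by rw [(h' t ht).1]; exact h.mem t ht,
    fun t ht => by rw [(h' t ht).2]; exact h.ne t ht,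
    fun t ht => by rw [(h' t ht).1, (h' t ht).2]; exact h.sq t ht,
    h.cont.congr fun t ht => (h' t ht).2,
    fun t ht => by
      rw [(h' t ht).2]
      refine (h.deriv t ht).congr_of_eventuallyEq ?_
      filter_upwards [hΩ.mem_nhds ht] with u hu using (h' u hu).1⟩

theorem IsHolFlow.line {Ω : Set ℂ} {χ σ : ℂ → ℂ} (h : IsHolFlow X D e Ω χ σ) {I : Set ℝ}
    (w k : ℂ) (hI : ∀ t ∈ I, w + k * t ∈ Ω) :
    IsFlow X D (e * k) I (fun t => χ (w + k * t)) (fun t => σ (w + k * t)) :=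
  ⟨fun t ht => h.mem _ (hI t ht), fun t ht => h.ne _ (hI t ht), fun t ht => h.sq _ (hI t ht),
    h.cont.comp (f := fun t : ℝ => w + k * (t : ℂ)) (by fun_prop) hI,
    fun t ht => by
      have h2 : HasDerivAt (fun t : ℝ => w + k * (t : ℂ)) k t := by
        simpa using (((hasDerivAt_id t).ofReal_comp).const_mul k).const_add w
      have := HasDerivAt.scomp (𝕜 := ℝ) (𝕜' := ℂ) t (h.deriv _ (hI t ht)) h2
      refine (this.congr_deriv ?_).hasDerivWithinAt
      rw [smul_eq_mul]; ring⟩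

namespace SqrtChart

variable {x s₀ : ℂ} (c : SqrtChart X D x s₀)

theorem G_zero : c.G 0 = x := by
  have h0 : (0 : ℂ) ∈ Metric.ball (0 : ℂ) c.ε := Metric.mem_ball_self c.pos
  refine c.inj (c.G_mem 0 h0) c.mem ?_
  rw [c.F_G 0 h0, c.zero]

theorem isHolFlow (he : ‖e‖ = 1) (ζ : ℂ) : IsHolFlow X D e (Metric.ball ζ c.ε)
    (fun z => c.G (e * (z - ζ))) (fun z => c.σ (c.G (e * (z - ζ)))) := by
  have hm : ∀ z ∈ Metric.ball ζ c.ε, e * (z - ζ) ∈ Metric.ball (0 : ℂ) c.ε := fun z hz => by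
    rw [mem_ball_zero_iff, norm_mul, he, one_mul, ← dist_eq_norm]
    exact hz
  have hd : ∀ z ∈ Metric.ball ζ c.ε, HasDerivAt (fun z => c.G (e * (z - ζ)))
      (e / c.σ (c.G (e * (z - ζ)))) z := fun z hz => by
    have h1 : HasDerivAt (fun z => e * (z - ζ)) e z := by
      simpa using ((hasDerivAt_id z).sub_const ζ).const_mul e
    refine ((c.G_deriv _ (hm z hz)).comp z h1).congr_deriv ?_
    ring
  refine ⟨fun z hz => c.sub (c.G_mem _ (hm z hz)), fun z hz => c.ne _ (c.G_mem _ (hm z hz)),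
    fun z hz => c.sq _ (c.G_mem _ (hm z hz)), ?_, hd⟩
  exact c.diff.continuousOn.comp (f := fun z => c.G (e * (z - ζ)))
    (fun z hz => (hd z hz).continuousAt.continuousWithinAt) fun z hz => c.G_mem _ (hm z hz)

/-- Along the flow F ∘ γ - e t has zero derivative, because s is the chart's branch at γ. So γ is
the image under the chart's inverse G of a straight segment. -/
theorem flow_eventually_eq {I : Set ℝ} {γ s : ℝ → ℂ} (hI : Convex ℝ I)
    (h : IsFlow X D e I γ s) {t₀ : ℝ} (ht₀ : t₀ ∈ I) (hx : γ t₀ = x) (hs : s t₀ = s₀) :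
    ∀ᶠ t in 𝓝[I] t₀, γ t = c.G (e * ((t : ℂ) - t₀)) ∧
      s t = c.σ (c.G (e * ((t : ℂ) - t₀))) := by
  have hs0 : s₀ ≠ 0 := hs ▸ h.ne t₀ ht₀
  have h1 : ∀ᶠ t in 𝓝[I] t₀, γ t ∈ c.N :=
    (h.deriv t₀ ht₀).continuousWithinAt.eventually_mem (by rw [hx]; exact c.isOpen.mem_nhds c.mem)
  have h2 : ∀ᶠ t in 𝓝[I] t₀, ‖s t - s₀‖ < ‖s₀‖ := by
    have h3 : Tendsto (fun t => ‖s t - s₀‖) (𝓝[I] t₀) (𝓝 0) := by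
      have := ((h.cont t₀ ht₀).sub (continuousWithinAt_const (b := s₀))).norm
      simpa [ContinuousWithinAt, hs] using this
    exact h3.eventually (gt_mem_nhds (norm_pos_iff.2 hs0))
  obtain ⟨η, hη, hsub⟩ := Metric.mem_nhdsWithin_iff.1 (h1.and h2)
  have h4 : ∀ᶠ t : ℝ in 𝓝[I] t₀, e * ((t : ℂ) - t₀) ∈ Metric.ball (0 : ℂ) c.ε := by
    have : ContinuousAt (fun t : ℝ => e * ((t : ℂ) - t₀)) t₀ := by fun_prop
    refine (this.eventually_mem ?_).filter_mono nhdsWithin_le_nhds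
    simpa using Metric.isOpen_ball.mem_nhds (Metric.mem_ball_self c.pos)
  have hJ : Convex ℝ (Metric.ball t₀ η ∩ I) := (convex_ball _ _).inter hI
  have hmem : t₀ ∈ Metric.ball t₀ η ∩ I := ⟨Metric.mem_ball_self hη, ht₀⟩
  filter_upwards [h4, inter_mem_nhdsWithin I (Metric.ball_mem_nhds t₀ hη)] with t ht4 ht
  have ht' : t ∈ Metric.ball t₀ η ∩ I := ⟨ht.2, ht.1⟩
  have hσ : ∀ u ∈ Metric.ball t₀ η ∩ I, s u = c.σ (γ u) := fun u hu =>
    c.branch _ (hsub hu).1 _ (h.sq u hu.2) (hsub hu).2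
  have hder : ∀ u ∈ Metric.ball t₀ η ∩ I,
      HasDerivWithinAt (fun u : ℝ => c.F (γ u) - e * u) 0 (Metric.ball t₀ η ∩ I) u := fun u hu => by
    have d1 := (h.deriv u hu.2).mono (inter_subset_right (s := Metric.ball t₀ η))
    have d2 := (c.deriv _ (hsub hu).1).scomp_hasDerivWithinAt (𝕜 := ℝ) (𝕜' := ℂ) u d1
    have d3 : HasDerivWithinAt (fun u : ℝ => e * (u : ℂ)) e (Metric.ball t₀ η ∩ I) u := by
      simpa using (((hasDerivAt_id u).ofReal_comp).const_mul e).hasDerivWithinAt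
    refine (d2.sub d3).congr_deriv ?_
    have := h.ne u hu.2
    rw [← hσ u hu, smul_eq_mul, div_mul_cancel₀ _ this, sub_self]
  have hconst := hJ.norm_image_sub_le_of_norm_hasDerivWithin_le (C := 0) hder (by simp) hmem ht'
  rw [zero_mul, norm_le_zero_iff, sub_eq_zero, hx, c.zero] at hconst
  have hF : c.F (γ t) = e * ((t : ℂ) - t₀) := by linear_combination hconst
  have hγ : γ t = c.G (e * ((t : ℂ) - t₀)) :=
    c.inj (hsub ht').1 (c.G_mem _ ht4) (by rw [hF, c.F_G _ ht4])
  exact ⟨hγ, by rw [← hγ]; exact hσ t ht'⟩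

end SqrtChart

/-- Flows with the same value and branch at one point coincide. -/
theorem IsFlow.eq (hX : IsOpen X) (hD : DifferentiableOn ℂ D X) {I : Set ℝ} (hI : Convex ℝ I)
    {γ₁ s₁ γ₂ s₂ : ℝ → ℂ} (h₁ : IsFlow X D e I γ₁ s₁) (h₂ : IsFlow X D e I γ₂ s₂) {t₀ : ℝ}
    (ht₀ : t₀ ∈ I) (hγ : γ₁ t₀ = γ₂ t₀) (hs : s₁ t₀ = s₂ t₀) :
    ∀ t ∈ I, γ₁ t = γ₂ t ∧ s₁ t = s₂ t := by
  intro t ht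
  -- Near each parameter either both flows follow the same chart and agree, or by continuity they
  -- differ. Agreement is thus locally constant on the interval.
  have key : (γ₁ t₀ = γ₂ t₀ ∧ s₁ t₀ = s₂ t₀) ↔ (γ₁ t = γ₂ t ∧ s₁ t = s₂ t) := by
    refine hI.isPreconnected.induction₂
      (fun a b => (γ₁ a = γ₂ a ∧ s₁ a = s₂ a) ↔ (γ₁ b = γ₂ b ∧ s₁ b = s₂ b)) ?_
      (fun a b c _ _ _ hab hbc => hab.trans hbc) (fun a b _ _ hab => hab.symm) ht₀ ht
    intro a ha
    by_cases hag : γ₁ a = γ₂ a ∧ s₁ a = s₂ a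
    · obtain ⟨c⟩ := exists_sqrtChart hX hD (h₁.mem a ha) (h₁.ne a ha) (h₁.sq a ha)
      filter_upwards [c.flow_eventually_eq hI h₁ ha rfl rfl,
        c.flow_eventually_eq hI h₂ ha hag.1.symm hag.2.symm] with b hb1 hb2
      simp only [hag, true_iff, and_self]
      exact ⟨hb1.1.trans hb2.1.symm, hb1.2.trans hb2.2.symm⟩
    · have c1 : ContinuousWithinAt (fun u => γ₁ u - γ₂ u) I a :=
        (h₁.deriv a ha).continuousWithinAt.sub (h₂.deriv a ha).continuousWithinAt
      have c2 : ContinuousWithinAt (fun u => s₁ u - s₂ u) I a := (h₁.cont a ha).sub (h₂.cont a ha)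
      rcases not_and_or.1 hag with h | h
      · filter_upwards [c1.eventually_ne (sub_ne_zero.2 h)] with b hb
        exact ⟨fun h' => absurd h' hag, fun h' => absurd (sub_eq_zero.2 h'.1) hb⟩
      · filter_upwards [c2.eventually_ne (sub_ne_zero.2 h)] with b hb
        exact ⟨fun h' => absurd h' hag, fun h' => absurd (sub_eq_zero.2 h'.2) hb⟩
  exact key.1 ⟨hγ, hs⟩

theorem IsCompleteRay.isFlow {θ : ℝ} {α : ℤˣ} {x s₀ : ℂ} {γ s : ℝ → ℂ}
    (h : IsCompleteRay X D θ α x s₀ γ s) :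
    IsFlow X D (((α : ℤ) : ℂ) * Complex.exp (θ * Complex.I)) (Ici 0) γ s :=
  ⟨fun t ht => h.mem t ht, fun t ht => h.regular t ht, fun t ht => h.branch_sq t ht,
    h.branch_continuous, fun t ht => h.liouville t ht⟩

theorem norm_direction (θ : ℝ) (α : ℤˣ) :
    ‖((α : ℤ) : ℂ) * Complex.exp (θ * Complex.I)‖ = 1 := by
  rw [norm_mul, norm_units_cast, Complex.norm_exp_ofReal_mul_I, mul_one]

/-- The inverse of the Liouville transformation extends to a half-strip. -/
theorem exists_strip (hX : IsOpen X) (hD : DifferentiableOn ℂ D X) {U : Set ℂ} (hU : IsOpen U)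
    (hUX : U ⊆ X) {sq : ℂ → ℂ} (hsq : DifferentiableOn ℂ sq U) (hsq2 : ∀ x ∈ U, sq x ^ 2 = D x)
    (hreg : ∀ x ∈ U, D x ≠ 0) {θ : ℝ} {α : ℤˣ}
    (hcomp : ∀ x ∈ U, ∃ γ s : ℝ → ℂ, IsCompleteRay X D θ α x (sq x) γ s)
    {x₁ : ℂ} {V : Set ℂ} (hV : IsOpen V) (hx₁ : x₁ ∈ V) (hVU : V ⊆ U) :
    ∃ ρ : ℝ, 0 < ρ ∧ ∃ χ σ : ℂ → ℂ,
      IsHolFlow X D (((α : ℤ) : ℂ) * Complex.exp (θ * Complex.I)) (halfStrip ρ) χ σ ∧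
      χ 0 = x₁ ∧ ∀ z ∈ Metric.ball (0 : ℂ) ρ, χ z ∈ V ∧ σ z = sq (χ z) := by
  set e := ((α : ℤ) : ℂ) * Complex.exp (θ * Complex.I) with he
  have he1 : ‖e‖ = 1 := norm_direction θ α
  have hx₁U := hVU hx₁
  have hsq0 : ∀ x ∈ U, sq x ≠ 0 := fun x hx h => hreg x hx (by rw [← hsq2 x hx, h]; ring)
  obtain ⟨c₀⟩ := exists_sqrtChart hX hD (hUX hx₁U) (hsq0 _ hx₁U) (hsq2 _ hx₁U)
  have hflow₀ := c₀.isHolFlow he1 0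
  set χ₀ : ℂ → ℂ := fun z => c₀.G (e * (z - 0)) with hχ₀
  set σ₀ : ℂ → ℂ := fun z => c₀.σ (c₀.G (e * (z - 0))) with hσ₀
  have hχ₀0 : χ₀ 0 = x₁ := by simp [hχ₀, c₀.G_zero]
  have hnear : ∀ᶠ z in 𝓝 (0 : ℂ), z ∈ Metric.ball (0 : ℂ) c₀.ε ∧ χ₀ z ∈ V ∧ σ₀ z = sq (χ₀ z) := by
    have h0 : (0 : ℂ) ∈ Metric.ball (0 : ℂ) c₀.ε := Metric.mem_ball_self c₀.pos
    have hc : ContinuousAt χ₀ 0 := (hflow₀.deriv 0 h0).continuousAt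
    have h1 : ∀ᶠ y in 𝓝 x₁, y ∈ V ∧ y ∈ c₀.N ∧ ‖sq y - sq x₁‖ < ‖sq x₁‖ := by
      refine (hV.eventually_mem hx₁).and ((c₀.isOpen.eventually_mem c₀.mem).and ?_)
      have hsc : ContinuousAt sq x₁ := (hsq.differentiableAt (hU.mem_nhds hx₁U)).continuousAt
      have h3 : Tendsto (fun t => ‖sq t - sq x₁‖) (𝓝 x₁) (𝓝 0) := by
        have := (hsc.sub (continuousAt_const (y := sq x₁))).norm
        simpa [ContinuousAt] using this
      exact h3.eventually (gt_mem_nhds (norm_pos_iff.2 (hsq0 _ hx₁U)))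
    have hc' : Tendsto χ₀ (𝓝 0) (𝓝 x₁) := by
      have := hc.tendsto
      rwa [hχ₀0] at this
    filter_upwards [Metric.ball_mem_nhds (0 : ℂ) c₀.pos, hc'.eventually h1] with z hz h
    exact ⟨hz, h.1, (c₀.branch _ h.2.1 _ (hsq2 _ (hVU h.1)) h.2.2).symm⟩
  obtain ⟨ρ, hρ, hball⟩ := Metric.eventually_nhds_iff_ball.1 hnear
  have hflowρ : IsHolFlow X D e (Metric.ball 0 ρ) χ₀ σ₀ :=
    ⟨fun z hz => hflow₀.mem z (hball z hz).1, fun z hz => hflow₀.ne z (hball z hz).1,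
      fun z hz => hflow₀.sq z (hball z hz).1, hflow₀.cont.mono fun z hz => (hball z hz).1,
      fun z hz => hflow₀.deriv z (hball z hz).1⟩
  choose! γ s hray using hcomp
  have hbI : ∀ b : ℝ, |b| < ρ → ((b : ℂ) * Complex.I) ∈ Metric.ball (0 : ℂ) ρ := fun b hb => by
    simpa using hb
  -- Γ t b is the point at time t on the ray issued from the local inverse at height b, to be read
  -- as χ(t + ib). Each row is a flow by hypothesis; holomorphy across rows is what has to be shown.
  set Γ : ℝ → ℝ → ℂ := fun t b => γ (χ₀ (b * Complex.I)) t with hΓ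
  set Λ : ℝ → ℝ → ℂ := fun t b => s (χ₀ (b * Complex.I)) t with hΛ
  have hrow : ∀ b : ℝ, |b| < ρ → IsFlow X D e (Ici 0) (fun t => Γ t b) (fun t => Λ t b) :=
    fun b hb => (hray _ (hVU (hball _ (hbI b hb)).2.1)).isFlow
  have hstart : ∀ b : ℝ, |b| < ρ → Γ 0 b = χ₀ (b * Complex.I) ∧ Λ 0 b = σ₀ (b * Complex.I) :=
    fun b hb => by
      have h1 := hball _ (hbI b hb)
      have h2 := hray _ (hVU h1.2.1)
      exact ⟨h2.start, h2.branch_start.trans h1.2.2.symm⟩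
  -- agreement with the local flow, given the vertical flow through one point
  have key : ∀ b₀ : ℝ, |b₀| < ρ → ∀ T₀ : ℝ, 0 ≤ T₀ → ∃ ε : ℝ, 0 < ε ∧ ∃ f g : ℂ → ℂ,
      IsHolFlow X D e (Metric.ball (T₀ + b₀ * Complex.I) (2 * ε)) f g ∧
      ∀ T₁ ∈ Ici (0 : ℝ) ∩ Metric.ball T₀ ε,
        (∃ η > 0, IsFlow X D (e * Complex.I) (Metric.ball b₀ η) (fun b => Γ T₁ b)
          (fun b => Λ T₁ b)) →
        ∃ η > 0, η ≤ ε ∧ ∀ b ∈ Metric.ball b₀ η, ∀ t ∈ Ici (0 : ℝ) ∩ Metric.ball T₀ ε,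
          Γ t b = f (b * Complex.I + 1 * t) ∧ Λ t b = g (b * Complex.I + 1 * t) := by
    intro b₀ hb₀ T₀ hT₀
    have hr := hrow b₀ hb₀
    obtain ⟨c⟩ := exists_sqrtChart hX hD (hr.mem T₀ hT₀) (hr.ne T₀ hT₀) (hr.sq T₀ hT₀)
    set ζ : ℂ := T₀ + b₀ * Complex.I with hζ
    have hfl := c.isHolFlow he1 ζ
    set f : ℂ → ℂ := fun z => c.G (e * (z - ζ)) with hf
    set g : ℂ → ℂ := fun z => c.σ (c.G (e * (z - ζ))) with hg
    have hfζ : f ζ = Γ T₀ b₀ := by simp [hf, c.G_zero]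
    have hgζ : g ζ = Λ T₀ b₀ := by simp [hg, c.G_zero, c.base]
    have hε : 0 < c.ε := c.pos
    have hmem : ∀ t b : ℝ, |t - T₀| < c.ε / 2 → |b - b₀| < c.ε / 2 →
        (b : ℂ) * Complex.I + 1 * t ∈ Metric.ball ζ c.ε := fun t b ht hb => by
      rw [Metric.mem_ball, dist_eq_norm]
      have : (b : ℂ) * Complex.I + 1 * t - ζ = ((t - T₀ : ℝ) : ℂ) + ((b - b₀ : ℝ) : ℂ) * Complex.I := by
        rw [hζ]; push_cast; ring
      rw [this]
      refine (norm_add_le _ _).trans_lt ?_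
      rw [norm_mul, Complex.norm_I, mul_one, Complex.norm_real, Complex.norm_real, Real.norm_eq_abs,
        Real.norm_eq_abs]
      linarith
    have hconv : Convex ℝ (Ici (0 : ℝ) ∩ Metric.ball T₀ (c.ε / 2)) :=
      (convex_Ici 0).inter (convex_ball _ _)
    -- One common point with the chart is enough for a whole piece of a row to coincide with the
    -- chart, by uniqueness of flows.
    have hhor : ∀ b : ℝ, |b - b₀| < c.ε / 2 → |b| < ρ →
        ∀ t₁ ∈ Ici (0 : ℝ) ∩ Metric.ball T₀ (c.ε / 2),
        Γ t₁ b = f (b * Complex.I + 1 * t₁) → Λ t₁ b = g (b * Complex.I + 1 * t₁) →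
        ∀ t ∈ Ici (0 : ℝ) ∩ Metric.ball T₀ (c.ε / 2),
          Γ t b = f (b * Complex.I + 1 * t) ∧ Λ t b = g (b * Complex.I + 1 * t) := by
      intro b hb hbρ t₁ ht₁ h1 h2 t ht
      have hl := hfl.line (I := Ici (0 : ℝ) ∩ Metric.ball T₀ (c.ε / 2)) (b * Complex.I) 1
        fun t ht => hmem t b (by simpa [Real.dist_eq] using ht.2) hb
      rw [mul_one] at hl
      exact ((hrow b hbρ).mono inter_subset_left).eq hX hD hconv hl ht₁ h1 h2 t ht
    have hT₀m : T₀ ∈ Ici (0 : ℝ) ∩ Metric.ball T₀ (c.ε / 2) :=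
      ⟨hT₀, Metric.mem_ball_self (by linarith)⟩
    have hrow₀ := hhor b₀ (by simpa using by linarith) hb₀ T₀ hT₀m
      (by rw [← hfζ]; congr 1; rw [hζ]; ring) (by rw [← hgζ]; congr 1; rw [hζ]; ring)
    refine ⟨c.ε / 2, by linarith, f, g, by rwa [mul_div_cancel₀ _ two_ne_zero], ?_⟩
    rintro T₁ hT₁ ⟨η, hη, hv⟩
    have hρ' : 0 < ρ - |b₀| := by linarith
    set η' := min (min η (c.ε / 2)) (ρ - |b₀|) with hη'
    have hη'0 : 0 < η' := by
      simp only [hη', lt_min_iff]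
      exact ⟨⟨hη, by linarith⟩, hρ'⟩
    have hle1 : η' ≤ η := (min_le_left _ _).trans (min_le_left _ _)
    have hle2 : η' ≤ c.ε / 2 := (min_le_left _ _).trans (min_le_right _ _)
    have hle3 : η' ≤ ρ - |b₀| := min_le_right _ _
    -- The row at b₀ fits the chart at T₁; the vertical flow through that point carries the fit to
    -- all nearby heights and supplies the common point needed on each neighbouring row.
    have hvert : ∀ b ∈ Metric.ball b₀ η', Γ T₁ b = f (T₁ + Complex.I * b) ∧
        Λ T₁ b = g (T₁ + Complex.I * b) := by
      have hl := hfl.line (I := Metric.ball b₀ η') (T₁ : ℂ) Complex.I fun b hb => by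
        have := hmem T₁ b (by simpa [Real.dist_eq] using hT₁.2)
          (by have := Metric.mem_ball.1 hb; rw [Real.dist_eq] at this; linarith)
        convert this using 1; ring
      have h1 := hrow₀ T₁ hT₁
      refine (hv.mono (Metric.ball_subset_ball hle1)).eq hX hD (convex_ball _ _) hl
        (Metric.mem_ball_self hη'0) ?_ ?_
      · rw [h1.1]; congr 1; ring
      · rw [h1.2]; congr 1; ring
    refine ⟨η', hη'0, hle2, fun b hb t ht => ?_⟩
    have hbb : |b - b₀| < η' := by simpa [Real.dist_eq] using hb
    have hbρ : |b| < ρ := by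
      have := abs_sub_abs_le_abs_sub b b₀
      linarith
    refine hhor b (by linarith) hbρ T₁ hT₁ ?_ ?_ t ht
    · rw [(hvert b hb).1]; congr 1; ring
    · rw [(hvert b hb).2]; congr 1; ring
  -- the vertical flow through every point
  have hQ : ∀ b₀ : ℝ, |b₀| < ρ → ∀ T : ℝ, 0 ≤ T → ∃ η > 0,
      IsFlow X D (e * Complex.I) (Metric.ball b₀ η) (fun b => Γ T b) (fun b => Λ T b) := by
    intro b₀ hb₀ T hT
    have h0 : ∃ η > 0, IsFlow X D (e * Complex.I) (Metric.ball b₀ η) (fun b => Γ 0 b)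
        (fun b => Λ 0 b) := by
      refine ⟨ρ - |b₀|, by linarith, ?_⟩
      have hb : ∀ b ∈ Metric.ball b₀ (ρ - |b₀|), |b| < ρ := fun b hb => by
        have h1 : |b - b₀| < ρ - |b₀| := by simpa [Real.dist_eq] using hb
        have := abs_sub_abs_le_abs_sub b b₀
        linarith
      refine (hflowρ.line (I := Metric.ball b₀ (ρ - |b₀|)) 0 Complex.I fun b hb' => by
        simpa [mul_comm] using hb b hb').congr fun b hb' => ?_
      have := hstart b (hb b hb')
      simpa [mul_comm] using this
    have step : ∀ T₀ : ℝ, 0 ≤ T₀ → ∃ ε > 0, ∀ T₁ ∈ Ici (0 : ℝ) ∩ Metric.ball T₀ ε,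
        ∀ T₂ ∈ Ici (0 : ℝ) ∩ Metric.ball T₀ ε,
        (∃ η > 0, IsFlow X D (e * Complex.I) (Metric.ball b₀ η) (fun b => Γ T₁ b)
          (fun b => Λ T₁ b)) →
        ∃ η > 0, IsFlow X D (e * Complex.I) (Metric.ball b₀ η) (fun b => Γ T₂ b)
          (fun b => Λ T₂ b) := by
      intro T₀ hT₀
      obtain ⟨ε, hε, f, g, hfl, hk⟩ := key b₀ hb₀ T₀ hT₀
      refine ⟨ε, hε, fun T₁ hT₁ T₂ hT₂ h1 => ?_⟩
      obtain ⟨η, hη, hηε, hag⟩ := hk T₁ hT₁ h1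
      refine ⟨η, hη, (hfl.line (I := Metric.ball b₀ η) (T₂ : ℂ) Complex.I fun b hb => ?_).congr
        fun b hb => ?_⟩
      · rw [Metric.mem_ball, dist_eq_norm]
        have : (T₂ : ℂ) + Complex.I * b - (T₀ + b₀ * Complex.I) =
            ((T₂ - T₀ : ℝ) : ℂ) + ((b - b₀ : ℝ) : ℂ) * Complex.I := by push_cast; ring
        rw [this]
        refine (norm_add_le _ _).trans_lt ?_
        rw [norm_mul, Complex.norm_I, mul_one, Complex.norm_real, Complex.norm_real,
          Real.norm_eq_abs, Real.norm_eq_abs]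
        have e1 : |b - b₀| < η := by simpa [Real.dist_eq] using hb
        have e2 : |T₂ - T₀| < ε := by simpa [Real.dist_eq] using hT₂.2
        linarith
      · have := hag b hb T₂ hT₂
        have e3 : (T₂ : ℂ) + Complex.I * b = b * Complex.I + 1 * T₂ := by ring
        simp only [e3]
        exact this
    -- The property of being a vertical flow near b₀ is propagated from T = 0, where the local
    -- inverse provides it, to all times by connectedness of [0, ∞). The resulting width depends on
    -- T, which is harmless since only local holomorphy is needed.
    refine ((convex_Ici (0 : ℝ)).isPreconnected.induction₂ (fun T₁ T₂ =>
      (∃ η > 0, IsFlow X D (e * Complex.I) (Metric.ball b₀ η) (fun b => Γ T₁ b)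
          (fun b => Λ T₁ b)) ↔ ∃ η > 0, IsFlow X D (e * Complex.I) (Metric.ball b₀ η)
          (fun b => Γ T₂ b) (fun b => Λ T₂ b)) (fun T₀ hT₀ => ?_)
      (fun a b c _ _ _ hab hbc => hab.trans hbc) (fun a b _ _ hab => hab.symm) self_mem_Ici hT).1 h0
    obtain ⟨ε, hε, h⟩ := step T₀ hT₀
    filter_upwards [inter_mem_nhdsWithin (Ici (0 : ℝ)) (Metric.ball_mem_nhds T₀ hε)] with T₁ hT₁
    exact ⟨h T₀ ⟨hT₀, Metric.mem_ball_self hε⟩ T₁ hT₁, h T₁ hT₁ T₀ ⟨hT₀, Metric.mem_ball_self hε⟩⟩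
  -- Points of the half-strip with negative real part lie in the disc of radius ρ, where the local
  -- inverse is used; on the rest of the disc the two definitions agree by uniqueness of flows along
  -- rows.
  set χ : ℂ → ℂ := fun z => if 0 ≤ z.re then Γ z.re z.im else χ₀ z with hχ
  set σ : ℂ → ℂ := fun z => if 0 ≤ z.re then Λ z.re z.im else σ₀ z with hσ
  have hagree : ∀ z ∈ Metric.ball (0 : ℂ) ρ, χ z = χ₀ z ∧ σ z = σ₀ z := by
    intro z hz
    by_cases hre : 0 ≤ z.re
    · simp only [hχ, hσ, if_pos hre]
      have him : |z.im| < ρ := (Complex.abs_im_le_norm z).trans_lt (by simpa using hz)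
      have hz' : ‖z‖ < ρ := by simpa using hz
      have hl := hflowρ.line (I := Icc 0 z.re) (z.im * Complex.I) 1 fun t ht => by
        rw [mem_ball_zero_iff]
        refine lt_of_le_of_lt ?_ hz'
        have e1 : (z.im : ℂ) * Complex.I + 1 * t = ⟨t, z.im⟩ := by
          apply Complex.ext <;> simp
        rw [e1, Complex.norm_eq_sqrt_sq_add_sq, Complex.norm_eq_sqrt_sq_add_sq]
        refine Real.sqrt_le_sqrt ?_
        have := pow_le_pow_left₀ ht.1 ht.2 2
        simpa using this
      rw [mul_one] at hl
      have h2 := hstart z.im him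
      have := ((hrow z.im him).mono Icc_subset_Ici_self).eq hX hD (convex_Icc 0 z.re) hl
        (left_mem_Icc.2 hre) (by simpa using h2.1) (by simpa using h2.2) z.re (right_mem_Icc.2 hre)
      have e2 : (z.im : ℂ) * Complex.I + 1 * z.re = z := by
        apply Complex.ext <;> simp
      rw [e2] at this
      exact this
    · simp only [hχ, hσ, if_neg hre, and_self]
  have hlocal : ∀ z ∈ halfStrip ρ, ∃ N : Set ℂ, IsOpen N ∧ z ∈ N ∧ IsHolFlow X D e N χ σ := by
    rintro z ⟨t, ht, hz⟩
    by_cases hzb : z ∈ Metric.ball (0 : ℂ) ρ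
    · exact ⟨_, Metric.isOpen_ball, hzb, hflowρ.congr Metric.isOpen_ball hagree⟩
    · have him : |z.im| < ρ := by
        have := Complex.abs_im_le_norm (z - t)
        simp only [Complex.sub_im, Complex.ofReal_im, sub_zero] at this
        linarith
      have hre : 0 < z.re := by
        by_contra hneg
        push Not at hneg
        refine hzb ?_
        rw [mem_ball_zero_iff]
        refine lt_of_le_of_lt ?_ hz
        rw [Complex.norm_eq_sqrt_sq_add_sq, Complex.norm_eq_sqrt_sq_add_sq]
        refine Real.sqrt_le_sqrt ?_
        simp only [Complex.sub_re, Complex.ofReal_re, Complex.sub_im, Complex.ofReal_im, sub_zero]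
        nlinarith
      obtain ⟨ε, hε, f, g, hfl, hk⟩ := key z.im him z.re hre.le
      obtain ⟨η, hη, hηε, hag⟩ := hk z.re ⟨hre.le, Metric.mem_ball_self hε⟩
        (hQ z.im him z.re hre.le)
      have hzc : (z.re : ℂ) + z.im * Complex.I = z := Complex.re_add_im z
      rw [hzc] at hfl
      set κ := min η z.re with hκ
      have hκ0 : 0 < κ := lt_min hη hre
      have hκη : κ ≤ η := min_le_left _ _
      refine ⟨Metric.ball z κ, Metric.isOpen_ball, Metric.mem_ball_self hκ0, ?_⟩
      have hsub : Metric.ball z κ ⊆ Metric.ball z (2 * ε) :=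
        Metric.ball_subset_ball (by linarith)
      refine IsHolFlow.congr (χ := f) (σ := g) Metric.isOpen_ball
        ⟨fun w hw => hfl.mem w (hsub hw), fun w hw => hfl.ne w (hsub hw),
          fun w hw => hfl.sq w (hsub hw), hfl.cont.mono hsub, fun w hw => hfl.deriv w (hsub hw)⟩ ?_
      intro w hw
      rw [Metric.mem_ball, dist_eq_norm] at hw
      have r1 := (Complex.abs_re_le_norm (w - z)).trans_lt hw
      have r2 := (Complex.abs_im_le_norm (w - z)).trans_lt hw
      rw [Complex.sub_re] at r1
      rw [Complex.sub_im] at r2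
      have hwre : 0 ≤ w.re := by
        have := (abs_lt.1 (r1.trans_le (min_le_right _ _))).1
        linarith
      simp only [hχ, hσ, if_pos hwre]
      have := hag w.im (by rw [Metric.mem_ball, Real.dist_eq]; linarith) w.re
        ⟨hwre, by rw [Metric.mem_ball, Real.dist_eq]; linarith⟩
      have e2 : (w.im : ℂ) * Complex.I + 1 * w.re = w := by
        apply Complex.ext <;> simp
      rw [e2] at this
      exact this
  have h0ρ : (0 : ℂ) ∈ Metric.ball (0 : ℂ) ρ := Metric.mem_ball_self hρ
  refine ⟨ρ, hρ, χ, σ, ⟨fun z hz => ?_, fun z hz => ?_, fun z hz => ?_, fun z hz => ?_,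
    fun z hz => ?_⟩, by rw [(hagree 0 h0ρ).1, hχ₀0], fun z hz => ?_⟩
  · obtain ⟨N, hN, hzN, h⟩ := hlocal z hz
    exact h.mem z hzN
  · obtain ⟨N, hN, hzN, h⟩ := hlocal z hz
    exact h.ne z hzN
  · obtain ⟨N, hN, hzN, h⟩ := hlocal z hz
    exact h.sq z hzN
  · obtain ⟨N, hN, hzN, h⟩ := hlocal z hz
    exact (h.cont.continuousAt (hN.mem_nhds hzN)).continuousWithinAt
  · obtain ⟨N, hN, hzN, h⟩ := hlocal z hz
    exact h.deriv z hzN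
  · have h1 := hagree z hz
    have h2 := hball z hz
    rw [h1.1, h1.2]
    exact h2.2


/-! ### Transport of Gevrey bounds and compactness on half-strips -/

section Transport

variable {ι ι' : Type} {f : ι → ℂ → ℂ} {c : ℕ → ι → ℂ} {V : Set ι} {S : Set ℂ}

theorem GevreyBounds.comp_left (hf : GevreyBounds f c V S) {g : ι' → ι} {W : Set ι'}
    (hg : ∀ z ∈ W, g z ∈ V) :
    GevreyBounds (fun z h => f (g z) h) (fun k z => c k (g z)) W S := by
  obtain ⟨C, M, hC, hM, H⟩ := hf
  exact ⟨C, M, hC, hM, fun n z hz h hh => H n (g z) (hg z hz) h hh⟩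

/-- A rotation of ħ changes neither |ħ| nor the constants; it reduces the direction θ to 0. -/
theorem GevreyBounds.rotate (hf : GevreyBounds f c V S) {κ : ℂ} (hκ : ‖κ‖ = 1) {S' : Set ℂ}
    (hS : ∀ h ∈ S', κ * h ∈ S) :
    GevreyBounds (fun x h => f x (κ * h)) (fun k x => κ ^ k * c k x) V S' := by
  obtain ⟨C, M, hC, hM, H⟩ := hf
  refine ⟨C, M, hC, hM, fun n x hx h hh => ?_⟩
  have h1 := H n x hx _ (hS h hh)
  have h2 : remainder (fun x h => f x (κ * h)) (fun k x => κ ^ k * c k x) n x h =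
      remainder f c n x (κ * h) := by
    simp only [remainder, mul_pow]
    congr 1
    exact Finset.sum_congr rfl fun k _ => by ring
  rw [h2]
  rwa [norm_mul, hκ, one_mul] at h1

theorem GevreyBounds.union {V' : Set ι} (hf : GevreyBounds f c V S) (hf' : GevreyBounds f c V' S) :
    GevreyBounds f c (V ∪ V') S := by
  obtain ⟨C, hC, h1⟩ := hf.exists_with
  obtain ⟨D, hD, h2⟩ := hf'.exists_with
  have e1 := h1 (max C D) (max C D) (le_max_left _ _) (le_max_left _ _)
  have e2 := h2 (max C D) (max C D) (le_max_right _ _) (le_max_right _ _)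
  have h0 : 0 < max C D := lt_of_lt_of_le (by linarith) (le_max_left _ _)
  exact ⟨_, _, h0, h0, fun n x hx h hh => hx.elim (fun hx => e1 n x hx h hh)
    fun hx => e2 n x hx h hh⟩

end Transport

theorem mul_mem_borelDisc {θ δ : ℝ} {h : ℂ} (hh : h ∈ borelDisc 0 δ) :
    Complex.exp (θ * Complex.I) * h ∈ borelDisc θ δ := by
  rw [mem_borelDisc_zero] at hh
  rwa [mem_borelDisc_iff, ← div_div, div_self (Complex.exp_ne_zero _)]

theorem mul_mem_borelDisc_zero {θ δ : ℝ} {h : ℂ} (hh : h ∈ borelDisc θ δ) :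
    Complex.exp (-(θ * Complex.I)) * h ∈ borelDisc 0 δ := by
  rw [mem_borelDisc_iff] at hh
  rw [mem_borelDisc_zero]
  have : 1 / (Complex.exp (-(θ * Complex.I)) * h) = Complex.exp (θ * Complex.I) / h := by
    rw [Complex.exp_neg, ← div_div, one_div, inv_inv]
  rwa [this]

/-- A property of sets that holds locally and near infinity holds on smaller half-strips. -/
theorem halfStrip_induction {P : Set ℂ → Prop} (hempty : P ∅) (hmono : ∀ s t, s ⊆ t → P t → P s)
    (hunion : ∀ s t, P s → P t → P (s ∪ t)) {r ρ T : ℝ} (hrρ : r < ρ)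
    (hnear : ∀ z ∈ halfStrip ρ, ∃ N ∈ 𝓝 z, P N) (hfar : P {z ∈ halfStrip ρ | T < z.re}) :
    P (halfStrip r) := by
  -- A point of the smaller half-strip with real part at most T is within r of some t ≤ T + r, so it
  -- lies in a compact part of the larger half-strip; there the local hypothesis suffices.
  set K : Set ℂ := (fun w : ℂ × ℝ => w.1 + (w.2 : ℂ)) ''
    (Metric.closedBall (0 : ℂ) r ×ˢ Icc (0 : ℝ) (T + r)) with hK
  have hKc : IsCompact K :=
    ((isCompact_closedBall 0 r).prod isCompact_Icc).image (by fun_prop)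
  have hKsub : K ⊆ halfStrip ρ := by
    rintro _ ⟨w, hw, rfl⟩
    refine ⟨w.2, hw.2.1, ?_⟩
    have := hw.1
    rw [mem_closedBall_zero_iff] at this
    simpa using this.trans_lt hrρ
  have hPK : P K := hKc.induction_on hempty (fun s t => hmono s t) (fun s t => hunion s t)
    fun z hz => by
      obtain ⟨N, hN, h⟩ := hnear z (hKsub hz)
      exact ⟨N, mem_nhdsWithin_of_mem_nhds hN, h⟩
  refine hmono _ _ ?_ (hunion _ _ hPK hfar)
  intro z hz
  have hz' := halfStrip_mono hrρ.le hz
  obtain ⟨t, ht, hzt⟩ := hz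
  by_cases hT : T < z.re
  · exact Or.inr ⟨hz', hT⟩
  · refine Or.inl ⟨(z - t, t), ⟨?_, ht, ?_⟩, by simp⟩
    · simpa using hzt.le
    · have := (Complex.abs_re_le_norm (z - t)).trans hzt.le
      rw [Complex.sub_re, Complex.ofReal_re] at this
      have := (abs_le.1 this).1
      push Not at hT
      linarith

/-! ### The standing setting and uniform bounds along half-strips -/

/-- The standing assumptions on the equation, the domain `U` and the direction `θ`. -/
structure Setting (X S : Set ℂ) (a b : ℝ) (p q : ℂ → ℂ → ℂ) (pc qc : ℕ → ℂ → ℂ) (θ : ℝ)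
    (U : Set ℂ) (x₀ : ℂ) (sq : ℂ → ℂ) : Prop where
  hX : IsOpen X
  hp : DifferentiableOn ℂ (fun z : ℂ × ℂ => p z.1 z.2) (X ×ˢ S)
  hq : DifferentiableOn ℂ (fun z : ℂ × ℂ => q z.1 z.2) (X ×ˢ S)
  hpc : ∀ k, DifferentiableOn ℂ (pc k) X
  hqc : ∀ k, DifferentiableOn ℂ (qc k) X
  hpA : LocGevreyClosed p pc X a b S
  hqA : LocGevreyClosed q qc X a b S
  hθ : θ ∈ Icc (a + Real.pi / 2) (b - Real.pi / 2)
  hU : IsOpen U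
  hUs : IsSimplyConnected U
  hUX : U ⊆ X
  hx₀ : x₀ ∈ U
  hreg : ∀ x ∈ U, disc₀ pc qc x ≠ 0
  hsq : DifferentiableOn ℂ sq U
  hsq2 : ∀ x ∈ U, sq x ^ 2 = disc₀ pc qc x

variable {X S : Set ℂ} {a b : ℝ} {p q : ℂ → ℂ → ℂ} {pc qc : ℕ → ℂ → ℂ} {θ : ℝ}
  {U : Set ℂ} {x₀ : ℂ} {sq : ℂ → ℂ}

theorem Setting.disc_differentiableOn (H : Setting X S a b p q pc qc θ U x₀ sq) :
    DifferentiableOn ℂ (disc₀ pc qc) X :=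
  ((H.hpc 0).pow 2).sub ((H.hqc 0).const_mul 4)

theorem Setting.sq_ne_zero (H : Setting X S a b p q pc qc θ U x₀ sq) {x : ℂ} (hx : x ∈ U) :
    sq x ≠ 0 := fun h => H.hreg x hx (by rw [← H.hsq2 x hx, h]; ring)

/-- Horizontal half-lines of the half-strip that start in the initial disc are WKB rays. This places
χ z in the swept region when Re z is large. -/
theorem IsHolFlow.isCompleteRay {D : ℂ → ℂ} {α : ℤˣ} {ρ : ℝ} {χ σ : ℂ → ℂ}
    (h : IsHolFlow X D (((α : ℤ) : ℂ) * Complex.exp (θ * Complex.I)) (halfStrip ρ) χ σ) {u : ℂ}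
    (hu : u ∈ Metric.ball (0 : ℂ) ρ) (hσ : σ u = sq (χ u)) :
    IsCompleteRay X D θ α (χ u) (sq (χ u)) (fun t => χ (u + t)) (fun t => σ (u + t)) := by
  have hl := h.line (I := Ici 0) u 1 fun t ht => by
    rw [one_mul]; exact add_mem_halfStrip (ball_zero_subset_halfStrip ρ hu) ht
  simp only [one_mul, mul_one] at hl
  exact ⟨by simp, by simpa using hσ, hl.cont, fun t ht => hl.mem t ht, fun t ht => hl.ne t ht,
    fun t ht => hl.sq t ht, fun t ht => hl.deriv t ht⟩

theorem IsHolFlow.differentiableOn {D : ℂ → ℂ} {e : ℂ} (he : e ≠ 0) {Ω : Set ℂ} (hΩ : IsOpen Ω)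
    {χ σ : ℂ → ℂ} (h : IsHolFlow X D e Ω χ σ) : DifferentiableOn ℂ χ Ω ∧ DifferentiableOn ℂ σ Ω := by
  have hχ : DifferentiableOn ℂ χ Ω := fun z hz =>
    (h.deriv z hz).differentiableAt.differentiableWithinAt
  refine ⟨hχ, ((differentiableOn_const e).fun_div (hχ.deriv hΩ) fun z hz => ?_).congr
    fun z hz => ?_⟩
  · rw [(h.deriv z hz).deriv]; exact div_ne_zero he (h.ne z hz)
  · have := h.ne z hz
    rw [(h.deriv z hz).deriv]; field_simp

/-- The Liouville coordinate of `χ`. -/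
theorem Setting.primitive_comp (H : Setting X S a b p q pc qc θ U x₀ sq) {e : ℂ} {ρ : ℝ} {χ σ : ℂ → ℂ}
    (hρ : 0 < ρ) (h : IsHolFlow X (disc₀ pc qc) e (halfStrip ρ) χ σ)
    (hb : ∀ z ∈ Metric.ball (0 : ℂ) ρ, χ z ∈ U ∧ σ z = sq (χ z)) :
    ∀ z ∈ Metric.ball (0 : ℂ) ρ, primitive U x₀ sq (χ z) = primitive U x₀ sq (χ 0) + e * z := by
  intro z hz
  have hspec := (primitive_spec H.hU H.hUs H.hsq H.hx₀).2
  have hd : ∀ z ∈ Metric.ball (0 : ℂ) ρ,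
      HasDerivAt (fun z => primitive U x₀ sq (χ z) - e * z) 0 z := fun z hz => by
    have h1 := (hspec _ (hb z hz).1).comp z (h.deriv z (ball_zero_subset_halfStrip ρ hz))
    have h2 : HasDerivAt (fun z : ℂ => e * z) e z := by
      simpa using (hasDerivAt_id z).const_mul e
    refine (h1.sub h2).congr_deriv ?_
    have := h.ne z (ball_zero_subset_halfStrip ρ hz)
    rw [← (hb z hz).2]; field_simp; ring
  have := Metric.isOpen_ball.is_const_of_deriv_eq_zero (convex_ball (0 : ℂ) ρ).isPreconnected
    (fun y hy => (hd y hy).differentiableAt.differentiableWithinAt)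
    (fun y hy => (hd y hy).deriv) hz (Metric.mem_ball_self hρ)
  simp only [mul_zero, sub_zero] at this
  linear_combination this

theorem exists_gevreyBounds_halfStrip {F : ℂ → ℂ → ℂ} {c : ℕ → ℂ → ℂ} {S : Set ℂ} {θ r ρ T : ℝ}
    (hrρ : r < ρ) (hnear : ∀ z ∈ halfStrip ρ, ∃ N ∈ 𝓝 z, ∃ δ > 0, borelDisc θ δ ⊆ S ∧
      GevreyBounds F c N (borelDisc θ δ))
    (hfar : ∃ δ > 0, borelDisc θ δ ⊆ S ∧
      GevreyBounds F c {z ∈ halfStrip ρ | T < z.re} (borelDisc θ δ)) :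
    ∃ δ > 0, borelDisc θ δ ⊆ S ∧ GevreyBounds F c (halfStrip r) (borelDisc θ δ) := by
  refine halfStrip_induction (P := fun s => ∃ δ > 0, borelDisc θ δ ⊆ S ∧
    GevreyBounds F c s (borelDisc θ δ)) ?_ ?_ ?_ hrρ hnear hfar
  · obtain ⟨δ, hδ, hsub, -⟩ := hfar
    exact ⟨δ, hδ, hsub, 1, 1, one_pos, one_pos, fun n x hx => absurd hx (notMem_empty x)⟩
  · rintro s t hst ⟨δ, hδ, hS, hG⟩
    exact ⟨δ, hδ, hS, hG.mono hst subset_rfl⟩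
  · rintro s t ⟨δ₁, hδ₁, hS₁, h₁⟩ ⟨δ₂, hδ₂, hS₂, h₂⟩
    have hm : 0 < min δ₁ δ₂ := lt_min hδ₁ hδ₂
    have m1 := borelDisc_mono (θ := θ) hm (min_le_left δ₁ δ₂)
    have m2 := borelDisc_mono (θ := θ) hm (min_le_right δ₁ δ₂)
    exact ⟨_, hm, m1.trans hS₁, (h₁.mono subset_rfl m1).union (h₂.mono subset_rfl m2)⟩

theorem exists_bound_halfStrip {F : ℂ → ℂ} {r ρ T : ℝ} (hrρ : r < ρ)
    (hF : ContinuousOn F (halfStrip ρ))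
    (hfar : ∃ B : ℝ, ∀ z ∈ halfStrip ρ, T < z.re → ‖F z‖ ≤ B) :
    ∃ B : ℝ, ∀ z ∈ halfStrip r, ‖F z‖ ≤ B := by
  refine halfStrip_induction (P := fun s => ∃ B : ℝ, ∀ z ∈ s, ‖F z‖ ≤ B)
    ⟨0, fun z hz => absurd hz (notMem_empty z)⟩
    (fun s t hst ⟨B, hB⟩ => ⟨B, fun z hz => hB z (hst hz)⟩)
    (fun s t ⟨B, hB⟩ ⟨B', hB'⟩ => ⟨max B B', fun z hz => hz.elim
      (fun hz => (hB z hz).trans (le_max_left _ _)) fun hz => (hB' z hz).trans (le_max_right _ _)⟩)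
    hrρ (T := T) (fun z hz => ?_) (by
      obtain ⟨B, hB⟩ := hfar
      exact ⟨B, fun z hz => hB z hz.1 hz.2⟩)
  have hc := (hF.continuousAt ((isOpen_halfStrip ρ).mem_nhds hz)).norm
  exact ⟨{w | ‖F w‖ ≤ ‖F z‖ + 1}, hc.eventually_le_const (lt_add_one ‖F z‖), ‖F z‖ + 1,
    fun w hw => hw⟩

theorem exists_gevreyBounds_nhds {X S : Set ℂ} {a b θ : ℝ} {f : ℂ → ℂ → ℂ} {c : ℕ → ℂ → ℂ}
    (hf : LocGevreyClosed f c X a b S) (hθ : θ ∈ Icc (a + Real.pi / 2) (b - Real.pi / 2))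
    {χ w : ℂ → ℂ} {z : ℂ} (hz : χ z ∈ X) (hχ : ContinuousAt χ z) (hw : ContinuousAt w z) :
    ∃ N ∈ 𝓝 z, ∃ δ > 0, borelDisc θ δ ⊆ S ∧
      GevreyBounds (fun z h => w z * f (χ z) h) (fun k z => w z * c k (χ z)) N
        (borelDisc θ δ) := by
  obtain ⟨V', hV', hxV', -, hG⟩ := hf (χ z) hz
  obtain ⟨δ, hδ, hsub, hG⟩ := hG.exists_bounds hθ
  refine ⟨{u | χ u ∈ V' ∧ ‖w u‖ ≤ ‖w z‖ + 1}, (hχ.eventually_mem (hV'.mem_nhds hxV')).and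
    (hw.norm.eventually_le_const (lt_add_one ‖w z‖)), δ, hδ, hsub, ?_⟩
  exact (hG.comp_left (g := χ) (W := {u | χ u ∈ V' ∧ ‖w u‖ ≤ ‖w z‖ + 1})
    fun u hu => hu.1).const_mul (A := ‖w z‖ + 1) fun u hu => hu.2

/-- Uniform bounds along the half-strip. -/
theorem Setting.exists_strip_bounds (H : Setting X S a b p q pc qc θ U x₀ sq) {α : ℤˣ}
    {V : Set ℂ} {R : ℝ} (hVU : V ⊆ U)
    (hB : ∃ B : ℝ, ∀ z ∈ sweptRegion X (disc₀ pc qc) U x₀ sq θ α V R,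
      ‖1 / z.2 * (deriv (disc₀ pc qc) z.1 / (2 * disc₀ pc qc z.1))‖ ≤ B)
    (hpV : GevreyClosed (fun (z : ℂ × ℂ) h => 1 / z.2 * p z.1 h) (fun k z => 1 / z.2 * pc k z.1)
      (sweptRegion X (disc₀ pc qc) U x₀ sq θ α V R) (θ - Real.pi / 2) (θ + Real.pi / 2) S)
    (hqV : GevreyClosed (fun (z : ℂ × ℂ) h => 1 / disc₀ pc qc z.1 * q z.1 h)
      (fun k z => 1 / disc₀ pc qc z.1 * qc k z.1)
      (sweptRegion X (disc₀ pc qc) U x₀ sq θ α V R) (θ - Real.pi / 2) (θ + Real.pi / 2) S)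
    {ρ r : ℝ} {χ σ : ℂ → ℂ} (hr : 0 < r) (hrρ : r < ρ)
    (h : IsHolFlow X (disc₀ pc qc) (((α : ℤ) : ℂ) * Complex.exp (θ * Complex.I)) (halfStrip ρ) χ σ)
    (hb : ∀ z ∈ Metric.ball (0 : ℂ) ρ, χ z ∈ V ∧ σ z = sq (χ z)) :
    (∃ B : ℝ, ∀ z ∈ halfStrip r, ‖deriv σ z / σ z‖ ≤ B) ∧
    (∃ δ > 0, borelDisc θ δ ⊆ S ∧ GevreyBounds (fun z h => 1 / σ z * p (χ z) h)
      (fun k z => 1 / σ z * pc k (χ z)) (halfStrip r) (borelDisc θ δ)) ∧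
    (∃ δ > 0, borelDisc θ δ ⊆ S ∧ GevreyBounds (fun z h => 1 / disc₀ pc qc (χ z) * q (χ z) h)
      (fun k z => 1 / disc₀ pc qc (χ z) * qc k (χ z)) (halfStrip r) (borelDisc θ δ)) := by
  set D := disc₀ pc qc with hD
  set e := ((α : ℤ) : ℂ) * Complex.exp (θ * Complex.I) with he
  have hρ : 0 < ρ := hr.trans hrρ
  have he1 : ‖e‖ = 1 := norm_direction θ α
  have he0 : e ≠ 0 := fun h0 => by rw [h0, norm_zero] at he1; exact zero_ne_one he1
  obtain ⟨hχd, hσd⟩ := h.differentiableOn he0 (isOpen_halfStrip ρ)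
  have hprim := H.primitive_comp hρ h fun z hz => ⟨hVU (hb z hz).1, (hb z hz).2⟩
  set c₁ := (((α : ℤ) : ℂ) * Complex.exp (-(θ * Complex.I)) * primitive U x₀ sq (χ 0)).re with hc₁
  -- Write z = u + t with u in the initial disc. Since α e^{-iθ} times the direction of the ray is
  -- 1, the half-plane condition of the swept region becomes Re z + c₁ > R.
  have hswept : ∀ z ∈ halfStrip ρ, R - c₁ < z.re → (χ z, σ z) ∈ sweptRegion X D U x₀ sq θ α V R := by
    rintro z ⟨t, ht, hzt⟩ hre
    have hu : z - t ∈ Metric.ball (0 : ℂ) ρ := by simpa using hzt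
    refine ⟨χ (z - t), (hb _ hu).1, _, _, h.isCompleteRay hu (hb _ hu).2, t, ht, ?_, by simp⟩
    rw [hprim _ hu]
    have e1 : ((α : ℤ) : ℂ) * Complex.exp (-(θ * Complex.I)) * e = 1 := by
      rw [he]
      have h1 := units_mul_self_cast α
      have h2 : Complex.exp (-(θ * Complex.I)) * Complex.exp (θ * Complex.I) = 1 := by
        rw [← Complex.exp_add]; simp
      linear_combination (Complex.exp (-(θ * Complex.I)) * Complex.exp (θ * Complex.I)) * h1 + h2
    have e2 : ((α : ℤ) : ℂ) * Complex.exp (-(θ * Complex.I)) *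
        (primitive U x₀ sq (χ 0) + e * (z - t) + e * t) =
        ((α : ℤ) : ℂ) * Complex.exp (-(θ * Complex.I)) * primitive U x₀ sq (χ 0) + z := by
      linear_combination z * e1
    rw [e2, Complex.add_re]
    linarith
  have hσc : ∀ z ∈ halfStrip ρ, ContinuousAt σ z := fun z hz =>
    (hσd.differentiableAt ((isOpen_halfStrip ρ).mem_nhds hz)).continuousAt
  have hχc : ∀ z ∈ halfStrip ρ, ContinuousAt χ z := fun z hz =>
    (hχd.differentiableAt ((isOpen_halfStrip ρ).mem_nhds hz)).continuousAt
  -- Differentiating σ² = D ∘ χ identifies σ'/σ with the quantity bounded in the first hypothesis,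
  -- up to the unimodular direction.
  have hL : ∀ z ∈ halfStrip ρ, deriv σ z / σ z = e * (1 / σ z * (deriv D (χ z) / (2 * D (χ z)))) := by
    intro z hz
    have hσz := (hσd.differentiableAt ((isOpen_halfStrip ρ).mem_nhds hz)).hasDerivAt
    have hDz := (H.disc_differentiableOn.differentiableAt (H.hX.mem_nhds (h.mem z hz))).hasDerivAt
    have d1 := hσz.fun_pow 2
    have d2 := (hDz.comp z (h.deriv z hz)).congr_of_eventuallyEq (f₁ := fun w => σ w ^ 2) (by
      filter_upwards [(isOpen_halfStrip ρ).mem_nhds hz] with w hw using h.sq w hw)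
    have := d1.unique d2
    have hne := h.ne z hz
    rw [← h.sq z hz]
    rw [← hD] at this
    field_simp at this ⊢
    simp only [Nat.cast_ofNat] at this
    linear_combination this
  refine ⟨exists_bound_halfStrip (T := R - c₁) hrρ ?_ ?_, ?_, ?_⟩
  · exact (hσd.deriv (isOpen_halfStrip ρ)).continuousOn.div hσd.continuousOn h.ne
  · obtain ⟨B, hB⟩ := hB
    refine ⟨B, fun z hz hT => ?_⟩
    rw [hL z hz, norm_mul, he1, one_mul]
    exact hB (χ z, σ z) (hswept z hz hT)
  -- The compact part of the half-strip uses the locally uniform asymptotics on X along the large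
  -- arc; the end at infinity uses the uniform asymptotics on the swept region.
  · refine exists_gevreyBounds_halfStrip (T := R - c₁) hrρ (fun z hz =>
      exists_gevreyBounds_nhds H.hpA H.hθ (w := fun z => 1 / σ z) (h.mem z hz) (hχc z hz)
        (continuousAt_const.div (hσc z hz) (h.ne z hz))) ?_
    obtain ⟨δ, hδ, hsub, hG⟩ := hpV.exists_bounds (half_plane_mem θ)
    exact ⟨δ, hδ, hsub, hG.comp_left (g := fun z => (χ z, σ z)) fun z hz => hswept z hz.1 hz.2⟩
  · refine exists_gevreyBounds_halfStrip (T := R - c₁) hrρ (fun z hz =>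
      exists_gevreyBounds_nhds H.hqA H.hθ (w := fun z => 1 / D (χ z)) (h.mem z hz) (hχc z hz) ?_) ?_
    · have hDc := (H.disc_differentiableOn.differentiableAt (H.hX.mem_nhds (h.mem z hz))).continuousAt
      refine continuousAt_const.div (hDc.comp (hχc z hz)) ?_
      change D (χ z) ≠ 0
      rw [← h.sq z hz]
      exact pow_ne_zero _ (h.ne z hz)
    · obtain ⟨δ, hδ, hsub, hG⟩ := hqV.exists_bounds (half_plane_mem θ)
      exact ⟨δ, hδ, hsub, hG.comp_left (g := fun z => (χ z, σ z)) fun z hz => hswept z hz.1 hz.2⟩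


/-! ### The Riccati equation in the Liouville coordinate -/

variable {X S : Set ℂ} {a b : ℝ} {p q : ℂ → ℂ → ℂ} {pc qc : ℕ → ℂ → ℂ} {θ : ℝ}
  {U : Set ℂ} {x₀ : ℂ} {sq : ℂ → ℂ}

/-- The first coefficient of the Riccati equation in the Liouville coordinate. -/
def stripP (p : ℂ → ℂ → ℂ) (θ : ℝ) (α : ℤˣ) (χ σ : ℂ → ℂ) (z h : ℂ) : ℂ :=
  ((α : ℤ) : ℂ) * (1 / σ z * p (χ z) (Complex.exp (θ * Complex.I) * h)) + h * (deriv σ z / σ z)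

/-- The last summand is present only for k = 1 and comes from h σ'/σ, produced by differentiating
the factor 1/σ in the rescaled unknown. Its nested form is the one returned by `GevreyBounds.h_mul`
applied to `gevreyBounds_const`. -/
def stripPc (pc : ℕ → ℂ → ℂ) (θ : ℝ) (α : ℤˣ) (χ σ : ℂ → ℂ) (k : ℕ) (z : ℂ) : ℂ :=
  ((α : ℤ) : ℂ) * (Complex.exp (θ * Complex.I) ^ k * (1 / σ z * pc k (χ z))) +
    if k = 0 then 0 else if k - 1 = 0 then deriv σ z / σ z else 0

/-- The zeroth-order coefficient of the Riccati equation in the Liouville coordinate. -/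
def stripQ (q : ℂ → ℂ → ℂ) (D : ℂ → ℂ) (θ : ℝ) (χ : ℂ → ℂ) (z h : ℂ) : ℂ :=
  1 / D (χ z) * q (χ z) (Complex.exp (θ * Complex.I) * h)

def stripQc (qc : ℕ → ℂ → ℂ) (D : ℂ → ℂ) (θ : ℝ) (χ : ℂ → ℂ) (k : ℕ) (z : ℂ) : ℂ :=
  Complex.exp (θ * Complex.I) ^ k * (1 / D (χ z) * qc k (χ z))

/-- The formal Riccati solution in the Liouville coordinate. -/
theorem Setting.formalRoot_strip (H : Setting X S a b p q pc qc θ U x₀ sq) {α : ℤˣ} {Ω : Set ℂ}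
    {χ σ : ℂ → ℂ} (hΩ : IsOpen Ω)
    (h : IsHolFlow X (disc₀ pc qc) (((α : ℤ) : ℂ) * Complex.exp (θ * Complex.I)) Ω χ σ)
    (hb : ∀ z ∈ Ω, χ z ∈ U ∧ σ z = sq (χ z)) (k : ℕ) :
    ∀ z ∈ Ω, ((α : ℤ) : ℂ) / σ z * Complex.exp (θ * Complex.I) ^ k *
        formalRoot pc qc sq α k (χ z) =
      formalRoot (stripPc pc θ α χ σ) (stripQc qc (disc₀ pc qc) θ χ) (fun _ => 1) 1 k z := by
  have hα := units_mul_self_cast α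
  have hα0 := units_cast_ne_zero α
  set A : ℂ := ((α : ℤ) : ℂ) with hA
  set κ : ℂ := Complex.exp (θ * Complex.I) with hκ
  have hκ0 : κ ≠ 0 := Complex.exp_ne_zero _
  obtain ⟨-, hσd⟩ := h.differentiableOn (mul_ne_zero hα0 hκ0) hΩ
  have hroot := formalRoot_differentiableOn (pc := pc) (qc := qc) (sq := sq) α H.hU
    (fun k => (H.hpc k).mono H.hUX) (fun k => (H.hqc k).mono H.hUX) H.hsq fun x hx => H.sq_ne_zero hx
  -- The rescaled coefficients are shown to obey the recursion with the transformed coefficients and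
  -- leading term for discriminant 1 and sign +; the formal solution being unique, they are the
  -- formal root.
  refine formalRoot_unique (c := fun k z => A / σ z * κ ^ k * formalRoot pc qc sq α k (χ z))
    hΩ (fun _ _ => one_ne_zero) (fun z hz => ?_) (fun n z hz => ?_) k
  · have hσ := h.ne z hz
    simp only [stripPc, if_true, pow_zero, Units.val_one, Int.cast_one, ← hA]
    rw [formalRoot_zero, (hb z hz).2]
    rw [(hb z hz).2] at hσ
    rw [← hA]
    field_simp
    linear_combination (sq (χ z)) * hα
  · have hσ := h.ne z hz
    set s : ℕ → ℂ := fun k => formalRoot pc qc sq α k (χ z) with hs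
    set L : ℂ := deriv σ z / σ z with hL
    have hσz := (hσd.differentiableAt (hΩ.mem_nhds hz)).hasDerivAt
    have hsz := ((hroot n).differentiableAt (H.hU.mem_nhds (hb z hz).1)).hasDerivAt.comp z
      (h.deriv z hz)
    have hd : HasDerivAt (fun z => A / σ z * κ ^ n * formalRoot pc qc sq α n (χ z))
        (-(A * deriv σ z) / σ z ^ 2 * κ ^ n * s n + A / σ z * κ ^ n *
          (deriv (formalRoot pc qc sq α n) (χ z) * (A * κ / σ z))) z := by
      have h1 := (((hasDerivAt_const z A).fun_div hσz hσ).mul_const (κ ^ n)).fun_mul hsz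
      refine h1.congr_deriv ?_
      simp only [hs, zero_mul, zero_sub, Function.comp_apply]
    rw [hd.deriv, formalRoot_riccati pc qc α (H.sq_ne_zero (hb z hz).1) n]
    have e1 : ∑ i ∈ Finset.range (n + 2), (A / σ z * κ ^ i * formalRoot pc qc sq α i (χ z)) *
        (A / σ z * κ ^ (n + 1 - i) * formalRoot pc qc sq α (n + 1 - i) (χ z)) =
        κ ^ (n + 1) / σ z ^ 2 * ∑ i ∈ Finset.range (n + 2), s i * s (n + 1 - i) := by
      rw [Finset.mul_sum]
      refine Finset.sum_congr rfl fun i hi => ?_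
      rw [Finset.mem_range] at hi
      have : κ ^ (n + 1) = κ ^ i * κ ^ (n + 1 - i) := by rw [← pow_add]; congr 1; omega
      rw [this]
      field_simp
      linear_combination (s i * s (n + 1 - i)) * hα
    have e2 : ∑ i ∈ Finset.range (n + 2), stripPc pc θ α χ σ i z *
        (A / σ z * κ ^ (n + 1 - i) * formalRoot pc qc sq α (n + 1 - i) (χ z)) =
        κ ^ (n + 1) / σ z ^ 2 * ∑ i ∈ Finset.range (n + 2), pc i (χ z) * s (n + 1 - i) +
          L * (A / σ z * κ ^ n * s n) := by
      simp only [stripPc, add_mul, Finset.sum_add_distrib]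
      congr 1
      · rw [Finset.mul_sum]
        refine Finset.sum_congr rfl fun i hi => ?_
        rw [Finset.mem_range] at hi
        have : κ ^ (n + 1) = κ ^ i * κ ^ (n + 1 - i) := by rw [← pow_add]; congr 1; omega
        rw [this, ← hA, ← hκ]
        field_simp
        linear_combination (pc i (χ z) * s (n + 1 - i)) * hα
      · rw [Finset.sum_eq_single 1]
        · simp [hs, hL]
        · intro i _ hi
          rcases Nat.eq_zero_or_pos i with h0 | h0
          · simp [h0]
          · have : i - 1 ≠ 0 := by omega
            simp [this]
        · intro h1
          exact absurd (Finset.mem_range.2 (by omega)) h1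
    rw [e1, e2]
    have e3 : stripQc qc (disc₀ pc qc) θ χ (n + 1) z = κ ^ (n + 1) / σ z ^ 2 * qc (n + 1) (χ z) := by
      simp only [stripQc]
      rw [← h.sq z hz, ← hκ]; ring
    rw [e3]
    generalize ∑ i ∈ Finset.range (n + 2), s i * s (n + 1 - i) = T₁
    generalize ∑ i ∈ Finset.range (n + 2), pc i (χ z) * s (n + 1 - i) = T₂
    rw [hL]
    field_simp
    linear_combination (κ * κ ^ n * (T₁ - T₂ + qc (n + 1) (χ z))) * hα

/-- Near every point, there is a characteristic root that is asymptotic to the formal one. -/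
theorem Setting.exists_local_root (H : Setting X S a b p q pc qc θ U x₀ sq) {α : ℤˣ}
    (Hα : Hypotheses X S p q pc qc U x₀ sq θ α) {x₁ : ℂ} (hx₁ : x₁ ∈ U) :
    ∃ r > 0, Metric.ball x₁ r ⊆ U ∧ ∃ δ > 0, borelDisc θ δ ⊆ S ∧ ∃ s : ℂ → ℂ → ℂ,
      DifferentiableOn ℂ (fun z : ℂ × ℂ => s z.1 z.2) (Metric.ball x₁ r ×ˢ borelDisc θ δ) ∧
      (∀ x ∈ Metric.ball x₁ r, ∀ h ∈ borelDisc θ δ,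
        HasDerivAt (fun x => s x h) ((s x h * s x h - p x h * s x h + q x h) / h) x) ∧
      GevreyBounds s (formalRoot pc qc sq α) (Metric.ball x₁ r) (borelDisc θ δ) := by
  obtain ⟨V, R, hV, hxV, hVU, -, hB, hpV, hqV⟩ := Hα.bounds x₁ hx₁
  obtain ⟨ρ, hρ, χ, σ, hflow, hχ0, hbV⟩ := exists_strip H.hX H.disc_differentiableOn H.hU H.hUX H.hsq
    H.hsq2 H.hreg Hα.complete hV hxV hVU
  have hbU : ∀ z ∈ Metric.ball (0 : ℂ) ρ, χ z ∈ U ∧ σ z = sq (χ z) := fun z hz =>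
    ⟨hVU (hbV z hz).1, (hbV z hz).2⟩
  -- The flow lives on the half-strip of radius ρ, uniform bounds hold on radius ρ/2, and the
  -- Riccati solution is found on radius ρ/4: each stage needs room around the next.
  obtain ⟨⟨B, hLB⟩, ⟨δ₁, hδ₁, hS₁, hG₁⟩, ⟨δ₂, hδ₂, hS₂, hG₂⟩⟩ := H.exists_strip_bounds hVU hB hpV hqV
    (r := ρ / 2) (by linarith) (by linarith) hflow hbV
  have hprim := H.primitive_comp hρ hflow hbU
  have hα := units_mul_self_cast α
  have hα0 := units_cast_ne_zero α
  have hα1 := norm_units_cast α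
  have hformal := fun k => H.formalRoot_strip (α := α) Metric.isOpen_ball
    (Ω := Metric.ball 0 ρ) (χ := χ) (σ := σ)
    ⟨fun z hz => hflow.mem z (ball_zero_subset_halfStrip ρ hz),
      fun z hz => hflow.ne z (ball_zero_subset_halfStrip ρ hz),
      fun z hz => hflow.sq z (ball_zero_subset_halfStrip ρ hz),
      hflow.cont.mono (ball_zero_subset_halfStrip ρ),
      fun z hz => hflow.deriv z (ball_zero_subset_halfStrip ρ hz)⟩ hbU k
  set D := disc₀ pc qc with hD
  set A : ℂ := ((α : ℤ) : ℂ) with hA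
  set κ : ℂ := Complex.exp (θ * Complex.I) with hκ
  have hκ0 : κ ≠ 0 := Complex.exp_ne_zero _
  have hκ1 : ‖κ‖ = 1 := Complex.norm_exp_ofReal_mul_I θ
  have hκ' : Complex.exp (-(θ * Complex.I)) = κ⁻¹ := Complex.exp_neg _
  have he0 : A * κ ≠ 0 := mul_ne_zero hα0 hκ0
  obtain ⟨hχd, hσd⟩ := hflow.differentiableOn he0 (isOpen_halfStrip ρ)
  set δ₃ := min δ₁ δ₂ with hδ₃
  have hδ₃0 : 0 < δ₃ := lt_min hδ₁ hδ₂
  have hG₁' := hG₁.mono subset_rfl (borelDisc_mono hδ₃0 (min_le_left δ₁ δ₂))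
  have hG₂' := hG₂.mono subset_rfl (borelDisc_mono hδ₃0 (min_le_right δ₁ δ₂))
  have hS₃ : borelDisc θ δ₃ ⊆ S := (borelDisc_mono hδ₃0 (min_le_left δ₁ δ₂)).trans hS₁
  have hsub : halfStrip (ρ / 2) ⊆ halfStrip ρ := halfStrip_mono (by linarith)
  have hχ2 := hχd.mono hsub
  have hσ2 := hσd.mono hsub
  have hDχ0 : ∀ z ∈ halfStrip ρ, D (χ z) ≠ 0 := fun z hz => by
    rw [← hflow.sq z hz]; exact pow_ne_zero _ (hflow.ne z hz)
  have hDχ : DifferentiableOn ℂ (fun z => D (χ z)) (halfStrip (ρ / 2)) :=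
    H.disc_differentiableOn.comp hχ2 fun z hz => hflow.mem z (hsub hz)
  have hLd : DifferentiableOn ℂ (fun z => deriv σ z / σ z) (halfStrip (ρ / 2)) :=
    ((hσd.deriv (isOpen_halfStrip ρ)).mono hsub).fun_div hσ2 fun z hz => hflow.ne z (hsub hz)
  have hiσ : DifferentiableOn ℂ (fun z => 1 / σ z) (halfStrip (ρ / 2)) :=
    (differentiableOn_const 1).fun_div hσ2 fun z hz => hflow.ne z (hsub hz)
  have hiD : DifferentiableOn ℂ (fun z => 1 / D (χ z)) (halfStrip (ρ / 2)) :=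
    (differentiableOn_const 1).fun_div hDχ fun z hz => hDχ0 z (hsub hz)
  have hmaps : ∀ z ∈ halfStrip (ρ / 2) ×ˢ borelDisc 0 δ₃, (χ z.1, κ * z.2) ∈ X ×ˢ S := fun z hz =>
    ⟨hflow.mem _ (hsub hz.1), hS₃ (mul_mem_borelDisc hz.2)⟩
  have hpair : DifferentiableOn ℂ (fun z : ℂ × ℂ => (χ z.1, κ * z.2))
      (halfStrip (ρ / 2) ×ˢ borelDisc 0 δ₃) :=
    (hχ2.comp differentiableOn_fst fun z hz => hz.1).prodMk (differentiableOn_snd.const_mul κ)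
  have lift : ∀ {f : ℂ → ℂ}, DifferentiableOn ℂ f (halfStrip (ρ / 2)) →
      DifferentiableOn ℂ (fun z : ℂ × ℂ => f z.1) (halfStrip (ρ / 2) ×ˢ borelDisc 0 δ₃) := fun hf =>
    hf.comp differentiableOn_fst fun z hz => hz.1
  obtain ⟨δ₄, hδ₄, hδ₄3, y, hyd, hyode, hyG⟩ := exists_riccati_gevrey
    (P := stripP p θ α χ σ) (Q := stripQ q D θ χ) (Pc := stripPc pc θ α χ σ) (Qc := stripQc qc D θ χ)
    (r := ρ / 4) (ρ := ρ / 2) hδ₃0 (by linarith) (by linarith)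
    ((((lift hiσ).mul (H.hp.comp hpair hmaps)).const_mul A).add
      (differentiableOn_snd.mul (lift hLd)))
    ((lift hiD).mul (H.hq.comp hpair hmaps))
    (fun k => by
      refine (((hiσ.fun_mul ((H.hpc k).comp hχ2 fun z hz => hflow.mem z (hsub hz))).const_mul
        (κ ^ k)).const_mul A).fun_add ?_
      split_ifs
      · exact differentiableOn_const _
      · exact hLd
      · exact differentiableOn_const _)
    (fun k => (hiD.fun_mul ((H.hqc k).comp hχ2 fun z hz => hflow.mem z (hsub hz))).const_mul (κ ^ k))
    (((hG₁'.rotate hκ1 fun h hh => mul_mem_borelDisc hh).const_mul (a := fun _ => A) (A := 1)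
      fun _ _ => hα1.le).add ((gevreyBounds_const hLB).h_mul fun h hh =>
        (norm_lt_of_mem_borelDisc hδ₃0 hh).le))
    (hG₂'.rotate hκ1 fun h hh => mul_mem_borelDisc hh)
    -- The normalisation of the discriminant to 1: p₀²/σ² - 4q₀/D = D/σ² at the point χ z.
    (fun z hz => by
      have h1 := hflow.ne z (hsub hz)
      have h2 := hflow.sq z (hsub hz)
      have h3 : D (χ z) = pc 0 (χ z) ^ 2 - 4 * qc 0 (χ z) := rfl
      simp only [disc₀, stripPc, stripQc, if_true, pow_zero, one_mul, add_zero]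
      rw [← h2, ← hA]
      field_simp
      rw [h2, h3]
      linear_combination (pc 0 (χ z) ^ 2) * hα)
  -- the inverse of `χ`
  set Φ := primitive U x₀ sq with hΦ
  have hΦd := (primitive_spec H.hU H.hUs H.hsq H.hx₀).2
  set u : ℂ → ℂ := fun x => (Φ x - Φ x₁) / (A * κ) with hu
  have h0ρ : (0 : ℂ) ∈ Metric.ball (0 : ℂ) ρ := Metric.mem_ball_self hρ
  have h0s := ball_zero_subset_halfStrip ρ h0ρ
  -- χ has nonzero derivative at 0, so the image of a small disc is a neighbourhood of x₁. On it the
  -- inverse of χ is the explicit function u, because Φ(χ z) is affine in z.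
  have hstrict : HasStrictDerivAt χ (A * κ / σ 0) 0 := by
    have := (hχd.analyticAt ((isOpen_halfStrip ρ).mem_nhds h0s)).hasStrictDerivAt
    rwa [(hflow.deriv 0 h0s).deriv] at this
  have himg : χ '' Metric.ball 0 (ρ / 4) ∈ 𝓝 x₁ := by
    rw [← hχ0, ← hstrict.map_nhds_eq (div_ne_zero he0 (hflow.ne 0 h0s))]
    exact image_mem_map (Metric.ball_mem_nhds 0 (by linarith))
  have hsqc : ContinuousAt sq x₁ := (H.hsq.differentiableAt (H.hU.mem_nhds hx₁)).continuousAt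
  have hev : ∀ᶠ x in 𝓝 x₁, x ∈ χ '' Metric.ball 0 (ρ / 4) ∧ x ∈ U ∧ ‖sq x‖ ≤ ‖sq x₁‖ + 1 :=
    Filter.Eventually.and himg ((H.hU.eventually_mem hx₁).and
      (hsqc.norm.eventually_le_const (lt_add_one ‖sq x₁‖)))
  obtain ⟨r, hr, hrsub⟩ := Metric.eventually_nhds_iff_ball.1 hev
  have hux : ∀ x ∈ Metric.ball x₁ r,
      u x ∈ Metric.ball (0 : ℂ) (ρ / 4) ∧ χ (u x) = x ∧ σ (u x) = sq x := by
    intro x hx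
    obtain ⟨z, hz, rfl⟩ := (hrsub x hx).1
    have hz' : z ∈ Metric.ball (0 : ℂ) ρ := Metric.ball_subset_ball (by linarith) hz
    have huz : u (χ z) = z := by
      simp only [hu]
      rw [hprim z hz', hχ0]
      field_simp; ring
    rw [huz]
    exact ⟨hz, rfl, (hbU z hz').2⟩
  have hrU : Metric.ball x₁ r ⊆ U := fun x hx => (hrsub x hx).2.1
  have hud : ∀ x ∈ Metric.ball x₁ r, HasDerivAt u (sq x / (A * κ)) x := fun x hx =>
    ((hΦd x (hrU hx)).sub_const _).div_const _
  have hmem4 : ∀ {x h : ℂ}, x ∈ Metric.ball x₁ r → h ∈ borelDisc θ δ₄ →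
      u x ∈ halfStrip (ρ / 4) ∧ κ⁻¹ * h ∈ borelDisc 0 δ₄ := fun hx hh =>
    ⟨ball_zero_subset_halfStrip _ (hux _ hx).1, by rw [← hκ']; exact mul_mem_borelDisc_zero hh⟩
  -- The normalisation is undone: s = α √D₀ · y, evaluated at the Liouville coordinate of x and at
  -- the rotated parameter e^{-iθ}ħ.
  refine ⟨r, hr, hrU, δ₄, hδ₄, (borelDisc_mono hδ₄ hδ₄3).trans hS₃,
    fun x h => A * sq x * y (u x) (κ⁻¹ * h), ?_, ?_, ?_⟩
  · have hud' : DifferentiableOn ℂ u (Metric.ball x₁ r) := fun x hx =>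
      (hud x hx).differentiableAt.differentiableWithinAt
    refine DifferentiableOn.mul ?_ ?_
    · exact ((H.hsq.mono hrU).const_mul A).comp differentiableOn_fst fun z hz => hz.1
    · exact hyd.comp (f := fun z : ℂ × ℂ => (u z.1, κ⁻¹ * z.2))
        ((hud'.comp differentiableOn_fst fun z hz => hz.1).prodMk
          (differentiableOn_snd.const_mul κ⁻¹)) fun z hz => hmem4 hz.1 hz.2
  · intro x hx h hh
    have hh0 := ne_zero_of_mem_borelDisc hδ₄ hh
    obtain ⟨hm1, hm2⟩ := hmem4 hx hh
    obtain ⟨hz, hχx, hσx⟩ := hux x hx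
    have hsqx := H.sq_ne_zero (hrU hx)
    have hsqd := (H.hsq.differentiableAt (H.hU.mem_nhds (hrU hx))).hasDerivAt
    have d1 := (hyode _ hm1 _ hm2).comp x (hud x hx)
    have d2 := (hsqd.const_mul A).fun_mul d1
    refine d2.congr_deriv ?_
    have hzρ : u x ∈ Metric.ball (0 : ℂ) ρ := Metric.ball_subset_ball (by linarith) hz
    have hσ' : deriv σ (u x) = deriv sq x * (A * κ / sq x) := by
      have d3 : HasDerivAt σ (deriv sq x * (A * κ / sq x)) (u x) := by
        have d4 : HasDerivAt sq (deriv sq x) (χ (u x)) := by rw [hχx]; exact hsqd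
        have d5 := d4.comp (u x) (hflow.deriv _ (ball_zero_subset_halfStrip ρ hzρ))
        rw [hσx] at d5
        refine d5.congr_of_eventuallyEq ?_
        filter_upwards [Metric.isOpen_ball.mem_nhds hzρ] with w hw using (hbU w hw).2
      exact d3.deriv
    have hP : stripP p θ α χ σ (u x) (κ⁻¹ * h) =
        A * (1 / sq x * p x h) + κ⁻¹ * h * (deriv sq x * (A * κ / sq x) / sq x) := by
      rw [stripP, hσ', hσx, hχx, ← hκ, mul_inv_cancel_left₀ hκ0]
    have hQ : stripQ q D θ χ (u x) (κ⁻¹ * h) = 1 / sq x ^ 2 * q x h := by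
      rw [stripQ, hχx, ← hκ, mul_inv_cancel_left₀ hκ0, H.hsq2 x (hrU hx)]
    rw [hP, hQ]
    simp only [Function.comp_apply]
    generalize y (u x) (κ⁻¹ * h) = Y
    field_simp
    linear_combination (-(sq x * sq x * Y * Y)) * hα
  · have g1 := (hyG.rotate (κ := κ⁻¹) (S' := borelDisc θ δ₄) (by rw [norm_inv, hκ1, inv_one])
      fun h hh => by rw [← hκ']; exact mul_mem_borelDisc_zero hh).comp_left (g := u)
        (W := Metric.ball x₁ r) fun x hx => ball_zero_subset_halfStrip _ (hux x hx).1
    refine (g1.const_mul (a := fun x => A * sq x) (A := ‖sq x₁‖ + 1) fun x hx => ?_).congr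
      (fun x _ h _ => rfl) fun k x hx => ?_
    · rw [norm_mul, hα1, one_mul]
      exact (hrsub x hx).2.2
    · obtain ⟨hz, hχx, hσx⟩ := hux x hx
      have hsqx := H.sq_ne_zero (hrU hx)
      rw [← hformal k (u x) (Metric.ball_subset_ball (by linarith) hz), hχx, hσx, inv_pow]
      have : κ ^ k ≠ 0 := pow_ne_zero _ hκ0
      field_simp
      linear_combination (-formalRoot pc qc sq α k x) * hα


/-! ### The linear equation at fixed parameter, and primitives with parameter -/

/-- The matrix of the first-order system equivalent to `ψ'' + P ψ' + Q ψ = 0`. -/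
def odeMatrix (P Q : ℂ) : ℂ × ℂ →L[ℂ] ℂ × ℂ :=
  (ContinuousLinearMap.snd ℂ ℂ ℂ).prod 0
    - P • (0 : ℂ × ℂ →L[ℂ] ℂ).prod (ContinuousLinearMap.snd ℂ ℂ ℂ)
    - Q • (0 : ℂ × ℂ →L[ℂ] ℂ).prod (ContinuousLinearMap.fst ℂ ℂ ℂ)

theorem odeMatrix_apply (P Q : ℂ) (v : ℂ × ℂ) :
    odeMatrix P Q v = (v.2, -P * v.2 - Q * v.1) := by
  ext <;> simp [odeMatrix]

/-- Solutions of the equation at a fixed value of `ħ` are determined by their Cauchy data. -/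
theorem solution_unique {U : Set ℂ} (hU : IsOpen U) (hUc : IsPreconnected U) {P Q : ℂ → ℂ}
    (hP : DifferentiableOn ℂ P U) (hQ : DifferentiableOn ℂ Q U) {h : ℂ} (hh : h ≠ 0)
    {y z : ℂ → ℂ} (hyd : DifferentiableOn ℂ y U) (hzd : DifferentiableOn ℂ z U)
    (hy : ∀ x ∈ U, h ^ 2 * deriv (deriv y) x + P x * h * deriv y x + Q x * y x = 0)
    (hz : ∀ x ∈ U, h ^ 2 * deriv (deriv z) x + P x * h * deriv z x + Q x * z x = 0)
    {x₁ : ℂ} (hx₁ : x₁ ∈ U) (h0 : y x₁ = z x₁) (h1 : deriv y x₁ = deriv z x₁) :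
    ∀ x ∈ U, y x = z x := by
  have key : ∀ y : ℂ → ℂ, DifferentiableOn ℂ y U →
      (∀ x ∈ U, h ^ 2 * deriv (deriv y) x + P x * h * deriv y x + Q x * y x = 0) →
      ∀ x ∈ U, HasDerivAt (fun x => (y x, deriv y x))
        (odeMatrix (P x / h) (Q x / h ^ 2) (y x, deriv y x)) x := by
    intro y hyd hy x hx
    have e1 := (hyd.differentiableAt (hU.mem_nhds hx)).hasDerivAt
    have e2 := ((hyd.deriv hU).differentiableAt (hU.mem_nhds hx)).hasDerivAt
    refine (e1.prodMk e2).congr_deriv ?_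
    rw [odeMatrix_apply]
    refine Prod.ext rfl ?_
    have := hy x hx
    simp only
    field_simp
    linear_combination this
  have hA : ContinuousOn (fun x => odeMatrix (P x / h) (Q x / h ^ 2)) U := by
    unfold odeMatrix
    have h1 := hP.continuousOn
    have h2 := hQ.continuousOn
    fun_prop (disch := simp [hh])
  have := linear_ode_unique hU hUc hA (y := fun x => (y x, deriv y x) - (z x, deriv z x))
    (fun x hx => ((key y hyd hy x hx).sub (key z hzd hz x hx)).congr_deriv
      (map_sub (odeMatrix (P x / h) (Q x / h ^ 2)) _ _).symm) hx₁ (by simp [h0, h1])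
  intro x hx
  have := congrArg Prod.fst (this x hx)
  simpa [sub_eq_zero] using this

/-- Primitives of functions that depend holomorphically on a parameter. -/
theorem exists_primitive_parameter {s : ℂ → ℂ → ℂ} {U H : Set ℂ} (hU : IsOpen U)
    (hUs : IsSimplyConnected U) (hH : IsOpen H)
    (hs : DifferentiableOn ℂ (fun z : ℂ × ℂ => s z.1 z.2) (U ×ˢ H)) {x₀ : ℂ} (hx₀ : x₀ ∈ U) :
    ∃ F : ℂ → ℂ → ℂ, (∀ h ∈ H, F x₀ h = 0) ∧
      (∀ h ∈ H, ∀ x ∈ U, HasDerivAt (fun x => F x h) (s x h) x) ∧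
      DifferentiableOn ℂ (fun z : ℂ × ℂ => F z.1 z.2) (U ×ˢ H) := by
  -- A primitive is the first component of the linear system (F, 1)' = (s · 1, 0), so holomorphic
  -- dependence on the parameter follows from the linear theory.
  set E₁ : ℂ × ℂ →L[ℂ] ℂ × ℂ := (ContinuousLinearMap.snd ℂ ℂ ℂ).prod 0 with hE₁
  obtain ⟨y, hy0, hy, hyd⟩ := exists_linear_ode_parameter (A := fun x h => s x h • E₁) hU hUs hH
    (hs.smul_const E₁) hx₀ (v := fun _ => ((0 : ℂ), (1 : ℂ))) (differentiableOn_const _)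
  have h2 : ∀ h ∈ H, ∀ x ∈ U, (y x h).2 = 1 := by
    intro h hh x hx
    have hd : ∀ x ∈ U, HasDerivAt (fun x => (y x h).2 - 1)
        ((0 : ℂ →L[ℂ] ℂ) ((y x h).2 - 1)) x := fun x hx => by
      have := ((ContinuousLinearMap.snd ℂ ℂ ℂ).hasFDerivAt.comp_hasDerivAt x (hy h hh x hx)).sub_const 1
      refine this.congr_deriv ?_
      simp [hE₁]
    have hc : IsPreconnected U := hUs.isPathConnected.isConnected.isPreconnected
    have := linear_ode_unique hU hc (A := fun _ => (0 : ℂ →L[ℂ] ℂ)) continuousOn_const hd hx₀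
      (by simp [hy0 h hh]) x hx
    exact sub_eq_zero.1 this
  refine ⟨fun x h => (y x h).1, fun h hh => by simp [hy0 h hh], fun h hh x hx => ?_,
    hyd.fst⟩
  have := (ContinuousLinearMap.fst ℂ ℂ ℂ).hasFDerivAt.comp_hasDerivAt x (hy h hh x hx)
  refine this.congr_deriv ?_
  simp [hE₁, h2 h hh x hx]

theorem isSimplyConnected_ball (x : ℂ) {r : ℝ} (hr : 0 < r) :
    IsSimplyConnected (Metric.ball x r) := by
  have := (convex_ball x r).contractibleSpace ⟨x, Metric.mem_ball_self hr⟩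
  exact SimplyConnectedSpace.ofContractible _


/-! ### WKB exponents and their propagation on a disc -/

variable {X S : Set ℂ} {a b : ℝ} {p q : ℂ → ℂ → ℂ} {pc qc : ℕ → ℂ → ℂ} {θ : ℝ}
  {U : Set ℂ} {x₀ : ℂ} {sq : ℂ → ℂ}

theorem Setting.differentiableOn_formalRoot (H : Setting X S a b p q pc qc θ U x₀ sq) (α : ℤˣ)
    (n : ℕ) : DifferentiableOn ℂ (formalRoot pc qc sq α n) U :=
  formalRoot_differentiableOn (pc := pc) (qc := qc) (sq := sq) α H.hU
    (fun k => (H.hpc k).mono H.hUX) (fun k => (H.hqc k).mono H.hUX) H.hsq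
    (fun _ hx => H.sq_ne_zero hx) n

theorem Setting.primitive_formalRoot (H : Setting X S a b p q pc qc θ U x₀ sq) (α : ℤˣ) (n : ℕ) :
    primitive U x₀ (formalRoot pc qc sq α n) x₀ = 0 ∧ ∀ x ∈ U,
      HasDerivAt (primitive U x₀ (formalRoot pc qc sq α n)) (formalRoot pc qc sq α n x) x :=
  primitive_spec H.hU H.hUs (H.differentiableOn_formalRoot α n) H.hx₀

theorem Setting.isPreconnected (H : Setting X S a b p q pc qc θ U x₀ sq) : IsPreconnected U :=
  H.hUs.isPathConnected.isConnected.isPreconnected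

theorem Setting.differentiableOn_coeff (H : Setting X S a b p q pc qc θ U x₀ sq) {h : ℂ}
    (hh : h ∈ S) : DifferentiableOn ℂ (fun x => p x h) U ∧ DifferentiableOn ℂ (fun x => q x h) U := by
  have e : DifferentiableOn ℂ (fun x : ℂ => (x, h)) U :=
    differentiableOn_id.prodMk (differentiableOn_const h)
  have m : MapsTo (fun x : ℂ => (x, h)) U (X ×ˢ S) := fun x hx => ⟨H.hUX hx, hh⟩
  exact ⟨H.hp.comp e m, H.hq.comp e m⟩

/-- On `V × borelDisc θ δ`, the function `ψ` is the exponential of `g - Φ_α / ħ`, where `g` is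
asymptotic to the exponent of the formal WKB solution. -/
def HasWKBExponent (pc qc : ℕ → ℂ → ℂ) (U : Set ℂ) (x₀ : ℂ) (sq : ℂ → ℂ) (θ : ℝ) (α : ℤˣ)
    (ψ : ℂ → ℂ → ℂ) (V : Set ℂ) (δ : ℝ) : Prop :=
  ∃ g : ℂ → ℂ → ℂ, DifferentiableOn ℂ (fun z : ℂ × ℂ => g z.1 z.2) (V ×ˢ borelDisc θ δ) ∧
    (∀ x ∈ V, ∀ h ∈ borelDisc θ δ,
      ψ x h = Complex.exp (g x h - wkbExponent pc qc U x₀ sq α x / h)) ∧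
    GevreyBounds g (fun k x => -primitive U x₀ (formalRoot pc qc sq α (k + 1)) x) V
      (borelDisc θ δ)

/-- A characteristic root `s` asymptotic to the formal one on a disc determines the asymptotics of
the solution with logarithmic derivative `-s / ħ`, once they are known at one point. -/
theorem Setting.hasWKBExponent_ball (H : Setting X S a b p q pc qc θ U x₀ sq) {α : ℤˣ}
    {x₁ x₂ : ℂ} {r δ : ℝ} (hr : 0 < r) (hrU : Metric.ball x₁ r ⊆ U) (hδ : 0 < δ)
    (hδS : borelDisc θ δ ⊆ S) {s : ℂ → ℂ → ℂ}
    (hsd : DifferentiableOn ℂ (fun z : ℂ × ℂ => s z.1 z.2) (Metric.ball x₁ r ×ˢ borelDisc θ δ))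
    (hs : ∀ x ∈ Metric.ball x₁ r, ∀ h ∈ borelDisc θ δ,
      HasDerivAt (fun x => s x h) ((s x h * s x h - p x h * s x h + q x h) / h) x)
    (hsG : GevreyBounds s (formalRoot pc qc sq α) (Metric.ball x₁ r) (borelDisc θ δ))
    {ψ : ℂ → ℂ → ℂ} (hψ : IsSolution p q U (borelDisc θ δ) ψ) (hx₂ : x₂ ∈ Metric.ball x₁ r)
    (hψ2 : ∀ h ∈ borelDisc θ δ, h * deriv (fun x => ψ x h) x₂ = -s x₂ h * ψ x₂ h)
    (hg : HasWKBExponent pc qc U x₀ sq θ α ψ {x₂} δ) :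
    HasWKBExponent pc qc U x₀ sq θ α ψ (Metric.ball x₁ r) δ := by
  obtain ⟨g₂, hg2d, hg2, hg2G⟩ := hg
  have hB := isOpen_borelDisc (θ := θ) hδ
  have hx₁ : x₁ ∈ Metric.ball x₁ r := Metric.mem_ball_self hr
  obtain ⟨F, hF0, hF, hFd⟩ := exists_primitive_parameter Metric.isOpen_ball
    (isSimplyConnected_ball x₁ hr) hB hsd hx₁
  have hP := H.primitive_formalRoot α
  set P : ℕ → ℂ → ℂ := fun n => primitive U x₀ (formalRoot pc qc sq α n) with hPdef
  have hPhi : wkbExponent pc qc U x₀ sq α = P 0 := rfl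
  have hFG : GevreyBounds F (fun n x => P n x - P n x₁) (Metric.ball x₁ r) (borelDisc θ δ) :=
    hsG.primitive hr hF (fun n x hx => ((hP n).2 x (hrU hx)).sub_const _) hF0 fun n => sub_self _
  -- F = ∫ s has leading coefficient ∫ λ_α, the part divergent after division by ħ. Removing it and
  -- dividing shifts the index by one, which yields exactly the coefficients ∫ s_{k+1} of the
  -- exponent.
  have hLG := hFG.div (zero_notMem_borelDisc hδ)
  set L : ℂ → ℂ → ℂ := fun x h => (F x h - (P 0 x - P 0 x₁)) / h with hL
  have hPd : ∀ n, DifferentiableOn ℂ (P n) U := fun n x hx =>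
    ((hP n).2 x hx).differentiableAt.differentiableWithinAt
  have hne : ∀ z ∈ Metric.ball x₁ r ×ˢ borelDisc θ δ, (z : ℂ × ℂ).2 ≠ 0 := fun z hz =>
    ne_zero_of_mem_borelDisc hδ hz.2
  have hLd : DifferentiableOn ℂ (fun z : ℂ × ℂ => L z.1 z.2) (Metric.ball x₁ r ×ˢ borelDisc θ δ) := by
    have h0 : DifferentiableOn ℂ (fun z : ℂ × ℂ => P 0 z.1) (Metric.ball x₁ r ×ˢ borelDisc θ δ) :=
      (hPd 0).comp differentiableOn_fst fun z hz => hrU hz.1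
    simp only [hL, div_eq_mul_inv]
    exact (hFd.sub (h0.sub_const _)).mul (differentiableOn_snd.fun_inv hne)
  have hsec : DifferentiableOn ℂ (fun z : ℂ × ℂ => ((x₂, z.2) : ℂ × ℂ))
      (Metric.ball x₁ r ×ˢ borelDisc θ δ) := (differentiableOn_const x₂).prodMk differentiableOn_snd
  have hm1 : MapsTo (fun z : ℂ × ℂ => ((x₂, z.2) : ℂ × ℂ)) (Metric.ball x₁ r ×ˢ borelDisc θ δ)
      (Metric.ball x₁ r ×ˢ borelDisc θ δ) := fun z hz => ⟨hx₂, hz.2⟩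
  have hm2 : MapsTo (fun z : ℂ × ℂ => ((x₂, z.2) : ℂ × ℂ)) (Metric.ball x₁ r ×ˢ borelDisc θ δ)
      (({x₂} : Set ℂ) ×ˢ borelDisc θ δ) := fun z hz => ⟨rfl, hz.2⟩
  refine ⟨fun x h => g₂ x₂ h - (L x h - L x₂ h),
    (hg2d.comp hsec hm2).sub (hLd.sub (hLd.comp hsec hm1)), fun x hx h hh => ?_, ?_⟩
  · have hh0 := ne_zero_of_mem_borelDisc hδ hh
    have hpq := H.differentiableOn_coeff (hδS hh)
    have hψd : DifferentiableOn ℂ (fun x => ψ x h) U := fun y hy =>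
      (differentiableAt_fst_section (H.hU.prod hB) hψ.1
        (z := (y, h)) ⟨hy, hh⟩).differentiableWithinAt
    -- The Riccati equation for s makes z a solution of the second-order equation. Its Cauchy data
    -- at x₂ are those of ψ by the assumption on the logarithmic derivative, so z = ψ on the disc.
    set z : ℂ → ℂ := fun x => ψ x₂ h * Complex.exp (-(F x h - F x₂ h) / h) with hz
    have hz1 : ∀ y ∈ Metric.ball x₁ r, HasDerivAt z (-(s y h / h) * z y) y := fun y hy => by
      have := ((((hF h hh y hy).sub_const (F x₂ h)).neg.div_const h).cexp).const_mul (ψ x₂ h)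
      refine this.congr_deriv ?_
      simp only [hz, Pi.neg_apply]; ring
    have hz1' : ∀ y ∈ Metric.ball x₁ r, deriv z =ᶠ[𝓝 y] fun y => -(s y h / h) * z y := fun y hy => by
      filter_upwards [Metric.isOpen_ball.mem_nhds hy] with w hw using (hz1 w hw).deriv
    have huniq := solution_unique Metric.isOpen_ball (convex_ball x₁ r).isPreconnected
      (hpq.1.mono hrU) (hpq.2.mono hrU) hh0 (y := fun x => ψ x h) (z := z) (hψd.mono hrU)
      (fun y hy => (hz1 y hy).differentiableAt.differentiableWithinAt)
      (fun y hy => hψ.2 y (hrU hy) h hh) (fun y hy => ?_) hx₂ (by simp [hz]) ?_ x hx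
    · rw [huniq, hz]
      simp only
      rw [hg2 x₂ rfl h hh, ← Complex.exp_add, hPhi]
      congr 1
      simp only [hL]
      field_simp
      ring
    · have e := (((hs y hy h hh).div_const h).fun_neg.fun_mul (hz1 y hy)).congr_of_eventuallyEq
        (hz1' y hy)
      rw [e.deriv, (hz1 y hy).deriv]
      field_simp
      ring
    · rw [(hz1 x₂ hx₂).deriv]
      have := hψ2 h hh
      have hz2 : z x₂ = ψ x₂ h := by simp [hz]
      rw [hz2]
      field_simp
      linear_combination this
  · have e1 := hg2G.comp_left (g := fun _ : ℂ => x₂) (W := Metric.ball x₁ r) fun _ _ => rfl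
    have e2 := hLG.comp_left (g := fun _ : ℂ => x₂) (W := Metric.ball x₁ r) fun _ _ => hx₂
    refine (e1.sub (hLG.sub e2)).congr (fun _ _ _ _ => rfl) fun n x hx => ?_
    ring

/-- The asymptotics of the logarithmic derivative of a solution with a WKB exponent. -/
theorem Setting.logDeriv_eq (H : Setting X S a b p q pc qc θ U x₀ sq) {α : ℤˣ}
    {V : Set ℂ} {x₂ : ℂ} {δ : ℝ} (hV : IsOpen V) (hx₂ : x₂ ∈ V) (hVU : V ⊆ U) (hδ : 0 < δ)
    {s : ℂ → ℂ → ℂ} (hsd : DifferentiableOn ℂ (s x₂) (borelDisc θ δ))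
    (hsG : GevreyBounds s (formalRoot pc qc sq α) {x₂} (borelDisc θ δ))
    {ψ : ℂ → ℂ → ℂ} (hg : HasWKBExponent pc qc U x₀ sq θ α ψ V δ) :
    ∀ h ∈ borelDisc θ δ, h * deriv (fun x => ψ x h) x₂ = -s x₂ h * ψ x₂ h := by
  obtain ⟨g, hgd, hg, hgG⟩ := hg
  have hB := isOpen_borelDisc (θ := θ) hδ
  have hP := H.primitive_formalRoot α
  obtain ⟨r, hr, hrV⟩ := Metric.isOpen_iff.1 hV x₂ hx₂
  have hgx : ∀ x ∈ V, ∀ h ∈ borelDisc θ δ, DifferentiableAt ℂ (fun y => g y h) x := fun x hx h hh =>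
    differentiableAt_fst_section (hV.prod hB) hgd (z := (x, h)) ⟨hx, hh⟩
  have h1 := hgG.deriv (V' := {x₂}) hr (fun x hx => by rw [hx]; exact hrV)
    (fun h hh x hx => (hgx x hx h hh).differentiableWithinAt)
    (fun n x hx => ((hP (n + 1)).2 x (hVU hx)).neg.differentiableAt.differentiableWithinAt)
  have h2 := h1.h_mul (r := δ) fun h hh => (norm_lt_of_mem_borelDisc hδ hh).le
  have h3 := gevreyBounds_const (S := borelDisc θ δ) (V := ({x₂} : Set ℂ))
    (a := fun x => formalRoot pc qc sq α 0 x) (A := ‖formalRoot pc qc sq α 0 x₂‖)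
    (fun x hx => by rw [hx])
  have h4 := (h3.sub h2).congr (c' := formalRoot pc qc sq α) (fun _ _ _ _ => rfl) (by
    intro n x hx
    rw [mem_singleton_iff] at hx
    subst hx
    rcases n with _ | n
    · simp
    · simp only [Nat.add_one_ne_zero, if_false, Nat.add_sub_cancel]
      rw [((hP (n + 1)).2 x (hVU hx₂)).fun_neg.deriv]
      ring)
  have hdd := differentiableOn_deriv_fst (hV.prod hB) hgd
  have hds : DifferentiableOn ℂ (fun h => formalRoot pc qc sq α 0 x₂ -
      h * deriv (fun y => g y h) x₂) (borelDisc θ δ) :=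
    (differentiableOn_const _).sub (differentiableOn_id.mul
      (hdd.comp (f := fun h : ℂ => (x₂, h)) ((differentiableOn_const x₂).prodMk differentiableOn_id)
        fun h hh => ⟨hx₂, hh⟩))
  -- Both s(x₂, ·) and λ_α - ħ ∂ₓg have the formal root as Gevrey expansion on the same Borel disc,
  -- so Watson's lemma identifies them. This is the step that glues the local roots.
  have key := eq_of_gevreyBounds hδ hsG h4 (x := x₂) rfl hsd hds
  intro h hh
  have hh0 := ne_zero_of_mem_borelDisc hδ hh
  have he : (fun x => ψ x h) =ᶠ[𝓝 x₂] fun x => Complex.exp (g x h -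
      wkbExponent pc qc U x₀ sq α x / h) := by
    filter_upwards [hV.mem_nhds hx₂] with x hx using hg x hx h hh
  have hd := (((hgx x₂ hx₂ h hh).hasDerivAt.fun_sub
    (((hP 0).2 x₂ (hVU hx₂)).div_const h)).cexp).congr_of_eventuallyEq he
  rw [hd.deriv, key h hh, hg x₂ hx₂ h hh]
  simp only [wkbExponent]
  field_simp
  ring


/-! ### Existence of exact WKB solutions -/

variable {X S : Set ℂ} {a b : ℝ} {p q : ℂ → ℂ → ℂ} {pc qc : ℕ → ℂ → ℂ} {θ : ℝ}
  {U : Set ℂ} {x₀ : ℂ} {sq : ℂ → ℂ}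

theorem HasWKBExponent.mono {α : ℤˣ} {ψ : ℂ → ℂ → ℂ} {V V' : Set ℂ} {δ δ' : ℝ}
    (h : HasWKBExponent pc qc U x₀ sq θ α ψ V δ) (hV : V' ⊆ V) (h0 : 0 < δ') (hδ : δ' ≤ δ) :
    HasWKBExponent pc qc U x₀ sq θ α ψ V' δ' := by
  obtain ⟨g, hgd, hg, hgG⟩ := h
  have hB := borelDisc_mono (θ := θ) h0 hδ
  exact ⟨g, hgd.mono (prod_mono hV hB), fun x hx h hh => hg x (hV hx) h (hB hh), hgG.mono hV hB⟩

theorem IsSolution.mono {U' S' : Set ℂ} {ψ : ℂ → ℂ → ℂ} (h : IsSolution p q U S ψ) (hU : U' ⊆ U)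
    (hS : S' ⊆ S) : IsSolution p q U' S' ψ :=
  ⟨h.1.mono (prod_mono hU hS), fun x hx k hk => h.2 x (hU hx) k (hS hk)⟩

theorem Setting.differentiableOn_coeff_prod (H : Setting X S a b p q pc qc θ U x₀ sq) {T : Set ℂ}
    (hT : T ⊆ S) : DifferentiableOn ℂ (fun z : ℂ × ℂ => p z.1 z.2) (U ×ˢ T) ∧
      DifferentiableOn ℂ (fun z : ℂ × ℂ => q z.1 z.2) (U ×ˢ T) :=
  ⟨H.hp.mono (prod_mono H.hUX hT), H.hq.mono (prod_mono H.hUX hT)⟩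

/-- The Cauchy problem for the equation, with initial data holomorphic in `ħ`. -/
theorem Setting.exists_isSolution (H : Setting X S a b p q pc qc θ U x₀ sq) {T : Set ℂ}
    (hT : IsOpen T) (hTS : T ⊆ S) (hT0 : (0 : ℂ) ∉ T) {v w : ℂ → ℂ} (hv : DifferentiableOn ℂ v T)
    (hw : DifferentiableOn ℂ w T) :
    ∃ ψ : ℂ → ℂ → ℂ, IsSolution p q U T ψ ∧ ∀ h ∈ T, ψ x₀ h = v h ∧
      deriv (fun x => ψ x h) x₀ = w h := by
  obtain ⟨hp, hq⟩ := H.differentiableOn_coeff_prod hTS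
  have hne : ∀ z ∈ U ×ˢ T, (z : ℂ × ℂ).2 ≠ 0 := fun z hz h0 => hT0 (h0 ▸ hz.2)
  have hA : DifferentiableOn ℂ (fun z : ℂ × ℂ =>
      odeMatrix (p z.1 z.2 / z.2) (q z.1 z.2 / z.2 ^ 2)) (U ×ˢ T) := by
    unfold odeMatrix
    have hi : DifferentiableOn ℂ (fun z : ℂ × ℂ => z.2⁻¹) (U ×ˢ T) :=
      differentiableOn_snd.fun_inv hne
    simp only [div_eq_mul_inv, ← inv_pow]
    exact ((differentiableOn_const _).sub ((hp.mul hi).smul_const _)).sub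
      ((hq.mul (hi.pow 2)).smul_const _)
  obtain ⟨y, hy0, hy, hyd⟩ := exists_linear_ode_parameter
    (A := fun x h => odeMatrix (p x h / h) (q x h / h ^ 2)) H.hU H.hUs hT hA H.hx₀
    (v := fun h => (v h, w h)) (hv.prodMk hw)
  have h1 : ∀ h ∈ T, ∀ x ∈ U, HasDerivAt (fun x => (y x h).1) (y x h).2 x := fun h hh x hx => by
    have := (ContinuousLinearMap.fst ℂ ℂ ℂ).hasFDerivAt.comp_hasDerivAt x (hy h hh x hx)
    refine this.congr_deriv ?_
    simp [odeMatrix_apply]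
  have h2 : ∀ h ∈ T, ∀ x ∈ U, HasDerivAt (fun x => (y x h).2)
      (-(p x h / h) * (y x h).2 - q x h / h ^ 2 * (y x h).1) x := fun h hh x hx => by
    have := (ContinuousLinearMap.snd ℂ ℂ ℂ).hasFDerivAt.comp_hasDerivAt x (hy h hh x hx)
    refine this.congr_deriv ?_
    simp [odeMatrix_apply]
  refine ⟨fun x h => (y x h).1, ⟨hyd.fst, fun x hx h hh => ?_⟩, fun h hh => ⟨?_, ?_⟩⟩
  · have he : deriv (fun x => (y x h).1) =ᶠ[𝓝 x] fun x => (y x h).2 := by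
      filter_upwards [H.hU.mem_nhds hx] with z hz using (h1 h hh z hz).deriv
    have hh0 : h ≠ 0 := fun h0 => hT0 (h0 ▸ hh)
    rw [he.deriv_eq, (h2 h hh x hx).deriv, (h1 h hh x hx).deriv]
    field_simp
    ring
  · simp [hy0 h hh]
  · rw [(h1 h hh x₀ H.hx₀).deriv, hy0 h hh]

/-- Existence of the exact WKB solution, with its local exponents. -/
theorem Setting.exists_hasWKBExponent (H : Setting X S a b p q pc qc θ U x₀ sq) {α : ℤˣ}
    (Hα : Hypotheses X S p q pc qc U x₀ sq θ α) {δ : ℝ} (hδ : 0 < δ) :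
    ∃ δ' : ℝ, 0 < δ' ∧ δ' ≤ δ ∧ borelDisc θ δ' ⊆ S ∧ ∃ ψ : ℂ → ℂ → ℂ,
      IsSolution p q U (borelDisc θ δ') ψ ∧ (∀ h ∈ borelDisc θ δ', ψ x₀ h = 1) ∧
      ∀ x ∈ U, ∃ r > 0, Metric.ball x r ⊆ U ∧ ∃ δ₁ > 0, δ₁ ≤ δ' ∧
        HasWKBExponent pc qc U x₀ sq θ α ψ (Metric.ball x r) δ₁ := by
  obtain ⟨r, hr, hrU, δ₀, hδ₀, hS₀, s, hsd, hs, hsG⟩ := H.exists_local_root Hα H.hx₀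
  set δ' := min δ δ₀ with hδ'
  have hδ'0 : 0 < δ' := lt_min hδ hδ₀
  have hsub : borelDisc θ δ' ⊆ borelDisc θ δ₀ := borelDisc_mono hδ'0 (min_le_right _ _)
  have hB := isOpen_borelDisc (θ := θ) hδ'0
  have hxr : x₀ ∈ Metric.ball x₀ r := Metric.mem_ball_self hr
  have h00 : ∀ h ∈ borelDisc θ δ', h ≠ 0 := fun h hh => ne_zero_of_mem_borelDisc hδ'0 hh
  -- The slope prescribed at x₀ is the logarithmic derivative -s/ħ of the local root; it fixes δ'
  -- once and for all, while the linear equation extends ψ over all of U.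
  have hs0 : DifferentiableOn ℂ (fun h => -s x₀ h / h) (borelDisc θ δ') :=
    ((hsd.comp (f := fun h : ℂ => (x₀, h)) ((differentiableOn_const x₀).prodMk differentiableOn_id)
        fun h hh => ⟨hxr, hsub hh⟩).neg).fun_div differentiableOn_id h00
  obtain ⟨ψ, hψ, hψ0⟩ := H.exists_isSolution hB (hsub.trans hS₀) (zero_notMem_borelDisc hδ'0)
    (v := fun _ => 1) (differentiableOn_const _) hs0
  refine ⟨δ', hδ'0, min_le_left _ _, hsub.trans hS₀, ψ, hψ, fun h hh => (hψ0 h hh).1, ?_⟩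
  have hP := H.primitive_formalRoot α
  -- The asymptotics may hold only on a smaller Borel disc, of diameter δ₁ depending on the point.
  -- This is allowed by local uniformity and is what makes the continuation argument possible.
  set Good : ℂ → Prop := fun x => ∃ r > 0, Metric.ball x r ⊆ U ∧ ∃ δ₁ > 0, δ₁ ≤ δ' ∧
    HasWKBExponent pc qc U x₀ sq θ α ψ (Metric.ball x r) δ₁ with hGood
  have hball : ∀ {x₁ r δ₁ y}, Metric.ball x₁ r ⊆ U → 0 < δ₁ → δ₁ ≤ δ' →
      HasWKBExponent pc qc U x₀ sq θ α ψ (Metric.ball x₁ r) δ₁ → y ∈ Metric.ball x₁ r → Good y := by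
    intro x₁ r δ₁ y hU h0 h1 h2 hy
    obtain ⟨ε, hε, hεs⟩ := Metric.isOpen_iff.1 Metric.isOpen_ball y hy
    exact ⟨ε, hε, hεs.trans hU, δ₁, h0, h1, h2.mono hεs h0 le_rfl⟩
  have base : Good x₀ := by
    refine ⟨r, hr, hrU, δ', hδ'0, le_rfl, H.hasWKBExponent_ball hr hrU hδ'0 (hsub.trans hS₀)
      (hsd.mono (prod_mono_right hsub)) (fun x hx h hh => hs x hx h (hsub hh))
      (hsG.mono subset_rfl hsub) hψ hxr (fun h hh => ?_) ⟨fun _ _ => 0, differentiableOn_const _,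
        fun x hx h hh => ?_, 1, 1, one_pos, one_pos, fun n x hx h hh => ?_⟩⟩
    · rw [(hψ0 h hh).2, (hψ0 h hh).1]
      have := h00 h hh
      field_simp
    · rw [mem_singleton_iff.1 hx, (hψ0 h hh).1]
      simp [wkbExponent, (hP 0).1]
    · rw [mem_singleton_iff.1 hx]
      simp only [remainder, (hP _).1]
      simp
      positivity
  -- If the asymptotics hold near one point of a disc carrying a local root, `Setting.logDeriv_eq`
  -- matches ψ with that root there, and the root then gives the asymptotics on the whole disc.
  -- Connectedness of U finishes.
  have loc : ∀ x₁ ∈ U, ∃ r > 0, Metric.ball x₁ r ⊆ U ∧ ∀ x₂ ∈ Metric.ball x₁ r, Good x₂ →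
      ∀ y ∈ Metric.ball x₁ r, Good y := by
    intro x₁ hx₁
    obtain ⟨r, hr, hrU, δ₂, hδ₂, hS₂, s, hsd, hs, hsG⟩ := H.exists_local_root Hα hx₁
    refine ⟨r, hr, hrU, fun x₂ hx₂ ⟨r₂, hr₂, hr₂U, δ₁, hδ₁, hδ₁', hE⟩ y hy => ?_⟩
    set δ₃ := min δ₁ δ₂ with hδ₃
    have hδ₃0 : 0 < δ₃ := lt_min hδ₁ hδ₂
    have hsub : borelDisc θ δ₃ ⊆ borelDisc θ δ₂ := borelDisc_mono hδ₃0 (min_le_right _ _)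
    have hsub' : borelDisc θ δ₃ ⊆ borelDisc θ δ' :=
      borelDisc_mono hδ₃0 ((min_le_left _ _).trans hδ₁')
    have hE' := hE.mono subset_rfl hδ₃0 (min_le_left δ₁ δ₂)
    have hsec : DifferentiableOn ℂ (s x₂) (borelDisc θ δ₃) :=
      hsd.comp (f := fun h : ℂ => (x₂, h)) ((differentiableOn_const x₂).prodMk differentiableOn_id)
        fun h hh => ⟨hx₂, hsub hh⟩
    have hlog := H.logDeriv_eq Metric.isOpen_ball (Metric.mem_ball_self hr₂) hr₂U hδ₃0 hsec
      (hsG.mono (singleton_subset_iff.2 hx₂) hsub) hE'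
    exact hball hrU hδ₃0 ((min_le_left _ _).trans hδ₁') (H.hasWKBExponent_ball hr hrU hδ₃0
      (hsub.trans hS₂) (hsd.mono (prod_mono_right hsub)) (fun x hx h hh => hs x hx h (hsub hh))
      (hsG.mono subset_rfl hsub) (hψ.mono subset_rfl hsub') hx₂ hlog
      (hE'.mono (singleton_subset_iff.2 (Metric.mem_ball_self hr₂)) hδ₃0 le_rfl)) hy
  intro x hx
  refine (H.isPreconnected.induction₂ (fun y z => Good y ↔ Good z) (fun x₁ hx₁ => ?_)
    (fun a b c _ _ _ hab hbc => hab.trans hbc) (fun a b _ _ hab => hab.symm) H.hx₀ hx).1 base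
  obtain ⟨r, hr, -, hl⟩ := loc x₁ hx₁
  filter_upwards [mem_nhdsWithin_of_mem_nhds (Metric.ball_mem_nhds x₁ hr)] with y hy
  exact ⟨fun h => hl x₁ (Metric.mem_ball_self hr) h y hy,
    fun h => hl y hy h x₁ (Metric.mem_ball_self hr)⟩


/-! ### Asymptotics and uniqueness of exact WKB solutions -/

variable {X S : Set ℂ} {a b : ℝ} {p q : ℂ → ℂ → ℂ} {pc qc : ℕ → ℂ → ℂ} {θ : ℝ}
  {U : Set ℂ} {x₀ : ℂ} {sq : ℂ → ℂ}

theorem differentiableOn_coeff_pow {R : ℂ → PowerSeries ℂ}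
    (hR : ∀ n, DifferentiableOn ℂ (fun x => PowerSeries.coeff n (R x)) U) (j n : ℕ) :
    DifferentiableOn ℂ (fun x => PowerSeries.coeff n (R x ^ j)) U := by
  induction j generalizing n with
  | zero => simp only [pow_zero]; exact differentiableOn_const _
  | succ j ih =>
    simp only [pow_succ, PowerSeries.coeff_mul]
    exact DifferentiableOn.fun_sum fun i _ => (ih i.1).mul (hR i.2)

theorem differentiableOn_coeff_expSeries {R : ℂ → PowerSeries ℂ}
    (hR : ∀ n, DifferentiableOn ℂ (fun x => PowerSeries.coeff n (R x)) U) (n : ℕ) :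
    DifferentiableOn ℂ (fun x => PowerSeries.coeff n (expSeries (R x))) U := by
  have h0 : DifferentiableOn ℂ (fun x => PowerSeries.constantCoeff (R x)) U := by
    simpa using hR 0
  have h1 : ∀ n, DifferentiableOn ℂ (fun x => PowerSeries.coeff n
      (R x - PowerSeries.C (PowerSeries.constantCoeff (R x)))) U := by
    intro n
    simp only [map_sub, PowerSeries.coeff_C]
    refine (hR n).sub ?_
    split_ifs
    · exact h0
    · exact differentiableOn_const _
  simp only [expSeries, PowerSeries.coeff_mk]
  exact h0.cexp.mul (DifferentiableOn.fun_sum fun j _ =>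
    (differentiableOn_coeff_pow h1 j n).div_const _)

theorem Setting.differentiableOn_wkbCoeff (H : Setting X S a b p q pc qc θ U x₀ sq) (α : ℤˣ)
    (n : ℕ) : DifferentiableOn ℂ (wkbCoeff pc qc U x₀ sq α n) U := by
  refine differentiableOn_coeff_expSeries (fun n => ?_) n
  simp only [PowerSeries.coeff_mk]
  exact fun x hx => ((H.primitive_formalRoot α (n + 1)).2 x hx).differentiableAt.neg.differentiableWithinAt

theorem Setting.differentiableOn_wkbExponent (H : Setting X S a b p q pc qc θ U x₀ sq) (α : ℤˣ) :
    DifferentiableOn ℂ (wkbExponent pc qc U x₀ sq α) U :=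
  fun x hx => ((H.primitive_formalRoot α 0).2 x hx).differentiableAt.differentiableWithinAt

/-- The local exponents are exponentiated; the coefficients delivered by `GevreyBounds.cexp` are
those of `wkbCoeff` by definition. -/
theorem Setting.exists_isExactWKB (H : Setting X S a b p q pc qc θ U x₀ sq) {α : ℤˣ}
    (Hα : Hypotheses X S p q pc qc U x₀ sq θ α) {δ : ℝ} (hδ : 0 < δ) :
    ∃ δ' : ℝ, 0 < δ' ∧ δ' ≤ δ ∧ ∃ ψ : ℂ → ℂ → ℂ, IsExactWKB p q pc qc U x₀ sq θ α δ' ψ := by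
  obtain ⟨δ', h0, h1, -, ψ, hψ, hψ0, hE⟩ := H.exists_hasWKBExponent Hα hδ
  refine ⟨δ', h0, h1, ψ, hψ, hψ0, fun x hx => ?_⟩
  obtain ⟨r, hr, hrU, δ₁, hδ₁, hδ₁', g, -, hg, hG⟩ := hE x hx
  refine ⟨Metric.ball x r, Metric.isOpen_ball, Metric.mem_ball_self hr, hrU, borelDisc θ δ₁,
    borelDisc_mono hδ₁ hδ₁', isSectorialDomain_borelDisc hδ₁, ?_⟩
  refine (hG.cexp (accumulates_borelDisc hδ₁)).congr (fun y hy h hh => ?_) fun _ _ _ => rfl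
  rw [hg y hy h hh, ← Complex.exp_add]
  congr 1
  ring

/-- Holomorphic functions that agree on a Borel disc agree on every larger domain. -/
theorem eqOn_of_eqOn_borelDisc {f g : ℂ → ℂ} {T : Set ℂ} {δ : ℝ} (hT : IsOpen T)
    (hTc : IsPreconnected T) (hδ : 0 < δ) (hδT : borelDisc θ δ ⊆ T) (hf : DifferentiableOn ℂ f T)
    (hg : DifferentiableOn ℂ g T) (h : EqOn f g (borelDisc θ δ)) : EqOn f g T := by
  obtain ⟨z, hz⟩ : (borelDisc θ δ).Nonempty := by
    rw [borelDisc_eq_ball hδ]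
    exact Metric.nonempty_ball.2 (by linarith)
  exact (hf.analyticOnNhd hT).eqOn_of_preconnected_of_eventuallyEq (hg.analyticOnNhd hT) hTc
    (hδT hz) (h.eventuallyEq_of_mem ((isOpen_borelDisc hδ).mem_nhds hz))

theorem IsExactWKB.exists_bounds {α : ℤˣ} {δ : ℝ} {ψ : ℂ → ℂ → ℂ}
    (h : IsExactWKB p q pc qc U x₀ sq θ α δ ψ) (hδ : 0 < δ) {x : ℂ} (hx : x ∈ U) :
    ∃ r > 0, Metric.ball x r ⊆ U ∧ ∃ δ₁ > 0, δ₁ ≤ δ ∧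
      GevreyBounds (fun x h => Complex.exp (wkbExponent pc qc U x₀ sq α x / h) * ψ x h)
        (wkbCoeff pc qc U x₀ sq α) (Metric.ball x r) (borelDisc θ δ₁) := by
  obtain ⟨V, hV, hxV, hVU, hG⟩ := h.asymptotics x hx
  obtain ⟨δ₁, h1, h2, h3⟩ := hG.exists_bounds (half_plane_mem θ)
  obtain ⟨r, hr, hrV⟩ := Metric.isOpen_iff.1 hV x hxV
  exact ⟨r, hr, hrV.trans hVU, min δ₁ δ, lt_min h1 hδ, min_le_right _ _,
    h3.mono hrV (borelDisc_mono (lt_min h1 hδ) (min_le_left _ _))⟩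

theorem IsSolution.differentiableOn_snd {ψ : ℂ → ℂ → ℂ} (hU : IsOpen U) (hS : IsOpen S)
    (hψ : IsSolution p q U S ψ) {x : ℂ} (hx : x ∈ U) : DifferentiableOn ℂ (ψ x) S :=
  fun _ hh => (differentiableAt_snd_section (hU.prod hS) hψ.1
    (z := (x, _)) ⟨hx, hh⟩).differentiableWithinAt

theorem IsSolution.differentiableOn_fst {ψ : ℂ → ℂ → ℂ} (hU : IsOpen U) (hS : IsOpen S)
    (hψ : IsSolution p q U S ψ) {h : ℂ} (hh : h ∈ S) : DifferentiableOn ℂ (fun x => ψ x h) U :=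
  fun x hx => (differentiableAt_fst_section (hU.prod hS) hψ.1
    (z := (x, h)) ⟨hx, hh⟩).differentiableWithinAt

theorem differentiableOn_exp_div_mul {T : Set ℂ} (hT : (0 : ℂ) ∉ T) (w : ℂ) {f : ℂ → ℂ}
    (hf : DifferentiableOn ℂ f T) : DifferentiableOn ℂ (fun h => Complex.exp (w / h) * f h) T :=
  ((differentiableOn_const w).fun_div differentiableOn_id
    (fun _ hh h0 => hT (h0 ▸ hh))).cexp.mul hf

/-- At each x Watson's lemma gives equality on a Borel disc so small that both expansions hold
there; the identity theorem extends it to the full Borel disc. -/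
theorem IsExactWKB.eq (hU : IsOpen U) {α : ℤˣ} {δ : ℝ} (hδ : 0 < δ) {ψ ψ' : ℂ → ℂ → ℂ}
    (h : IsExactWKB p q pc qc U x₀ sq θ α δ ψ) (h' : IsExactWKB p q pc qc U x₀ sq θ α δ ψ') :
    ∀ x ∈ U, ∀ k ∈ borelDisc θ δ, ψ x k = ψ' x k := by
  intro x hx
  obtain ⟨r, hr, -, δ₁, h1, hδ1, hG⟩ := h.exists_bounds hδ hx
  obtain ⟨r', hr', -, δ₁', h1', hδ1', hG'⟩ := h'.exists_bounds hδ hx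
  have hB := isOpen_borelDisc (θ := θ) hδ
  have h3 : 0 < min δ₁ δ₁' := lt_min h1 h1'
  have hsub : borelDisc θ (min δ₁ δ₁') ⊆ borelDisc θ δ :=
    borelDisc_mono h3 ((min_le_left _ _).trans hδ1)
  have hd := h.solution.differentiableOn_snd hU hB hx
  have hd' := h'.solution.differentiableOn_snd hU hB hx
  refine eqOn_of_eqOn_borelDisc hB (isPreconnected_borelDisc hδ) h3 hsub hd hd' fun k hk => ?_
  have := eq_of_gevreyBounds h3
    (hG.mono (singleton_subset_iff.2 (Metric.mem_ball_self hr))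
      (borelDisc_mono h3 (min_le_left _ _)))
    (hG'.mono (singleton_subset_iff.2 (Metric.mem_ball_self hr'))
      (borelDisc_mono h3 (min_le_right _ _))) (x := x) rfl
    (differentiableOn_exp_div_mul (zero_notMem_borelDisc h3) _ (hd.mono hsub))
    (differentiableOn_exp_div_mul (zero_notMem_borelDisc h3) _ (hd'.mono hsub)) k hk
  exact mul_left_cancel₀ (Complex.exp_ne_zero _) this

theorem Setting.locExpGevrey (H : Setting X S a b p q pc qc θ U x₀ sq) {α : ℤˣ} {δ : ℝ}
    (hδ : 0 < δ) {ψ : ℂ → ℂ → ℂ} (h : IsExactWKB p q pc qc U x₀ sq θ α δ ψ) :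
    LocExpGevrey ψ U (θ - Real.pi / 2) (θ + Real.pi / 2) (borelDisc θ δ) := by
  -- The exponent is a polynomial of degree 0 in ħ⁻¹; the sign compensates the minus sign in
  -- `expFactor`.
  refine ⟨0, fun _ x => -wkbExponent pc qc U x₀ sq α x, wkbCoeff pc qc U x₀ sq α,
    fun _ => (H.differentiableOn_wkbExponent α).neg, H.differentiableOn_wkbCoeff α,
    fun x hx => ?_⟩
  obtain ⟨r, hr, hrU, δ₁, h1, hδ1, hG⟩ := h.exists_bounds hδ hx
  refine ⟨Metric.ball x r, Metric.isOpen_ball, Metric.mem_ball_self hr, hrU, ?_⟩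
  refine (hG.congr (fun y _ h _ => ?_) fun _ _ _ => rfl).gevreyOpen h1 (borelDisc_mono h1 hδ1)
  simp [expFactor]

theorem LocExpGevrey.locExpPoincare {ψ : ℂ → ℂ → ℂ} (h : LocExpGevrey ψ U a b S) :
    LocExpPoincare ψ U a b S := by
  obtain ⟨m, φ, c, hφ, hc, hG⟩ := h
  refine ⟨m, φ, c, hφ, hc, fun x hx => ?_⟩
  obtain ⟨V, h1, h2, h3, h4⟩ := hG x hx
  exact ⟨V, h1, h2, h3, h4.poincareOpen⟩

theorem Setting.isGevreyExactSolution (H : Setting X S a b p q pc qc θ U x₀ sq) {α : ℤˣ} {δ : ℝ}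
    (hδ : 0 < δ) (hδS : borelDisc θ δ ⊆ S) {ψ : ℂ → ℂ → ℂ}
    (h : IsExactWKB p q pc qc U x₀ sq θ α δ ψ) :
    IsGevreyExactSolution p q S U (θ - Real.pi / 2) (θ + Real.pi / 2) (borelDisc θ δ) ψ :=
  ⟨⟨hδS, isSectorialDomain_borelDisc hδ, h.solution, (H.locExpGevrey hδ h).locExpPoincare⟩,
    H.locExpGevrey hδ h⟩

/-- Existence and uniqueness of exact WKB solutions. -/
theorem Setting.exists_unique_isExactWKB (H : Setting X S a b p q pc qc θ U x₀ sq) {α : ℤˣ}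
    (Hα : Hypotheses X S p q pc qc U x₀ sq θ α) {δ : ℝ} (hδ : 0 < δ) (hδS : borelDisc θ δ ⊆ S) :
    ∃ δ' : ℝ, 0 < δ' ∧ δ' ≤ δ ∧ ∃ ψ : ℂ → ℂ → ℂ,
      IsExactWKB p q pc qc U x₀ sq θ α δ' ψ ∧
      IsExactSolution p q S U (θ - Real.pi / 2) (θ + Real.pi / 2) (borelDisc θ δ') ψ ∧
      ∀ ψ' : ℂ → ℂ → ℂ, IsExactWKB p q pc qc U x₀ sq θ α δ' ψ' →
        ∀ x ∈ U, ∀ h ∈ borelDisc θ δ', ψ' x h = ψ x h := by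
  obtain ⟨δ', h0, h1, ψ, hψ⟩ := H.exists_isExactWKB Hα hδ
  exact ⟨δ', h0, h1, ψ, hψ,
    (H.isGevreyExactSolution h0 ((borelDisc_mono h0 h1).trans hδS) hψ).1,
    fun ψ' hψ' => hψ'.eq H.hU h0 hψ⟩


/-! ### Asymptotic expansions in `ħ` along an open arc -/

theorem straightSector_mono {a b r r' : ℝ} (h : r ≤ r') : straightSector a b r ⊆ straightSector a b r' :=
  fun _ ⟨ρ, φ, h1, h2, h3⟩ => ⟨ρ, φ, h1, h2.trans_le h, h3⟩

section

variable {ι : Type} {f g : ι → ℂ → ℂ} {c : ℕ → ι → ℂ} {V V' : Set ι} {S S' : Set ℂ} {a b θ δ : ℝ}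

/-- Only sectors compactly contained in the arc matter, and after shortening they lie in any Borel
disc bisected by θ. So the domain can be replaced by one even without an inclusion. -/
theorem PoincareOpen.mono (hf : PoincareOpen f c V (θ - Real.pi / 2) (θ + Real.pi / 2) S) (hδ : 0 < δ)
    (hV : V' ⊆ V) : PoincareOpen f c V' (θ - Real.pi / 2) (θ + Real.pi / 2) (borelDisc θ δ) := by
  intro n a' b' ha hab hb
  obtain ⟨r, hr, -, C, hC⟩ := hf n a' b' ha hab hb
  obtain ⟨r', hr', hs⟩ := exists_sector_subset_borelDisc hδ ha hab hb
  exact ⟨min r r', lt_min hr hr', (straightSector_mono (min_le_right _ _)).trans hs, C,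
    fun x hx h hh => hC x (hV hx) h (straightSector_mono (min_le_left _ _) hh)⟩

theorem GevreyOpen.mono (hf : GevreyOpen f c V (θ - Real.pi / 2) (θ + Real.pi / 2) S) (hδ : 0 < δ)
    (hV : V' ⊆ V) : GevreyOpen f c V' (θ - Real.pi / 2) (θ + Real.pi / 2) (borelDisc θ δ) := by
  intro a' b' ha hab hb
  obtain ⟨r, hr, -, hG⟩ := hf a' b' ha hab hb
  obtain ⟨r', hr', hs⟩ := exists_sector_subset_borelDisc hδ ha hab hb
  exact ⟨min r r', lt_min hr hr', (straightSector_mono (min_le_right _ _)).trans hs,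
    hG.mono hV (straightSector_mono (min_le_left _ _))⟩

end

theorem PoincareOpen.deriv {f : ℂ → ℂ → ℂ} {c : ℕ → ℂ → ℂ} {V V' S : Set ℂ} {a b r : ℝ} (hr : 0 < r)
    (hV : ∀ x ∈ V', Metric.ball x r ⊆ V) (hg : PoincareOpen f c V a b S)
    (hf : ∀ h ∈ S, DifferentiableOn ℂ (fun y => f y h) V) (hc : ∀ n, DifferentiableOn ℂ (c n) V) :
    PoincareOpen (fun y h => _root_.deriv (fun y => f y h) y) (fun n => _root_.deriv (c n))
      V' a b S := by
  intro n a' b' ha hab hb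
  obtain ⟨ρ, hρ, hs, C, hC⟩ := hg n a' b' ha hab hb
  refine ⟨ρ, hρ, hs, C / r, fun x hx h hh => ?_⟩
  have := norm_remainder_deriv_le (n := n) hr ((hf h (hs hh)).mono (hV x hx))
    (fun n => (hc n).mono (hV x hx)) (fun y hy => hC y (hV x hx hy) h hh)
  rwa [div_mul_eq_mul_div]

theorem GevreyOpen.deriv {f : ℂ → ℂ → ℂ} {c : ℕ → ℂ → ℂ} {V V' S : Set ℂ} {a b r : ℝ} (hr : 0 < r)
    (hV : ∀ x ∈ V', Metric.ball x r ⊆ V) (hg : GevreyOpen f c V a b S)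
    (hf : ∀ h ∈ S, DifferentiableOn ℂ (fun y => f y h) V) (hc : ∀ n, DifferentiableOn ℂ (c n) V) :
    GevreyOpen (fun y h => _root_.deriv (fun y => f y h) y) (fun n => _root_.deriv (c n))
      V' a b S := by
  intro a' b' ha hab hb
  obtain ⟨ρ, hρ, hs, hG⟩ := hg a' b' ha hab hb
  exact ⟨ρ, hρ, hs, hG.deriv hr hV (fun h hh => hf h (hs hh)) hc⟩

/-- `f` has a Poincaré expansion along the half-plane arc bisected by `θ`. -/
def HasPoincare (θ : ℝ) (T : Set ℂ) (f : ℂ → ℂ) : Prop :=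
  ∃ c : ℕ → ℂ, PoincareOpen (fun (_ : Unit) h => f h) (fun k _ => c k) univ
    (θ - Real.pi / 2) (θ + Real.pi / 2) T

/-- `f` has a Gevrey expansion along the half-plane arc bisected by `θ`. -/
def HasGevrey (θ : ℝ) (T : Set ℂ) (f : ℂ → ℂ) : Prop :=
  ∃ c : ℕ → ℂ, GevreyOpen (fun (_ : Unit) h => f h) (fun k _ => c k) univ
    (θ - Real.pi / 2) (θ + Real.pi / 2) T

/-- The closure properties shared by functions with Poincaré and with Gevrey expansions. -/
structure IsAsymptoticAlgebra (T : Set ℂ) (𝒜 : (ℂ → ℂ) → Prop) : Prop where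
  congr : ∀ f g : ℂ → ℂ, 𝒜 f → (∀ h ∈ T, g h = f h) → 𝒜 g
  sub : ∀ f g : ℂ → ℂ, 𝒜 f → 𝒜 g → 𝒜 fun h => f h - g h
  mul : ∀ f g : ℂ → ℂ, 𝒜 f → 𝒜 g → 𝒜 fun h => f h * g h
  of_gevrey : ∀ (f : ℂ → ℂ) (c : ℕ → ℂ),
    GevreyBounds (fun (_ : Unit) h => f h) (fun k _ => c k) univ T → 𝒜 f

namespace IsAsymptoticAlgebra

variable {T : Set ℂ} {𝒜 : (ℂ → ℂ) → Prop} (h𝒜 : IsAsymptoticAlgebra T 𝒜)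
include h𝒜

theorem const (z : ℂ) : 𝒜 fun _ => z :=
  h𝒜.of_gevrey _ _ (gevreyBounds_const (a := fun _ : Unit => z) fun _ _ => le_rfl)

theorem add {f g : ℂ → ℂ} (hf : 𝒜 f) (hg : 𝒜 g) : 𝒜 fun h => f h + g h :=
  h𝒜.congr _ _ (h𝒜.sub _ _ hf (h𝒜.sub _ _ (h𝒜.const 0) hg)) fun h _ => by ring

theorem sum (n : ℕ) {f : ℕ → ℂ → ℂ} (hf : ∀ j < n, 𝒜 (f j)) :
    𝒜 fun h => ∑ j ∈ Finset.range n, f j h := by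
  induction n with
  | zero => simpa using h𝒜.const 0
  | succ n ih =>
    simp only [Finset.sum_range_succ]
    exact h𝒜.add (ih fun j hj => hf j (by omega)) (hf n (by omega))

theorem id {r : ℝ} (hr : ∀ h ∈ T, ‖h‖ ≤ r) : 𝒜 fun h => h := by
  have := (gevreyBounds_const (S := T) (V := (univ : Set Unit)) (a := fun _ : Unit => (1 : ℂ)) fun _ _ => le_rfl).h_mul hr
  exact h𝒜.congr _ _ (h𝒜.of_gevrey (fun h => h * 1) _ this) fun h _ => by ring

end IsAsymptoticAlgebra

/-- In Poincaré asymptotics the radius depends on the order. A bound of order n on one sector gives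
all lower orders on the same sector, which is what products need. -/
theorem norm_remainder_le_of_le {f : ℂ → ℂ} {c : ℕ → ℂ} {T : Set ℂ} (hT : ∀ h ∈ T, ‖h‖ ≤ 1)
    {n : ℕ} {C : ℝ} (hC : ∀ h ∈ T, ‖remainder (fun (_ : Unit) h => f h) (fun k _ => c k) n () h‖ ≤
      C * ‖h‖ ^ n) {m : ℕ} (hm : m ≤ n) :
    ∃ C', ∀ h ∈ T, ‖remainder (fun (_ : Unit) h => f h) (fun k _ => c k) m () h‖ ≤ C' * ‖h‖ ^ m := by
  induction hm using Nat.decreasingInduction with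
  | self => exact ⟨C, hC⟩
  | of_succ m hm ih =>
    obtain ⟨C', hC'⟩ := ih
    refine ⟨‖c m‖ + |C'|, fun h hh => ?_⟩
    rw [remainder_eq_succ]
    refine (norm_add_le _ _).trans ?_
    rw [norm_mul, norm_pow, add_mul]
    gcongr
    refine (hC' h hh).trans ?_
    rw [pow_succ]
    have h1 := hT h hh
    have h2 : 0 ≤ ‖h‖ ^ m := by positivity
    have h3 : ‖h‖ ^ m * ‖h‖ ≤ ‖h‖ ^ m := mul_le_of_le_one_right h2 h1
    calc C' * (‖h‖ ^ m * ‖h‖) ≤ |C'| * (‖h‖ ^ m * ‖h‖) := by gcongr; exact le_abs_self _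
      _ ≤ _ := by gcongr

theorem isAsymptoticAlgebra_hasPoincare {θ δ : ℝ} (hδ : 0 < δ) (hδ1 : δ ≤ 1) :
    IsAsymptoticAlgebra (borelDisc θ δ) (HasPoincare θ (borelDisc θ δ)) where
  congr := by
    rintro f g ⟨c, hf⟩ h
    refine ⟨c, fun n a' b' ha hab hb => ?_⟩
    obtain ⟨r, hr, hs, C, hC⟩ := hf n a' b' ha hab hb
    refine ⟨r, hr, hs, C, fun x hx k hk => ?_⟩
    have := hC x hx k hk
    simp only [remainder] at this ⊢
    rwa [h k (hs hk)]
  sub := by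
    rintro f g ⟨c, hf⟩ ⟨d, hg⟩
    refine ⟨fun k => c k - d k, fun n a' b' ha hab hb => ?_⟩
    obtain ⟨r, hr, hs, C, hC⟩ := hf n a' b' ha hab hb
    obtain ⟨r', hr', hs', C', hC'⟩ := hg n a' b' ha hab hb
    refine ⟨min r r', lt_min hr hr', (straightSector_mono (min_le_left _ _)).trans hs, C + C',
      fun x hx k hk => ?_⟩
    have h1 := hC x hx k (straightSector_mono (min_le_left _ _) hk)
    have h2 := hC' x hx k (straightSector_mono (min_le_right _ _) hk)
    have e : remainder (fun (_ : Unit) h => f h - g h) (fun k _ => c k - d k) n x k =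
        remainder (fun (_ : Unit) h => f h) (fun k _ => c k) n x k -
          remainder (fun (_ : Unit) h => g h) (fun k _ => d k) n x k := by
      simp only [remainder, sub_mul, Finset.sum_sub_distrib]
      ring
    rw [e, add_mul]
    exact (norm_sub_le _ _).trans (add_le_add h1 h2)
  mul := by
    rintro f g ⟨c, hf⟩ ⟨d, hg⟩
    refine ⟨fun n => ∑ k ∈ Finset.range (n + 1), d k * c (n - k), fun n a' b' ha hab hb => ?_⟩
    obtain ⟨r, hr, hs, C, hC⟩ := hf n a' b' ha hab hb
    obtain ⟨r', hr', hs', C', hC'⟩ := hg n a' b' ha hab hb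
    set T := straightSector a' b' (min r r') with hT
    have hTr : T ⊆ straightSector a' b' r := straightSector_mono (min_le_left _ _)
    have hTr' : T ⊆ straightSector a' b' r' := straightSector_mono (min_le_right _ _)
    have hT1 : ∀ h ∈ T, ‖h‖ ≤ 1 := fun h hh =>
      (norm_lt_of_mem_borelDisc hδ (hs (hTr hh))).le.trans hδ1
    have hk : ∀ m ≤ n, ∃ K, ∀ h ∈ T,
        ‖remainder (fun (_ : Unit) h => f h) (fun k _ => c k) m () h‖ ≤ K * ‖h‖ ^ m := fun m hm =>
      norm_remainder_le_of_le hT1 (fun h hh => hC () trivial h (hTr hh)) hm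
    choose! K hK using hk
    refine ⟨min r r', lt_min hr hr', hTr.trans hs,
      K 0 * C' + ∑ k ∈ Finset.range n, ‖d k‖ * K (n - k), fun x _ h hh => ?_⟩
    rw [remainder_mul (fun (_ : Unit) h => f h) (fun (_ : Unit) h => g h) (fun k _ => c k)
      (fun k _ => d k)]
    refine (norm_add_le _ _).trans ?_
    rw [add_mul, Finset.sum_mul]
    have h0 : ‖f h‖ ≤ K 0 := by
      simpa [remainder] using hK 0 (Nat.zero_le _) h hh
    refine add_le_add ?_ ((norm_sum_le _ _).trans (Finset.sum_le_sum fun k hk => ?_))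
    · rw [norm_mul, mul_assoc]
      exact mul_le_mul h0 (hC' () trivial h (hTr' hh)) (norm_nonneg _) ((norm_nonneg _).trans h0)
    · rw [Finset.mem_range] at hk
      have h2 := hK (n - k) (Nat.sub_le _ _) h hh
      have e : ‖h‖ ^ n = ‖h‖ ^ k * ‖h‖ ^ (n - k) := by rw [← pow_add]; congr 1; omega
      rw [norm_mul, norm_mul, norm_pow, e]
      calc ‖d k‖ * ‖h‖ ^ k * _ ≤ ‖d k‖ * ‖h‖ ^ k * (K (n - k) * ‖h‖ ^ (n - k)) := by gcongr
        _ = _ := by ring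
  of_gevrey f c h := ⟨c, (h.gevreyOpen hδ subset_rfl).poincareOpen⟩

theorem isAsymptoticAlgebra_hasGevrey {θ δ : ℝ} (hδ : 0 < δ) :
    IsAsymptoticAlgebra (borelDisc θ δ) (HasGevrey θ (borelDisc θ δ)) where
  congr := by
    rintro f g ⟨c, hf⟩ h
    refine ⟨c, fun a' b' ha hab hb => ?_⟩
    obtain ⟨r, hr, hs, hG⟩ := hf a' b' ha hab hb
    exact ⟨r, hr, hs, hG.congr (fun _ _ k hk => h k (hs hk)) fun _ _ _ => rfl⟩
  sub := by
    rintro f g ⟨c, hf⟩ ⟨d, hg⟩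
    refine ⟨fun k => c k - d k, fun a' b' ha hab hb => ?_⟩
    obtain ⟨r, hr, hs, hG⟩ := hf a' b' ha hab hb
    obtain ⟨r', hr', -, hG'⟩ := hg a' b' ha hab hb
    exact ⟨min r r', lt_min hr hr', (straightSector_mono (min_le_left _ _)).trans hs,
      (hG.mono subset_rfl (straightSector_mono (min_le_left _ _))).sub
        (hG'.mono subset_rfl (straightSector_mono (min_le_right _ _)))⟩
  mul := by
    rintro f g ⟨c, hf⟩ ⟨d, hg⟩
    refine ⟨fun n => ∑ k ∈ Finset.range (n + 1), d k * c (n - k), fun a' b' ha hab hb => ?_⟩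
    obtain ⟨r, hr, hs, hG⟩ := hf a' b' ha hab hb
    obtain ⟨r', hr', -, hG'⟩ := hg a' b' ha hab hb
    exact ⟨min r r', lt_min hr hr', (straightSector_mono (min_le_left _ _)).trans hs,
      (hG.mono subset_rfl (straightSector_mono (min_le_left _ _))).mul
        (hG'.mono subset_rfl (straightSector_mono (min_le_right _ _)))
        (accumulates_straightSector hab (lt_min hr hr'))⟩
  of_gevrey f c h := ⟨c, h.gevreyOpen hδ subset_rfl⟩

/-- Flat functions remain flat after division by `ħ`. -/
theorem PoincareOpen.div_of_flat {f : ℂ → ℂ} {a b : ℝ} {T : Set ℂ} (hT : (0 : ℂ) ∉ T)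
    (hf : PoincareOpen (fun (_ : Unit) h => f h) (fun _ _ => 0) univ a b T) :
    PoincareOpen (fun (_ : Unit) h => f h / h) (fun _ _ => 0) univ a b T := by
  intro n a' b' ha hab hb
  obtain ⟨r, hr, hs, C, hC⟩ := hf (n + 1) a' b' ha hab hb
  refine ⟨r, hr, hs, C, fun x hx h hh => ?_⟩
  have h0 : 0 < ‖h‖ := norm_pos_iff.2 fun h0 => hT (h0 ▸ hs hh)
  have := hC x hx h hh
  simp only [remainder, zero_mul, Finset.sum_const_zero, sub_zero, norm_div] at this ⊢
  rw [div_le_iff₀ h0, mul_assoc, ← pow_succ]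
  exact this

theorem GevreyOpen.div_of_flat {f : ℂ → ℂ} {a b : ℝ} {T : Set ℂ} (hT : (0 : ℂ) ∉ T)
    (hf : GevreyOpen (fun (_ : Unit) h => f h) (fun _ _ => 0) univ a b T) :
    GevreyOpen (fun (_ : Unit) h => f h / h) (fun _ _ => 0) univ a b T := by
  intro a' b' ha hab hb
  obtain ⟨r, hr, hs, hG⟩ := hf a' b' ha hab hb
  exact ⟨r, hr, hs, (hG.div fun h0 => hT (hs h0)).congr (fun _ _ _ _ => by simp) fun _ _ _ => rfl⟩


/-! ### The leading order of a solution with exponential asymptotics -/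

/-- The filter of points tending to the origin along the ray of direction `θ`. -/
def rayFilter (θ : ℝ) : Filter ℂ :=
  map (fun t : ℝ => (t : ℂ) * Complex.exp (θ * Complex.I)) (𝓝[>] 0)

instance (θ : ℝ) : (rayFilter θ).NeBot := by unfold rayFilter; infer_instance

theorem rayFilter_le (θ : ℝ) : rayFilter θ ≤ 𝓝 0 := by
  have : Tendsto (fun t : ℝ => (t : ℂ) * Complex.exp (θ * Complex.I)) (𝓝 0)
      (𝓝 (((0 : ℝ) : ℂ) * Complex.exp (θ * Complex.I))) :=
    (Complex.continuous_ofReal.mul continuous_const).tendsto _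
  simp only [Complex.ofReal_zero, zero_mul] at this
  exact this.mono_left nhdsWithin_le_nhds

theorem straightSector_mem_rayFilter {θ a b r : ℝ} (ha : a < θ) (hb : θ < b) (hr : 0 < r) :
    straightSector a b r ∈ rayFilter θ := by
  rw [rayFilter, mem_map]
  filter_upwards [Ioo_mem_nhdsGT hr] with t ht using ⟨t, θ, ht.1, ht.2, ha, hb, rfl⟩

/-- When the coefficients below n vanish, R_{n+1} = (f/h^n - c_n) h^n, so its bound leaves an error
O(|h|). -/
theorem PoincareOpen.tendsto {ι : Type} {f : ι → ℂ → ℂ} {c : ℕ → ι → ℂ} {V : Set ι} {S : Set ℂ}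
    {θ : ℝ} (hf : PoincareOpen f c V (θ - Real.pi / 2) (θ + Real.pi / 2) S) {x : ι} (hx : x ∈ V)
    {n : ℕ} (hc : ∀ k < n, c k x = 0) :
    Tendsto (fun h => f x h / h ^ n) (rayFilter θ) (𝓝 (c n x)) := by
  have hpi := Real.pi_pos
  obtain ⟨r, hr, -, C, hC⟩ := hf (n + 1) (θ - Real.pi / 4) (θ + Real.pi / 4) (by linarith)
    (by linarith) (by linarith)
  have h0 : Tendsto (fun h : ℂ => C * ‖h‖) (rayFilter θ) (𝓝 0) := by
    have := (tendsto_norm_zero (E := ℂ)).const_mul C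
    rw [mul_zero] at this
    exact this.mono_left (rayFilter_le θ)
  refine tendsto_iff_norm_sub_tendsto_zero.2 (squeeze_zero' (Eventually.of_forall fun _ =>
    norm_nonneg _) ?_ h0)
  filter_upwards [straightSector_mem_rayFilter (a := θ - Real.pi / 4) (b := θ + Real.pi / 4)
    (by linarith) (by linarith) hr] with h hh
  have hh0 : h ≠ 0 := by
    obtain ⟨ρ, φ, h1, -, -, -, rfl⟩ := hh
    exact mul_ne_zero (by exact_mod_cast h1.ne') (Complex.exp_ne_zero _)
  have h1 := hC x hx h hh
  have e : remainder f c (n + 1) x h = (f x h / h ^ n - c n x) * h ^ n := by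
    rw [remainder, Finset.sum_range_succ, Finset.sum_eq_zero fun k hk => by
      rw [hc k (Finset.mem_range.1 hk), zero_mul]]
    field_simp
    ring
  rw [e, norm_mul, norm_pow, pow_succ', ← mul_assoc] at h1
  exact le_of_mul_le_mul_right h1 (by positivity)

theorem tendsto_pow_mul_sum {l : Filter ℂ} (hl : l ≤ 𝓝 0) (hl0 : ∀ᶠ h in l, h ≠ 0) (m J : ℕ)
    (hJ : J ≤ m) (a : ℕ → ℂ) (ha : ∀ j, J < j → j ≤ m → a j = 0) :
    Tendsto (fun h : ℂ => h ^ J * ∑ j ∈ Finset.range (m + 1), a j * h⁻¹ ^ j) l (𝓝 (a J)) := by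
  have h1 : Tendsto (fun h : ℂ => ∑ j ∈ Finset.range (m + 1), a j * h ^ (J - j)) l
      (𝓝 (∑ j ∈ Finset.range (m + 1), if j = J then a J else 0)) := by
    refine tendsto_finsetSum _ fun j hj => ?_
    rcases lt_trichotomy j J with h | h | h
    · rw [if_neg h.ne]
      have : Tendsto (fun h : ℂ => a j * h ^ (J - j)) (𝓝 0) (𝓝 (a j * 0 ^ (J - j))) :=
        (Continuous.tendsto (by fun_prop) _)
      rw [zero_pow (by omega), mul_zero] at this
      exact this.mono_left hl
    · subst h
      simpa using tendsto_const_nhds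
    · rw [if_neg h.ne', ha j h (by have := Finset.mem_range.1 hj; omega)]
      simpa using tendsto_const_nhds
  rw [Finset.sum_ite_eq' , if_pos (Finset.mem_range.2 (by omega))] at h1
  refine h1.congr' ?_
  filter_upwards [hl0] with h hh
  rw [Finset.mul_sum]
  refine Finset.sum_congr rfl fun j hj => ?_
  by_cases hjJ : j ≤ J
  · have : h ^ J = h ^ (J - j) * h ^ j := by rw [← pow_add]; congr 1; omega
    rw [this, inv_pow]
    field_simp
  · rw [ha j (by omega) (by have := Finset.mem_range.1 hj; omega)]
    simp

/-- The leading term of the equation satisfied by `g = exp (-G / ħ) ψ`. -/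
theorem leading_order {l : Filter ℂ} [l.NeBot] (hl : l ≤ 𝓝 0) (hl0 : ∀ᶠ h in l, h ≠ 0) {m J k : ℕ}
    (hJ : J ≤ m) (hJ1 : 1 ≤ J) {a b : ℕ → ℂ} (ha : ∀ j, J < j → j ≤ m → a j = 0)
    (hb : ∀ j, J < j → j ≤ m → b j = 0) {P Q g g₁ g₂ : ℂ → ℂ} {P₀ Q₀ c c₁ c₂ : ℂ}
    (hP : Tendsto P l (𝓝 P₀)) (hQ : Tendsto Q l (𝓝 Q₀))
    (hg : Tendsto (fun h => g h / h ^ k) l (𝓝 c)) (hg₁ : Tendsto (fun h => g₁ h / h ^ k) l (𝓝 c₁))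
    (hg₂ : Tendsto (fun h => g₂ h / h ^ k) l (𝓝 c₂))
    (heq : ∀ᶠ h in l, ∀ A B, A = ∑ j ∈ Finset.range (m + 1), a j * h⁻¹ ^ j →
      B = ∑ j ∈ Finset.range (m + 1), b j * h⁻¹ ^ j →
      h * (h * g₂ h + B * g h + A * g₁ h) + A * (h * g₁ h + A * g h) +
        P h * (h * g₁ h + A * g h) + Q h * g h = 0) :
    a J ^ 2 * c = 0 := by
  have hA := tendsto_pow_mul_sum hl hl0 m J hJ a ha
  have hB := tendsto_pow_mul_sum hl hl0 m J hJ b hb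
  have hid : Tendsto (fun h : ℂ => h) l (𝓝 0) := hl
  have hpow : ∀ n, 1 ≤ n → Tendsto (fun h : ℂ => h ^ n) l (𝓝 0) := fun n hn => by
    have := hid.pow n
    rwa [zero_pow (by omega)] at this
  set A' : ℂ → ℂ := fun h => h ^ J * ∑ j ∈ Finset.range (m + 1), a j * h⁻¹ ^ j with hA'
  set B' : ℂ → ℂ := fun h => h ^ J * ∑ j ∈ Finset.range (m + 1), b j * h⁻¹ ^ j with hB'
  have hJ0 := hpow J hJ1
  -- The equation is multiplied by h^{2J-k}. Here h^J A and h^J B converge, g, g₁, g₂ are divided by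
  -- h^k, and every term other than A² g keeps a spare positive power of h because J ≥ 1. Only a_J²
  -- c survives in the limit.
  have hlim := ((((hid.mul hJ0).mul (((hid.mul hJ0).mul hg₂).add ((hB.mul hg).add
    (hA.mul hg₁)))).add (hA.mul (((hid.mul hJ0).mul hg₁).add (hA.mul hg)))).add
    ((hP.mul hJ0).mul (((hid.mul hJ0).mul hg₁).add (hA.mul hg)))).add
    (((hQ.mul hJ0).mul hJ0).mul hg)
  have hz := hlim.congr' (f₂ := fun _ => (0 : ℂ)) (by
    filter_upwards [heq, hl0] with h hh hh0
    have := hh _ _ rfl rfl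
    have e : ∀ A B : ℂ, h * (h * g₂ h + B * g h + A * g₁ h) + A * (h * g₁ h + A * g h) +
        P h * (h * g₁ h + A * g h) + Q h * g h = 0 →
        h * h ^ J * (h * h ^ J * (g₂ h / h ^ k) + (h ^ J * B * (g h / h ^ k) + h ^ J * A * (g₁ h / h ^ k)))
          + h ^ J * A * (h * h ^ J * (g₁ h / h ^ k) + h ^ J * A * (g h / h ^ k)) +
          P h * h ^ J * (h * h ^ J * (g₁ h / h ^ k) + h ^ J * A * (g h / h ^ k)) +
          Q h * h ^ J * h ^ J * (g h / h ^ k) = 0 := by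
      intro A B hAB
      have : (h ^ J * h ^ J / h ^ k) * (h * (h * g₂ h + B * g h + A * g₁ h) + A * (h * g₁ h + A * g h) +
        P h * (h * g₁ h + A * g h) + Q h * g h) = 0 := by rw [hAB, mul_zero]
      rw [← this]
      ring
    exact e _ _ this)
  have := tendsto_nhds_unique hz tendsto_const_nhds
  simp only [mul_zero, zero_mul, zero_add, add_zero] at this
  rw [← this]
  ring

/-- Conjugation by the exponential: e^{-G/ħ} ħ∂ₓ = (ħ∂ₓ + G') e^{-G/ħ} with G = ∑ φ_j ħ^{-j}.
Applied twice it gives the conjugated equation of `expFactor_ode`. -/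
theorem expFactor_mul_deriv {m : ℕ} {φ : ℕ → ℂ → ℂ} {y : ℂ → ℂ} {V : Set ℂ} (hV : IsOpen V)
    (hφ : ∀ j, DifferentiableOn ℂ (φ j) V) (hy : DifferentiableOn ℂ y V) {h : ℂ} (hh : h ≠ 0)
    {x : ℂ} (hx : x ∈ V) :
    expFactor m (fun j => φ j x) h * (h * deriv y x) =
      h * deriv (fun x => expFactor m (fun j => φ j x) h * y x) x +
        (∑ j ∈ Finset.range (m + 1), deriv (φ j) x * h⁻¹ ^ j) *
          (expFactor m (fun j => φ j x) h * y x) := by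
  have hG : HasDerivAt (fun x => ∑ j ∈ Finset.range (m + 1), φ j x * h⁻¹ ^ j)
      (∑ j ∈ Finset.range (m + 1), deriv (φ j) x * h⁻¹ ^ j) x :=
    HasDerivAt.fun_sum fun j _ =>
      (((hφ j).differentiableAt (hV.mem_nhds hx)).hasDerivAt).mul_const _
  have h1 := ((hG.fun_neg.div_const h).cexp).fun_mul
    ((hy.differentiableAt (hV.mem_nhds hx)).hasDerivAt)
  have e : deriv (fun x => expFactor m (fun j => φ j x) h * y x) x = _ := h1.deriv
  rw [e]
  simp only [expFactor]
  field_simp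
  ring

theorem expFactor_ode {m : ℕ} {φ : ℕ → ℂ → ℂ} {y P Q : ℂ → ℂ} {V : Set ℂ} (hV : IsOpen V)
    (hφ : ∀ j, DifferentiableOn ℂ (φ j) V) (hy : DifferentiableOn ℂ y V) {h : ℂ} (hh : h ≠ 0)
    (hode : ∀ x ∈ V, h ^ 2 * deriv (deriv y) x + P x * h * deriv y x + Q x * y x = 0)
    {g : ℂ → ℂ} (hg : g = fun x => expFactor m (fun j => φ j x) h * y x)
    {x : ℂ} (hx : x ∈ V) (A B : ℂ) (hA : A = ∑ j ∈ Finset.range (m + 1), deriv (φ j) x * h⁻¹ ^ j)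
    (hB : B = ∑ j ∈ Finset.range (m + 1), deriv (deriv (φ j)) x * h⁻¹ ^ j) :
    h * (h * deriv (deriv g) x + B * g x + A * deriv g x) + A * (h * deriv g x + A * g x) +
      P x * (h * deriv g x + A * g x) + Q x * g x = 0 := by
  have hyd : DifferentiableOn ℂ (fun x => h * deriv y x) V := (hy.deriv hV).const_mul h
  have k1 := expFactor_mul_deriv (m := m) hV hφ hy hh hx
  have k2 := expFactor_mul_deriv (m := m) hV hφ hyd hh hx
  have hk : (fun x => expFactor m (fun j => φ j x) h * (h * deriv y x)) =ᶠ[𝓝 x] fun x =>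
      h * deriv g x + (∑ j ∈ Finset.range (m + 1), deriv (φ j) x * h⁻¹ ^ j) * g x := by
    filter_upwards [hV.mem_nhds hx] with z hz
    rw [expFactor_mul_deriv (m := m) hV hφ hy hh hz, hg]
  have hgd : DifferentiableOn ℂ g V := by
    rw [hg]
    unfold expFactor
    exact (((DifferentiableOn.fun_sum fun j _ => (hφ j).mul_const _).fun_neg).div_const h).cexp.mul hy
  have hS : HasDerivAt (fun x => ∑ j ∈ Finset.range (m + 1), deriv (φ j) x * h⁻¹ ^ j) B x := by
    rw [hB]
    exact HasDerivAt.fun_sum fun j _ =>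
      ((((hφ j).deriv hV).differentiableAt (hV.mem_nhds hx)).hasDerivAt).mul_const _
  have hd := ((((hgd.deriv hV).differentiableAt (hV.mem_nhds hx)).hasDerivAt.const_mul h).fun_add
    (hS.fun_mul (hgd.differentiableAt (hV.mem_nhds hx)).hasDerivAt))
  rw [hk.deriv_eq, hd.deriv, deriv_const_mul _ ((hy.deriv hV).differentiableAt (hV.mem_nhds hx)),
    ← hA] at k2
  have hgx : g x = expFactor m (fun j => φ j x) h * y x := by rw [hg]
  rw [← hg, ← hA] at k1
  have := hode x hx
  rw [k1] at k2
  rw [← hgx] at k1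
  have k3 : expFactor m (fun j => φ j x) h * (h ^ 2 * deriv (deriv y) x + P x * h * deriv y x + Q x * y x) = 0 := by
    rw [this, mul_zero]
  rw [← hgx] at k2
  linear_combination k3 - k2 - P x * k1 + Q x * hgx


variable {X S : Set ℂ} {a b : ℝ} {p q : ℂ → ℂ → ℂ} {pc qc : ℕ → ℂ → ℂ} {θ : ℝ}
  {U : Set ℂ} {x₀ : ℂ} {sq : ℂ → ℂ}

theorem LocGevreyClosed.tendsto {f : ℂ → ℂ → ℂ} {c : ℕ → ℂ → ℂ} (hf : LocGevreyClosed f c X a b S)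
    (hθ : θ ∈ Icc (a + Real.pi / 2) (b - Real.pi / 2)) {x : ℂ} (hx : x ∈ X) :
    Tendsto (f x) (rayFilter θ) (𝓝 (c 0 x)) := by
  obtain ⟨V, -, hxV, -, hG⟩ := hf x hx
  obtain ⟨δ, hδ, -, hB⟩ := hG.exists_bounds hθ
  simpa using (hB.gevreyOpen hδ subset_rfl).poincareOpen.tendsto hxV (n := 0) (by simp)

theorem eventually_ne_rayFilter (θ : ℝ) : ∀ᶠ h in rayFilter θ, h ≠ 0 := by
  have hpi := Real.pi_pos
  filter_upwards [straightSector_mem_rayFilter (θ := θ) (a := θ - Real.pi / 4)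
    (b := θ + Real.pi / 4) (by linarith) (by linarith) one_pos] with h hh
  obtain ⟨ρ, φ, h1, -, -, -, rfl⟩ := hh
  exact mul_ne_zero (by exact_mod_cast h1.ne') (Complex.exp_ne_zero _)

theorem borelDisc_mem_rayFilter (θ : ℝ) {δ : ℝ} (hδ : 0 < δ) : borelDisc θ δ ∈ rayFilter θ := by
  have hpi := Real.pi_pos
  obtain ⟨r, hr, hs⟩ := exists_sector_subset_borelDisc (θ := θ) (a' := θ - Real.pi / 4)
    (b' := θ + Real.pi / 4) hδ (by linarith) (by linarith) (by linarith)
  exact mem_of_superset (straightSector_mem_rayFilter (by linarith) (by linarith) hr) hs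

/-- The exponent of a solution with exponential asymptotics has no polar part, up to constants,
unless the solution is flat. -/
theorem Setting.flat_or_deriv_eq_zero (H : Setting X S a b p q pc qc θ U x₀ sq) {δ : ℝ} (hδ : 0 < δ)
    {V : Set ℂ} (hV : IsOpen V) (hVU : V ⊆ U) {x₁ : ℂ} (hx₁ : x₁ ∈ V) {ψ : ℂ → ℂ → ℂ}
    (hψ : IsSolution p q U (borelDisc θ δ) ψ) {m : ℕ} {φ c : ℕ → ℂ → ℂ}
    (hφ : ∀ j, DifferentiableOn ℂ (φ j) V) (hc : ∀ k, DifferentiableOn ℂ (c k) V)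
    (hG : PoincareOpen (fun y h => expFactor m (fun j => φ j y) h * ψ y h) c V
      (θ - Real.pi / 2) (θ + Real.pi / 2) (borelDisc θ δ)) :
    (∀ k, c k x₁ = 0) ∨ ∀ j, 1 ≤ j → j ≤ m → deriv (φ j) x₁ = 0 := by
  by_contra! hcon
  obtain ⟨⟨k, hk⟩, j, hj1, hjm, hj⟩ := hcon
  have hB := isOpen_borelDisc (θ := θ) hδ
  -- Nonvanishing at x₁ is weakened to not vanishing identically near x₁. Then k₀ is the first
  -- nontrivial coefficient and J the highest nontrivial polar order near x₁, so the coefficients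
  -- before k₀ and the polar terms above J vanish on a neighbourhood, together with their
  -- derivatives.
  have hk' : ∃ k, ¬ ∀ᶠ x in 𝓝 x₁, c k x = 0 := ⟨k, fun h => hk h.self_of_nhds⟩
  have hj' : ¬ ∀ᶠ x in 𝓝 x₁, deriv (φ j) x = 0 := fun h => hj h.self_of_nhds
  classical
  set k₀ := Nat.find hk' with hk₀
  have hk₀1 : ¬ ∀ᶠ x in 𝓝 x₁, c k₀ x = 0 := Nat.find_spec hk'
  have hk₀2 : ∀ k < k₀, ∀ᶠ x in 𝓝 x₁, c k x = 0 := fun k hk => not_not.1 (Nat.find_min hk' hk)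
  set J := Nat.findGreatest (fun j => ¬ ∀ᶠ x in 𝓝 x₁, deriv (φ j) x = 0) m with hJ
  have hJ1 : ¬ ∀ᶠ x in 𝓝 x₁, deriv (φ J) x = 0 :=
    Nat.findGreatest_spec (P := fun j => ¬ ∀ᶠ x in 𝓝 x₁, deriv (φ j) x = 0) hjm hj'
  have hJ2 : ∀ j, J < j → j ≤ m → ∀ᶠ x in 𝓝 x₁, deriv (φ j) x = 0 := fun j h1 h2 =>
    not_not.1 (Nat.findGreatest_is_greatest h1 h2)
  have hJm : J ≤ m := Nat.findGreatest_le m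
  have hjJ : j ≤ J := Nat.le_findGreatest hjm hj'
  set g : ℂ → ℂ → ℂ := fun y h => expFactor m (fun j => φ j y) h * ψ y h with hg
  have hgd : ∀ h ∈ borelDisc θ δ, DifferentiableOn ℂ (fun y => g y h) V := by
    intro h hh
    have := (hψ.differentiableOn_fst H.hU hB hh).mono hVU
    simp only [hg]
    unfold expFactor
    exact (((DifferentiableOn.fun_sum fun j _ => (hφ j).mul_const _).fun_neg).div_const h).cexp.mul
      this
  obtain ⟨r, hr, hrV⟩ := Metric.isOpen_iff.1 hV x₁ hx₁
  have hb1 : ∀ x ∈ Metric.ball x₁ (r / 2), Metric.ball x (r / 2) ⊆ V := fun x hx =>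
    (Metric.ball_subset_ball' (by rw [Metric.mem_ball] at hx; linarith)).trans hrV
  have hb2 : ∀ x ∈ Metric.ball x₁ (r / 4), Metric.ball x (r / 4) ⊆ Metric.ball x₁ (r / 2) :=
    fun x hx => Metric.ball_subset_ball' (by rw [Metric.mem_ball] at hx; linarith)
  have hbV : Metric.ball x₁ (r / 2) ⊆ V := (Metric.ball_subset_ball (by linarith)).trans hrV
  have hG1 := hG.deriv (half_pos hr) hb1 hgd hc
  have hG2 := hG1.deriv (r := r / 4) (by linarith) hb2
    (fun h hh => ((hgd h hh).deriv hV).mono hbV) (fun n => ((hc n).deriv hV).mono hbV)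
  -- The leading-order identity at every nearby point, not only at x₁, where both factors may vanish
  -- by accident.
  have hz : ∀ᶠ x in 𝓝 x₁, deriv (φ J) x ^ 2 * c k₀ x = 0 := by
    have e1 : ∀ᶠ x in 𝓝 x₁, ∀ k < k₀, c k x = 0 := by
      have := (Finset.eventually_all (Finset.range k₀) (l := 𝓝 x₁) (p := fun k x => c k x = 0)).2
        fun k hk => hk₀2 k (Finset.mem_range.1 hk)
      filter_upwards [this] with x hx k hk using hx k (Finset.mem_range.2 hk)
    have e2 : ∀ᶠ x in 𝓝 x₁, ∀ j, J < j → j ≤ m → deriv (φ j) x = 0 := by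
      have := (Finset.eventually_all (Finset.Ioc J m) (l := 𝓝 x₁)
        (p := fun j x => deriv (φ j) x = 0)).2
        fun j hj => hJ2 j (Finset.mem_Ioc.1 hj).1 (Finset.mem_Ioc.1 hj).2
      filter_upwards [this] with x hx j h1 h2 using hx j (Finset.mem_Ioc.2 ⟨h1, h2⟩)
    filter_upwards [e1.eventually_nhds, e2.eventually_nhds, Metric.ball_mem_nhds x₁ (ε := r / 4)
      (by linarith)] with x hx1 hx2 hxb
    have hxb' : x ∈ Metric.ball x₁ (r / 2) := Metric.ball_subset_ball (by linarith) hxb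
    have hxV := hbV hxb'
    have c1 : ∀ k < k₀, deriv (c k) x = 0 ∧ deriv (deriv (c k)) x = 0 := by
      intro k hk
      have h0 : c k =ᶠ[𝓝 x] fun _ => 0 := hx1.mono fun y hy => hy k hk
      have h1 : deriv (c k) =ᶠ[𝓝 x] fun _ => 0 := by simpa using h0.deriv
      exact ⟨h1.self_of_nhds, by simpa using h1.deriv_eq⟩
    have d1 : ∀ j, J < j → j ≤ m → deriv (deriv (φ j)) x = 0 := by
      intro j h1 h2
      have h0 : deriv (φ j) =ᶠ[𝓝 x] fun _ => 0 := hx2.mono fun y hy => hy j h1 h2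
      simpa using h0.deriv_eq
    refine leading_order (rayFilter_le θ) (eventually_ne_rayFilter θ) (k := k₀) hJm (hj1.trans hjJ)
      (a := fun j => deriv (φ j) x) (b := fun j => deriv (deriv (φ j)) x) hx2.self_of_nhds d1
      (H.hpA.tendsto H.hθ (H.hUX (hVU hxV))) (H.hqA.tendsto H.hθ (H.hUX (hVU hxV)))
      (hG.tendsto hxV hx1.self_of_nhds) (hG1.tendsto hxb' fun k hk => (c1 k hk).1)
      (hG2.tendsto hxb fun k hk => (c1 k hk).2) ?_
    filter_upwards [borelDisc_mem_rayFilter θ hδ] with h hh A B hA hB'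
    exact expFactor_ode (P := fun x => p x h) (Q := fun x => q x h) hV hφ
      ((hψ.differentiableOn_fst H.hU hB hh).mono hVU) (ne_zero_of_mem_borelDisc hδ hh)
      (fun x hx => hψ.2 x (hVU hx) h hh) rfl hxV A B hA hB'
  -- Two analytic functions that are not identically zero near x₁ are both nonzero on a punctured
  -- neighbourhood, against the vanishing of the product.
  have a1 : AnalyticAt ℂ (deriv (φ J)) x₁ := ((hφ J).deriv hV).analyticAt (hV.mem_nhds hx₁)
  have a2 : AnalyticAt ℂ (c k₀) x₁ := (hc k₀).analyticAt (hV.mem_nhds hx₁)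
  rcases a1.eventually_eq_zero_or_eventually_ne_zero with h1 | h1
  · exact hJ1 h1
  rcases a2.eventually_eq_zero_or_eventually_ne_zero with h2 | h2
  · exact hk₀1 h2
  obtain ⟨x, hx, hx1, hx2⟩ := ((hz.filter_mono nhdsWithin_le_nhds).and (h1.and h2)).exists
  exact mul_ne_zero (pow_ne_zero 2 hx1) hx2 hx

/-- The asymptotics of the derivative of a solution with exponential asymptotics, in an asymptotic
algebra `𝒜`. -/
theorem IsAsymptoticAlgebra.expFactor_mul_deriv {𝒜 : (ℂ → ℂ) → Prop} {δ : ℝ} (hδ : 0 < δ)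
    (h𝒜 : IsAsymptoticAlgebra (borelDisc θ δ) 𝒜) {V : Set ℂ} (hV : IsOpen V)
    {x₁ : ℂ} (hx₁ : x₁ ∈ V) {ψ : ℂ → ℂ → ℂ}
    (hψ : ∀ h ∈ borelDisc θ δ, DifferentiableOn ℂ (fun x => ψ x h) V) {m : ℕ} {φ : ℕ → ℂ → ℂ}
    (hφ : ∀ j, DifferentiableOn ℂ (φ j) V) {g : ℂ → ℂ → ℂ}
    (hg : g = fun y h => expFactor m (fun j => φ j y) h * ψ y h) (h0 : 𝒜 (g x₁))
    (h1 : 𝒜 fun h => deriv (fun y => g y h) x₁)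
    (hd : (∀ j, 𝒜 fun h => g x₁ h / h ^ j) ∨ ∀ j, 1 ≤ j → j ≤ m → deriv (φ j) x₁ = 0) :
    𝒜 fun h => expFactor m (fun j => φ j x₁) h * (h * deriv (fun x => ψ x h) x₁) := by
  have hid := h𝒜.id fun h hh => (norm_lt_of_mem_borelDisc hδ hh).le
  -- The dangerous terms φ_j'(x₁) ħ^{-j} g: in the first case g ħ^{-j} is itself in the algebra, in
  -- the second only j = 0 contributes.
  have hsum : 𝒜 fun h => ∑ j ∈ Finset.range (m + 1), deriv (φ j) x₁ * (g x₁ h / h ^ j) := by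
    refine h𝒜.sum (m + 1) fun j hj => ?_
    rcases hd with hd | hd
    · exact h𝒜.mul _ _ (h𝒜.const _) (hd j)
    · rcases Nat.eq_zero_or_pos j with rfl | hj0
      · simpa using h𝒜.mul _ _ (h𝒜.const _) h0
      · simpa [hd j hj0 (by omega)] using h𝒜.const 0
  refine h𝒜.congr _ _ (h𝒜.add (h𝒜.mul _ _ hid h1) hsum) fun h hh => ?_
  have hh0 := ne_zero_of_mem_borelDisc hδ hh
  rw [ExactWKB.expFactor_mul_deriv hV hφ (hψ h hh) hh0 hx₁, hg, Finset.sum_mul]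
  congr 1
  refine Finset.sum_congr rfl fun j _ => ?_
  rw [inv_pow]
  field_simp


/-! ### The Wronskian and linear independence -/

variable {X S : Set ℂ} {a b : ℝ} {p q : ℂ → ℂ → ℂ} {pc qc : ℕ → ℂ → ℂ} {θ : ℝ}
  {U : Set ℂ} {x₀ : ℂ} {sq : ℂ → ℂ}

/-- The Cauchy data of an exact WKB solution at the base point. -/
theorem Setting.gevreyBounds_deriv (H : Setting X S a b p q pc qc θ U x₀ sq) {α : ℤˣ} {δ : ℝ}
    (hδ : 0 < δ) {ψ : ℂ → ℂ → ℂ} (hψ : IsExactWKB p q pc qc U x₀ sq θ α δ ψ) :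
    ∃ δ₁ > 0, δ₁ ≤ δ ∧ ∃ d : ℕ → ℂ, d 0 = -formalRoot pc qc sq α 0 x₀ ∧
      GevreyBounds (fun (_ : Unit) h => h * deriv (fun x => ψ x h) x₀) (fun k _ => d k) univ
        (borelDisc θ δ₁) := by
  obtain ⟨r, hr, hrU, δ₁, hδ₁, hle, hG⟩ := hψ.exists_bounds hδ H.hx₀
  have hB := isOpen_borelDisc (θ := θ) hδ
  have hsub := borelDisc_mono (θ := θ) hδ₁ hle
  have hP := H.primitive_formalRoot α 0
  have hψd : ∀ h ∈ borelDisc θ δ₁, DifferentiableOn ℂ (fun x => ψ x h) U := fun h hh =>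
    hψ.solution.differentiableOn_fst H.hU hB (hsub hh)
  have h1 := hG.deriv (V' := {x₀}) hr (fun x hx => by rw [mem_singleton_iff.1 hx])
    (fun h hh => ((((H.differentiableOn_wkbExponent α).div_const h).cexp.mul (hψd h hh)).mono hrU))
    (fun n => (H.differentiableOn_wkbCoeff α n).mono hrU)
  -- At x₀ one has ħ ∂ₓ(e^{Φ_α/ħ} ψ) = λ_α + ħ ∂ₓψ. The left side has no term of order 0, so the
  -- expansion of ħ ∂ₓψ starts with -λ_α.
  have h2 := (h1.h_mul (r := δ₁) fun h hh => (norm_lt_of_mem_borelDisc hδ₁ hh).le).comp_left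
    (g := fun _ : Unit => x₀) (W := univ) fun _ _ => rfl
  have h3 := h2.sub (gevreyBounds_const (S := borelDisc θ δ₁) (V := (univ : Set Unit))
    (a := fun _ : Unit => formalRoot pc qc sq α 0 x₀) fun _ _ => le_rfl)
  refine ⟨δ₁, hδ₁, hle, _, ?_, h3.congr (fun _ _ h hh => ?_) fun _ _ _ => rfl⟩
  · simp
  · have hh0 := ne_zero_of_mem_borelDisc hδ₁ hh
    have hd := ((hP.2 x₀ H.hx₀).div_const h).cexp.fun_mul
      ((hψd h hh).differentiableAt (H.hU.mem_nhds H.hx₀)).hasDerivAt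
    have e : deriv (fun x => Complex.exp (wkbExponent pc qc U x₀ sq α x / h) * ψ x h) x₀ = _ :=
      hd.deriv
    rw [e, hψ.normalised h (hsub hh), hP.1]
    simp only [zero_div, Complex.exp_zero]
    field_simp
    ring

theorem formalRoot_one_sub_formalRoot_neg_one :
    formalRoot pc qc sq 1 0 x₀ - formalRoot pc qc sq (-1) 0 x₀ = sq x₀ := by
  rw [formalRoot_zero, formalRoot_zero]
  push_cast
  ring

/-- The Cauchy data and the Wronskian of the two exact WKB solutions at the base point. -/
theorem Setting.exists_wronskian (H : Setting X S a b p q pc qc θ U x₀ sq) {δ₁ δ₂ : ℝ}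
    (hδ₁ : 0 < δ₁) (hδ₂ : 0 < δ₂) {ψ₁ ψ₂ : ℂ → ℂ → ℂ}
    (h₁ : IsExactWKB p q pc qc U x₀ sq θ 1 δ₁ ψ₁)
    (h₂ : IsExactWKB p q pc qc U x₀ sq θ (-1) δ₂ ψ₂) :
    ∃ δ > 0, δ ≤ δ₁ ∧ δ ≤ δ₂ ∧ δ ≤ 1 ∧ ∃ d₁ d₂ e : ℕ → ℂ,
      GevreyBounds (fun (_ : Unit) h => h * deriv (fun x => ψ₁ x h) x₀) (fun k _ => d₁ k) univ
        (borelDisc θ δ) ∧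
      GevreyBounds (fun (_ : Unit) h => h * deriv (fun x => ψ₂ x h) x₀) (fun k _ => d₂ k) univ
        (borelDisc θ δ) ∧
      GevreyBounds (fun (_ : Unit) h => (h * deriv (fun x => ψ₂ x h) x₀ -
        h * deriv (fun x => ψ₁ x h) x₀)⁻¹) (fun k _ => e k) univ (borelDisc θ δ) ∧
      ∀ h ∈ borelDisc θ δ, h * deriv (fun x => ψ₂ x h) x₀ - h * deriv (fun x => ψ₁ x h) x₀ ≠ 0 := by
  obtain ⟨η₁, hη₁, hle₁, d₁, hd₁, hG₁⟩ := H.gevreyBounds_deriv hδ₁ h₁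
  obtain ⟨η₂, hη₂, hle₂, d₂, hd₂, hG₂⟩ := H.gevreyBounds_deriv hδ₂ h₂
  set η := min η₁ η₂ with hη
  have hη0 : 0 < η := lt_min hη₁ hη₂
  have hG₁' := hG₁.mono subset_rfl (borelDisc_mono hη0 (min_le_left η₁ η₂))
  have hG₂' := hG₂.mono subset_rfl (borelDisc_mono hη0 (min_le_right η₁ η₂))
  have hsq := H.sq_ne_zero H.hx₀
  -- The leading coefficient of the Wronskian is λ₊ - λ₋ = √D₀(x₀), nonzero because x₀ is not a
  -- turning point; hence the inverse is Gevrey.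
  obtain ⟨e, ρ, hρ, he⟩ := (hG₂'.sub hG₁').inv (zero_notMem_borelDisc hη0) (norm_pos_iff.2 hsq)
    (fun _ _ => by rw [hd₁, hd₂, neg_sub_neg, formalRoot_one_sub_formalRoot_neg_one])
  set δ := min η (min ρ 1) with hδ
  have hδ0 : 0 < δ := lt_min hη0 (lt_min hρ one_pos)
  have hδη : δ ≤ η := min_le_left _ _
  have hsub : borelDisc θ δ ⊆ borelDisc θ η := borelDisc_mono hδ0 hδη
  obtain ⟨hne, hinv⟩ := he (borelDisc θ δ) hsub (accumulates_borelDisc hδ0) fun h hh =>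
    (norm_lt_of_mem_borelDisc hδ0 hh).le.trans ((min_le_right _ _).trans (min_le_left _ _))
  exact ⟨δ, hδ0, (hδη.trans (min_le_left _ _)).trans hle₁, (hδη.trans (min_le_right _ _)).trans hle₂,
    (min_le_right _ _).trans (min_le_right _ _), d₁, d₂, fun k => e k (),
    hG₁'.mono subset_rfl hsub, hG₂'.mono subset_rfl hsub, hinv, hne ()  trivial⟩

/-- The exact WKB solutions are linearly independent over the holomorphic sectorial germs. -/
theorem Setting.linearIndependent (H : Setting X S a b p q pc qc θ U x₀ sq) {δ₁ δ₂ : ℝ}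
    (hδ₁ : 0 < δ₁) (hδ₂ : 0 < δ₂) {ψ₁ ψ₂ : ℂ → ℂ → ℂ}
    (h₁ : IsExactWKB p q pc qc U x₀ sq θ 1 δ₁ ψ₁)
    (h₂ : IsExactWKB p q pc qc U x₀ sq θ (-1) δ₂ ψ₂) {T : Set ℂ} {c₁ c₂ : ℂ → ℂ}
    (hT : T ⊆ borelDisc θ δ₁ ∩ borelDisc θ δ₂)
    (hTs : IsSectorialDomain (θ - Real.pi / 2) (θ + Real.pi / 2) T)
    (hc₁ : DifferentiableOn ℂ c₁ T)
    (h0 : ∀ x ∈ U, ∀ h ∈ T, c₁ h * ψ₁ x h + c₂ h * ψ₂ x h = 0) :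
    ∀ h ∈ T, c₁ h = 0 ∧ c₂ h = 0 := by
  obtain ⟨δ, hδ, -, -, -, -, -, -, -, -, -, hne⟩ := H.exists_wronskian hδ₁ hδ₂ h₁ h₂
  obtain ⟨δ', hδ', hle, hsub⟩ := hTs.exists_borelDisc (half_plane_mem θ) δ hδ
  have hsum : ∀ h ∈ T, c₁ h + c₂ h = 0 := fun h hh => by
    simpa [h₁.normalised h (hT hh).1, h₂.normalised h (hT hh).2] using h0 x₀ H.hx₀ h hh
  -- The relation and its derivative at x₀ give c₁ times the Wronskian equal to 0, but the Wronskian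
  -- is controlled only on a small Borel disc; the identity theorem then covers T.
  have hz : EqOn c₁ (fun _ => 0) (borelDisc θ δ') := by
    intro h hh
    have hhT := hsub hh
    have e1 := ((h₁.solution.differentiableOn_fst H.hU (isOpen_borelDisc hδ₁)
      (hT hhT).1).differentiableAt (H.hU.mem_nhds H.hx₀)).hasDerivAt
    have e2 := ((h₂.solution.differentiableOn_fst H.hU (isOpen_borelDisc hδ₂)
      (hT hhT).2).differentiableAt (H.hU.mem_nhds H.hx₀)).hasDerivAt
    have e3 : (fun x => c₁ h * ψ₁ x h + c₂ h * ψ₂ x h) =ᶠ[𝓝 x₀] fun _ => 0 := by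
      filter_upwards [H.hU.mem_nhds H.hx₀] with x hx using h0 x hx h hhT
    have e4 := ((e1.const_mul (c₁ h)).fun_add (e2.const_mul (c₂ h))).deriv.symm.trans e3.deriv_eq
    simp only [deriv_const] at e4
    have hw := hne h (borelDisc_mono hδ' hle hh)
    refine (mul_eq_zero.1 (?_ : c₁ h * (h * deriv (fun x => ψ₂ x h) x₀ -
      h * deriv (fun x => ψ₁ x h) x₀) = 0)).resolve_right hw
    linear_combination h * deriv (fun x => ψ₂ x h) x₀ * hsum h hhT - h * e4
  have hc0 := eqOn_of_eqOn_borelDisc hTs.isOpen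
    hTs.simplyConnected.isPathConnected.isConnected.isPreconnected hδ' hsub hc₁
    (differentiableOn_const _) hz
  intro h hh
  have e1 : c₁ h = 0 := hc0 hh
  have := hsum h hh
  rw [e1, zero_add] at this
  exact ⟨e1, this⟩


/-! ### Decomposition of exact solutions along the WKB basis -/

variable {X S : Set ℂ} {a b : ℝ} {p q : ℂ → ℂ → ℂ} {pc qc : ℕ → ℂ → ℂ} {θ : ℝ}
  {U : Set ℂ} {x₀ : ℂ} {sq : ℂ → ℂ}

/-- Decomposition of a solution along the exact WKB solutions: the coefficients are combinations,
in every asymptotic algebra, of the Cauchy data of the solution. -/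
theorem Setting.exists_decomposition (H : Setting X S a b p q pc qc θ U x₀ sq) {δ₁ δ₂ : ℝ}
    (hδ₁ : 0 < δ₁) (hδ₂ : 0 < δ₂) (hS₁ : borelDisc θ δ₁ ⊆ S) {ψ₁ ψ₂ : ℂ → ℂ → ℂ}
    (h₁ : IsExactWKB p q pc qc U x₀ sq θ 1 δ₁ ψ₁)
    (h₂ : IsExactWKB p q pc qc U x₀ sq θ (-1) δ₂ ψ₂) {S' : Set ℂ} {ψ : ℂ → ℂ → ℂ}
    (hS' : IsSectorialDomain (θ - Real.pi / 2) (θ + Real.pi / 2) S')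
    (hψ : IsSolution p q U S' ψ) :
    ∃ δ > 0, δ ≤ 1 ∧ borelDisc θ δ ⊆ S' ∩ (borelDisc θ δ₁ ∩ borelDisc θ δ₂) ∧ ∃ c₁ c₂ : ℂ → ℂ,
      DifferentiableOn ℂ c₁ (borelDisc θ δ) ∧ DifferentiableOn ℂ c₂ (borelDisc θ δ) ∧
      (∀ x ∈ U, ∀ h ∈ borelDisc θ δ, ψ x h = c₁ h * ψ₁ x h + c₂ h * ψ₂ x h) ∧
      ∀ (𝒜 : (ℂ → ℂ) → Prop), IsAsymptoticAlgebra (borelDisc θ δ) 𝒜 → ∀ E : ℂ → ℂ,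
        𝒜 (fun h => E h * ψ x₀ h) → 𝒜 (fun h => E h * (h * deriv (fun x => ψ x h) x₀)) →
          𝒜 (fun h => E h * c₁ h) ∧ 𝒜 (fun h => E h * c₂ h) := by
  obtain ⟨η, hη, hle₁, hle₂, hle, d₁, d₂, e, hG₁, hG₂, hGe, hne⟩ :=
    H.exists_wronskian hδ₁ hδ₂ h₁ h₂
  obtain ⟨δ, hδ, hδη, hsub'⟩ := hS'.exists_borelDisc (half_plane_mem θ) η hη
  have hsub := borelDisc_mono (θ := θ) hδ hδη
  have hT₁ : borelDisc θ δ ⊆ borelDisc θ δ₁ := borelDisc_mono hδ (hδη.trans hle₁)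
  have hT₂ : borelDisc θ δ ⊆ borelDisc θ δ₂ := borelDisc_mono hδ (hδη.trans hle₂)
  have hB := isOpen_borelDisc (θ := θ) hδ
  have hs := hψ.mono subset_rfl hsub'
  have hs₁ := h₁.solution.mono subset_rfl hT₁
  have hs₂ := h₂.solution.mono subset_rfl hT₂
  have hdd : ∀ {ψ : ℂ → ℂ → ℂ}, IsSolution p q U (borelDisc θ δ) ψ →
      DifferentiableOn ℂ (fun h => h * deriv (fun x => ψ x h) x₀) (borelDisc θ δ) := fun hψ =>
    differentiableOn_id.mul ((differentiableOn_deriv_fst (H.hU.prod hB) hψ.1).comp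
      (f := fun h : ℂ => (x₀, h)) ((differentiableOn_const x₀).prodMk differentiableOn_id)
        fun h hh => ⟨H.hx₀, hh⟩)
  set v : ℂ → ℂ := fun h => ψ x₀ h with hv
  set u : ℂ → ℂ := fun h => h * deriv (fun x => ψ x h) x₀ with hu
  set u₁ : ℂ → ℂ := fun h => h * deriv (fun x => ψ₁ x h) x₀ with hu₁
  set u₂ : ℂ → ℂ := fun h => h * deriv (fun x => ψ₂ x h) x₀ with hu₂
  have hvd : DifferentiableOn ℂ v (borelDisc θ δ) := hs.differentiableOn_snd H.hU hB H.hx₀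
  have hwd : DifferentiableOn ℂ (fun h => (u₂ h - u₁ h)⁻¹) (borelDisc θ δ) :=
    ((hdd hs₂).sub (hdd hs₁)).fun_inv fun h hh => hne h (hsub hh)
  -- Cramer's rule for the Cauchy data at x₀: the values of the basis are both 1, its ħ-derivatives
  -- are u₁ and u₂.
  refine ⟨δ, hδ, hδη.trans hle, fun h hh => ⟨hsub' hh, hT₁ hh, hT₂ hh⟩,
    fun h => (v h * u₂ h - u h) * (u₂ h - u₁ h)⁻¹, fun h => (u h - v h * u₁ h) * (u₂ h - u₁ h)⁻¹,
    ((hvd.mul (hdd hs₂)).sub (hdd hs)).mul hwd, ((hdd hs).sub (hvd.mul (hdd hs₁))).mul hwd,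
    fun x hx h hh => ?_, fun 𝒜 h𝒜 E hEv hEu => ?_⟩
  · have hh0 := ne_zero_of_mem_borelDisc hδ hh
    have hw : u₂ h - u₁ h ≠ 0 := hne h (hsub hh)
    obtain ⟨hpd, hqd⟩ := H.differentiableOn_coeff (hS₁ (hT₁ hh))
    have f0 := hs.differentiableOn_fst H.hU hB hh
    have f1 := hs₁.differentiableOn_fst H.hU hB hh
    have f2 := hs₂.differentiableOn_fst H.hU hB hh
    set C₁ : ℂ := (v h * u₂ h - u h) * (u₂ h - u₁ h)⁻¹ with hC₁
    set C₂ : ℂ := (u h - v h * u₁ h) * (u₂ h - u₁ h)⁻¹ with hC₂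
    have hd : ∀ {f g : ℂ → ℂ} {x : ℂ}, DifferentiableOn ℂ f U → DifferentiableOn ℂ g U → x ∈ U →
        deriv (fun x => C₁ * f x + C₂ * g x) x = C₁ * deriv f x + C₂ * deriv g x :=
      fun {f g x} hf hg hx =>
      (((hf.differentiableAt (H.hU.mem_nhds hx)).hasDerivAt.const_mul C₁).fun_add
        ((hg.differentiableAt (H.hU.mem_nhds hx)).hasDerivAt.const_mul C₂)).deriv
    refine solution_unique H.hU H.isPreconnected hpd hqd hh0 (y := fun x => ψ x h)
      (z := fun x => C₁ * ψ₁ x h + C₂ * ψ₂ x h) f0 ((f1.const_mul C₁).add (f2.const_mul C₂))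
      (fun y hy => hs.2 y hy h hh) (fun y hy => ?_) H.hx₀ ?_ ?_ x hx
    · have he : deriv (fun x => C₁ * ψ₁ x h + C₂ * ψ₂ x h) =ᶠ[𝓝 y] fun y =>
          C₁ * deriv (fun x => ψ₁ x h) y + C₂ * deriv (fun x => ψ₂ x h) y := by
        filter_upwards [H.hU.mem_nhds hy] with z hz using hd f1 f2 hz
      rw [he.deriv_eq, hd (f1.deriv H.hU) (f2.deriv H.hU) hy, hd f1 f2 hy]
      linear_combination C₁ * hs₁.2 y hy h hh + C₂ * hs₂.2 y hy h hh
    · rw [h₁.normalised h (hT₁ hh), h₂.normalised h (hT₂ hh), hC₁, hC₂]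
      field_simp
      simp only [hv]
      ring
    · rw [hd f1 f2 H.hx₀]
      refine mul_left_cancel₀ hh0 ?_
      have : h * (C₁ * deriv (fun x => ψ₁ x h) x₀ + C₂ * deriv (fun x => ψ₂ x h) x₀) =
        C₁ * u₁ h + C₂ * u₂ h := by simp only [hu₁, hu₂]; ring
      rw [this, hC₁, hC₂]
      change u h = _
      field_simp
      ring
  -- Cramer's formulas are linear in the data of ψ, so the exponential factor E passes through, and
  -- the other factors are Gevrey. The Poincaré and Gevrey versions are both instances.
  · have a₁ := h𝒜.of_gevrey _ _ (hG₁.mono subset_rfl hsub)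
    have a₂ := h𝒜.of_gevrey _ _ (hG₂.mono subset_rfl hsub)
    have ae := h𝒜.of_gevrey _ _ (hGe.mono subset_rfl hsub)
    exact ⟨h𝒜.congr _ _ (h𝒜.mul _ _ (h𝒜.sub _ _ (h𝒜.mul _ _ hEv a₂) hEu) ae) fun h _ => by
        simp only [hv, hu, hu₁, hu₂]; ring,
      h𝒜.congr _ _ (h𝒜.mul _ _ (h𝒜.sub _ _ hEu (h𝒜.mul _ _ hEv a₁)) ae) fun h _ => by
        simp only [hv, hu, hu₁, hu₂]; ring⟩

theorem PoincareOpen.hasPoincare {ι : Type} {f : ι → ℂ → ℂ} {c : ℕ → ι → ℂ} {V : Set ι} {T : Set ℂ}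
    (hf : PoincareOpen f c V (θ - Real.pi / 2) (θ + Real.pi / 2) T) {x : ι} (hx : x ∈ V) :
    PoincareOpen (fun (_ : Unit) h => f x h) (fun k _ => c k x) univ
      (θ - Real.pi / 2) (θ + Real.pi / 2) T := by
  intro n a' b' ha hab hb
  obtain ⟨r, hr, hs, C, hC⟩ := hf n a' b' ha hab hb
  exact ⟨r, hr, hs, C, fun _ _ h hh => hC x hx h hh⟩

theorem GevreyOpen.hasGevrey {ι : Type} {f : ι → ℂ → ℂ} {c : ℕ → ι → ℂ} {V : Set ι} {T : Set ℂ}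
    (hf : GevreyOpen f c V (θ - Real.pi / 2) (θ + Real.pi / 2) T) {x : ι} (hx : x ∈ V) :
    GevreyOpen (fun (_ : Unit) h => f x h) (fun k _ => c k x) univ
      (θ - Real.pi / 2) (θ + Real.pi / 2) T := by
  intro a' b' ha hab hb
  obtain ⟨r, hr, hs, hG⟩ := hf a' b' ha hab hb
  exact ⟨r, hr, hs, hG.comp_left fun _ _ => hx⟩

theorem Setting.differentiableOn_expFactor_mul {δ : ℝ} (H : Setting X S a b p q pc qc θ U x₀ sq)
    (hδ : 0 < δ) {ψ : ℂ → ℂ → ℂ} (hψ : IsSolution p q U (borelDisc θ δ) ψ) {m : ℕ}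
    {φ : ℕ → ℂ → ℂ} (hφ : ∀ j, DifferentiableOn ℂ (φ j) U) :
    ∀ h ∈ borelDisc θ δ, DifferentiableOn ℂ
      (fun y => expFactor m (fun j => φ j y) h * ψ y h) U := by
  intro h hh
  unfold expFactor
  exact (((DifferentiableOn.fun_sum fun j _ => (hφ j).mul_const _).fun_neg).div_const h).cexp.mul
    (hψ.differentiableOn_fst H.hU (isOpen_borelDisc hδ) hh)

/-- The Cauchy data at the base point of a solution with exponential asymptotics. -/
theorem Setting.hasPoincare_cauchyData (H : Setting X S a b p q pc qc θ U x₀ sq) {δ : ℝ}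
    (hδ : 0 < δ) (hδ1 : δ ≤ 1) {T : Set ℂ} (hT : borelDisc θ δ ⊆ T) {ψ : ℂ → ℂ → ℂ}
    (hψ : IsSolution p q U T ψ)
    (hE : LocExpPoincare ψ U (θ - Real.pi / 2) (θ + Real.pi / 2) T) :
    ∃ (m : ℕ) (φ : ℕ → ℂ), HasPoincare θ (borelDisc θ δ) (fun h => expFactor m φ h * ψ x₀ h) ∧
      HasPoincare θ (borelDisc θ δ)
        (fun h => expFactor m φ h * (h * deriv (fun x => ψ x h) x₀)) := by
  obtain ⟨m, φ, c, hφ, hc, hloc⟩ := hE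
  obtain ⟨V, hV, hxV, hVU, hG⟩ := hloc x₀ H.hx₀
  replace hψ := hψ.mono subset_rfl hT
  replace hG := hG.mono hδ (V' := V) subset_rfl
  obtain ⟨r, hr, hrV⟩ := Metric.isOpen_iff.1 hV x₀ hxV
  have hd := H.differentiableOn_expFactor_mul hδ hψ (m := m) hφ
  have hG1 := hG.deriv (V' := {x₀}) hr (fun x hx => by rwa [mem_singleton_iff.1 hx])
    (fun h hh => (hd h hh).mono hVU) fun n => (hc n).mono hVU
  have hG0 := hG.hasPoincare hxV
  -- Either the polar part of the exponent is stationary at x₀, or the expansion there is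
  -- identically zero; in the latter case dividing by any power of ħ leaves it zero.
  have hdich := H.flat_or_deriv_eq_zero hδ hV hVU hxV hψ (fun j => (hφ j).mono hVU)
    (fun k => (hc k).mono hVU) hG
  refine ⟨m, fun j => φ j x₀, ⟨_, hG0⟩,
    (isAsymptoticAlgebra_hasPoincare hδ hδ1).expFactor_mul_deriv hδ H.hU H.hx₀
      (fun h hh => hψ.differentiableOn_fst H.hU (isOpen_borelDisc hδ) hh) hφ rfl ⟨_, hG0⟩
      ⟨_, hG1.hasPoincare rfl⟩ (hdich.imp_left fun h0 j => ⟨fun _ => 0, ?_⟩)⟩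
  simp only [h0] at hG0
  induction j with
  | zero => simpa using hG0
  | succ j ih =>
    simpa only [div_div, ← pow_succ] using ih.div_of_flat (zero_notMem_borelDisc hδ)

theorem Setting.hasGevrey_cauchyData (H : Setting X S a b p q pc qc θ U x₀ sq) {δ : ℝ}
    (hδ : 0 < δ) {T : Set ℂ} (hT : borelDisc θ δ ⊆ T) {ψ : ℂ → ℂ → ℂ}
    (hψ : IsSolution p q U T ψ)
    (hE : LocExpGevrey ψ U (θ - Real.pi / 2) (θ + Real.pi / 2) T) :
    ∃ (m : ℕ) (φ : ℕ → ℂ), HasGevrey θ (borelDisc θ δ) (fun h => expFactor m φ h * ψ x₀ h) ∧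
      HasGevrey θ (borelDisc θ δ)
        (fun h => expFactor m φ h * (h * deriv (fun x => ψ x h) x₀)) := by
  obtain ⟨m, φ, c, hφ, hc, hloc⟩ := hE
  obtain ⟨V, hV, hxV, hVU, hG⟩ := hloc x₀ H.hx₀
  replace hψ := hψ.mono subset_rfl hT
  replace hG := hG.mono hδ (V' := V) subset_rfl
  obtain ⟨r, hr, hrV⟩ := Metric.isOpen_iff.1 hV x₀ hxV
  have hd := H.differentiableOn_expFactor_mul hδ hψ (m := m) hφ
  have hG1 := hG.deriv (V' := {x₀}) hr (fun x hx => by rwa [mem_singleton_iff.1 hx])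
    (fun h hh => (hd h hh).mono hVU) fun n => (hc n).mono hVU
  have hG0 := hG.hasGevrey hxV
  have hdich := H.flat_or_deriv_eq_zero hδ hV hVU hxV hψ (fun j => (hφ j).mono hVU)
    (fun k => (hc k).mono hVU) hG.poincareOpen
  refine ⟨m, fun j => φ j x₀, ⟨_, hG0⟩,
    (isAsymptoticAlgebra_hasGevrey hδ).expFactor_mul_deriv hδ H.hU H.hx₀
      (fun h hh => hψ.differentiableOn_fst H.hU (isOpen_borelDisc hδ) hh) hφ rfl ⟨_, hG0⟩
      ⟨_, hG1.hasGevrey rfl⟩ (hdich.imp_left fun h0 j => ⟨fun _ => 0, ?_⟩)⟩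
  simp only [h0] at hG0
  induction j with
  | zero => simpa using hG0
  | succ j ih =>
    simpa only [div_div, ← pow_succ] using ih.div_of_flat (zero_notMem_borelDisc hδ)

theorem Setting.isBasisOfGerms (H : Setting X S a b p q pc qc θ U x₀ sq) {δ₁ δ₂ : ℝ}
    (hδ₁ : 0 < δ₁) (hδ₂ : 0 < δ₂) (hS₁ : borelDisc θ δ₁ ⊆ S) (hS₂ : borelDisc θ δ₂ ⊆ S)
    {ψ₁ ψ₂ : ℂ → ℂ → ℂ} (h₁ : IsExactWKB p q pc qc U x₀ sq θ 1 δ₁ ψ₁)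
    (h₂ : IsExactWKB p q pc qc U x₀ sq θ (-1) δ₂ ψ₂) :
    IsBasisOfGerms (IsExactSolution p q S U (θ - Real.pi / 2) (θ + Real.pi / 2))
      (ExpPoincare (θ - Real.pi / 2) (θ + Real.pi / 2))
      U (θ - Real.pi / 2) (θ + Real.pi / 2) (borelDisc θ δ₁) (borelDisc θ δ₂) ψ₁ ψ₂ := by
  refine ⟨(H.isGevreyExactSolution hδ₁ hS₁ h₁).1, (H.isGevreyExactSolution hδ₂ hS₂ h₂).1,
    fun S' ψ hψ => ?_, fun T c₁ c₂ hT hTs hc₁ _ h0 =>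
      H.linearIndependent hδ₁ hδ₂ h₁ h₂ hT hTs hc₁ h0⟩
  obtain ⟨-, hs, hsol, hE⟩ := hψ
  obtain ⟨δ, hδ, hδ1, hsub, c₁, c₂, hc₁, hc₂, heq, h𝒜⟩ :=
    H.exists_decomposition hδ₁ hδ₂ hS₁ h₁ h₂ hs hsol
  obtain ⟨m, φ, hv, hu⟩ := H.hasPoincare_cauchyData hδ hδ1 (fun h hh => (hsub hh).1) hsol hE
  obtain ⟨⟨d₁, hd₁⟩, d₂, hd₂⟩ := h𝒜 _ (isAsymptoticAlgebra_hasPoincare hδ hδ1) _ hv hu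
  exact ⟨borelDisc θ δ, c₁, c₂, hsub, isSectorialDomain_borelDisc hδ, hc₁, hc₂, ⟨m, φ, d₁, hd₁⟩,
    ⟨m, φ, d₂, hd₂⟩, heq⟩

theorem Setting.isBasisOfGerms_gevrey (H : Setting X S a b p q pc qc θ U x₀ sq) {δ₁ δ₂ : ℝ}
    (hδ₁ : 0 < δ₁) (hδ₂ : 0 < δ₂) (hS₁ : borelDisc θ δ₁ ⊆ S) (hS₂ : borelDisc θ δ₂ ⊆ S)
    {ψ₁ ψ₂ : ℂ → ℂ → ℂ} (h₁ : IsExactWKB p q pc qc U x₀ sq θ 1 δ₁ ψ₁)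
    (h₂ : IsExactWKB p q pc qc U x₀ sq θ (-1) δ₂ ψ₂) :
    IsBasisOfGerms (IsGevreyExactSolution p q S U (θ - Real.pi / 2) (θ + Real.pi / 2))
      (ExpGevrey (θ - Real.pi / 2) (θ + Real.pi / 2))
      U (θ - Real.pi / 2) (θ + Real.pi / 2) (borelDisc θ δ₁) (borelDisc θ δ₂) ψ₁ ψ₂ := by
  refine ⟨H.isGevreyExactSolution hδ₁ hS₁ h₁, H.isGevreyExactSolution hδ₂ hS₂ h₂,
    fun S' ψ hψ => ?_, fun T c₁ c₂ hT hTs hc₁ _ h0 =>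
      H.linearIndependent hδ₁ hδ₂ h₁ h₂ hT hTs hc₁ h0⟩
  obtain ⟨⟨-, hs, hsol, -⟩, hE⟩ := hψ
  obtain ⟨δ, hδ, -, hsub, c₁, c₂, hc₁, hc₂, heq, h𝒜⟩ :=
    H.exists_decomposition hδ₁ hδ₂ hS₁ h₁ h₂ hs hsol
  obtain ⟨m, φ, hv, hu⟩ := H.hasGevrey_cauchyData hδ (fun h hh => (hsub hh).1) hsol hE
  obtain ⟨⟨d₁, hd₁⟩, d₂, hd₂⟩ := h𝒜 _ (isAsymptoticAlgebra_hasGevrey hδ) _ hv hu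
  exact ⟨borelDisc θ δ, c₁, c₂, hsub, isSectorialDomain_borelDisc hδ, hc₁, hc₂, ⟨m, φ, d₁, hd₁⟩,
    ⟨m, φ, d₂, hd₂⟩, heq⟩

end

end ExactWKB

theorem theorem210116200501
    (X S : Set ℂ) (a b : ℝ) (p q : ℂ → ℂ → ℂ) (pc qc : ℕ → ℂ → ℂ)
    (hX : IsOpen X) (hXc : IsConnected X)
    (hA : Real.pi ≤ b - a) (hS : ExactWKB.IsSectorialDomain a b S)
    (hp : DifferentiableOn ℂ (fun z : ℂ × ℂ => p z.1 z.2) (X ×ˢ S))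
    (hq : DifferentiableOn ℂ (fun z : ℂ × ℂ => q z.1 z.2) (X ×ˢ S))
    (hpc : ∀ k, DifferentiableOn ℂ (pc k) X) (hqc : ∀ k, DifferentiableOn ℂ (qc k) X)
    (hpA : ExactWKB.LocGevreyClosed p pc X a b S)
    (hqA : ExactWKB.LocGevreyClosed q qc X a b S)
    (θ : ℝ) (hθ : θ ∈ Set.Icc (a + Real.pi / 2) (b - Real.pi / 2))
    (δ : ℝ) (hδ : 0 < δ) (hSθ : ExactWKB.borelDisc θ δ ⊆ S)
    (U : Set ℂ) (hU : IsOpen U) (hUs : IsSimplyConnected U) (hUX : U ⊆ X)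
    (x₀ : ℂ) (hx₀ : x₀ ∈ U)
    (hreg : ∀ x ∈ U, ExactWKB.disc₀ pc qc x ≠ 0)
    (sq : ℂ → ℂ) (hsq : DifferentiableOn ℂ sq U)
    (hsq2 : ∀ x ∈ U, sq x ^ 2 = ExactWKB.disc₀ pc qc x) :
    (∀ α : ℤˣ, ExactWKB.Hypotheses X S p q pc qc U x₀ sq θ α →
      ∃ δ' : ℝ, 0 < δ' ∧ δ' ≤ δ ∧ ∃ ψ : ℂ → ℂ → ℂ,
        ExactWKB.IsExactWKB p q pc qc U x₀ sq θ α δ' ψ ∧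
        ExactWKB.IsExactSolution p q S U (θ - Real.pi / 2) (θ + Real.pi / 2)
          (ExactWKB.borelDisc θ δ') ψ ∧
        ∀ ψ' : ℂ → ℂ → ℂ, ExactWKB.IsExactWKB p q pc qc U x₀ sq θ α δ' ψ' →
          ∀ x ∈ U, ∀ h ∈ ExactWKB.borelDisc θ δ', ψ' x h = ψ x h) ∧
    (ExactWKB.Hypotheses X S p q pc qc U x₀ sq θ 1 →
      ExactWKB.Hypotheses X S p q pc qc U x₀ sq θ (-1) →
      ∀ (δ₁ δ₂ : ℝ) (ψ₁ ψ₂ : ℂ → ℂ → ℂ), 0 < δ₁ → δ₁ ≤ δ → 0 < δ₂ → δ₂ ≤ δ →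
        ExactWKB.IsExactWKB p q pc qc U x₀ sq θ 1 δ₁ ψ₁ →
        ExactWKB.IsExactWKB p q pc qc U x₀ sq θ (-1) δ₂ ψ₂ →
        ExactWKB.IsBasisOfGerms
          (ExactWKB.IsExactSolution p q S U (θ - Real.pi / 2) (θ + Real.pi / 2))
          (ExactWKB.ExpPoincare (θ - Real.pi / 2) (θ + Real.pi / 2))
          U (θ - Real.pi / 2) (θ + Real.pi / 2)
          (ExactWKB.borelDisc θ δ₁) (ExactWKB.borelDisc θ δ₂) ψ₁ ψ₂ ∧
        ExactWKB.IsBasisOfGerms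
          (ExactWKB.IsGevreyExactSolution p q S U (θ - Real.pi / 2) (θ + Real.pi / 2))
          (ExactWKB.ExpGevrey (θ - Real.pi / 2) (θ + Real.pi / 2))
          U (θ - Real.pi / 2) (θ + Real.pi / 2)
          (ExactWKB.borelDisc θ δ₁) (ExactWKB.borelDisc θ δ₂) ψ₁ ψ₂) := by
  have H : ExactWKB.Setting X S a b p q pc qc θ U x₀ sq :=
    ⟨hX, hp, hq, hpc, hqc, hpA, hqA, hθ, hU, hUs, hUX, hx₀, hreg, hsq, hsq2⟩
  refine ⟨fun α Hα => H.exists_unique_isExactWKB Hα hδ hSθ,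
    fun _ _ δ₁ δ₂ ψ₁ ψ₂ hδ₁ hle₁ hδ₂ hle₂ h₁ h₂ => ?_⟩
  have hS₁ := (ExactWKB.borelDisc_mono hδ₁ hle₁).trans hSθ
  have hS₂ := (ExactWKB.borelDisc_mono hδ₂ hle₂).trans hSθ
  exact ⟨H.isBasisOfGerms hδ₁ hδ₂ hS₁ hS₂ h₁ h₂, H.isBasisOfGerms_gevrey hδ₁ hδ₂ hS₁ hS₂ h₁ h₂⟩
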